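/- Call a graph $G$ on finitely many vertices a \emph{hyperbolic unit disk graph} if its vertices can be placed at points of the hyperbolic plane (curvature $-1$) such that, for some threshold $t$, two distinct vertices are adjacent exactly when their distance is at most $t$. A \emph{co-bipartite neighborhood edge elimination ordering} (CNEEO) of $G$ is an ordering $e_1,\dots,e_m$ of its edges such that, for every $i$ with $e_i=uv$, the common neighbors of $u$ and $v$ in the graph with edge set $\{e_i,\dots,e_m\}$ induce in $G$ a subgraph whose complement is bipartite. For $\alpha,C\in\mathbb R$ and $n\ge 1$ with $R=2\ln n+C>0$, the hyperbolic random graph $\mathcal G_{n,\alpha,C}$ is the unit disk graph with threshold $R$ on $n$ independent random points of the hyperbolic plane, whose polar coordinates $(r,\phi)$ are independent, with $r$ of density $\frac{\alpha\sinh(\alpha r)}{\cosh(\alpha R)-1}$ on $[0,R]$ and $\phi$ uniform on $[0,2\pi)$. Algorithms are programs of a word RAM with words of $c(\lfloor\log_2 n\rfloor+1)$ bits, for a constant $c$, that receive only the adjacency lists of a graph on $\{0,\dots,n-1\}$, in any order, and no geometric representation. Write $m$ for the number of edges of $G$. (1) Every hyperbolic unit disk graph admits a CNEEO. (2) There is a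 single such program (with a single $c$, independent of $\alpha$ and $C$) such that: (a) there is a constant $K$ such that, on every graph $G$ that admits a CNEEO (in particular, on every hyperbolic unit disk graph), the program halts after at most $K\,(1+m^3+mn^{2.5})$ steps, and its output is a maximum clique of $G$; (b) for all $\alpha,C\in\mathbb R$ with $\frac12<\alpha<1$ there is a constant $K=K(\alpha,C)$ such that, for all $n\ge1$ with $2\ln n+C>0$ and $G$ drawn from $\mathcal G_{n,\alpha,C}$, the number $T(G)$ of steps of the program, in the worst case over the order of the adjacency lists of $G$, satisfies $$\mathbb E[T(G)]\le K\left(\mathbb E[m]+n^{6(1-\alpha)}\right).$$ -/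

import Mathlib

open MeasureTheory
open scoped ENNReal

namespace HyperbolicClique

/-! ### Hyperbolic unit disk graphs and hyperbolic random graphs -/

/-- The hyperbolic distance (curvature `-1`) between the points with polar coordinates
`p = (r, φ)` and `q = (r', φ')` around a fixed origin. -/
noncomputable def hypDist (p q : ℝ × ℝ) : ℝ :=
  Real.arcosh (Real.cosh p.1 * Real.cosh q.1 - Real.sinh p.1 * Real.sinh q.1 * Real.cos (p.2 - q.2))

/-- The unit disk graph with radius threshold `t` on the points `p v`, `v : V`,
of the hyperbolic plane (in polar coordinates). -/
def diskGraph {V : Type*} (t : ℝ) (p : V → ℝ × ℝ) : SimpleGraph V :=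
  SimpleGraph.fromRel fun u v => hypDist (p u) (p v) ≤ t

/-- `G` is a hyperbolic unit disk graph. -/
def IsHyperbolicUnitDiskGraph {V : Type*} (G : SimpleGraph V) : Prop :=
  ∃ (t : ℝ) (p : V → ℝ × ℝ), (∀ v, 0 ≤ (p v).1) ∧ G = diskGraph t p

/-- The radius `R = 2 ln n + C` of the disk, which is also the radius threshold. -/
noncomputable def diskRadius (n : ℕ) (C : ℝ) : ℝ := 2 * Real.log n + C

/-- The law of the radial coordinate: density `α sinh (α r) / (cosh (α R) - 1)` on `[0, R]`. -/
noncomputable def radialLaw (α R : ℝ) : Measure ℝ :=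
  (volume.restrict (Set.Icc 0 R)).withDensity fun r =>
    ENNReal.ofReal (α * Real.sinh (α * r) / (Real.cosh (α * R) - 1))

/-- The law of the angular coordinate: uniform on `[0, 2π)`. -/
noncomputable def angularLaw : Measure ℝ :=
  (ENNReal.ofReal (2 * Real.pi))⁻¹ • volume.restrict (Set.Ico 0 (2 * Real.pi))

/-- The joint law of the polar coordinates of `n` independent random points. The random graph is
`diskGraph (diskRadius n C) p` for `p` drawn from this law. -/
noncomputable def pointsLaw (n : ℕ) (α C : ℝ) : Measure (Fin n → ℝ × ℝ) :=
  Measure.pi fun _ => (radialLaw α (diskRadius n C)).prod angularLaw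

/-! ### Co-bipartite neighborhood edge elimination orderings -/

/-- A graph is co-bipartite if its complement is bipartite. -/
def IsCobipartite {V : Type*} (G : SimpleGraph V) : Prop := Gᶜ.IsBipartite

/-- `L` is a co-bipartite neighborhood edge elimination ordering of `G`: it lists every edge of `G`
exactly once, and for each of its entries `uv`, at position `i`, the common neighbors of `u` and `v`
in the graph with the edges from position `i` on induce a co-bipartite subgraph of `G`. -/
def IsCNEEO {V : Type*} (G : SimpleGraph V) (L : List (Sym2 V)) : Prop :=
  L.Nodup ∧ (∀ e, e ∈ L ↔ e ∈ G.edgeSet) ∧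
    ∀ (i : ℕ) (u v : V), L[i]? = some s(u, v) →
      IsCobipartite (G.induce
        ((SimpleGraph.fromEdgeSet {e | e ∈ L.drop i}).neighborSet u ∩
          (SimpleGraph.fromEdgeSet {e | e ∈ L.drop i}).neighborSet v))

/-- `G` admits a CNEEO. -/
def AdmitsCNEEO {V : Type*} (G : SimpleGraph V) : Prop := ∃ L, IsCNEEO G L

/-! ### A word RAM -/

/-- The arithmetic operations of the machine. -/
inductive Op
  | add | sub | mul | div | mod | lt | eq

/-- The value of an operation on words of `w` bits. Subtraction is truncated at `0`, and the
comparisons return `1` or `0`. -/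
def Op.eval (w : ℕ) : Op → ℕ → ℕ → ℕ
  | .add, a, b => (a + b) % 2 ^ w
  | .sub, a, b => (a - b) % 2 ^ w
  | .mul, a, b => (a * b) % 2 ^ w
  | .div, a, b => (a / b) % 2 ^ w
  | .mod, a, b => (a % b) % 2 ^ w
  | .lt, a, b => (if a < b then 1 else 0) % 2 ^ w
  | .eq, a, b => (if a = b then 1 else 0) % 2 ^ w

/-- A state of the machine: the contents of the registers and of the memory cells. With words of `w`
bits all the contents, and hence all the addresses that can be accessed, are below `2 ^ w`. -/
@[ext] structure State where
  reg : ℕ → ℕ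
  mem : ℕ → ℕ

/-- Instructions. `a`, `b`, `d` are numbers of registers. -/
inductive Instr
  | const (d k : ℕ)
  | op (o : Op) (d a b : ℕ)
  | load (d a : ℕ)
  | store (a b : ℕ)

/-- The effect of an instruction: `const d k` puts `k` into register `d`; `op o d a b` applies `o` to
the registers `a`, `b` and puts the result into register `d`; `load d a` copies the memory cell whose
address is in register `a` to register `d`; `store a b` copies register `b` to the memory cell whose
address is in register `a`. -/
def Instr.eval (w : ℕ) : Instr → State → State
  | .const d k, s => { s with reg := Function.update s.reg d (k % 2 ^ w) }
  | .op o d a b, s => { s with reg := Function.update s.reg d (o.eval w (s.reg a) (s.reg b)) }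
  | .load d a, s => { s with reg := Function.update s.reg d (s.mem (s.reg a)) }
  | .store a b, s => { s with mem := Function.update s.mem (s.reg a) (s.reg b) }

/-- Programs: instructions, composition, and conditionals and loops that test whether a register
is nonzero. -/
inductive Prog
  | instr (i : Instr)
  | seq (p q : Prog)
  | ite (r : ℕ) (p q : Prog)
  | loop (r : ℕ) (p : Prog)

/-- `Exec w p s t s'`: with words of `w` bits, program `p` started in state `s` halts in state `s'`
after exactly `t` steps. Each instruction and each test is one step. -/
inductive Exec (w : ℕ) : Prog → State → ℕ → State → Prop
  | instr (i : Instr) (s : State) : Exec w (.instr i) s 1 (i.eval w s)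
  | seq {p q : Prog} {s s' s'' : State} {t t' : ℕ} :
      Exec w p s t s' → Exec w q s' t' s'' → Exec w (.seq p q) s (t + t') s''
  | ite_pos {r : ℕ} {p q : Prog} {s s' : State} {t : ℕ} :
      s.reg r ≠ 0 → Exec w p s t s' → Exec w (.ite r p q) s (t + 1) s'
  | ite_neg {r : ℕ} {p q : Prog} {s s' : State} {t : ℕ} :
      s.reg r = 0 → Exec w q s t s' → Exec w (.ite r p q) s (t + 1) s'
  | loop_done {r : ℕ} {p : Prog} {s : State} : s.reg r = 0 → Exec w (.loop r p) s 1 s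
  | loop_step {r : ℕ} {p : Prog} {s s' s'' : State} {t t' : ℕ} :
      s.reg r ≠ 0 → Exec w p s t s' → Exec w (.loop r p) s' t' s'' →
      Exec w (.loop r p) s (t + t' + 1) s''

/-- The machine is deterministic. -/
theorem Exec.det {w : ℕ} {p : Prog} {s s₁ s₂ : State} {t₁ t₂ : ℕ}
    (h₁ : Exec w p s t₁ s₁) (h₂ : Exec w p s t₂ s₂) : t₁ = t₂ ∧ s₁ = s₂ := by
  induction h₁ generalizing t₂ s₂ with
  | instr i s => cases h₂; exact ⟨rfl, rfl⟩
  | seq _ _ ih ih' =>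
    cases h₂ with
    | seq k k' =>
      obtain ⟨rfl, rfl⟩ := ih k
      obtain ⟨rfl, rfl⟩ := ih' k'
      exact ⟨rfl, rfl⟩
  | ite_pos h _ ih =>
    cases h₂ with
    | ite_pos _ k => obtain ⟨rfl, rfl⟩ := ih k; exact ⟨rfl, rfl⟩
    | ite_neg h' _ => exact absurd h' h
  | ite_neg h _ ih =>
    cases h₂ with
    | ite_pos h' _ => exact absurd h h'
    | ite_neg _ k => obtain ⟨rfl, rfl⟩ := ih k; exact ⟨rfl, rfl⟩
  | loop_done h =>
    cases h₂ with
    | loop_done _ => exact ⟨rfl, rfl⟩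
    | loop_step h' _ _ => exact absurd h h'
  | loop_step h _ _ ih ih' =>
    cases h₂ with
    | loop_done h' => exact absurd h' h
    | loop_step _ k k' =>
      obtain ⟨rfl, rfl⟩ := ih k
      obtain ⟨rfl, rfl⟩ := ih' k'
      exact ⟨rfl, rfl⟩

/-! ### Graphs as inputs, cliques as outputs -/

/-- `adj v` lists the neighbors of `v` in `G`, in any order and without repetition. -/
def IsAdjLists {n : ℕ} (G : SimpleGraph (Fin n)) (adj : Fin n → List (Fin n)) : Prop :=
  ∀ v, (adj v).Nodup ∧ ∀ u, u ∈ adj v ↔ G.Adj v u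

/-- The adjacency lists as a sequence of numbers: first `n`, then for `v = 0, …, n` the address
at which the list of vertex `v` starts (for `v = n`: the end of the input), and then the lists of the
vertices `0, …, n - 1`, one after the other. -/
def encode {n : ℕ} (adj : Fin n → List (Fin n)) : List ℕ :=
  [n] ++
  (List.range (n + 1)).map (fun v =>
    n + 2 + (((List.finRange n).filter fun u => u.val < v).map fun u => (adj u).length).sum) ++
  ((List.finRange n).flatMap adj).map Fin.val

/-- The initial state: all registers are zero, and the memory holds the input, followed by zeros. -/
def initState {n : ℕ} (w : ℕ) (adj : Fin n → List (Fin n)) : State where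
  reg _ := 0
  mem i := (encode adj).getD i 0 % 2 ^ w

/-- The output in state `s`: the numbers in the `k` memory cells from address `a` on, where register
`0` contains `a` and register `1` contains `k`. -/
def State.output (s : State) : List ℕ :=
  (List.range (s.reg 1)).map fun i => s.mem (s.reg 0 + i)

/-- The output in state `s` lists, without repetition, the vertices of a maximum clique of `G`. -/
def OutputsMaximumClique {n : ℕ} (G : SimpleGraph (Fin n)) (s : State) : Prop :=
  ∃ l : List (Fin n), l.Nodup ∧ s.output = l.map Fin.val ∧ G.IsMaximumClique l.toFinset

/-- The word length `c (⌊log₂ n⌋ + 1)` for graphs with `n` vertices. -/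
def wordLength (c n : ℕ) : ℕ := c * (Nat.log 2 n + 1)

/-- `P`, with the word length given by `c`, computes a maximum clique of `G`: it halts with a maximum
clique as its output, for all adjacency lists of `G`. -/
def ComputesMaximumClique {n : ℕ} (P : Prog) (c : ℕ) (G : SimpleGraph (Fin n)) : Prop :=
  ∀ adj, IsAdjLists G adj →
    ∃ t s, Exec (wordLength c n) P (initState (wordLength c n) adj) t s ∧ OutputsMaximumClique G s

/-- The number of steps of `P` on the input `adj` (`⊤` if it does not halt). -/
noncomputable def runTime {n : ℕ} (P : Prog) (c : ℕ) (adj : Fin n → List (Fin n)) : ℕ∞ :=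
  ⨅ (t : ℕ) (_ : ∃ s, Exec (wordLength c n) P (initState (wordLength c n) adj) t s), (t : ℕ∞)

/-- The number of steps of `P` on the graph `G`, for the worst order of its adjacency lists. -/
noncomputable def graphTime {n : ℕ} (P : Prog) (c : ℕ) (G : SimpleGraph (Fin n)) : ℝ≥0∞ :=
  ⨆ (adj : Fin n → List (Fin n)) (_ : IsAdjLists G adj), (runTime P c adj : ℝ≥0∞)

end HyperbolicClique

open HyperbolicClique

/-!
A point of the hyperbolic plane is a vector of the upper sheet of the hyperboloid, and two points
are adjacent when their Lorentzian product is at most a constant. The geometric fact behind both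
parts is `lor_le_of_same_side`: if `z` and `w` lie on the same side of the line `xy`, are not
farther from `x` than `y` is, and are adjacent to `y`, where `x` and `y` are not farther apart than
adjacent points may be, then `z` and `w` are adjacent. It follows from the linear dependence of the
four vectors: the signs of its coefficients tell whether one point lies in the triangle of the
others or two segments cross, and in each case pairing the dependence with the four vectors gives
the bound. With a longest edge `xy` this shows that the common neighborhood of its endpoints is
covered by two cliques, one for each side, so the edges in the order of decreasing length form an
elimination ordering. With the origin as `x` and a vertex of largest radius as `y` it shows that
every set of vertices of a hyperbolic random graph contains a vertex whose neighborhood in that set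
is co-bipartite (`vertexElim_diskGraph`).

The program removes the vertices one after the other, in phases `k = 0, 1, …`: phase `k` removes the
vertices that have at most `k` remaining neighbors at the time of their turn. Before a vertex is
given up, the largest clique that contains it is searched for in its remaining neighborhood
(`localC_run`): as long as possible, an edge with co-bipartite common neighborhood is removed, after
a maximum clique of that neighborhood has been found by bipartite matching, in the form of an
auction (`cliqueC_run`). A vertex that is removed in phase `k` takes time `O((k + 2) ^ 5)`; if every
set of vertices contains a vertex whose neighborhood in that set is co-bipartite, only edges at the
removed vertex need to be considered, and the time is `O((k + 2) ^ 4)`. The program is written in a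
small structured language, whose compilation to the word RAM preserves the time up to a constant
factor (`Cmd.code_runs`).

Since a vertex that survives the phases before `k` has `k` neighbors that survive the phases before
`k - 1` (`IsLeveling`), the phase `k` of a vertex is at most its degree, and `k ^ 2` is at most
twice the number `m` of the edges. Summing `k ^ 5` over all the vertices gives the bound `O(m ^ 3)`
for the worst case (`graphTime_le_worst`). In the random graph, charging each edge to its endpoint
with larger radius shows that the sum of the `k ^ 4` is at most a constant times the sum of the
`δ ^ 4`, where `δ v` is the number of neighbors of `v` whose radius is at most that of `v`
(`IsLeveling.sum_pow_four_le`). Given the position of `v`, `δ v` is binomial, and the probability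
that a point is such a neighbor of `v` is at most a constant times `exp ((τ / 2 - α) R + (α - τ) r)`
for `0 ≤ τ ≤ 1`, where `r` is the radius of `v` (`pointLaw_closeBelow_le`). With
`τ = min 1 ((6 α - 1) / 4)` the expectation of the sum of the fourth moments is at most a constant
times `n + n ^ (6 (1 - α))`, and `n` is at most a constant times the expected number of edges
(`le_lintegral_ncard`).
-/

namespace HyperbolicClique

/-! ### A structured language with arrays -/

/-- The variables of the structured language. -/
inductive Vr
  | bk | n | z | u | lo | hi | t | nb | cnt | k | old | vv | D | a | b | r | prog | j | kk | h
  | p | q | ok | cur | nx | it | bp | tt | lev | l | f | al | w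
  deriving DecidableEq

/-- The arrays of the structured language; each of them is indexed by pairs of numbers. -/
inductive Ar
  | AM | deg | AL | alive | X | L | Cm | memo | S | col | dn | pr | own | I | B
  deriving DecidableEq

/-- Binary operations; `add` and `mul` are taken modulo a bound `V`. -/
inductive HOp
  | add | mul | sub | lt | eq | and

/-- Expressions. -/
inductive Ex
  | lit (k : Fin 4)
  | var (x : Vr)
  | bin (o : HOp) (a b : Ex)
  | rd (id : Ar) (i j : Ex)
  | inp (a : Ex)

/-- States of the structured language: the variables, the arrays, and a region of memory that holds
the input at the start and the output at the end. -/
structure St where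
  v : Vr → ℕ
  arr : Ar → ℕ → ℕ → ℕ
  inp : ℕ → ℕ

/-- The value of an operation. -/
def HOp.eval (V : ℕ) : HOp → ℕ → ℕ → ℕ
  | .add, a, b => (a + b) % V
  | .mul, a, b => (a * b) % V
  | .sub, a, b => a - b
  | .lt, a, b => if a < b then 1 else 0
  | .eq, a, b => if a = b then 1 else 0
  | .and, a, b => if a ≠ 0 ∧ b ≠ 0 then 1 else 0

/-- The value of an expression in a state. -/
def Ex.eval (V : ℕ) : Ex → St → ℕ
  | .lit k, _ => k.val
  | .var x, s => s.v x
  | .bin o a b, s => o.eval V (a.eval V s) (b.eval V s)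
  | .rd id i j, s => s.arr id (i.eval V s) (j.eval V s)
  | .inp a, s => s.inp (a.eval V s)

/-- Commands. `out i e` writes `e` to position `i` of the input region (and does nothing beyond the
end of that region). The bound of a loop is evaluated once, on entry. -/
inductive Cmd
  | skip
  | set (x : Vr) (e : Ex)
  | st (id : Ar) (i j e : Ex)
  | out (i e : Ex)
  | seq (p q : Cmd)
  | ite (e : Ex) (p q : Cmd)
  | rep (x : Vr) (e : Ex) (p : Cmd)

/-- Composition of commands. -/
infixr:20 " ;; " => Cmd.seq

/-- Assignment to a variable. -/
def St.setv (s : St) (x : Vr) (a : ℕ) : St := { s with v := Function.update s.v x a }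

/-- Assignment to an array entry. -/
def St.seta (s : St) (id : Ar) (i j a : ℕ) : St :=
  { s with arr := Function.update s.arr id (Function.update (s.arr id) i
      (Function.update (s.arr id i) j a)) }

/-- The state after `j` rounds of a loop with the body `f`. -/
def iterSt (x : Vr) (f : St → St) (s : St) : ℕ → St
  | 0 => s
  | j + 1 => f ((iterSt x f s j).setv x j)

/-- The final state of a command, for the bound `V` on values and an input region of size `Z`. -/
def Cmd.run (V Z : ℕ) : Cmd → St → St
  | .skip, s => s
  | .set x e, s => s.setv x (e.eval V s)
  | .st id i j e, s => s.seta id (i.eval V s) (j.eval V s) (e.eval V s)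
  | .out i e, s =>
      if i.eval V s < Z then { s with inp := Function.update s.inp (i.eval V s) (e.eval V s) } else s
  | .seq p q, s => q.run V Z (p.run V Z s)
  | .ite e p q, s => if e.eval V s ≠ 0 then p.run V Z s else q.run V Z s
  | .rep x e p, s => iterSt x (p.run V Z) s (e.eval V s)

/-- The number of commands that are executed. -/
def Cmd.cost (V Z : ℕ) : Cmd → St → ℕ
  | .skip, _ => 1
  | .set _ _, _ => 1
  | .st _ _ _ _, _ => 1
  | .out _ _, _ => 1
  | .seq p q, s => p.cost V Z s + q.cost V Z (p.run V Z s)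
  | .ite e p q, s => 1 + if e.eval V s ≠ 0 then p.cost V Z s else q.cost V Z s
  | .rep x e p, s => 1 + ∑ j ∈ Finset.range (e.eval V s),
      (1 + p.cost V Z ((iterSt x (p.run V Z) s j).setv x j))

/-! ### Compilation to the word RAM -/

/-- The register of a variable. -/
def Vr.reg (x : Vr) : ℕ := 3 * x.ctorIdx + 1

theorem Vr.reg_inj {x y : Vr} : x.reg = y.reg ↔ x = y := by
  constructor
  · intro h
    have h' : x.ctorIdx = y.ctorIdx := by unfold Vr.reg at h; omega
    rw [← Vr.ofNat_ctorIdx x, ← Vr.ofNat_ctorIdx y, h']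
  · rintro rfl; rfl

theorem Ar.idx_inj {x y : Ar} : x.ctorIdx = y.ctorIdx ↔ x = y := by
  constructor
  · intro h
    rw [← Ar.ofNat_ctorIdx x, ← Ar.ofNat_ctorIdx y, h]
  · rintro rfl; rfl

theorem Ar.idx_lt (x : Ar) : x.ctorIdx < 16 := by cases x <;> decide

/-- The machine instruction for an operation on registers. -/
def opI (o : Op) (d a b : ℕ) : Prog := .instr (.op o d a b)

/-- The machine instruction for loading a constant. -/
def constI (d k : ℕ) : Prog := .instr (.const d k)

/-- Combines the values in registers `3 * t` and `3 * (t + 1)`; register `3` contains `V`. -/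
def HOp.code (t : ℕ) : HOp → Prog
  | .add => .seq (opI .add (3 * t) (3 * t) (3 * (t + 1))) (opI .mod (3 * t) (3 * t) 3)
  | .mul => .seq (opI .mul (3 * t) (3 * t) (3 * (t + 1))) (opI .mod (3 * t) (3 * t) 3)
  | .sub => opI .sub (3 * t) (3 * t) (3 * (t + 1))
  | .lt => opI .lt (3 * t) (3 * t) (3 * (t + 1))
  | .eq => opI .eq (3 * t) (3 * t) (3 * (t + 1))
  | .and => .seq (opI .mul (3 * t) (3 * t) (3 * (t + 1)))
      (.seq (constI (3 * (t + 1)) 0) (opI .lt (3 * t) (3 * (t + 1)) (3 * t)))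

/-- The address of entry `(i, j)` of an array. The map from pairs to numbers is injective, and
arrays are interleaved, so that all entries of all arrays have distinct addresses. -/
def addr (Z : ℕ) (id : Ar) (i j : ℕ) : ℕ := Z + (((i + j) * (i + j) + i) * 16 + id.ctorIdx)

theorem addr_inj {Z : ℕ} {id id' : Ar} {i j i' j' : ℕ} :
    addr Z id i j = addr Z id' i' j' ↔ id = id' ∧ i = i' ∧ j = j' := by
  constructor
  · intro h
    unfold addr at h
    have h1 := id.idx_lt
    have h2 := id'.idx_lt
    have h3 : (i + j) * (i + j) + i = (i' + j') * (i' + j') + i' := by omega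
    have h4 : id.ctorIdx = id'.ctorIdx := by omega
    have h5 : i + j = i' + j' := by
      by_contra hne
      rcases Nat.lt_or_gt_of_ne hne with hlt | hlt <;> nlinarith
    rw [h5] at h3
    exact ⟨Ar.idx_inj.1 h4, by omega, by omega⟩
  · rintro ⟨rfl, rfl, rfl⟩; rfl

/-- Replaces the indices in registers `3 * t` and `3 * (t + 1)` by an address in register `3 * t`;
register `0` contains the start of the arrays. -/
def addrCode (id : Ar) (t : ℕ) : Prog :=
  .seq (opI .add (3 * (t + 1)) (3 * t) (3 * (t + 1)))
  (.seq (opI .mul (3 * (t + 1)) (3 * (t + 1)) (3 * (t + 1)))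
  (.seq (opI .add (3 * t) (3 * (t + 1)) (3 * t))
  (.seq (constI (3 * (t + 1)) 16)
  (.seq (opI .mul (3 * t) (3 * t) (3 * (t + 1)))
  (.seq (constI (3 * (t + 1)) id.ctorIdx)
  (.seq (opI .add (3 * t) (3 * t) (3 * (t + 1)))
  (opI .add (3 * t) 0 (3 * t))))))))

/-- Copies register `a` to register `d`, with register `3 * t` as scratch. -/
def mvCode (t d a : ℕ) : Prog := .seq (constI (3 * t) 0) (opI .add d a (3 * t))

/-- Evaluates an expression into register `3 * t`, with the registers `3 * t'`, `t ≤ t'`, as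
scratch. -/
def Ex.code (t : ℕ) : Ex → Prog
  | .lit k => constI (3 * t) k
  | .var x => mvCode t (3 * t) x.reg
  | .bin o a b => .seq (a.code t) (.seq (b.code (t + 1)) (o.code t))
  | .rd id i j => .seq (i.code t) (.seq (j.code (t + 1)) (.seq (addrCode id t)
      (.instr (.load (3 * t) (3 * t)))))
  | .inp a => .seq (a.code t) (.seq (opI .lt (3 * (t + 1)) (3 * t) 0)
      (.seq (.instr (.load (3 * t) (3 * t))) (opI .mul (3 * t) (3 * t) (3 * (t + 1)))))

/-- Compiles a command inside `d` loops. The loop counter and the bound of a loop are kept in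
registers of their own, which the body of the loop cannot access. -/
def Cmd.code (d : ℕ) : Cmd → Prog
  | .skip => constI 6 0
  | .set x e => .seq (e.code 2) (mvCode 3 x.reg 6)
  | .st id i j e => .seq (e.code 2) (.seq (i.code 3) (.seq (j.code 4) (.seq (addrCode id 3)
      (.instr (.store 9 6)))))
  | .out i e => .seq (e.code 2) (.seq (i.code 3) (.seq (opI .lt 12 9 0)
      (.ite 12 (.instr (.store 9 6)) (constI 6 0))))
  | .seq p q => .seq (p.code d) (q.code d)
  | .ite e p q => .seq (e.code 2) (.ite 6 (p.code d) (q.code d))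
  | .rep x e p => .seq (e.code 2) (.seq (mvCode 3 (3 * (2 * d + 1) + 2) 6)
      (.seq (constI (3 * (2 * d) + 2) 0)
      (.seq (opI .lt 6 (3 * (2 * d) + 2) (3 * (2 * d + 1) + 2))
      (.loop 6 (.seq (mvCode 3 x.reg (3 * (2 * d) + 2)) (.seq (p.code (d + 1))
        (.seq (constI 9 1) (.seq (opI .add (3 * (2 * d) + 2) (3 * (2 * d) + 2) 9)
          (opI .lt 6 (3 * (2 * d) + 2) (3 * (2 * d + 1) + 2))))))))))

/-- A bound on the number of machine instructions for the evaluation of an expression. -/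
def Ex.sz : Ex → ℕ
  | .lit _ => 1
  | .var _ => 2
  | .bin _ a b => a.sz + b.sz + 3
  | .rd _ i j => i.sz + j.sz + 9
  | .inp a => a.sz + 3

/-- A bound on the number of machine instructions per executed command. -/
def Cmd.sz : Cmd → ℕ
  | .skip => 1
  | .set _ e => e.sz + 2
  | .st _ i j e => e.sz + i.sz + j.sz + 9
  | .out i e => e.sz + i.sz + 3
  | .seq p q => p.sz + q.sz
  | .ite e p q => e.sz + p.sz + q.sz + 1
  | .rep _ e p => e.sz + p.sz + 8

/-- The machine state `s` represents the state `st`, and all the values are below `V`. -/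
structure Sim (V Z w : ℕ) (s : State) (st : St) : Prop where
  hw : 100 * V ^ 2 ≤ 2 ^ w
  hV : 4 ≤ V
  hZ : Z ≤ V
  regZ : s.reg 0 = Z
  regV : s.reg 3 = V
  var : ∀ x : Vr, s.reg x.reg = st.v x
  arr : ∀ id i j, s.mem (addr Z id i j) = st.arr id i j
  inp : ∀ i < Z, s.mem i = st.inp i
  inp0 : ∀ i, Z ≤ i → st.inp i = 0
  bv : ∀ x, st.v x < V
  barr : ∀ id i j, st.arr id i j < V
  binp : ∀ i, st.inp i < V

/-- `Runs w p s T Q`: from `s`, `p` halts after at most `T` steps in a state that satisfies `Q`. -/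
def Runs (w : ℕ) (p : Prog) (s : State) (T : ℕ) (Q : State → Prop) : Prop :=
  ∃ t s', Exec w p s t s' ∧ t ≤ T ∧ Q s'

theorem Runs.instr {w : ℕ} {i : Instr} {s : State} {Q : State → Prop} (h : Q (i.eval w s)) :
    Runs w (.instr i) s 1 Q := ⟨1, _, .instr i s, le_rfl, h⟩

theorem Runs.seq {w : ℕ} {p q : Prog} {s : State} {T₁ T₂ : ℕ} {P Q : State → Prop}
    (hp : Runs w p s T₁ P) (hq : ∀ s', P s' → Runs w q s' T₂ Q) : Runs w (.seq p q) s (T₁ + T₂) Q := by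
  obtain ⟨t, s', h1, h2, h3⟩ := hp
  obtain ⟨t', s'', h4, h5, h6⟩ := hq s' h3
  exact ⟨_, _, .seq h1 h4, by omega, h6⟩

theorem Runs.mono {w : ℕ} {p : Prog} {s : State} {T T' : ℕ} {P Q : State → Prop}
    (hp : Runs w p s T P) (hT : T ≤ T') (h : ∀ s', P s' → Q s') : Runs w p s T' Q := by
  obtain ⟨t, s', h1, h2, h3⟩ := hp
  exact ⟨t, s', h1, by omega, h s' h3⟩

theorem Runs.opI {w : ℕ} {o : Op} {d a b : ℕ} {s : State} {Q : State → Prop}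
    (h : Q { s with reg := Function.update s.reg d (o.eval w (s.reg a) (s.reg b)) }) :
    Runs w (opI o d a b) s 1 Q := .instr h

theorem Runs.constI {w : ℕ} {d k : ℕ} {s : State} {Q : State → Prop}
    (h : Q { s with reg := Function.update s.reg d (k % 2 ^ w) }) :
    Runs w (constI d k) s 1 Q := .instr h

/-- `s'` differs from `s` at most in the scratch registers `3 * t'`, `t ≤ t'`. -/
def Keeps (t : ℕ) (s s' : State) : Prop :=
  s'.mem = s.mem ∧ ∀ r, (∀ t', t ≤ t' → r ≠ 3 * t') → s'.reg r = s.reg r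

theorem Keeps.trans {t : ℕ} {s s' s'' : State} (h : Keeps t s s') (h' : Keeps t s' s'') :
    Keeps t s s'' := ⟨h'.1.trans h.1, fun r hr => (h'.2 r hr).trans (h.2 r hr)⟩

theorem Keeps.weaken {t t' : ℕ} (ht : t ≤ t') {s s' : State} (h : Keeps t' s s') : Keeps t s s' :=
  ⟨h.1, fun r hr => h.2 r fun t'' ht'' => hr t'' (by omega)⟩

theorem Keeps.update {t t' : ℕ} (ht : t ≤ t') {s s' : State} (h : Keeps t s s') (a : ℕ) :
    Keeps t s { s' with reg := Function.update s'.reg (3 * t') a } := by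
  refine ⟨h.1, fun r hr => ?_⟩
  rw [← h.2 r hr]
  exact Function.update_of_ne (hr t' ht) _ _

theorem Keeps.refl (t : ℕ) (s : State) : Keeps t s s := ⟨rfl, fun _ _ => rfl⟩

theorem Keeps.sim {V Z w t : ℕ} (ht : 2 ≤ t) {s s' : State} {st : St} (h : Keeps t s s')
    (hs : Sim V Z w s st) : Sim V Z w s' st where
  hw := hs.hw
  hV := hs.hV
  hZ := hs.hZ
  regZ := by rw [h.2 0 (by intros; omega), hs.regZ]
  regV := by rw [h.2 3 (by intros; omega), hs.regV]
  var x := by rw [h.2 _ (by intros; unfold Vr.reg; omega), hs.var]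
  arr := by rw [h.1]; exact hs.arr
  inp := by rw [h.1]; exact hs.inp
  inp0 := hs.inp0
  bv := hs.bv
  barr := hs.barr
  binp := hs.binp

theorem Sim.V_lt {V Z w : ℕ} {s : State} {st : St} (hs : Sim V Z w s st) : V < 2 ^ w := by
  nlinarith [hs.hw, hs.hV]

theorem HOp.eval_lt {V Z w : ℕ} {s : State} {st : St} (hs : Sim V Z w s st) (o : HOp) {a b : ℕ}
    (ha : a < V) : o.eval V a b < V := by
  have := hs.hV
  cases o <;> simp only [HOp.eval]
  · exact Nat.mod_lt _ (by omega)
  · exact Nat.mod_lt _ (by omega)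
  · omega
  · split_ifs <;> omega
  · split_ifs <;> omega
  · split_ifs <;> omega

theorem Ex.eval_lt {V Z w : ℕ} {s : State} {st : St} (hs : Sim V Z w s st) (e : Ex) :
    e.eval V st < V := by
  induction e with
  | lit k => exact lt_of_lt_of_le k.2 hs.hV
  | var x => exact hs.bv x
  | bin o a b ha hb => exact o.eval_lt hs ha
  | rd id i j => exact hs.barr _ _ _
  | inp a => exact hs.binp _

theorem HOp.code_runs {V Z w t : ℕ} (ht : 2 ≤ t) {s : State} {st : St} (hs : Sim V Z w s st)
    (o : HOp) {a b : ℕ} (ha : s.reg (3 * t) = a) (hb : s.reg (3 * (t + 1)) = b) (ha' : a < V)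
    (hb' : b < V) :
    Runs w (o.code t) s 3 fun s' => Keeps t s s' ∧ s'.reg (3 * t) = o.eval V a b := by
  have hV := hs.V_lt
  have h4 := hs.hV
  have hw := hs.hw
  have hVr := hs.regV
  have hab : a * b < V * V := Nat.mul_lt_mul'' ha' hb'
  have hne : (3 : ℕ) ≠ 3 * t := by omega
  cases o <;> simp only [HOp.code]
  · refine Runs.mono (.seq (P := fun s' => s' = _) (.opI rfl) fun s' hs' => .opI (Q := _) ?_)
      (by norm_num) fun s' h => h
    subst hs'
    refine ⟨(((Keeps.refl t s).update le_rfl _).update le_rfl _), ?_⟩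
    simp only [Function.update_self, Function.update_of_ne hne, ha, hb, hVr, Op.eval, HOp.eval]
    rw [Nat.mod_eq_of_lt (a := a + b) (by nlinarith), Nat.mod_eq_of_lt]
    exact (Nat.mod_lt _ (by omega)).trans hV
  · refine Runs.mono (.seq (P := fun s' => s' = _) (.opI rfl) fun s' hs' => .opI (Q := _) ?_)
      (by norm_num) fun s' h => h
    subst hs'
    refine ⟨(((Keeps.refl t s).update le_rfl _).update le_rfl _), ?_⟩
    simp only [Function.update_self, Function.update_of_ne hne, ha, hb, hVr, Op.eval, HOp.eval]
    rw [Nat.mod_eq_of_lt (a := a * b) (by nlinarith), Nat.mod_eq_of_lt]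
    exact (Nat.mod_lt _ (by omega)).trans hV
  · refine Runs.mono (.opI (Q := _) ?_) (by norm_num) fun s' h => h
    refine ⟨(Keeps.refl t s).update le_rfl _, ?_⟩
    simp only [Function.update_self, ha, hb, Op.eval, HOp.eval]
    exact Nat.mod_eq_of_lt (by omega)
  · refine Runs.mono (.opI (Q := _) ?_) (by norm_num) fun s' h => h
    refine ⟨(Keeps.refl t s).update le_rfl _, ?_⟩
    simp only [Function.update_self, ha, hb, Op.eval, HOp.eval]
    exact Nat.mod_eq_of_lt (by split_ifs <;> omega)
  · refine Runs.mono (.opI (Q := _) ?_) (by norm_num) fun s' h => h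
    refine ⟨(Keeps.refl t s).update le_rfl _, ?_⟩
    simp only [Function.update_self, ha, hb, Op.eval, HOp.eval]
    exact Nat.mod_eq_of_lt (by split_ifs <;> omega)
  · refine Runs.mono (.seq (P := fun s' => s' = _) (.opI rfl) fun s' hs' => .seq
      (P := fun s' => s' = _) (.constI rfl) fun s'' hs'' => .opI (Q := _) ?_)
      (by norm_num) fun s' h => h
    subst hs' hs''
    refine ⟨(((Keeps.refl t s).update le_rfl _).update (t' := t + 1) (by omega) _).update le_rfl _, ?_⟩
    have hne' : 3 * t ≠ 3 * (t + 1) := by omega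
    simp only [Function.update_self, Function.update_of_ne hne', ha, hb, Op.eval, HOp.eval]
    rw [Nat.mod_eq_of_lt (a := a * b) (by nlinarith), Nat.zero_mod]
    rw [Nat.mod_eq_of_lt (by split_ifs <;> omega)]
    simp only [Nat.pos_iff_ne_zero, ne_eq, mul_eq_zero, not_or]

theorem addr_lt {V Z w : ℕ} {s : State} {st : St} (hs : Sim V Z w s st) (id : Ar) {i j : ℕ}
    (hi : i < V) (hj : j < V) : addr Z id i j < 2 ^ w := by
  have h1 := hs.hw
  have h2 := hs.hV
  have h3 := hs.hZ
  have h4 := id.idx_lt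
  have : (i + j) * (i + j) ≤ (2 * V) * (2 * V) := Nat.mul_le_mul (by omega) (by omega)
  unfold addr
  nlinarith

theorem addrCode_runs {V Z w t : ℕ} (ht : 2 ≤ t) {s : State} {st : St} (hs : Sim V Z w s st)
    (id : Ar) {i j : ℕ} (hi : s.reg (3 * t) = i) (hj : s.reg (3 * (t + 1)) = j) (hi' : i < V)
    (hj' : j < V) :
    Runs w (addrCode id t) s 8 fun s' => Keeps t s s' ∧ s'.reg (3 * t) = addr Z id i j := by
  have hA := addr_lt hs id hi' hj'
  have hV := hs.V_lt
  have h4 := hs.hV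
  have hw := hs.hw
  have hid := id.idx_lt
  have hZr := hs.regZ
  have hne' : 3 * t ≠ 3 * (t + 1) := by omega
  have hne0 : 0 ≠ 3 * (t + 1) := by omega
  have hne0' : 0 ≠ 3 * t := by omega
  unfold addrCode
  refine Runs.mono (.seq (P := fun s' => s' = _) (.opI rfl) fun s1 hs1 => .seq
    (P := fun s' => s' = _) (.opI rfl) fun s2 hs2 => .seq
    (P := fun s' => s' = _) (.opI rfl) fun s3 hs3 => .seq
    (P := fun s' => s' = _) (.constI rfl) fun s4 hs4 => .seq
    (P := fun s' => s' = _) (.opI rfl) fun s5 hs5 => .seq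
    (P := fun s' => s' = _) (.constI rfl) fun s6 hs6 => .seq
    (P := fun s' => s' = _) (.opI rfl) fun s7 hs7 => .opI (Q := _) ?_)
    (by norm_num) fun s' h => h
  subst hs1 hs2 hs3 hs4 hs5 hs6 hs7
  have ht1 : t ≤ t + 1 := by omega
  refine ⟨((((((((Keeps.refl t s).update ht1 _).update ht1 _).update le_rfl _).update ht1 _).update
    le_rfl _).update ht1 _).update le_rfl _).update le_rfl _, ?_⟩
  simp only [Function.update_self, Function.update_of_ne hne', Function.update_of_ne hne0,
    Function.update_of_ne hne0', hi, hj, hZr, Op.eval]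
  unfold addr at hA ⊢
  have b1 : i + j < 2 ^ w := by nlinarith
  have b0 : (i + j) * (i + j) < 2 ^ w := by nlinarith
  have b2 : (i + j) * (i + j) + i < 2 ^ w := by omega
  rw [Nat.mod_eq_of_lt b1, Nat.mod_eq_of_lt b0, Nat.mod_eq_of_lt b2,
    Nat.mod_eq_of_lt (a := 16) (by nlinarith), Nat.mod_eq_of_lt (a := _ * 16) (by omega),
    Nat.mod_eq_of_lt (a := id.ctorIdx) (by omega),
    Nat.mod_eq_of_lt (a := _ * 16 + id.ctorIdx) (by omega), Nat.mod_eq_of_lt hA]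

theorem Ex.code_runs {V Z w : ℕ} (e : Ex) {t : ℕ} (ht : 2 ≤ t) {s : State} {st : St}
    (hs : Sim V Z w s st) :
    Runs w (e.code t) s e.sz fun s' => Keeps t s s' ∧ s'.reg (3 * t) = e.eval V st := by
  induction e generalizing t s with
  | lit k =>
    refine .constI ⟨(Keeps.refl t s).update le_rfl _, ?_⟩
    simp only [Function.update_self, Ex.eval]
    exact Nat.mod_eq_of_lt (by have := k.2; have := hs.hV; have := hs.V_lt; omega)
  | var x =>
    refine .seq (P := fun s' => s' = _) (.constI rfl) fun s' hs' => .opI ?_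
    subst hs'
    refine ⟨((Keeps.refl t s).update le_rfl _).update le_rfl _, ?_⟩
    have hne : x.reg ≠ 3 * t := by unfold Vr.reg; omega
    simp only [Function.update_self, Ex.eval, Function.update_of_ne hne, Op.eval, hs.var,
      Nat.zero_mod, add_zero]
    exact Nat.mod_eq_of_lt ((hs.bv x).trans hs.V_lt)
  | bin o a b iha ihb =>
    refine Runs.mono (.seq (iha ht hs) fun s1 h1 => .seq (ihb (t := t + 1) (by omega)
      (h1.1.sim ht hs)) fun s2 h2 => ?_) (T := a.sz + (b.sz + 3)) (by simp only [Ex.sz]; omega)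
      fun s' h => h
    have k12 := h2.1.weaken (show t ≤ t + 1 by omega)
    have h2t : s2.reg (3 * t) = a.eval V st := by
      rw [h2.1.2 _ (by intros; omega), h1.2]
    refine (o.code_runs ht ((h1.1.trans k12).sim ht hs) h2t h2.2 (a.eval_lt hs)
      (b.eval_lt hs)).mono le_rfl fun s3 h3 => ⟨(h1.1.trans k12).trans h3.1, h3.2⟩
  | rd id i j ihi ihj =>
    refine Runs.mono (.seq (ihi ht hs) fun s1 h1 => .seq (ihj (t := t + 1) (by omega)
      (h1.1.sim ht hs)) fun s2 h2 => ?_) (T := i.sz + (j.sz + 9)) (by simp only [Ex.sz]; omega)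
      fun s' h => h
    have k12 := h2.1.weaken (show t ≤ t + 1 by omega)
    have h2t : s2.reg (3 * t) = i.eval V st := by
      rw [h2.1.2 _ (by intros; omega), h1.2]
    refine .seq (T₁ := 8) (addrCode_runs ht ((h1.1.trans k12).sim ht hs) id h2t h2.2 (i.eval_lt hs)
      (j.eval_lt hs)) fun s3 h3 => .instr ⟨(((h1.1.trans k12).trans h3.1).update le_rfl _), ?_⟩
    simp only [Instr.eval, Function.update_self, h3.2, Ex.eval]
    rw [((h1.1.trans k12).trans h3.1).1, hs.arr]
  | inp a iha =>
    refine .seq (T₂ := 3) (iha ht hs) fun s1 h1 => Runs.mono (.seq (P := fun s' => s' = _)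
      (.opI rfl) fun s2 hs2 => .seq (P := fun s' => s' = _) (.instr rfl) fun s3 hs3 => .opI (Q := _) ?_)
      (by norm_num) fun s' h => h
    subst hs2 hs3
    refine ⟨((h1.1.update (t' := t + 1) (by omega) _).update le_rfl _).update le_rfl _, ?_⟩
    have hne' : 3 * t ≠ 3 * (t + 1) := by omega
    have hZ' : s1.reg 0 = Z := (h1.1.sim ht hs).regZ
    simp only [Instr.eval, Function.update_self, Function.update_of_ne hne',
      Function.update_of_ne hne'.symm, Op.eval, h1.2, hZ', Ex.eval, h1.1.1]
    have hV := hs.V_lt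
    have := hs.hV
    by_cases hlt : a.eval V st < Z
    · rw [if_pos hlt, Nat.mod_eq_of_lt (a := 1) (by omega), hs.inp _ hlt, mul_one,
        Nat.mod_eq_of_lt ((hs.binp _).trans hV)]
    · rw [if_neg hlt, Nat.zero_mod, mul_zero, Nat.zero_mod, hs.inp0 _ (by omega)]

theorem Sim.setv {V Z w : ℕ} {s : State} {st : St} (hs : Sim V Z w s st) (y : Vr) {a : ℕ}
    (ha : a < V) : Sim V Z w { s with reg := Function.update s.reg y.reg a } (st.setv y a) where
  hw := hs.hw
  hV := hs.hV
  hZ := hs.hZ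
  regZ := (Function.update_of_ne (show 0 ≠ y.reg by unfold Vr.reg; omega) a s.reg).trans hs.regZ
  regV := (Function.update_of_ne (show 3 ≠ y.reg by unfold Vr.reg; omega) _ _).trans hs.regV
  var x := by
    simp only [St.setv, Function.update_apply, Vr.reg_inj, hs.var]
  arr := hs.arr
  inp := hs.inp
  inp0 := hs.inp0
  bv x := by
    simp only [St.setv, Function.update_apply]
    split_ifs
    exacts [ha, hs.bv x]
  barr := hs.barr
  binp := hs.binp

theorem Sim.counter {V Z w : ℕ} {s : State} {st : St} (hs : Sim V Z w s st) (j a : ℕ) :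
    Sim V Z w { s with reg := Function.update s.reg (3 * j + 2) a } st where
  hw := hs.hw
  hV := hs.hV
  hZ := hs.hZ
  regZ := (Function.update_of_ne (show 0 ≠ 3 * j + 2 by omega) a s.reg).trans hs.regZ
  regV := (Function.update_of_ne (show 3 ≠ 3 * j + 2 by omega) _ _).trans hs.regV
  var x := (Function.update_of_ne (show x.reg ≠ 3 * j + 2 by unfold Vr.reg; omega) _ _).trans (hs.var x)
  arr := hs.arr
  inp := hs.inp
  inp0 := hs.inp0
  bv := hs.bv
  barr := hs.barr
  binp := hs.binp

theorem Sim.seta {V Z w : ℕ} {s : State} {st : St} (hs : Sim V Z w s st) (id : Ar) {i j a : ℕ}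
    (ha : a < V) :
    Sim V Z w { s with mem := Function.update s.mem (addr Z id i j) a } (st.seta id i j a) where
  hw := hs.hw
  hV := hs.hV
  hZ := hs.hZ
  regZ := hs.regZ
  regV := hs.regV
  var := hs.var
  arr id' i' j' := by
    simp only [St.seta, Function.update_apply, addr_inj, hs.arr]
    by_cases h1 : id' = id <;> by_cases h2 : i' = i <;> by_cases h3 : j' = j <;>
      simp [h1, h2, h3]
  inp i' hi' := by
    exact (Function.update_of_ne (by unfold addr; omega) _ _).trans (hs.inp i' hi')
  inp0 := hs.inp0
  bv := hs.bv
  barr id' i' j' := by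
    have h := hs.barr id' i' j'
    simp only [St.seta, Function.update_apply]
    by_cases h1 : id' = id <;> by_cases h2 : i' = i <;> by_cases h3 : j' = j <;>
      simp_all
  binp := hs.binp

theorem Sim.out {V Z w : ℕ} {s : State} {st : St} (hs : Sim V Z w s st) {i a : ℕ} (hi : i < Z)
    (ha : a < V) : Sim V Z w { s with mem := Function.update s.mem i a }
      { st with inp := Function.update st.inp i a } where
  hw := hs.hw
  hV := hs.hV
  hZ := hs.hZ
  regZ := hs.regZ
  regV := hs.regV
  var := hs.var
  arr id' i' j' := (Function.update_of_ne (by unfold addr; omega) _ _).trans (hs.arr id' i' j')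
  inp i' hi' := by
    simp only [Function.update_apply, hs.inp i' hi']
  inp0 i' hi' := (Function.update_of_ne (by omega) _ _).trans (hs.inp0 i' hi')
  bv := hs.bv
  barr := hs.barr
  binp i' := by
    simp only [Function.update_apply]
    split_ifs
    exacts [ha, hs.binp i']

theorem mvCode_runs {V Z w t d a : ℕ} {s : State} {st : St} (hs : Sim V Z w s st) {x : ℕ}
    (ha : s.reg a = x) (hx : x < V) (hat : a ≠ 3 * t) :
    Runs w (mvCode t d a) s 2 fun s' => s' = { s with
      reg := Function.update (Function.update s.reg (3 * t) 0) d x } := by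
  refine .seq (T₁ := 1) (P := fun s' => s' = _) (.constI rfl) fun s' hs' => .opI ?_
  subst hs'
  simp only [Function.update_self, Op.eval, Nat.zero_mod, Function.update_of_ne hat, ha, add_zero]
  rw [Nat.mod_eq_of_lt (hx.trans hs.V_lt)]

theorem Runs.ite {w r : ℕ} {p q : Prog} {s : State} {T : ℕ} {Q : State → Prop}
    (hp : s.reg r ≠ 0 → Runs w p s T Q) (hq : s.reg r = 0 → Runs w q s T Q) :
    Runs w (.ite r p q) s (T + 1) Q := by
  by_cases h : s.reg r = 0
  · obtain ⟨t, s', h1, h2, h3⟩ := hq h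
    exact ⟨_, _, .ite_neg h h1, by omega, h3⟩
  · obtain ⟨t, s', h1, h2, h3⟩ := hp h
    exact ⟨_, _, .ite_pos h h1, by omega, h3⟩

theorem Runs.loop_step {w r : ℕ} {p : Prog} {s : State} {T₁ T₂ : ℕ} {P Q : State → Prop}
    (h : s.reg r ≠ 0) (hp : Runs w p s T₁ P) (hq : ∀ s', P s' → Runs w (.loop r p) s' T₂ Q) :
    Runs w (.loop r p) s (T₁ + T₂ + 1) Q := by
  obtain ⟨t, s', h1, h2, h3⟩ := hp
  obtain ⟨t', s'', h4, h5, h6⟩ := hq s' h3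
  exact ⟨_, _, .loop_step h h1 h4, by omega, h6⟩

theorem Keeps.counter {t j : ℕ} {s s' : State} (h : Keeps t s s') :
    s'.reg (3 * j + 2) = s.reg (3 * j + 2) := h.2 _ (by intros; omega)

/-- A compiled command simulates the command with a constant factor in the time, and keeps the loop
counters and bounds of the `d` surrounding loops. -/
theorem Cmd.code_runs {V Z w : ℕ} (c : Cmd) {d : ℕ} {s : State} {st : St} (hs : Sim V Z w s st) :
    Runs w (c.code d) s (c.sz * c.cost V Z st) fun s' => Sim V Z w s' (c.run V Z st) ∧
      ∀ j < 2 * d, s'.reg (3 * j + 2) = s.reg (3 * j + 2) := by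
  induction c generalizing d s st with
  | skip =>
    have k := (Keeps.refl 2 s).update le_rfl (0 % 2 ^ w)
    exact (Runs.constI ⟨k.sim le_rfl hs, fun j _ => k.counter⟩).mono (by simp [Cmd.sz, Cmd.cost])
      fun s' h => h
  | set y e =>
    refine Runs.mono (.seq (e.code_runs le_rfl hs) fun s1 h1 =>
      (mvCode_runs (h1.1.sim le_rfl hs) h1.2 (e.eval_lt hs) (by norm_num)).mono le_rfl
        (Q := _) fun s' h => ?_) (by simp [Cmd.sz, Cmd.cost]) fun s' h => h
    subst h
    have k := h1.1.update (t' := 3) (by norm_num) 0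
    refine ⟨(k.sim le_rfl hs).setv y (e.eval_lt hs), fun j hj => ?_⟩
    rw [← k.counter]
    exact Function.update_of_ne (by unfold Vr.reg; omega) _ _
  | st id i j e =>
    refine Runs.mono (.seq (e.code_runs le_rfl hs) fun s1 h1 => ?_)
      (T := e.sz + (i.sz + (j.sz + 9))) (by simp only [Cmd.sz, Cmd.cost]; omega) fun s' h => h
    have hs1 := h1.1.sim le_rfl hs
    refine .seq (i.code_runs (t := 3) (by norm_num) hs1) fun s2 h2 => ?_
    have hs2 := h2.1.sim (by norm_num) hs1
    refine .seq (j.code_runs (t := 4) (by norm_num) hs2) fun s3 h3 => ?_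
    have hs3 := h3.1.sim (by norm_num) hs2
    have h3' : s3.reg (3 * 3) = i.eval V st := by
      rw [h3.1.2 _ (by intros; omega), h2.2]
    refine .seq (T₁ := 8) (addrCode_runs (t := 3) (by norm_num) hs3 id h3' h3.2 (i.eval_lt hs)
      (j.eval_lt hs)) fun s4 h4 => .instr ?_
    have hs4 := h4.1.sim (by norm_num) hs3
    have h34 := (h2.1.trans (h3.1.weaken (by norm_num))).trans h4.1
    have h46 : s4.reg 6 = e.eval V st := by
      rw [h34.2 _ (by intros; omega)]
      exact h1.2
    have h49 : s4.reg 9 = addr Z id (i.eval V st) (j.eval V st) := h4.2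
    simp only [Instr.eval, h46, h49]
    refine ⟨hs4.seta id (e.eval_lt hs), fun j hj => ?_⟩
    exact (h1.1.trans (h34.weaken (by norm_num))).counter
  | out i e =>
    refine Runs.mono (.seq (e.code_runs le_rfl hs) fun s1 h1 => ?_)
      (T := e.sz + (i.sz + (1 + 2))) (by simp only [Cmd.sz, Cmd.cost]; omega) fun s' h => h
    have hs1 := h1.1.sim le_rfl hs
    refine .seq (i.code_runs (t := 3) (by norm_num) hs1) fun s2 h2 => ?_
    have hs2 := h2.1.sim (by norm_num) hs1
    refine .seq (P := fun s' => s' = _) (.opI rfl) fun s3 hs3 => ?_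
    have k := (h2.1.update (t' := 4) (by norm_num)
      (Op.eval w .lt (s2.reg 9) (s2.reg 0))).weaken (show 2 ≤ 3 by norm_num)
    rw [show 3 * 4 = 12 from rfl, ← hs3] at k
    have hs3' := (h1.1.trans k).sim le_rfl hs
    have h36 : s3.reg 6 = e.eval V st := by
      rw [hs3]
      have : s2.reg 6 = s1.reg 6 := h2.1.2 _ (by intros; omega)
      simpa [this] using h1.2
    have h39 : s3.reg 9 = i.eval V st := by
      rw [hs3]
      simpa using h2.2
    have h12 : s3.reg 12 = if i.eval V st < Z then 1 else 0 := by
      rw [hs3]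
      have := h2.2
      simp only [Nat.reduceMul] at this
      simp only [Function.update_self, Op.eval, hs2.regZ, this]
      have := hs.hV
      have := hs.V_lt
      exact Nat.mod_eq_of_lt (by split_ifs <;> omega)
    refine .ite (fun h => ?_) fun h => ?_
    · have hlt : i.eval V st < Z := by
        by_contra hcon
        simp [h12, hcon] at h
      refine .instr ?_
      simp only [Instr.eval, h36, h39, Cmd.run, if_pos hlt]
      exact ⟨hs3'.out hlt (e.eval_lt hs), fun j _ => (h1.1.trans k).counter⟩
    · have hlt : ¬ i.eval V st < Z := by
        intro hcon
        simp [h12, hcon] at h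
      simp only [Cmd.run, if_neg hlt]
      have k' := (h1.1.trans k).update (t' := 2) (by norm_num) (0 % 2 ^ w)
      exact .constI ⟨k'.sim le_rfl hs, fun j _ => k'.counter⟩
  | seq p q ihp ihq =>
    refine Runs.mono (.seq (ihp hs) fun s1 h1 => (ihq h1.1).mono le_rfl
      (Q := _) fun s' h => ?_) ?_ fun s' h => h
    · exact ⟨h.1, fun j hj => (h.2 j hj).trans (h1.2 j hj)⟩
    · simp only [Cmd.sz, Cmd.cost]
      nlinarith
  | ite e p q ihp ihq =>
    refine Runs.mono (.seq (e.code_runs le_rfl hs) fun s1 h1 => .ite (T := (p.sz + q.sz) *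
      (if e.eval V st ≠ 0 then p.cost V Z st else q.cost V Z st)) (fun h => ?_) fun h => ?_) ?_
      fun s' h => h
    · have he : e.eval V st ≠ 0 := by rwa [← h1.2]
      simp only [Cmd.run, if_pos he]
      exact (ihp (h1.1.sim le_rfl hs)).mono (by nlinarith) fun s' h' =>
        ⟨h'.1, fun j hj => (h'.2 j hj).trans h1.1.counter⟩
    · have he : ¬ e.eval V st ≠ 0 := by rwa [← h1.2, not_not]
      simp only [Cmd.run, if_neg he]
      exact (ihq (h1.1.sim le_rfl hs)).mono (by nlinarith) fun s' h' =>
        ⟨h'.1, fun j hj => (h'.2 j hj).trans h1.1.counter⟩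
    · simp only [Cmd.sz, Cmd.cost]
      generalize (if e.eval V st ≠ 0 then p.cost V Z st else q.cost V Z st) = C
      nlinarith
  | rep y e p ih =>
    -- the loop, started with the counter at `N - m`
    have key : ∀ m s st', m ≤ e.eval V st → st' = iterSt y (p.run V Z) st (e.eval V st - m) →
        Sim V Z w s st' → s.reg (3 * (2 * d) + 2) = e.eval V st - m →
        s.reg (3 * (2 * d + 1) + 2) = e.eval V st → s.reg 6 = (if 0 < m then 1 else 0) →
        Runs w (.loop 6 (.seq (mvCode 3 y.reg (3 * (2 * d) + 2)) (.seq (p.code (d + 1))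
          (.seq (constI 9 1) (.seq (opI .add (3 * (2 * d) + 2) (3 * (2 * d) + 2) 9)
          (opI .lt 6 (3 * (2 * d) + 2) (3 * (2 * d + 1) + 2))))))) s
          (1 + ∑ j ∈ Finset.Ico (e.eval V st - m) (e.eval V st),
            (6 + p.sz * p.cost V Z ((iterSt y (p.run V Z) st j).setv y j)))
          fun s' => Sim V Z w s' (iterSt y (p.run V Z) st (e.eval V st)) ∧
            ∀ j < 2 * d, s'.reg (3 * j + 2) = s.reg (3 * j + 2) := by
      set N := e.eval V st with hN
      have hNV : N < V := e.eval_lt hs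
      intro m
      induction m with
      | zero =>
        intro s st' _ hst hsim _ _ h6
        refine ⟨1, s, .loop_done (by simpa using h6), by omega, ?_, fun _ _ => rfl⟩
        rw [hst] at hsim
        simpa using hsim
      | succ m ihm =>
        intro s st' hm hst hsim hc hl h6
        have hlt : N - (m + 1) < N := by omega
        rw [← Finset.sum_Ioo_add_eq_sum_Ico hlt]
        have hIoo : Finset.Ioo (N - (m + 1)) N = Finset.Ico (N - m) N := by
          ext j; simp only [Finset.mem_Ioo, Finset.mem_Ico]; omega
        rw [hIoo]
        refine Runs.mono (.loop_step (T₂ := 1 + ∑ j ∈ Finset.Ico (N - m) N,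
            (6 + p.sz * p.cost V Z ((iterSt y (p.run V Z) st j).setv y j)))
            (P := fun s5 => Sim V Z w s5 (iterSt y (p.run V Z) st (N - m)) ∧
              s5.reg (3 * (2 * d) + 2) = N - m ∧ s5.reg (3 * (2 * d + 1) + 2) = N ∧
              s5.reg 6 = (if 0 < m then 1 else 0) ∧
              ∀ j < 2 * d, s5.reg (3 * j + 2) = s.reg (3 * j + 2))
          (by rw [h6]; simp) (.seq (mvCode_runs hsim hc (by omega)
          (by omega)) fun s1 h1 => .seq (P := fun s' => Sim V Z w s'
            (iterSt y (p.run V Z) st (N - m)) ∧ ∀ j < 2 * (d + 1), s'.reg (3 * j + 2) =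
              s.reg (3 * j + 2)) (T₁ := p.sz * p.cost V Z
                ((iterSt y (p.run V Z) st (N - (m + 1))).setv y (N - (m + 1)))) ?_
            fun s2 h2 => .seq (P := fun s' => s' = _)
            (.constI rfl) fun s3 h3 => .seq (P := fun s' => s' = _) (.opI rfl)
            fun s4 h4 => .opI ?_) fun s5 h5 => ?_) ?_ fun s' h => h
        · have hs1 : Sim V Z w s1 (st'.setv y (N - (m + 1))) := by
            rw [h1]
            exact (((Keeps.refl 3 s).update le_rfl 0).sim (by norm_num) hsim).setv y (by omega)
          have hj1 : ∀ j, s1.reg (3 * j + 2) = s.reg (3 * j + 2) := by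
            intro j
            rw [h1]
            simp only
            rw [Function.update_of_ne (by unfold Vr.reg; omega), Function.update_of_ne (by omega)]
          rw [hst] at hs1
          refine (ih (d := d + 1) hs1).mono le_rfl fun s2 h2 => ⟨?_, fun j hj =>
            (h2.2 j hj).trans (hj1 j)⟩
          have : N - m = (N - (m + 1)) + 1 := by omega
          rw [this]
          exact h2.1
        · have h2c : s2.reg (3 * (2 * d) + 2) = N - (m + 1) := by rw [h2.2 _ (by omega), hc]
          have h2l : s2.reg (3 * (2 * d + 1) + 2) = N := by rw [h2.2 _ (by omega), hl]
          have h4V := hs.hV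
          have hVw := hs.V_lt
          have k3 := ((Keeps.refl 2 s2).update (t' := 3) (by norm_num) (1 % 2 ^ w)).sim le_rfl h2.1
          rw [show 3 * 3 = 9 from rfl, ← h3] at k3
          have h4' : s4 = { s3 with reg := Function.update s3.reg (3 * (2 * d) + 2) (N - m) } := by
            rw [h4, h3]
            simp only [Function.update_self, Op.eval,
              Function.update_of_ne (show 3 * (2 * d) + 2 ≠ 9 by omega), h2c]
            rw [Nat.mod_eq_of_lt (a := 1) (by omega), Nat.mod_eq_of_lt (by omega)]
            congr 2
            omega
          have k4 := k3.counter (2 * d) (N - m)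
          rw [← h4'] at k4
          have h4c : s4.reg (3 * (2 * d) + 2) = N - m := by rw [h4']; simp
          have h4l : ∀ j, j ≠ 2 * d → s4.reg (3 * j + 2) = s2.reg (3 * j + 2) := by
            intro j hj
            rw [h4', h3]
            simp only
            rw [Function.update_of_ne (by omega), Function.update_of_ne (by omega)]
          have h6' : Op.eval w .lt (s4.reg (3 * (2 * d) + 2)) (s4.reg (3 * (2 * d + 1) + 2)) =
              if 0 < m then 1 else 0 := by
            rw [h4c, h4l _ (show 2 * d + 1 ≠ 2 * d by omega), h2l]
            simp only [Op.eval]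
            rw [Nat.mod_eq_of_lt (by split_ifs <;> omega)]
            have : N - m < N ↔ 0 < m := by omega
            simp only [this]
          rw [h6']
          have k5 := (Keeps.refl 2 s4).update (t' := 2) le_rfl (if 0 < m then 1 else 0)
          exact ⟨k5.sim le_rfl k4, by rw [k5.counter, h4c], by
            rw [k5.counter, h4l _ (by omega), h2l], by simp, fun j hj => by
            rw [k5.counter, h4l j (by omega), h2.2 j (by omega)]⟩
        · exact (ihm s5 _ (by omega) rfl h5.1 h5.2.1 h5.2.2.1 h5.2.2.2.1).mono le_rfl
            fun s' h => ⟨h.1, fun j hj => (h.2 j hj).trans (h5.2.2.2.2 j hj)⟩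
        · omega
    have hNV : e.eval V st < V := e.eval_lt hs
    have h4V := hs.hV
    have hVw := hs.V_lt
    refine Runs.mono (.seq (e.code_runs le_rfl hs) fun s1 h1 => .seq
      (mvCode_runs (h1.1.sim le_rfl hs) h1.2 hNV (by norm_num)) fun s2 h2 =>
      .seq (P := fun s' => s' = _) (.constI rfl) fun s3 h3 => .seq (P := fun s' => s' = _)
      (.opI rfl) fun s4 h4 => (key (e.eval V st) s4 st le_rfl (by simp [iterSt]) ?_ ?_ ?_ ?_).mono
        le_rfl (Q := _) fun s' h => ?_) ?_ fun s' h => h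
    · have k := h1.1.update (t' := 3) (by norm_num) 0
      have := (((k.sim le_rfl hs).counter (2 * d + 1) (e.eval V st)).counter (2 * d) (0 % 2 ^ w))
      rw [h4, h3, h2]
      exact ((Keeps.refl 2 _).update (t' := 2) le_rfl _).sim le_rfl this
    · rw [h4, h3, h2]
      simp only
      rw [Function.update_of_ne (by omega), Function.update_self, Nat.zero_mod]
      omega
    · rw [h4, h3, h2]
      simp only
      rw [Function.update_of_ne (by omega), Function.update_of_ne (by omega), Function.update_self]
    · rw [h4, h3, h2]
      simp only [Function.update_self, Op.eval]
      rw [Function.update_of_ne (show 3 * (2 * d + 1) + 2 ≠ 3 * (2 * d) + 2 by omega),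
        Function.update_self, Nat.zero_mod, Nat.mod_eq_of_lt]
      split_ifs <;> omega
    · refine ⟨h.1, fun j hj => ?_⟩
      rw [h.2 j hj, h4, h3, h2]
      simp only
      rw [Function.update_of_ne (by omega), Function.update_of_ne (by omega),
        Function.update_of_ne (by omega), Function.update_of_ne (by omega), h1.1.counter]
    · simp only [Cmd.sz, Cmd.cost, Nat.sub_self, Finset.range_eq_Ico]
      have : ∑ j ∈ Finset.Ico 0 (e.eval V st), (6 + p.sz * p.cost V Z
          ((iterSt y (p.run V Z) st j).setv y j)) ≤ (e.sz + p.sz + 8) *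
          ∑ j ∈ Finset.Ico 0 (e.eval V st), (1 + p.cost V Z
            ((iterSt y (p.run V Z) st j).setv y j)) := by
        rw [Finset.mul_sum]
        exact Finset.sum_le_sum fun j _ => by nlinarith
      nlinarith

/-! ### The input of the machine -/

section Encode

variable {n : ℕ} (adj : Fin n → List (Fin n))

/-- The address at which the list of vertex `k` starts. -/
def off (k : ℕ) : ℕ :=
  n + 2 + (((List.finRange n).filter fun u => u.val < k).map fun u => (adj u).length).sum

theorem filter_finRange (k : ℕ) :
    ((List.finRange n).filter fun u => u.val < k) = (List.finRange n).take k := by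
  conv_lhs => rw [← List.take_append_drop k (List.finRange n)]
  rw [List.filter_append, List.filter_eq_self.2, List.filter_eq_nil_iff.2, List.append_nil]
  · intro a ha
    obtain ⟨i, hi, rfl⟩ := List.mem_iff_getElem.1 ha
    simp
  · intro a ha
    obtain ⟨i, hi, rfl⟩ := List.mem_iff_getElem.1 ha
    simp only [List.length_take] at hi
    simp only [List.getElem_take, List.getElem_finRange, Fin.val_cast, decide_eq_true_eq]
    omega

theorem off_eq (k : ℕ) :
    off adj k = n + 2 + (((List.finRange n).take k).map fun u => (adj u).length).sum := by
  rw [off, filter_finRange]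

theorem off_succ (v : Fin n) : off adj (v + 1) = off adj v + (adj v).length := by
  rw [off_eq, off_eq, List.take_add_one]
  simp
  omega

theorem off_length : off adj n = (encode adj).length := by
  rw [off_eq, List.take_of_length_le (by simp)]
  simp [encode, List.length_flatMap]
  omega

theorem encode_zero : (encode adj).getD 0 0 = n := by simp [encode]

theorem encode_off {k : ℕ} (hk : k ≤ n) : (encode adj).getD (k + 1) 0 = off adj k := by
  have h : k < ((List.range (n + 1)).map (off adj)).length := by simp; omega
  have : encode adj = n :: (((List.range (n + 1)).map (off adj)) ++
    ((List.finRange n).flatMap adj).map Fin.val) := rfl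
  rw [this, List.getD_cons_succ, List.getD_append _ _ _ _ h, List.getD_eq_getElem _ _ h]
  simp

theorem encode_list (v : Fin n) {i : ℕ} (hi : i < (adj v).length) :
    (encode adj).getD (off adj v + i) 0 = ((adj v)[i] : Fin n) := by
  have : encode adj = (n :: ((List.range (n + 1)).map (off adj))) ++
    ((List.finRange n).flatMap adj).map Fin.val := rfl
  have hl : (n :: ((List.range (n + 1)).map (off adj))).length = n + 2 := by simp
  have ho : off adj v = n + 2 + (((List.finRange n).take v).flatMap adj).length := by
    rw [off_eq, List.length_flatMap]
  have hs : (List.finRange n).flatMap adj = ((List.finRange n).take v).flatMap adj ++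
      (adj v ++ ((List.finRange n).drop (v + 1)).flatMap adj) := by
    conv_lhs => rw [← List.take_append_drop v (List.finRange n)]
    rw [List.flatMap_append, List.drop_eq_getElem_cons (by simp), List.flatMap_cons]
    simp
  rw [this, List.getD_append_right _ _ _ _ (by omega), hl, ho, hs, List.map_append,
    List.map_append, List.getD_append_right _ _ _ _ (by simp; omega), List.length_map,
    List.getD_append _ _ _ _ (by simp; omega), List.getD_eq_getElem _ _ (by simp; omega)]
  simp only [List.getElem_map]
  congr 3
  omega

/-- The state of the structured language at the start. -/
def st0 : St where
  v _ := 0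
  arr _ _ _ := 0
  inp i := (encode adj).getD i 0

/-- The number of pairs of adjacent vertices, in the adjacency lists. -/
def totalDeg : ℕ := ∑ v, (adj v).length

theorem off_n : off adj n = n + 2 + totalDeg adj := by
  rw [off_eq, List.take_of_length_le (by simp), totalDeg, ← List.ofFn_eq_map, List.sum_ofFn]

theorem off_le_off (k : ℕ) : off adj k ≤ off adj n := by
  rw [off_eq, off_eq, List.take_of_length_le (i := n) (by simp)]
  have := (List.Sublist.map (fun u => (adj u).length) (List.take_sublist k (List.finRange n))).sum_le_sum
    (by simp)
  omega

variable {adj} {G : SimpleGraph (Fin n)}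

theorem length_adj_lt (hadj : IsAdjLists G adj) (v : Fin n) : (adj v).length < n := by
  classical
  have h1 : ((v :: adj v).toFinset).card ≤ n := by
    simpa using Finset.card_le_univ (v :: adj v).toFinset
  rw [List.toFinset_card_of_nodup] at h1
  · simpa using h1
  · exact List.nodup_cons.2 ⟨fun h => G.loopless.irrefl v (((hadj v).2 v).1 h), (hadj v).1⟩

theorem totalDeg_le (hadj : IsAdjLists G adj) : totalDeg adj ≤ n * n := by
  refine (Finset.sum_le_card_nsmul _ _ n fun v _ => (length_adj_lt hadj v).le).trans ?_
  simp

theorem encode_lt (hadj : IsAdjLists G adj) (i : ℕ) : (encode adj).getD i 0 < (n + 4) ^ 2 := by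
  have hoff : ∀ k, off adj k ≤ n + 2 + n * n := fun k => by
    have := off_le_off adj k
    have := off_n adj
    have := totalDeg_le hadj
    omega
  by_cases h : i < (encode adj).length
  · rw [List.getD_eq_getElem _ _ h]
    have hm := List.getElem_mem h
    generalize (encode adj)[i] = y at hm
    have : encode adj = n :: (((List.range (n + 1)).map (off adj)) ++
      ((List.finRange n).flatMap adj).map Fin.val) := rfl
    simp only [this, List.mem_cons, List.mem_append, List.mem_map, List.mem_flatMap] at hm
    rcases hm with hm | ⟨k, -, hm⟩ | ⟨u, -, hm⟩
    · nlinarith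
    · nlinarith [hoff k]
    · nlinarith [u.2]
  · rw [List.getD_eq_default _ _ (by omega)]
    positivity

end Encode

/-- Turns a command into a program: computes the end of the input and the bound on the values, runs
the command, and returns the numbers at the addresses from `0` on. -/
def Cmd.prog (c : Cmd) : Prog :=
  .seq (constI 6 0) (.seq (.instr (.load 6 6)) (.seq (constI 9 1) (.seq (opI .add 9 6 9)
    (.seq (.instr (.load 0 9)) (.seq (constI 9 4) (.seq (opI .add 9 6 9) (.seq (opI .mul 3 9 9)
    (.seq (c.code 0) (constI 0 0)))))))))

theorem wordLength_bound (n : ℕ) : 100 * ((n + 4) ^ 2) ^ 2 ≤ 2 ^ wordLength 40 n := by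
  have h1 : n + 1 ≤ 2 ^ (Nat.log 2 n + 1) := Nat.lt_pow_succ_log_self (by norm_num) n
  have h2 : 2 ≤ 2 ^ (Nat.log 2 n + 1) := by
    rw [pow_succ]
    have := Nat.one_le_two_pow (n := Nat.log 2 n)
    omega
  have h3 : n + 4 ≤ (2 ^ (Nat.log 2 n + 1)) ^ 3 := by
    generalize 2 ^ (Nat.log 2 n + 1) = y at h1 h2
    have : 4 ≤ y * y := Nat.mul_le_mul h2 h2
    nlinarith
  have h4 : 100 ≤ (2 ^ (Nat.log 2 n + 1)) ^ 7 :=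
    le_trans (by norm_num) (Nat.pow_le_pow_left h2 7)
  calc 100 * ((n + 4) ^ 2) ^ 2 ≤ (2 ^ (Nat.log 2 n + 1)) ^ 7 *
        ((((2 ^ (Nat.log 2 n + 1)) ^ 3) ^ 2) ^ 2) := by gcongr
    _ = (2 ^ (Nat.log 2 n + 1)) ^ 19 := by ring
    _ ≤ (2 ^ (Nat.log 2 n + 1)) ^ 40 := Nat.pow_le_pow_right (by omega) (by norm_num)
    _ = 2 ^ wordLength 40 n := by rw [wordLength, ← pow_mul, mul_comm 40]

theorem Cmd.prog_runs (c : Cmd) {n : ℕ} {G : SimpleGraph (Fin n)} {adj : Fin n → List (Fin n)}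
    (hadj : IsAdjLists G adj) :
    Runs (wordLength 40 n) c.prog (initState (wordLength 40 n) adj)
      (c.sz * c.cost ((n + 4) ^ 2) (off adj n) (st0 adj) + 9) fun s =>
        s.reg 0 = 0 ∧ s.reg 1 = (c.run ((n + 4) ^ 2) (off adj n) (st0 adj)).v .bk ∧
        ∀ i < off adj n, s.mem i = (c.run ((n + 4) ^ 2) (off adj n) (st0 adj)).inp i := by
  set V := (n + 4) ^ 2 with hV
  have hw := wordLength_bound n
  set w := wordLength 40 n with hw'
  rw [← hV] at hw
  have hV4 : 16 ≤ V := by rw [hV]; nlinarith [Nat.zero_le n]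
  have hnV : n + 4 ≤ V := by rw [hV]; nlinarith
  have hVw : V < 2 ^ w := by nlinarith
  have hZV : off adj n ≤ V := by
    have := off_n adj
    have := totalDeg_le hadj
    nlinarith
  have hmem : ∀ i, (initState w adj).mem i = (encode adj).getD i 0 := fun i =>
    Nat.mod_eq_of_lt ((encode_lt hadj i).trans hVw)
  refine Runs.mono (.seq (P := fun s' => s' = _) (.constI rfl) fun s1 h1 => .seq
    (P := fun s' => s' = _) (.instr rfl) fun s2 h2 => .seq (P := fun s' => s' = _) (.constI rfl)
    fun s3 h3 => .seq (P := fun s' => s' = _) (.opI rfl) fun s4 h4 => .seq (P := fun s' => s' = _)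
    (.instr rfl) fun s5 h5 => .seq (P := fun s' => s' = _) (.constI rfl) fun s6 h6 => .seq
    (P := fun s' => s' = _) (.opI rfl) fun s7 h7 => .seq (P := fun s' => s' = _) (.opI rfl)
    fun s8 h8 => .seq (c.code_runs (V := V) (Z := off adj n) (st := st0 adj) ?_) fun s9 h9 =>
    .constI (Q := _) ⟨by simp, ?_, fun i hi => h9.1.inp i hi⟩) (by omega) fun s h => h
  · have e2 : s2.reg 6 = n := by
      rw [h2, h1]
      simpa [Instr.eval, hmem] using encode_zero adj
    have e4 : s4.reg 9 = n + 1 := by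
      rw [h4, h3]
      simp only [Function.update_self, Op.eval, Function.update_of_ne (show (6 : ℕ) ≠ 9 by norm_num), e2]
      rw [Nat.mod_eq_of_lt (a := 1) (by omega), Nat.mod_eq_of_lt (by omega)]
    have m4 : s4.mem = (initState w adj).mem := by rw [h4, h3, h2, h1]; rfl
    have e5 : s5.reg 0 = off adj n := by
      rw [h5]
      simp only [Instr.eval, Function.update_self, e4, m4, hmem]
      exact encode_off adj le_rfl
    have e56 : s5.reg 6 = n := by
      rw [h5, h4, h3]
      simpa [Instr.eval] using e2
    have e7 : s7.reg 9 = n + 4 := by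
      rw [h7, h6]
      simp only [Function.update_self, Op.eval, Function.update_of_ne (show (6 : ℕ) ≠ 9 by norm_num), e56]
      rw [Nat.mod_eq_of_lt (a := 4) (by omega), Nat.mod_eq_of_lt (by omega)]
    refine ⟨hw, by omega, hZV, ?_, ?_, fun x => ?_, fun id i j => ?_, fun i hi => ?_, fun i hi => ?_,
      fun x => ?_, fun id i j => ?_, encode_lt hadj⟩
    · rw [h8, h7, h6]
      simpa using e5
    · rw [h8]
      simp only [Function.update_self, Op.eval, e7]
      rw [Nat.mod_eq_of_lt (by nlinarith), hV, sq]
    · rw [h8, h7, h6, h5, h4, h3, h2, h1]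
      simp only [Instr.eval]
      have : ∀ j, x.reg ≠ 3 * j := fun j => by unfold Vr.reg; omega
      rw [Function.update_of_ne (this 1), Function.update_of_ne (this 3),
        Function.update_of_ne (this 3), Function.update_of_ne (this 0), Function.update_of_ne (this 3),
        Function.update_of_ne (this 3), Function.update_of_ne (this 2), Function.update_of_ne (this 2)]
      rfl
    · rw [h8, h7, h6, h5]
      simp only [Instr.eval, m4, hmem]
      rw [List.getD_eq_default _ _ (by rw [← off_length]; unfold addr; omega)]
      rfl
    · rw [h8, h7, h6, h5]
      simp only [Instr.eval, m4, hmem]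
      rfl
    · exact List.getD_eq_default _ _ (by rw [← off_length]; omega)
    · simp only [st0]; omega
    · simp only [st0]; omega
  · have := h9.1.var .bk
    simpa [Vr.reg, Vr.ctorIdx] using this

/-! ### Reasoning about the structured language -/

instance : Coe Vr Ex := ⟨.var⟩
instance : OfNat Ex 0 := ⟨.lit 0⟩
instance : OfNat Ex 1 := ⟨.lit 1⟩
instance : OfNat Ex 2 := ⟨.lit 2⟩
instance : OfNat Ex 3 := ⟨.lit 3⟩
instance : Add Ex := ⟨.bin .add⟩
instance : Mul Ex := ⟨.bin .mul⟩
instance : Sub Ex := ⟨.bin .sub⟩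

/-- The comparison `a < b` as an expression. -/
infix:50 " <ₑ " => Ex.bin HOp.lt
/-- The comparison `a = b` as an expression. -/
infix:50 " =ₑ " => Ex.bin HOp.eq
/-- The conjunction as an expression. -/
infixr:35 " &ₑ " => Ex.bin HOp.and
/-- Assignment to a variable. -/
infix:25 " ≔ " => Cmd.set

/-- Entry `i` of a one-dimensional array, which is row `0` of a two-dimensional one. -/
def Ex.rd1 (id : Ar) (i : Ex) : Ex := .rd id 0 i

/-- Assignment to entry `i` of a one-dimensional array. -/
def Cmd.st1 (id : Ar) (i e : Ex) : Cmd := .st id 0 i e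

section Eval

variable {V Z : ℕ} {s : St}

@[simp] theorem eval_lit (k : Fin 4) : (Ex.lit k).eval V s = k := rfl
@[simp] theorem eval_zero : (0 : Ex).eval V s = 0 := rfl
@[simp] theorem eval_one : (1 : Ex).eval V s = 1 := rfl
@[simp] theorem eval_two : (2 : Ex).eval V s = 2 := rfl
@[simp] theorem eval_three : (3 : Ex).eval V s = 3 := rfl
@[simp] theorem eval_var (x : Vr) : (Ex.var x).eval V s = s.v x := rfl
@[simp] theorem eval_add (a b : Ex) : (a + b).eval V s = (a.eval V s + b.eval V s) % V := rfl
@[simp] theorem eval_mul (a b : Ex) : (a * b).eval V s = (a.eval V s * b.eval V s) % V := rfl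
@[simp] theorem eval_sub (a b : Ex) : (a - b).eval V s = a.eval V s - b.eval V s := rfl
@[simp] theorem eval_lt (a b : Ex) :
    (a <ₑ b).eval V s = if a.eval V s < b.eval V s then 1 else 0 := rfl
@[simp] theorem eval_eq (a b : Ex) :
    (a =ₑ b).eval V s = if a.eval V s = b.eval V s then 1 else 0 := rfl
@[simp] theorem eval_and (a b : Ex) :
    (a &ₑ b).eval V s = if a.eval V s ≠ 0 ∧ b.eval V s ≠ 0 then 1 else 0 := rfl
@[simp] theorem eval_rd (id : Ar) (i j : Ex) :
    (Ex.rd id i j).eval V s = s.arr id (i.eval V s) (j.eval V s) := rfl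
@[simp] theorem eval_rd1 (id : Ar) (i : Ex) :
    (Ex.rd1 id i).eval V s = s.arr id 0 (i.eval V s) := rfl
@[simp] theorem eval_inp (i : Ex) : (Ex.inp i).eval V s = s.inp (i.eval V s) := rfl

@[simp] theorem setv_v (x y : Vr) (a : ℕ) : (s.setv x a).v y = if y = x then a else s.v y := by
  simp [St.setv, Function.update_apply]
@[simp] theorem setv_arr (x : Vr) (a : ℕ) : (s.setv x a).arr = s.arr := rfl
@[simp] theorem setv_inp (x : Vr) (a : ℕ) : (s.setv x a).inp = s.inp := rfl
@[simp] theorem seta_v (id : Ar) (i j a : ℕ) : (s.seta id i j a).v = s.v := rfl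
@[simp] theorem seta_inp (id : Ar) (i j a : ℕ) : (s.seta id i j a).inp = s.inp := rfl
@[simp] theorem seta_arr (id id' : Ar) (i j i' j' a : ℕ) : (s.seta id i j a).arr id' i' j' =
    if id' = id ∧ i' = i ∧ j' = j then a else s.arr id' i' j' := by
  simp only [St.seta, Function.update_apply]
  by_cases h1 : id' = id <;> by_cases h2 : i' = i <;> by_cases h3 : j' = j <;> simp [h1, h2, h3]

@[simp] theorem run_skip : Cmd.skip.run V Z s = s := rfl
@[simp] theorem run_set (x : Vr) (e : Ex) : (x ≔ e).run V Z s = s.setv x (e.eval V s) := rfl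
@[simp] theorem run_st (id : Ar) (i j e : Ex) : (Cmd.st id i j e).run V Z s =
    s.seta id (i.eval V s) (j.eval V s) (e.eval V s) := rfl
@[simp] theorem run_st1 (id : Ar) (i e : Ex) : (Cmd.st1 id i e).run V Z s =
    s.seta id 0 (i.eval V s) (e.eval V s) := rfl
@[simp] theorem run_seq (p q : Cmd) : (p ;; q).run V Z s = q.run V Z (p.run V Z s) := rfl
@[simp] theorem run_ite (e : Ex) (p q : Cmd) : (Cmd.ite e p q).run V Z s =
    if e.eval V s ≠ 0 then p.run V Z s else q.run V Z s := rfl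
@[simp] theorem cost_skip : Cmd.skip.cost V Z s = 1 := rfl
@[simp] theorem cost_set (x : Vr) (e : Ex) : (x ≔ e).cost V Z s = 1 := rfl
@[simp] theorem cost_st (id : Ar) (i j e : Ex) : (Cmd.st id i j e).cost V Z s = 1 := rfl
@[simp] theorem cost_st1 (id : Ar) (i e : Ex) : (Cmd.st1 id i e).cost V Z s = 1 := rfl
@[simp] theorem cost_out (i e : Ex) : (Cmd.out i e).cost V Z s = 1 := rfl
@[simp] theorem cost_seq (p q : Cmd) :
    (p ;; q).cost V Z s = p.cost V Z s + q.cost V Z (p.run V Z s) := rfl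
@[simp] theorem cost_ite (e : Ex) (p q : Cmd) : (Cmd.ite e p q).cost V Z s =
    1 + if e.eval V s ≠ 0 then p.cost V Z s else q.cost V Z s := rfl

end Eval

/-- The variables that a command may change. -/
def Cmd.wv : Cmd → List Vr
  | .skip => []
  | .set x _ => [x]
  | .st _ _ _ _ => []
  | .out _ _ => []
  | .seq p q => p.wv ++ q.wv
  | .ite _ p q => p.wv ++ q.wv
  | .rep x _ p => x :: p.wv

/-- The arrays that a command may change. -/
def Cmd.wa : Cmd → List Ar
  | .skip => []
  | .set _ _ => []
  | .st id _ _ _ => [id]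
  | .out _ _ => []
  | .seq p q => p.wa ++ q.wa
  | .ite _ p q => p.wa ++ q.wa
  | .rep _ _ p => p.wa

/-- Whether a command has no output instructions. -/
def Cmd.quiet : Cmd → Bool
  | .out _ _ => false
  | .seq p q => p.quiet && q.quiet
  | .ite _ p q => p.quiet && q.quiet
  | .rep _ _ p => p.quiet
  | _ => true

theorem run_v {V Z : ℕ} {c : Cmd} {x : Vr} (h : x ∉ c.wv) (s : St) :
    (c.run V Z s).v x = s.v x := by
  induction c generalizing s with
  | skip => rfl
  | set y e => simp only [Cmd.wv, List.mem_singleton] at h; simp [h]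
  | st => rfl
  | out i e => simp only [Cmd.run]; split_ifs <;> rfl
  | seq p q ihp ihq =>
    simp only [Cmd.wv, List.mem_append, not_or] at h
    rw [run_seq, ihq h.2, ihp h.1]
  | ite e p q ihp ihq =>
    simp only [Cmd.wv, List.mem_append, not_or] at h
    rw [run_ite]
    split_ifs
    exacts [ihp h.1 s, ihq h.2 s]
  | rep y e p ih =>
    simp only [Cmd.wv, List.mem_cons, not_or] at h
    simp only [Cmd.run]
    induction e.eval V s with
    | zero => rfl
    | succ j ihj => rw [iterSt, ih h.2, setv_v, if_neg h.1, ihj]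

theorem run_arr {V Z : ℕ} {c : Cmd} {id : Ar} (h : id ∉ c.wa) (s : St) :
    (c.run V Z s).arr id = s.arr id := by
  induction c generalizing s with
  | skip => rfl
  | set y e => rfl
  | st id' i j e =>
    simp only [Cmd.wa, List.mem_singleton] at h
    exact Function.update_of_ne h _ _
  | out i e => simp only [Cmd.run]; split_ifs <;> rfl
  | seq p q ihp ihq =>
    simp only [Cmd.wa, List.mem_append, not_or] at h
    rw [run_seq, ihq h.2, ihp h.1]
  | ite e p q ihp ihq =>
    simp only [Cmd.wa, List.mem_append, not_or] at h
    rw [run_ite]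
    split_ifs
    exacts [ihp h.1 s, ihq h.2 s]
  | rep y e p ih =>
    simp only [Cmd.wa] at h
    simp only [Cmd.run]
    induction e.eval V s with
    | zero => rfl
    | succ j ihj => rw [iterSt, ih h, setv_arr, ihj]

theorem run_inp {V Z : ℕ} {c : Cmd} (h : c.quiet = true) (s : St) :
    (c.run V Z s).inp = s.inp := by
  induction c generalizing s with
  | skip => rfl
  | set y e => rfl
  | st id' i j e => rfl
  | out i e => simp [Cmd.quiet] at h
  | seq p q ihp ihq =>
    simp only [Cmd.quiet, Bool.and_eq_true] at h
    rw [run_seq, ihq h.2, ihp h.1]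
  | ite e p q ihp ihq =>
    simp only [Cmd.quiet, Bool.and_eq_true] at h
    rw [run_ite]
    split_ifs
    exacts [ihp h.1 s, ihq h.2 s]
  | rep y e p ih =>
    simp only [Cmd.quiet] at h
    simp only [Cmd.run]
    induction e.eval V s with
    | zero => rfl
    | succ j ihj => rw [iterSt, ih h, setv_inp, ihj]

/-- The rule for loops, with an invariant that may refer to the time spent in the loop so far. -/
theorem rep_rule {V Z : ℕ} {y : Vr} {e : Ex} {p : Cmd} {s : St} (I : ℕ → ℕ → St → Prop)
    (h0 : I 0 0 s) (hstep : ∀ j < e.eval V s, ∀ t s', I j t s' →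
      I (j + 1) (t + (1 + p.cost V Z (s'.setv y j))) (p.run V Z (s'.setv y j))) :
    ∃ t, (Cmd.rep y e p).cost V Z s = 1 + t ∧
      I (e.eval V s) t ((Cmd.rep y e p).run V Z s) := by
  refine ⟨_, rfl, ?_⟩
  simp only [Cmd.run]
  have : ∀ j ≤ e.eval V s, I j (∑ j ∈ Finset.range j,
      (1 + p.cost V Z ((iterSt y (p.run V Z) s j).setv y j))) (iterSt y (p.run V Z) s j) := by
    intro j hj
    induction j with
    | zero => simpa [iterSt] using h0
    | succ j ih =>
      rw [Finset.sum_range_succ]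
      exact hstep j hj _ _ (ih (by omega))
  exact this _ le_rfl

/-- The rule for loops, with an invariant. -/
theorem rep_inv {V Z : ℕ} {y : Vr} {e : Ex} {p : Cmd} {s : St} (I : ℕ → St → Prop) (h0 : I 0 s)
    (hstep : ∀ j < e.eval V s, ∀ s', I j s' → I (j + 1) (p.run V Z (s'.setv y j))) :
    I (e.eval V s) ((Cmd.rep y e p).run V Z s) :=
  (rep_rule (fun j _ s => I j s) h0 fun j hj _ s' h => hstep j hj s' h).choose_spec.2

/-- Whether an expression is built from constants and from variables outside of `W`. -/
def Ex.stable (W : List Vr) : Ex → Bool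
  | .lit _ => true
  | .var x => x ∉ W
  | .bin _ a b => a.stable W && b.stable W
  | .rd _ _ _ => false
  | .inp _ => false

/-- Whether the bounds of all loops are built from constants and from variables outside of `W`. -/
def Cmd.stable (W : List Vr) : Cmd → Bool
  | .seq p q => p.stable W && q.stable W
  | .ite _ p q => p.stable W && q.stable W
  | .rep _ e p => e.stable W && p.stable W
  | _ => true

/-- A bound on the cost of a command with stable loop bounds. -/
def Cmd.bd (V : ℕ) (s : St) : Cmd → ℕ
  | .seq p q => p.bd V s + q.bd V s
  | .ite _ p q => 1 + max (p.bd V s) (q.bd V s)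
  | .rep _ e p => 1 + e.eval V s * (1 + p.bd V s)
  | _ => 1

theorem Ex.stable_eval {V : ℕ} {W : List Vr} {e : Ex} (he : e.stable W = true) {s s' : St}
    (h : ∀ x ∉ W, s'.v x = s.v x) : e.eval V s' = e.eval V s := by
  induction e with
  | lit k => rfl
  | var x => exact h x (by simpa [Ex.stable] using he)
  | bin o a b iha ihb =>
    simp only [Ex.stable, Bool.and_eq_true] at he
    simp only [Ex.eval, iha he.1, ihb he.2]
  | rd => simp [Ex.stable] at he
  | inp => simp [Ex.stable] at he

theorem Cmd.cost_le_aux {V Z : ℕ} {W : List Vr} {c : Cmd} (hc : c.stable W = true)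
    (hW : ∀ x ∈ c.wv, x ∈ W) {s s' : St} (h : ∀ x ∉ W, s'.v x = s.v x) :
    c.cost V Z s' ≤ c.bd V s := by
  induction c generalizing s' with
  | skip => rfl
  | set y e => rfl
  | st id' i j e => rfl
  | out i e => rfl
  | seq p q ihp ihq =>
    simp only [Cmd.stable, Bool.and_eq_true] at hc
    simp only [Cmd.wv, List.mem_append] at hW
    refine add_le_add (ihp hc.1 (fun x hx => hW x (.inl hx)) h)
      (ihq hc.2 (fun x hx => hW x (.inr hx)) fun x hx => ?_)
    rw [run_v (fun hx' => hx (hW x (.inl hx'))), h x hx]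
  | ite e p q ihp ihq =>
    simp only [Cmd.stable, Bool.and_eq_true] at hc
    simp only [Cmd.wv, List.mem_append] at hW
    have h1 := ihp hc.1 (fun x hx => hW x (.inl hx)) h
    have h2 := ihq hc.2 (fun x hx => hW x (.inr hx)) h
    simp only [cost_ite, Cmd.bd]
    split_ifs <;> omega
  | rep y e p ih =>
    simp only [Cmd.stable, Bool.and_eq_true] at hc
    simp only [Cmd.wv, List.mem_cons] at hW
    obtain ⟨t, h1, h2⟩ := rep_rule (V := V) (Z := Z) (y := y) (e := e) (p := p) (s := s')
      (fun j t s₁ => t ≤ j * (1 + p.bd V s) ∧ ∀ x ∉ W, s₁.v x = s.v x) ⟨by simp, h⟩ (by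
        rintro j hj t s₁ ⟨k1, k2⟩
        have k3 : ∀ x ∉ W, (s₁.setv y j).v x = s.v x := fun x hx => by
          rw [setv_v, if_neg (by rintro rfl; exact hx (hW _ (.inl rfl))), k2 x hx]
        refine ⟨?_, fun x hx => ?_⟩
        · have := ih hc.2 (fun x hx => hW x (.inr hx)) k3
          rw [add_mul, one_mul]
          omega
        · rw [run_v (fun hx' => hx (hW x (.inr hx'))), k3 x hx])
    rw [h1, Cmd.bd, ← Ex.stable_eval hc.1 h]
    exact add_le_add le_rfl h2.1

/-- If the bounds of the loops in a command do not depend on what the command does, the cost is at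
most the value that is obtained by multiplying these bounds. -/
theorem Cmd.cost_le {V Z : ℕ} {c : Cmd} (hc : c.stable c.wv = true) (s : St) :
    c.cost V Z s ≤ c.bd V s := c.cost_le_aux hc (fun _ h => h) fun _ _ => rfl

/-! ### Vector commands -/

/-- `id[j] := e` for all `j < D` with `b`, where `b` and `e` may refer to `j` by the variable `c`. -/
def fillC (c : Vr) (id : Ar) (b e : Ex) : Cmd :=
  .rep c Vr.D (.ite b (.st1 id c e) .skip)

/-- Finds some `j < D` that satisfies `e`; the result is `D` if there is none. -/
def findC (x c : Vr) (e : Ex) : Cmd :=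
  (x ≔ Vr.D) ;; .rep c Vr.D (.ite e (x ≔ c) .skip)

/-- Counts the `j < D` that satisfy `e`. -/
def countC (x c : Vr) (e : Ex) : Cmd :=
  (x ≔ 0) ;; .rep c Vr.D (.ite e (x ≔ x + 1) .skip)

section Vector

variable {V Z : ℕ} {s : St}

theorem fill_run {c : Vr} {id : Ar} {b e : Ex} (gb : ℕ → Prop) [DecidablePred gb] (g : ℕ → ℕ)
    (hb : ∀ j < s.v .D, ∀ s' : St, (∀ x, s'.v x = if x = c then j else s.v x) →
      (∀ id', id' ≠ id → s'.arr id' = s.arr id') → s'.arr id 0 j = s.arr id 0 j →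
      ((b.eval V s' ≠ 0 ↔ gb j) ∧ (gb j → e.eval V s' = g j))) (j : ℕ) :
    ((fillC c id b e).run V Z s).arr id 0 j =
      if j < s.v .D ∧ gb j then g j else s.arr id 0 j := by
  have key := rep_inv (V := V) (Z := Z) (y := c) (e := Vr.D) (p := .ite b (.st1 id c e) .skip)
    (s := s) (fun m s' => (∀ x, x ≠ c → s'.v x = s.v x) ∧ (∀ id', id' ≠ id → s'.arr id' = s.arr id')
      ∧ ∀ j, s'.arr id 0 j = if j < m ∧ gb j then g j else s.arr id 0 j) (by simp) (by
    rintro m hm s' ⟨h1, h2, h3⟩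
    obtain ⟨hb1, hb2⟩ := hb m hm (s'.setv c m) (fun x => by
      rw [setv_v]; split_ifs with h
      · rfl
      · exact h1 x h) h2 (by simp [h3])
    refine ⟨fun x hx => ?_, fun id' hid => ?_, fun j => ?_⟩
    · rw [run_v (by simp [Cmd.wv, Cmd.st1]), setv_v, if_neg hx, h1 x hx]
    · rw [run_arr (by simp [Cmd.wa, Cmd.st1, hid]), setv_arr, h2 id' hid]
    · rw [run_ite]
      by_cases hg : gb m
      · rw [if_pos (hb1.2 hg)]
        simp only [run_st1, hb2 hg, seta_arr, eval_var, setv_v, setv_arr, h3, if_true, true_and]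
        by_cases hj : j = m
        · subst hj; simp [hg]
        · have : j < m + 1 ↔ j < m := by omega
          simp [hj, this]
      · rw [if_neg (fun h => hg (hb1.1 h))]
        simp only [run_skip, setv_arr, h3]
        by_cases hj : j = m
        · subst hj; simp [hg]
        · have : j < m + 1 ↔ j < m := by omega
          simp [this])
  exact key.2.2 j

theorem find_run {x c : Vr} {e : Ex} (hx : x ≠ .D) (g : ℕ → Prop)
    (hb : ∀ j < s.v .D, ∀ s' : St, (∀ y, y ≠ x → s'.v y = if y = c then j else s.v y) →
      s'.arr = s.arr → (e.eval V s' ≠ 0 ↔ g j)) (hxc : x ≠ c) :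
    (((findC x c e).run V Z s).v x = s.v .D ∧ ∀ j < s.v .D, ¬ g j) ∨
      (((findC x c e).run V Z s).v x < s.v .D ∧ g (((findC x c e).run V Z s).v x)) := by
  have hD : (Ex.var .D).eval V (s.setv x (s.v .D)) = s.v .D := by simp [hx.symm]
  have key := rep_inv (V := V) (Z := Z) (y := c) (e := Vr.D) (p := .ite e (x ≔ c) .skip)
    (s := s.setv x (s.v .D)) (fun m s' => (∀ y, y ≠ x → y ≠ c → s'.v y = s.v y) ∧ s'.arr = s.arr
      ∧ ((s'.v x = s.v .D ∧ ∀ j < m, ¬ g j) ∨ (s'.v x < s.v .D ∧ g (s'.v x)))) (by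
        simp +contextual) (by
    rintro m hm s' ⟨h1, h2, h3⟩
    rw [hD] at hm
    have hb1 := hb m hm (s'.setv c m) (fun y hy => by
      rw [setv_v]; split_ifs with h
      · rfl
      · exact h1 y hy h) h2
    refine ⟨fun y hy hyc => ?_, ?_, ?_⟩
    · rw [run_v (by simp [Cmd.wv, hy]), setv_v, if_neg hyc, h1 y hy hyc]
    · funext id
      rw [run_arr (by simp [Cmd.wa]), setv_arr, h2]
    · rw [run_ite]
      by_cases hg : g m
      · rw [if_pos (hb1.2 hg)]
        right
        simp [hm, hg]
      · rw [if_neg (fun h => hg (hb1.1 h))]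
        rw [run_skip, setv_v, if_neg hxc]
        rcases h3 with h3 | h3
        · refine .inl ⟨h3.1, fun j hj => ?_⟩
          rcases Nat.lt_succ_iff_lt_or_eq.1 hj with h | rfl
          exacts [h3.2 j h, hg]
        · exact .inr h3)
  have := key.2.2
  rwa [hD] at this

theorem count_run {x c : Vr} {e : Ex} (hx : x ≠ .D) (g : ℕ → Prop) [DecidablePred g]
    (hb : ∀ j < s.v .D, ∀ s' : St, (∀ y, y ≠ x → s'.v y = if y = c then j else s.v y) →
      s'.arr = s.arr → (e.eval V s' ≠ 0 ↔ g j)) (hxc : x ≠ c) (hV : s.v .D < V) :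
    ((countC x c e).run V Z s).v x = ((Finset.range (s.v .D)).filter g).card := by
  have hD : (Ex.var .D).eval V (s.setv x 0) = s.v .D := by simp [hx.symm]
  have key := rep_inv (V := V) (Z := Z) (y := c) (e := Vr.D) (p := .ite e (x ≔ x + 1) .skip)
    (s := s.setv x 0) (fun m s' => (∀ y, y ≠ x → y ≠ c → s'.v y = s.v y) ∧ s'.arr = s.arr
      ∧ s'.v x = ((Finset.range m).filter g).card) (by
        simp +contextual) (by
    rintro m hm s' ⟨h1, h2, h3⟩
    rw [hD] at hm
    have hb1 := hb m hm (s'.setv c m) (fun y hy => by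
      rw [setv_v]; split_ifs with h
      · rfl
      · exact h1 y hy h) h2
    have hle : ((Finset.range m).filter g).card ≤ m := by
      simpa using Finset.card_filter_le (Finset.range m) g
    refine ⟨fun y hy hyc => ?_, ?_, ?_⟩
    · rw [run_v (by simp [Cmd.wv, hy]), setv_v, if_neg hyc, h1 y hy hyc]
    · funext id
      rw [run_arr (by simp [Cmd.wa]), setv_arr, h2]
    · rw [run_ite, Finset.range_add_one, Finset.filter_insert]
      by_cases hg : g m
      · rw [if_pos (hb1.2 hg), if_pos hg, Finset.card_insert_of_notMem (by simp)]
        simp only [run_set, setv_v, eval_add, eval_var, hxc, if_true, if_false, eval_one, h3]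
        exact Nat.mod_eq_of_lt (by omega)
      · rw [if_neg (fun h => hg (hb1.1 h)), if_neg hg, run_skip, setv_v, if_neg hxc, h3])
  have := key.2.2
  rwa [hD] at this

end Vector

/-! ### Two-coloring the complement of a common neighborhood -/

/-- `f` is a proper two-coloring of the graph with the edges `C` on the `p < D` in `S`. -/
def ProperCol (D : ℕ) (S : ℕ → Prop) (C : ℕ → ℕ → Prop) (f : ℕ → Bool) : Prop :=
  ∀ p < D, ∀ q < D, S p → S q → C p q → f p ≠ f q

/-- Invariant of the search for a two-coloring: if there is a two-coloring, there is one that extends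
the colors `1` and `2` assigned so far (`0` stands for no color), and the processed vertices `dn` and
their neighbors have been assigned a color. -/
structure ColInv (D : ℕ) (S : ℕ → Prop) (C : ℕ → ℕ → Prop) (col dn : ℕ → ℕ) : Prop where
  le2 : ∀ c < D, col c ≤ 2
  ext : (∃ f, ProperCol D S C f) → ∃ f, ProperCol D S C f ∧
    ∀ c < D, S c → col c ≠ 0 → col c = bif f c then 1 else 2
  closed : ∀ p < D, S p → dn p ≠ 0 → col p ≠ 0 ∧ ∀ q < D, S q → C p q → col q ≠ 0

variable {D : ℕ} {S : ℕ → Prop} {C : ℕ → ℕ → Prop} {col dn : ℕ → ℕ}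

theorem ColInv.init (hcol : ∀ c < D, col c = 0) (hdn : ∀ c < D, dn c = 0) : ColInv D S C col dn where
  le2 c hc := by simp [hcol c hc]
  ext := fun ⟨f, hf⟩ => ⟨f, hf, fun c hc _ h => absurd (hcol c hc) h⟩
  closed p hp _ h := absurd (hdn p hp) h

/-- When all colored vertices have been processed, an uncolored vertex may receive any color: the
two-coloring can be flipped on the uncolored vertices. -/
theorem ColInv.start (h : ColInv D S C col dn) (hsymm : ∀ p q, C p q → C q p)
    (hdone : ∀ c < D, S c → dn c = 0 → col c = 0) {p : ℕ} (hp : p < D) (hSp : S p) (hdp : dn p = 0) :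
    ColInv D S C (fun c => if c = p then 1 else col c) dn where
  le2 c hc := by split_ifs; exacts [by norm_num, h.le2 c hc]
  ext hex := by
    obtain ⟨f, hf, hfc⟩ := h.ext hex
    have hcp : col p = 0 := hdone p hp hSp hdp
    by_cases hfp : f p = true
    · refine ⟨f, hf, fun c hc hS hcol => ?_⟩
      split_ifs with hcp'
      · rw [hcp', hfp]; rfl
      · exact hfc c hc hS (by simpa [hcp'] using hcol)
    · refine ⟨fun c => if col c = 0 then !f c else f c, fun x hx y hy hSx hSy hC => ?_,
        fun c hc hS hcol => ?_⟩
      · have hxy := hf x hx y hy hSx hSy hC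
        by_cases h1 : col x = 0 <;> by_cases h2 : col y = 0 <;> simp only [h1, h2, if_true, if_false]
        · simpa using hxy
        · have := (h.closed y hy hSy fun h0 => h2 (hdone y hy hSy h0)).2 x hx hSx (hsymm _ _ hC)
          exact absurd h1 this
        · have := (h.closed x hx hSx fun h0 => h1 (hdone x hx hSx h0)).2 y hy hSy hC
          exact absurd h2 this
        · exact hxy
      · dsimp only at hcol ⊢
        split_ifs with h1 h2 h2
        · rw [h1]; simp [hfp]
        · exact absurd (h1 ▸ hcp) h2
        · simp [h1, h2] at hcol
        · exact hfc c hc hS h2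
  closed q hq hSq hdq := by
    obtain ⟨h1, h2⟩ := h.closed q hq hSq hdq
    refine ⟨?_, fun x hx hSx hC => ?_⟩ <;> split_ifs
    exacts [by norm_num, h1, by norm_num, h2 x hx hSx hC]

theorem ColInv.spread (h : ColInv D S C col dn) [DecidablePred S] [∀ p, DecidablePred (C p)] {p : ℕ}
    (hp : p < D) (hSp : S p) (hcp : col p ≠ 0) {col' : ℕ → ℕ}
    (hcol' : ∀ q < D, col' q = if S q ∧ C p q ∧ col q = 0 then 3 - col p else col q) :
    ColInv D S C col' (fun c => if c = p then 1 else dn c) := by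
  have hle : ∀ q < D, col q ≠ 0 → col' q ≠ 0 := fun q hq hq' => by
    rw [hcol' q hq]; simp [hq']
  have hp2 := h.le2 p hp
  refine ⟨fun c hc => ?_, fun hex => ?_, fun x hx hSx hdx => ?_⟩
  · rw [hcol' c hc]
    split_ifs
    exacts [by omega, h.le2 c hc]
  · obtain ⟨f, hf, hfc⟩ := h.ext hex
    refine ⟨f, hf, fun c hc hS hne => ?_⟩
    rw [hcol' c hc] at hne ⊢
    split_ifs at hne ⊢ with h1
    · have := hf p hp c hc hSp hS h1.2.1
      rw [hfc p hp hSp hcp]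
      revert this
      cases f p <;> cases f c <;> simp
    · exact hfc c hc hS hne
  · by_cases hxp : x = p
    · subst hxp
      refine ⟨hle x hx hcp, fun q hq hSq hC => ?_⟩
      by_cases h0 : col q = 0
      · rw [hcol' q hq, if_pos ⟨hSq, hC, h0⟩]; omega
      · exact hle q hq h0
    · simp only [hxp, if_false] at hdx
      obtain ⟨h1, h2⟩ := h.closed x hx hSx hdx
      exact ⟨hle x hx h1, fun q hq hSq hC => hle q hq (h2 q hq hSq hC)⟩

/-- Chooses an unprocessed vertex `p`, if possible a colored one; an uncolored one is colored. -/
def pickC : Cmd :=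
  findC .p .j (.rd1 .S Vr.j &ₑ .rd1 .dn Vr.j =ₑ 0 &ₑ 0 <ₑ .rd1 .col Vr.j) ;;
  .ite (Vr.p =ₑ Vr.D)
    (findC .p .j (.rd1 .S Vr.j &ₑ .rd1 .dn Vr.j =ₑ 0) ;;
      .ite (Vr.p <ₑ Vr.D) (.st1 .col Vr.p 1) .skip) .skip

/-- Colors the neighbors of `p`. -/
def spreadC : Cmd :=
  .ite (Vr.p <ₑ Vr.D) (.st1 .dn Vr.p 1 ;; .tt ≔ 3 - .rd1 .col Vr.p ;;
    fillC .j .col (.rd1 .S Vr.j &ₑ .rd .Cm Vr.p Vr.j &ₑ .rd1 .col Vr.j =ₑ 0) Vr.tt) .skip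

/-- Checks whether the coloring is proper. -/
def verifyC : Cmd :=
  .ok ≔ 1 ;; .rep .p Vr.D
    (findC .q .j (.rd1 .S Vr.p &ₑ .rd1 .S Vr.j &ₑ .rd .Cm Vr.p Vr.j &ₑ
      .rd1 .col Vr.p =ₑ .rd1 .col Vr.j) ;; .ite (Vr.q <ₑ Vr.D) (.ok ≔ 0) .skip)

/-- Two-colors the complement graph `Cm` on `S`, and sets `ok` to `1` if that succeeds. -/
def colorC : Cmd :=
  fillC .j .col 1 0 ;; fillC .j .dn 1 0 ;; .rep .h Vr.D (pickC ;; spreadC) ;; verifyC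

/-- The predicate given by a vector. -/
abbrev St.tst (s : St) (id : Ar) (j : ℕ) : Prop := s.arr id 0 j ≠ 0

/-- The relation given by a matrix. -/
abbrev St.rel (s : St) (id : Ar) (i j : ℕ) : Prop := s.arr id i j ≠ 0

variable {V Z : ℕ}

theorem pickC_run {s : St} (hs : ∀ p q, s.rel .Cm p q → s.rel .Cm q p)
    (h : ColInv (s.v .D) (s.tst .S) (s.rel .Cm) (s.arr .col 0) (s.arr .dn 0)) :
    ColInv (s.v .D) (s.tst .S) (s.rel .Cm) ((pickC.run V Z s).arr .col 0) (s.arr .dn 0) ∧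
      (((pickC.run V Z s).v .p = s.v .D ∧ ∀ c < s.v .D, s.tst .S c → s.tst .dn c) ∨
      ((pickC.run V Z s).v .p < s.v .D ∧ s.tst .S ((pickC.run V Z s).v .p) ∧
        ¬ s.tst .dn ((pickC.run V Z s).v .p) ∧
        (pickC.run V Z s).tst .col ((pickC.run V Z s).v .p))) := by
  have h1 := find_run (V := V) (Z := Z) (s := s) (x := .p) (c := .j)
    (e := .rd1 .S Vr.j &ₑ .rd1 .dn Vr.j =ₑ 0 &ₑ 0 <ₑ .rd1 .col Vr.j) (by decide)
    (fun j => s.tst .S j ∧ ¬ s.tst .dn j ∧ s.tst .col j) (by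
      intro j hj s' hv ha
      simp [hv, ha, St.tst, Nat.pos_iff_ne_zero]) (by decide)
  unfold pickC
  rw [run_seq, run_ite]
  set s1 := (findC .p .j (.rd1 .S Vr.j &ₑ .rd1 .dn Vr.j =ₑ 0 &ₑ 0 <ₑ .rd1 .col Vr.j)).run V Z s
    with hs1
  have hD1 : s1.v .D = s.v .D := run_v (by decide) s
  have ha1 : s1.arr = s.arr := by funext id; exact run_arr (by cases id <;> decide) s
  simp only [eval_eq, eval_var, hD1]
  rcases h1 with ⟨hp, hno⟩ | ⟨hp, hg⟩
  · rw [if_pos (by simp [hp]), run_seq, run_ite]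
    have h2 := find_run (V := V) (Z := Z) (s := s1) (x := .p) (c := .j)
      (e := .rd1 .S Vr.j &ₑ .rd1 .dn Vr.j =ₑ 0) (by decide)
      (fun j => s.tst .S j ∧ ¬ s.tst .dn j) (by
        intro j hj s' hv ha
        simp [hv, ha, ha1, St.tst]) (by decide)
    set s2 := (findC .p .j (.rd1 .S Vr.j &ₑ .rd1 .dn Vr.j =ₑ 0)).run V Z s1 with hs2
    have hD2 : s2.v .D = s.v .D := (run_v (by decide) s1).trans hD1
    have ha2 : s2.arr = s.arr := by
      funext id; rw [← ha1]; exact run_arr (by cases id <;> decide) s1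
    rw [hD1] at h2
    simp only [eval_lt, eval_var, hD2]
    rcases h2 with ⟨hp2, hno2⟩ | ⟨hp2, hg2⟩
    · rw [if_neg (by simp [hp2]), run_skip, ha2]
      exact ⟨h, .inl ⟨hp2, fun c hc hS => not_not.1 fun hd => hno2 c hc ⟨hS, hd⟩⟩⟩
    · rw [if_pos (by simp [hp2])]
      have hst := h.start hs (fun c hc hS hd => not_not.1 fun hcol =>
        hno c hc ⟨hS, not_not.2 hd, hcol⟩) hp2 hg2.1 (not_not.1 hg2.2)
      refine ⟨?_, .inr ?_⟩
      · convert hst using 1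
        funext c
        simp [ha2]
      · simpa [hp2, St.tst] using hg2
  · rw [if_neg (by simp [hp.ne]), run_skip, ha1]
    refine ⟨h, .inr ⟨hp, hg.1, hg.2.1, ?_⟩⟩
    show s1.arr .col 0 _ ≠ 0
    rw [ha1]
    exact hg.2.2

theorem spreadC_run {s : St}
    (h : ColInv (s.v .D) (s.tst .S) (s.rel .Cm) (s.arr .col 0) (s.arr .dn 0))
    (hp : s.v .p < s.v .D) (hSp : s.tst .S (s.v .p)) (hcp : s.tst .col (s.v .p)) :
    ColInv (s.v .D) (s.tst .S) (s.rel .Cm) ((spreadC.run V Z s).arr .col 0)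
      ((spreadC.run V Z s).arr .dn 0) ∧
      ∀ c, (spreadC.run V Z s).arr .dn 0 c = if c = s.v .p then 1 else s.arr .dn 0 c := by
  unfold spreadC
  rw [run_ite, if_pos (by simp [hp]), run_seq, run_seq]
  set s1 := (Cmd.set .tt (3 - .rd1 .col Vr.p)).run V Z ((Cmd.st1 .dn Vr.p 1).run V Z s) with hs1
  have hfill := fill_run (V := V) (Z := Z) (s := s1) (c := .j) (id := .col)
    (b := .rd1 .S Vr.j &ₑ .rd .Cm Vr.p Vr.j &ₑ .rd1 .col Vr.j =ₑ 0) (e := Vr.tt)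
    (fun q => s.tst .S q ∧ s.rel .Cm (s.v .p) q ∧ s.arr .col 0 q = 0)
    (fun _ => 3 - s.arr .col 0 (s.v .p)) (by
      intro j hj s' hv ha hj'
      simp [hv, ha, hj', St.tst, St.rel, hs1])
  have hdn : ∀ c, ((fillC .j .col (.rd1 .S Vr.j &ₑ .rd .Cm Vr.p Vr.j &ₑ .rd1 .col Vr.j =ₑ 0)
      Vr.tt).run V Z s1).arr .dn 0 c = if c = s.v .p then 1 else s.arr .dn 0 c := by
    intro c
    rw [run_arr (by decide)]
    simp [hs1]
  refine ⟨?_, hdn⟩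
  have hD : s1.v .D = s.v .D := by simp [hs1]
  have hc1 : s1.arr .col = s.arr .col := by
    funext i j; simp [hs1]
  convert h.spread hp hSp hcp (col' := ((fillC .j .col (.rd1 .S Vr.j &ₑ .rd .Cm Vr.p Vr.j &ₑ
    .rd1 .col Vr.j =ₑ 0) Vr.tt).run V Z s1).arr .col 0) (fun q hq => ?_) using 1
  · funext c; exact hdn c
  · rw [hfill q, hD, hc1]
    simp [hq]

theorem verifyC_run (s : St) :
    ((verifyC.run V Z s).v .ok = 1 ∧ ∀ p < s.v .D, ∀ q < s.v .D, s.tst .S p → s.tst .S q →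
      s.rel .Cm p q → s.arr .col 0 p ≠ s.arr .col 0 q) ∨
    ((verifyC.run V Z s).v .ok = 0 ∧ ∃ p < s.v .D, ∃ q < s.v .D, s.tst .S p ∧ s.tst .S q ∧
      s.rel .Cm p q ∧ s.arr .col 0 p = s.arr .col 0 q) := by
  unfold verifyC
  rw [run_seq]
  set s1 := (Cmd.set .ok 1).run V Z s with hs1
  have hD : s1.v .D = s.v .D := by simp [hs1]
  have := rep_inv (V := V) (Z := Z) (y := .p) (e := Vr.D) (s := s1)
    (p := findC .q .j (.rd1 .S Vr.p &ₑ .rd1 .S Vr.j &ₑ .rd .Cm Vr.p Vr.j &ₑ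
      .rd1 .col Vr.p =ₑ .rd1 .col Vr.j) ;; .ite (Vr.q <ₑ Vr.D) (.ok ≔ 0) .skip)
    (fun m s' => s'.v .D = s.v .D ∧ s'.arr = s.arr ∧ ((s'.v .ok = 1 ∧ ∀ p < m, ∀ q < s.v .D,
      s.tst .S p → s.tst .S q → s.rel .Cm p q → s.arr .col 0 p ≠ s.arr .col 0 q) ∨
    (s'.v .ok = 0 ∧ ∃ p < s.v .D, ∃ q < s.v .D, s.tst .S p ∧ s.tst .S q ∧
      s.rel .Cm p q ∧ s.arr .col 0 p = s.arr .col 0 q))) (by simp [hs1]) (by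
    rintro m hm s' ⟨h1, h2, h3⟩
    rw [eval_var, hD] at hm
    have hf := find_run (V := V) (Z := Z) (s := s'.setv .p m) (x := .q) (c := .j)
      (e := .rd1 .S Vr.p &ₑ .rd1 .S Vr.j &ₑ .rd .Cm Vr.p Vr.j &ₑ
      .rd1 .col Vr.p =ₑ .rd1 .col Vr.j) (by decide)
      (fun q => s.tst .S m ∧ s.tst .S q ∧ s.rel .Cm m q ∧ s.arr .col 0 m = s.arr .col 0 q) (by
        intro j hj s' hv ha
        simp [hv, ha, h2, St.tst, St.rel]) (by decide)
    rw [run_seq]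
    set s2 := (findC .q .j (.rd1 .S Vr.p &ₑ .rd1 .S Vr.j &ₑ .rd .Cm Vr.p Vr.j &ₑ
      .rd1 .col Vr.p =ₑ .rd1 .col Vr.j)).run V Z (s'.setv .p m) with hs2
    have hD2 : s2.v .D = s.v .D := (run_v (by decide) _).trans (by simp [h1])
    have hok2 : s2.v .ok = s'.v .ok := (run_v (by decide) _).trans (by simp)
    have ha2 : s2.arr = s.arr := by
      funext id; rw [← h2]; exact run_arr (by cases id <;> decide) _
    simp only [setv_v, reduceCtorEq, if_false, h1] at hf
    simp only [run_ite, eval_lt, eval_var, hD2, run_skip]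
    rcases hf with ⟨hp, hno⟩ | ⟨hp, hg⟩
    · rw [if_neg (by simp [hp])]
      refine ⟨hD2, ha2, ?_⟩
      rw [hok2]
      rcases h3 with h3 | h3
      · refine .inl ⟨h3.1, fun p hp q hq a b c d => ?_⟩
        rcases Nat.lt_succ_iff_lt_or_eq.1 hp with h | rfl
        exacts [h3.2 p h q hq a b c d, hno q hq ⟨a, b, c, d⟩]
      · exact .inr h3
    · rw [if_pos (by simp [hp])]
      exact ⟨by simp [hD2], by simp [ha2], .inr ⟨by simp, m, hm, _, hp, hg⟩⟩)
  have h3 := this.2.2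
  rwa [eval_var, hD] at h3

theorem colorC_run {s : St} (hs : ∀ p q, s.rel .Cm p q → s.rel .Cm q p) :
    ((colorC.run V Z s).v .ok = 1 ∧
      (∀ c < s.v .D, s.tst .S c → (colorC.run V Z s).arr .col 0 c = 1 ∨
        (colorC.run V Z s).arr .col 0 c = 2) ∧
      ∀ p < s.v .D, ∀ q < s.v .D, s.tst .S p → s.tst .S q → s.rel .Cm p q →
        (colorC.run V Z s).arr .col 0 p ≠ (colorC.run V Z s).arr .col 0 q) ∨
    ((colorC.run V Z s).v .ok = 0 ∧ ¬ ∃ f, ProperCol (s.v .D) (s.tst .S) (s.rel .Cm) f) := by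
  unfold colorC
  rw [run_seq, run_seq, run_seq]
  set s1 := (fillC .j .col 1 0).run V Z s with hs1
  set s2 := (fillC .j .dn 1 0).run V Z s1 with hs2
  have hf1 : ∀ c < s.v .D, s2.arr .col 0 c = 0 := by
    intro c hc
    rw [hs2, run_arr (by decide), hs1, fill_run (fun _ => True) (fun _ => 0) (by simp)]
    simp [hc]
  have hD1 : s1.v .D = s.v .D := run_v (by decide) _
  have hD2 : s2.v .D = s.v .D := (run_v (by decide) _).trans hD1
  have hf2 : ∀ c < s.v .D, s2.arr .dn 0 c = 0 := by
    intro c hc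
    rw [hs2, fill_run (fun _ => True) (fun _ => 0) (by simp)]
    simp [hc, hD1]
  have hS2 : s2.arr .S = s.arr .S := (run_arr (by decide) _).trans (run_arr (by decide) _)
  have hC2 : s2.arr .Cm = s.arr .Cm := (run_arr (by decide) _).trans (run_arr (by decide) _)
  have key := rep_inv (V := V) (Z := Z) (y := .h) (e := Vr.D) (s := s2) (p := pickC ;; spreadC)
    (fun m s' => s'.v .D = s.v .D ∧ s'.arr .S = s.arr .S ∧ s'.arr .Cm = s.arr .Cm ∧
      ColInv (s.v .D) (s.tst .S) (s.rel .Cm) (s'.arr .col 0) (s'.arr .dn 0) ∧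
      ((∃ c < s.v .D, s.tst .S c ∧ ¬ s'.tst .dn c) →
        m ≤ ((Finset.range (s.v .D)).filter fun c => s'.tst .dn c).card))
    ⟨hD2, hS2, hC2, .init hf1 hf2, by simp⟩ (by
    rintro m - s' ⟨h1, h2, h3, h4, h5⟩
    rw [run_seq]
    have ht : ∀ t : St, t.v .D = s.v .D → t.arr .S = s.arr .S → t.arr .Cm = s.arr .Cm →
        ColInv (t.v .D) (t.tst .S) (t.rel .Cm) = ColInv (s.v .D) (s.tst .S) (s.rel .Cm) := by
      intro t e1 e2 e3
      have e2' : t.tst .S = s.tst .S := by funext c; simp only [St.tst, e2]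
      have e3' : t.rel .Cm = s.rel .Cm := by funext p q; simp only [St.rel, e3]
      rw [e1, e2', e3']
    set t0 := s'.setv .h m with ht0
    have ht0v : t0.v .D = s.v .D := by simp [ht0, h1]
    have hp := pickC_run (V := V) (Z := Z) (s := t0) (by
      intro p q; simpa only [ht0, St.rel, setv_arr, h3] using hs p q) (by
      rw [ht t0 ht0v h2 h3]; exact h4)
    set t1 := pickC.run V Z t0 with ht1
    have hD1 : t1.v .D = s.v .D := (run_v (by decide) _).trans ht0v
    have hS1 : t1.arr .S = s.arr .S := (run_arr (by decide) _).trans h2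
    have hC1 : t1.arr .Cm = s.arr .Cm := (run_arr (by decide) _).trans h3
    have hdn1 : t1.arr .dn = s'.arr .dn := run_arr (by decide) _
    refine ⟨(run_v (by decide) _).trans hD1, (run_arr (by decide) _).trans hS1,
      (run_arr (by decide) _).trans hC1, ?_⟩
    rw [ht t0 ht0v h2 h3, ht0v] at hp
    obtain ⟨hp1, hp2 | ⟨hp2, hp3, hp4, hp5⟩⟩ := hp
    · have : spreadC.run V Z t1 = t1 := by
        rw [spreadC, run_ite, if_neg (by simp [hp2.1, hD1]), run_skip]
      rw [this]
      have hdn' : t0.arr .dn = t1.arr .dn := hdn1.symm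
      rw [hdn'] at hp1
      refine ⟨hp1, ?_⟩
      rintro ⟨c, hc, hSc, hdc⟩
      refine absurd ?_ hdc
      have := hp2.2 c hc (by simpa only [St.tst, ht0, setv_arr, h2] using hSc)
      simpa only [St.tst, ht0, setv_arr, hdn1] using this
    · have hsp := spreadC_run (V := V) (Z := Z) (s := t1) (by
        rw [ht t1 hD1 hS1 hC1, hdn1]; exact hp1) (by rw [hD1]; exact hp2) (by
        simpa only [St.tst, hS1, ht0, setv_arr, h2] using hp3) hp5
      rw [ht t1 hD1 hS1 hC1] at hsp
      refine ⟨hsp.1, fun _ => ?_⟩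
      have hlt : m ≤ ((Finset.range (s.v .D)).filter fun c => s'.tst .dn c).card :=
        h5 ⟨_, hp2, by simpa only [St.tst, ht0, setv_arr, h2] using hp3, hp4⟩
      refine Nat.succ_le_of_lt (hlt.trans_lt (Finset.card_lt_card ?_))
      rw [Finset.ssubset_iff_of_subset]
      · refine ⟨t1.v .p, by simp [hp2, St.tst, hsp.2], fun h => hp4 (Finset.mem_filter.1 h).2⟩
      · intro c
        simp only [Finset.mem_filter, St.tst, hsp.2, hdn1]
        rintro ⟨a, b⟩
        exact ⟨a, by split_ifs <;> simp [b]⟩)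
  set s3 := (Cmd.rep .h Vr.D (pickC ;; spreadC)).run V Z s2 with hs3
  obtain ⟨hD3, hS3, hC3, hI, hcard⟩ := key
  rw [eval_var, hD2] at hcard
  have hall : ∀ c < s.v .D, s.tst .S c → s3.tst .dn c := by
    intro c hc hS
    by_contra hd
    have h1 := hcard ⟨c, hc, hS, not_not.2 hd⟩
    have h2 : ((Finset.range (s.v .D)).filter fun c => s3.tst .dn c) ⊂ Finset.range (s.v .D) := by
      rw [Finset.filter_ssubset]
      exact ⟨c, by simpa using hc, not_not.2 hd⟩
    have := Finset.card_lt_card h2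
    rw [Finset.card_range] at this
    omega
  have hv := verifyC_run (V := V) (Z := Z) s3
  rw [run_arr (by decide)]
  simp only [St.tst, St.rel, hD3, hS3, hC3] at hv
  rcases hv with ⟨h1, h2⟩ | ⟨h1, p, hp, q, hq, hSp, hSq, hC, heq⟩
  · refine .inl ⟨h1, fun c hc hS => ?_, h2⟩
    have := (hI.closed c hc hS (hall c hc hS)).1
    have := hI.le2 c hc
    omega
  · refine .inr ⟨h1, fun hex => ?_⟩
    obtain ⟨f, hf, hfc⟩ := hI.ext hex
    have hp1 := hfc p hp hSp (hI.closed p hp hSp (hall p hp hSp)).1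
    have hq1 := hfc q hq hSq (hI.closed q hq hSq (hall q hq hSq)).1
    have := hf p hp q hq hSp hSq hC
    rw [hp1, hq1] at heq
    revert this heq
    cases f p <;> cases f q <;> simp

/-! ### Maximum cliques of co-bipartite graphs by an auction -/

/-- Invariant of the auction, in which the left vertices bid for the right vertices. `pr` are the
prices, and `own q = p + 1` if `p` owns `q`. The left vertices below `nx` have entered the auction,
and `cur = p + 1` if it is the turn of `p` to bid. A left vertex gives up when all its neighbors
cost more than the limit `D`. -/
structure AucInv (D : ℕ) (L R : ℕ → Prop) (C : ℕ → ℕ → Prop) (pr own : ℕ → ℕ) (cur nx : ℕ) :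
    Prop where
  nx_le : nx ≤ D
  own_edge : ∀ q < D, ∀ p, own q = p + 1 → R q ∧ L p ∧ p < nx ∧ C p q
  own_inj : ∀ q < D, ∀ q' < D, own q ≠ 0 → own q = own q' → q = q'
  own_cur : ∀ q < D, cur ≠ 0 → own q ≠ cur
  cur_left : ∀ p, cur = p + 1 → L p ∧ p < nx
  pr_pos : ∀ q < D, pr q ≠ 0 → R q ∧ own q ≠ 0
  pr_le : ∀ q < D, pr q ≤ D + 1
  slack : ∀ q < D, ∀ p, own q = p + 1 → ∀ x < D, R x → C p x → pr q ≤ pr x + 1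
  entered : ∀ p < nx, L p → cur = p + 1 ∨ (∃ q < D, own q = p + 1) ∨
    ∀ x < D, R x → C p x → D + 1 ≤ pr x

variable {D : ℕ} {L R S : ℕ → Prop} {C : ℕ → ℕ → Prop} {pr own pr' own' : ℕ → ℕ} {cur nx lev : ℕ}

theorem AucInv.init (hpr : ∀ q < D, pr q = 0) (hown : ∀ q < D, own q = 0) :
    AucInv D L R C pr own 0 0 where
  nx_le := Nat.zero_le _
  own_edge q hq p h := by simp [hown q hq] at h
  own_inj q hq _ _ h := absurd (hown q hq) h
  own_cur _ _ h := absurd rfl h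
  cur_left p h := by simp at h
  pr_pos q hq h := absurd (hpr q hq) h
  pr_le q hq := by simp [hpr q hq]
  slack q hq p h := by simp [hown q hq] at h
  entered p hp := absurd hp (by omega)

theorem AucInv.take (h : AucInv D L R C pr own 0 nx) (hnx : nx < D) (hL : L nx) :
    AucInv D L R C pr own (nx + 1) (nx + 1) where
  nx_le := hnx
  own_edge q hq p hp := by
    obtain ⟨a, b, c, d⟩ := h.own_edge q hq p hp
    exact ⟨a, b, by omega, d⟩
  own_inj := h.own_inj
  own_cur q hq _ heq := by
    have := (h.own_edge q hq nx heq).2.2.1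
    omega
  cur_left p hp := by
    obtain rfl : nx = p := by omega
    exact ⟨hL, by omega⟩
  pr_pos := h.pr_pos
  pr_le := h.pr_le
  slack := h.slack
  entered p hp hLp := by
    rcases Nat.lt_succ_iff_lt_or_eq.1 hp with hp | rfl
    · rcases h.entered p hp hLp with h | h | h
      exacts [by simp at h, .inr (.inl h), .inr (.inr h)]
    · exact .inl rfl

theorem AucInv.pass (h : AucInv D L R C pr own 0 nx) (hnx : nx < D) (hL : ¬ L nx) :
    AucInv D L R C pr own 0 (nx + 1) where
  nx_le := hnx
  own_edge q hq p hp := by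
    obtain ⟨a, b, c, d⟩ := h.own_edge q hq p hp
    exact ⟨a, b, by omega, d⟩
  own_inj := h.own_inj
  own_cur := h.own_cur
  cur_left p hp := by simp at hp
  pr_pos := h.pr_pos
  pr_le := h.pr_le
  slack := h.slack
  entered p hp hLp := by
    rcases Nat.lt_succ_iff_lt_or_eq.1 hp with hp | rfl
    exacts [h.entered p hp hLp, absurd hLp hL]

theorem AucInv.giveUp {p : ℕ} (h : AucInv D L R C pr own (p + 1) nx)
    (hp : ∀ x < D, R x → C p x → D + 1 ≤ pr x) : AucInv D L R C pr own 0 nx where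
  nx_le := h.nx_le
  own_edge := h.own_edge
  own_inj := h.own_inj
  own_cur _ _ h := absurd rfl h
  cur_left p hp := by simp at hp
  pr_pos := h.pr_pos
  pr_le := h.pr_le
  slack := h.slack
  entered p' hp' hLp' := by
    rcases h.entered p' hp' hLp' with h | h | h
    · obtain rfl : p = p' := by omega
      exact .inr (.inr hp)
    · exact .inr (.inl h)
    · exact .inr (.inr h)

/-- The bidder buys a cheapest neighbor `q`; the previous owner of `q`, if there is one, is the next
bidder. -/
theorem AucInv.bid {p q : ℕ} (h : AucInv D L R C pr own (p + 1) nx) (hq : q < D) (hR : R q)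
    (hC : C p q) (hpr : pr q < D + 1) (hmin : ∀ x < D, R x → C p x → pr q ≤ pr x)
    (hpr' : ∀ x, pr' x = if x = q then pr q + 1 else pr x)
    (hown' : ∀ x, own' x = if x = q then p + 1 else own x) :
    AucInv D L R C pr' own' (own q) nx := by
  have hp := h.cur_left p rfl
  have hmono : ∀ x, pr x ≤ pr' x := fun x => by rw [hpr']; split_ifs with hx <;> simp [hx]
  refine ⟨h.nx_le, fun x hx p' hp' => ?_, fun x hx y hy h0 hxy => ?_, fun x hx h0 => ?_,
    fun p' hp' => ?_, fun x hx hx0 => ?_, fun x hx => ?_, fun x hx p' hp' y hy hRy hCy => ?_,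
    fun p' hp' hL' => ?_⟩
  · rw [hown'] at hp'
    split_ifs at hp' with hxq
    · obtain rfl : p = p' := by omega
      exact hxq ▸ ⟨hR, hp.1, hp.2, hC⟩
    · exact h.own_edge x hx p' hp'
  · rw [hown', hown'] at hxy
    rw [hown'] at h0
    split_ifs at hxy h0 with h1 h2 h2
    · rw [h1, h2]
    · exact absurd hxy.symm (h.own_cur y hy (by omega))
    · exact absurd hxy (h.own_cur x hx (by omega))
    · exact h.own_inj x hx y hy h0 hxy
  · rw [hown']
    split_ifs with hxq
    · exact (h.own_cur q hq (by omega)).symm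
    · exact fun heq => hxq (h.own_inj x hx q hq (heq ▸ h0) heq)
  · have := h.own_edge q hq p' hp'
    exact ⟨this.2.1, this.2.2.1⟩
  · rw [hpr'] at hx0
    rw [hown']
    split_ifs at hx0 ⊢ with hxq
    · exact ⟨hxq ▸ hR, by omega⟩
    · exact h.pr_pos x hx hx0
  · rw [hpr']
    split_ifs
    exacts [hpr, h.pr_le x hx]
  · rw [hown'] at hp'
    have h1 := hmono y
    split_ifs at hp' with hxq
    · obtain rfl : p = p' := by omega
      have := hmin y hy hRy hCy
      rw [hpr' x, if_pos hxq]
      omega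
    · have := h.slack x hx p' hp' y hy hRy hCy
      rw [hpr' x, if_neg hxq]
      omega
  · rcases h.entered p' hp' hL' with h1 | ⟨x, hx, hox⟩ | h1
    · exact .inr (.inl ⟨q, hq, by rw [hown', if_pos rfl, h1]⟩)
    · by_cases hxq : x = q
      · subst hxq; exact .inl hox
      · exact .inr (.inl ⟨x, hx, by rw [hown', if_neg hxq, hox]⟩)
    · exact .inr (.inr fun x hx hRx hCx => (h1 x hx hRx hCx).trans (hmono x))

/-- The clique that is read off at the end of the auction, for a level `lev` that is not a price:
right vertices with prices below `lev`, and left vertices that own no such vertex. -/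
def AucSet (D : ℕ) (S : ℕ → Prop) (pr own : ℕ → ℕ) (lev c : ℕ) : Prop :=
  S c ∧ pr c < lev ∧ ¬ ∃ q < D, pr q < lev ∧ own q = c + 1

/-- The result of the auction is independent in the graph `C`. -/
theorem AucInv.indep (h : AucInv D L R C pr own 0 D)
    (hCLR : ∀ x < D, ∀ y < D, S x → S y → C x y → L x ∧ R y ∨ L y ∧ R x)
    (hsymm : ∀ x y, C x y → C y x) (hlev' : lev ≤ D + 1)
    (hno : ∀ q < D, R q → pr q ≠ lev) {x y : ℕ} (hx : x < D) (hy : y < D)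
    (hxI : AucSet D S pr own lev x) (hyI : AucSet D S pr own lev y) : ¬ C x y := by
  have key : ∀ x < D, ∀ y < D, AucSet D S pr own lev x → AucSet D S pr own lev y → L x → R y →
      ¬ C x y := by
    intro x hx y hy hxI hyI hL hR hC
    rcases h.entered x hx hL with h1 | ⟨q, hq, hown⟩ | h1
    · simp at h1
    · have h2 := h.slack q hq x hown y hy hR hC
      have h3 := hyI.2.1
      have h4 : lev ≤ pr q := by
        by_contra hlt
        exact hxI.2.2 ⟨q, hq, by omega, hown⟩
      have h5 := hno q hq (h.own_edge q hq x hown).1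
      omega
    · have := h1 y hy hR hC
      have := hyI.2.1
      omega
  intro hC
  rcases hCLR x hx y hy hxI.1 hyI.1 hC with ⟨h1, h2⟩ | ⟨h1, h2⟩
  · exact key x hx y hy hxI hyI h1 h2 hC
  · exact key y hy x hx hyI hxI h1 h2 (hsymm _ _ hC)

/-- The result of the auction is a largest independent set of `C`: each vertex of `S` outside of it
is matched to a vertex inside of it, by ownership. -/
theorem AucInv.card_le (h : AucInv D L R C pr own 0 D) (hS : ∀ c < D, S c → L c ∨ R c)
    (hLR : ∀ c, L c → R c → False) (hL : ∀ c, L c → S c) (hR : ∀ c, R c → S c)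
    (hlev : 0 < lev) {I : Finset ℕ} (hI : ∀ c, c ∈ I ↔ c < D ∧ AucSet D S pr own lev c)
    {Q : Finset ℕ} (hQ : ∀ c ∈ Q, c < D ∧ S c) (hQC : ∀ x ∈ Q, ∀ y ∈ Q, ¬ C x y) :
    Q.card ≤ I.card := by
  classical
  have hex : ∀ x ∈ Q \ I, ∃ y ∈ I \ Q, (L x ∧ R y ∧ own y = x + 1) ∨ (R x ∧ L y ∧ own x = y + 1) := by
    intro x hx
    rw [Finset.mem_sdiff] at hx
    obtain ⟨hxD, hxS⟩ := hQ x hx.1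
    have hxI : ¬ AucSet D S pr own lev x := fun h => hx.2 ((hI x).2 ⟨hxD, h⟩)
    rcases hS x hxD hxS with hLx | hRx
    · have hpr0 : pr x = 0 := by
        by_contra h0
        exact hLR x hLx (h.pr_pos x hxD h0).1
      have : ∃ q < D, pr q < lev ∧ own q = x + 1 := by
        by_contra hno
        exact hxI ⟨hxS, by omega, hno⟩
      obtain ⟨q, hq, hql, hqo⟩ := this
      obtain ⟨e1, e2, e3, e4⟩ := h.own_edge q hq x hqo
      refine ⟨q, Finset.mem_sdiff.2 ⟨(hI q).2 ⟨hq, hR q e1, hql, ?_⟩, fun hqQ => hQC x hx.1 q hqQ e4⟩,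
        .inl ⟨hLx, e1, hqo⟩⟩
      rintro ⟨q', hq', -, ho'⟩
      exact hLR q (h.own_edge q' hq' q ho').2.1 e1
    · have hprx : lev ≤ pr x := by
        by_contra hlt
        refine hxI ⟨hxS, by omega, ?_⟩
        rintro ⟨q', hq', -, ho'⟩
        exact hLR x (h.own_edge q' hq' x ho').2.1 hRx
      obtain ⟨p, hp⟩ := Nat.exists_eq_succ_of_ne_zero (h.pr_pos x hxD (by omega)).2
      obtain ⟨e1, e2, e3, e4⟩ := h.own_edge x hxD p hp
      have hpr0 : pr p = 0 := by
        by_contra h0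
        exact hLR p e2 (h.pr_pos p e3 h0).1
      refine ⟨p, Finset.mem_sdiff.2 ⟨(hI p).2 ⟨e3, hL p e2, by omega, ?_⟩,
        fun hpQ => hQC p hpQ x hx.1 e4⟩, .inr ⟨hRx, e2, hp⟩⟩
      rintro ⟨q', hq', hl', ho'⟩
      have := h.own_inj q' hq' x hxD (by omega) (ho'.trans hp.symm)
      subst this
      omega
  choose! φ hφ using hex
  have hinj : (Q \ I).card ≤ (I \ Q).card := by
    refine Finset.card_le_card_of_injOn φ (fun x hx => (hφ x hx).1) fun x hx y hy hxy => ?_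
    have hφx := (hφ x hx).2
    have hφy := (hφ y hy).2
    rw [← hxy] at hφy
    have hxD := (hQ x (Finset.mem_sdiff.1 hx).1).1
    have hyD := (hQ y (Finset.mem_sdiff.1 hy).1).1
    rcases hφx with ⟨a, b, c⟩ | ⟨a, b, c⟩ <;> rcases hφy with ⟨a', b', c'⟩ | ⟨a', b', c'⟩
    · omega
    · exact (hLR _ b' b).elim
    · exact (hLR _ b b').elim
    · exact h.own_inj x hxD y hyD (by omega) (c.trans c'.symm)
  have h1 := Finset.card_sdiff_add_card_inter Q I
  have h2 := Finset.card_sdiff_add_card_inter I Q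
  rw [Finset.inter_comm] at h2
  omega

/-- Some number in `[1, D + 1]` is not the price of a right vertex. -/
theorem exists_level (D : ℕ) (pr : ℕ → ℕ) (h : ∀ l < D + 1, ∃ j < D, pr j = l + 1) : False := by
  choose! φ hφ using h
  have : (Finset.range (D + 1)).card ≤ (Finset.range D).card := by
    refine Finset.card_le_card_of_injOn φ (fun l hl => ?_) fun x hx y hy hxy => ?_
    · simpa using (hφ l (by simpa using hl)).1
    · have h1 := (hφ x (by simpa using hx)).2
      have h2 := (hφ y (by simpa using hy)).2
      rw [hxy] at h1
      omega
  simp at this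

/-- The next left vertex enters the auction. -/
def takeC : Cmd :=
  .ite (Vr.nx <ₑ Vr.D) (.ite (.rd1 .S Vr.nx &ₑ .rd1 .col Vr.nx =ₑ 1) (.cur ≔ Vr.nx + 1) .skip ;;
    .nx ≔ Vr.nx + 1) .skip

/-- Searches for the cheapest right neighbor `q` of the bidder. -/
def cheapC : Cmd :=
  .q ≔ Vr.D ;; .bp ≔ Vr.D + 1 ;;
  .rep .j Vr.D (.ite (.rd1 .S Vr.j &ₑ .rd1 .col Vr.j =ₑ 2 &ₑ .rd .Cm (Vr.cur - 1) Vr.j &ₑ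
    .rd1 .pr Vr.j <ₑ Vr.bp) (.q ≔ Vr.j ;; .bp ≔ .rd1 .pr Vr.j) .skip)

/-- The bidder buys `q`, and it is the turn of the previous owner. -/
def buyC : Cmd :=
  .ite (Vr.q =ₑ Vr.D) (.cur ≔ 0) (.tt ≔ .rd1 .own Vr.q ;; .st1 .own Vr.q Vr.cur ;;
    .st1 .pr Vr.q (.rd1 .pr Vr.q + 1) ;; .cur ≔ Vr.tt)

/-- The auction. -/
def auctionC : Cmd :=
  fillC .j .pr 1 0 ;; fillC .j .own 1 0 ;; .cur ≔ 0 ;; .nx ≔ 0 ;;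
  .rep .it (Vr.D * (Vr.D + 3)) (.ite (Vr.cur =ₑ 0) takeC (cheapC ;; buyC))

/-- Searches for a positive level that is not a price. -/
def levelC : Cmd :=
  .lev ≔ 0 ;; .rep .l (Vr.D + 1)
    (findC .q .j (.rd1 .S Vr.j &ₑ .rd1 .col Vr.j =ₑ 2 &ₑ .rd1 .pr Vr.j =ₑ Vr.l + 1) ;;
      .ite (Vr.q =ₑ Vr.D) (.lev ≔ Vr.l + 1) .skip)

/-- Writes the result of the auction to the vector `I`. -/
def extractC : Cmd :=
  fillC .j .I 1 (.rd1 .S Vr.j &ₑ .rd1 .pr Vr.j <ₑ Vr.lev) ;;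
  .rep .q Vr.D (.ite (.rd1 .pr Vr.q <ₑ Vr.lev &ₑ .rd1 .own Vr.q)
    (.st1 .I (.rd1 .own Vr.q - 1) 0) .skip)

/-- Computes a maximum clique of a two-colored graph on `S`. -/
def cliqueC : Cmd := auctionC ;; levelC ;; extractC

variable {V Z : ℕ}

/-- The left vertices. -/
def St.left (s : St) (c : ℕ) : Prop := s.tst .S c ∧ s.arr .col 0 c = 1

/-- The right vertices. -/
def St.right (s : St) (c : ℕ) : Prop := s.tst .S c ∧ s.arr .col 0 c = 2

theorem cheapC_run {s : St} {p : ℕ} (hp : s.v .cur = p + 1) (hV : s.v .D + 1 < V) :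
    ((cheapC.run V Z s).v .q = s.v .D ∧
      ∀ x < s.v .D, s.right x → s.rel .Cm p x → s.v .D + 1 ≤ s.arr .pr 0 x) ∨
    ((cheapC.run V Z s).v .q < s.v .D ∧ s.right ((cheapC.run V Z s).v .q) ∧
      s.rel .Cm p ((cheapC.run V Z s).v .q) ∧
      s.arr .pr 0 ((cheapC.run V Z s).v .q) < s.v .D + 1 ∧
      ∀ x < s.v .D, s.right x → s.rel .Cm p x →
        s.arr .pr 0 ((cheapC.run V Z s).v .q) ≤ s.arr .pr 0 x) := by
  unfold cheapC
  rw [run_seq, run_seq]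
  set s1 := (Cmd.set .bp (Vr.D + 1)).run V Z ((Cmd.set .q Vr.D).run V Z s) with hs1
  have hD1 : s1.v .D = s.v .D := by simp [hs1]
  have key := rep_inv (V := V) (Z := Z) (y := .j) (e := Vr.D) (s := s1)
    (p := .ite (.rd1 .S Vr.j &ₑ .rd1 .col Vr.j =ₑ 2 &ₑ .rd .Cm (Vr.cur - 1) Vr.j &ₑ
      .rd1 .pr Vr.j <ₑ Vr.bp) (.q ≔ Vr.j ;; .bp ≔ .rd1 .pr Vr.j) .skip)
    (fun m s' => s'.v .D = s.v .D ∧ s'.v .cur = p + 1 ∧ s'.arr = s.arr ∧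
      ((s'.v .q = s.v .D ∧ s'.v .bp = s.v .D + 1 ∧
        ∀ x < m, s.right x → s.rel .Cm p x → s.v .D + 1 ≤ s.arr .pr 0 x) ∨
      (s'.v .q < s.v .D ∧ s.right (s'.v .q) ∧ s.rel .Cm p (s'.v .q) ∧
        s'.v .bp = s.arr .pr 0 (s'.v .q) ∧ s.arr .pr 0 (s'.v .q) < s.v .D + 1 ∧
        ∀ x < m, s.right x → s.rel .Cm p x → s.arr .pr 0 (s'.v .q) ≤ s.arr .pr 0 x)))
    ⟨hD1, by simp [hs1, hp], by simp [hs1], .inl ⟨by simp [hs1], by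
      simp [hs1, Nat.mod_eq_of_lt hV], by simp⟩⟩ (by
    rintro m hm s' ⟨h1, h2, h3, h4⟩
    rw [eval_var, hD1] at hm
    simp only [run_ite, eval_and, eval_rd1, eval_var, setv_v, setv_arr, h3, eval_eq, eval_two,
      eval_rd, eval_sub, eval_one, h2, reduceCtorEq, if_false, if_true, eval_lt,
      Nat.add_sub_cancel, run_seq, run_set, run_skip]
    by_cases hg : s.right m ∧ s.rel .Cm p m ∧ s.arr .pr 0 m < s'.v .bp
    · rw [if_pos (by simpa [St.right, St.tst, St.rel, and_assoc] using hg)]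
      refine ⟨by simp [h1], by simp [h2], by simp [h3], .inr ?_⟩
      simp only [setv_v, if_true, reduceCtorEq, if_false]
      refine ⟨hm, hg.1, hg.2.1, trivial, ?_, fun x hx hRx hCx => ?_⟩
      · rcases h4 with h4 | h4 <;> omega
      · rcases Nat.lt_succ_iff_lt_or_eq.1 hx with hx | rfl
        · rcases h4 with h4 | h4
          · have := h4.2.2 x hx hRx hCx
            omega
          · have := h4.2.2.2.2.2 x hx hRx hCx
            omega
        · rfl
    · rw [if_neg (by simpa [St.right, St.tst, St.rel, and_assoc] using hg)]
      refine ⟨by simp [h1], by simp [h2], by simp [h3], ?_⟩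
      simp only [setv_v, reduceCtorEq, if_false]
      rcases h4 with h4 | h4
      · refine .inl ⟨h4.1, h4.2.1, fun x hx hRx hCx => ?_⟩
        rcases Nat.lt_succ_iff_lt_or_eq.1 hx with hx | rfl
        · exact h4.2.2 x hx hRx hCx
        · by_contra hlt
          exact hg ⟨hRx, hCx, by omega⟩
      · refine .inr ⟨h4.1, h4.2.1, h4.2.2.1, h4.2.2.2.1, h4.2.2.2.2.1, fun x hx hRx hCx => ?_⟩
        rcases Nat.lt_succ_iff_lt_or_eq.1 hx with hx | rfl
        · exact h4.2.2.2.2.2 x hx hRx hCx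
        · by_contra hlt
          exact hg ⟨hRx, hCx, by omega⟩)
  rw [eval_var, hD1] at key
  rcases key.2.2.2 with h | h
  · exact .inl ⟨h.1, h.2.2⟩
  · exact .inr ⟨h.1, h.2.1, h.2.2.1, h.2.2.2.2⟩

/-- The auction is over after `D (D + 3)` rounds: there are at most `D` rounds in which a vertex enters or
is passed over, `D` rounds in which a bidder gives up, and `D (D + 1)` rounds in which a price rises. -/
theorem auctionC_run {s : St} (hV : s.v .D * (s.v .D + 3) + s.v .D + 4 < V) :
    AucInv (s.v .D) s.left s.right (s.rel .Cm) ((auctionC.run V Z s).arr .pr 0)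
      ((auctionC.run V Z s).arr .own 0) 0 (s.v .D) := by
  unfold auctionC
  rw [run_seq, run_seq, run_seq, run_seq]
  set s1 := (fillC .j .pr 1 0).run V Z s with hs1
  set s2 := (fillC .j .own 1 0).run V Z s1 with hs2
  set s3 := (Cmd.set .nx 0).run V Z ((Cmd.set .cur 0).run V Z s2) with hs3
  have hD1 : s1.v .D = s.v .D := run_v (by decide) _
  have hD2 : s2.v .D = s.v .D := (run_v (by decide) _).trans hD1
  have hD3 : s3.v .D = s.v .D := by simp [hs3, hD2]
  have hf1 : ∀ c < s.v .D, s3.arr .pr 0 c = 0 := by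
    intro c hc
    simp only [hs3, run_set, setv_arr]
    rw [hs2, run_arr (by decide), hs1, fill_run (fun _ => True) (fun _ => 0) (by simp)]
    simp [hc]
  have hf2 : ∀ c < s.v .D, s3.arr .own 0 c = 0 := by
    intro c hc
    simp only [hs3, run_set, setv_arr]
    rw [hs2, fill_run (fun _ => True) (fun _ => 0) (by simp)]
    simp [hc, hD1]
  have ha3 : ∀ id, id ≠ .pr → id ≠ .own → s3.arr id = s.arr id := by
    intro id h1 h2
    simp only [hs3, run_set, setv_arr]
    rw [hs2, run_arr (by simp [fillC, Cmd.wa, Cmd.st1, h2]), hs1,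
      run_arr (by simp [fillC, Cmd.wa, Cmd.st1, h1])]
  have hlim : (Vr.D * (Vr.D + 3) : Ex).eval V s3 = s.v .D * (s.v .D + 3) := by
    simp only [eval_mul, eval_add, eval_var, eval_three, hD3]
    rw [Nat.mod_eq_of_lt (a := s.v .D + 3) (by omega), Nat.mod_eq_of_lt (by omega)]
  have key := rep_inv (V := V) (Z := Z) (y := .it) (e := Vr.D * (Vr.D + 3)) (s := s3)
    (p := .ite (Vr.cur =ₑ 0) takeC (cheapC ;; buyC))
    (fun m s' => s'.v .D = s.v .D ∧ s'.arr .S = s.arr .S ∧ s'.arr .col = s.arr .col ∧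
      s'.arr .Cm = s.arr .Cm ∧
      AucInv (s.v .D) s.left s.right (s.rel .Cm) (s'.arr .pr 0) (s'.arr .own 0) (s'.v .cur)
        (s'.v .nx) ∧
      ((s'.v .cur = 0 ∧ s'.v .nx = s.v .D) ∨ (m + if s'.v .cur = 0 then 0 else 1) ≤
        ∑ q ∈ Finset.range (s.v .D), s'.arr .pr 0 q + 2 * s'.v .nx))
    ⟨hD3, ha3 _ (by decide) (by decide), ha3 _ (by decide) (by decide),
      ha3 _ (by decide) (by decide), by
        have := AucInv.init (L := s.left) (R := s.right) (C := s.rel .Cm) hf1 hf2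
        simpa [hs3] using this, by simp [hs3]⟩ (by
    rintro m - s' ⟨h1, h2, h3, h4, h5, h6⟩
    rw [run_ite]
    simp only [eval_eq, eval_var, setv_v, eval_zero, reduceCtorEq, if_false]
    by_cases hcur : s'.v .cur = 0
    · rw [if_pos (by simp [hcur])]
      simp only [takeC, run_ite, eval_lt, eval_var, setv_v, reduceCtorEq, if_false, h1]
      rw [hcur] at h5
      by_cases hnx : s'.v .nx < s.v .D
      · have h6' := h6.resolve_left (fun h => by omega)
        rw [if_pos hcur] at h6'
        rw [if_pos (by simp [hnx])]
        simp only [run_seq, run_ite, eval_and, eval_rd1, eval_var, setv_v, setv_arr, reduceCtorEq,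
          if_false, eval_eq, eval_one, h2, h3]
        have hnV : (s'.v .nx + 1) % V = s'.v .nx + 1 := Nat.mod_eq_of_lt (by omega)
        by_cases hL : s.left (s'.v .nx)
        · rw [if_pos (by simpa [St.left, St.tst] using hL)]
          have := h5.take hnx hL
          refine ⟨by simp [h1], by simp [h2], by simp [h3], by simp [h4], ?_, ?_⟩
          · simpa [hnV] using this
          · right
            simp [hnV]
            omega
        · rw [if_neg (by simpa [St.left, St.tst] using hL)]
          have := h5.pass hnx hL
          refine ⟨by simp [h1], by simp [h2], by simp [h3], by simp [h4], ?_, ?_⟩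
          · simpa [hnV, hcur] using this
          · right
            simp [hnV, hcur]
            omega
      · rw [if_neg (by simp [hnx])]
        have := h5.nx_le
        refine ⟨by simp [h1], by simp [h2], by simp [h3], by simp [h4], ?_, ?_⟩
        · simpa [hcur] using h5
        · left
          simp [hcur]
          omega
    · rw [if_neg (by simp [hcur])]
      obtain ⟨p, hp⟩ := Nat.exists_eq_succ_of_ne_zero hcur
      have h6' := h6.resolve_left (fun h => hcur h.1)
      rw [if_neg hcur] at h6'
      have hc := cheapC_run (V := V) (Z := Z) (s := s'.setv .it m) (p := p) (by simp [hp])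
        (by simp [h1]; omega)
      rw [run_seq]
      set t := cheapC.run V Z (s'.setv .it m) with ht
      have hDt : t.v .D = s.v .D := (run_v (by decide) _).trans (by simp [h1])
      have hct : t.v .cur = p + 1 := (run_v (by decide) _).trans (by simp [hp])
      have hnt : t.v .nx = s'.v .nx := (run_v (by decide) _).trans (by simp)
      have hat : t.arr = s'.arr := by funext id; exact run_arr (by cases id <;> decide) _
      have hR : (s'.setv .it m).right = s.right := by
        funext c; simp only [St.right, St.tst, setv_arr, h2, h3]
      simp only [St.rel, hR, setv_v, setv_arr, reduceCtorEq, if_false, h1, h4] at hc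
      rw [hp] at h5
      rw [buyC, run_ite]
      simp only [eval_eq, eval_var, hDt]
      rcases hc with ⟨hq, hup⟩ | ⟨hq, hRq, hCq, hprq, hmin⟩
      · rw [if_pos (by simp [hq])]
        refine ⟨by simp [hDt], by simp [hat, h2], by simp [hat, h3], by simp [hat, h4], ?_, ?_⟩
        · simpa [hat, hnt] using h5.giveUp hup
        · right
          simp [hat, hnt]
          omega
      · rw [if_neg (by simp [hq.ne])]
        have hb := h5.bid hq hRq hCq hprq hmin (fun _ => rfl) (fun _ => rfl)
        have hmod : (s'.arr .pr 0 (t.v .q) + 1) % V = s'.arr .pr 0 (t.v .q) + 1 :=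
          Nat.mod_eq_of_lt (by omega)
        simp only [run_seq, run_set, run_st1, eval_rd1, eval_var, setv_v, setv_arr, seta_v,
          eval_add, eval_one, hat, reduceCtorEq, if_false, if_true]
        simp only [setv_arr, seta_arr, reduceCtorEq, false_and, if_false, hat, hDt, hct, hnt,
          true_and, hmod]
        refine ⟨?_, ?_, ?_, ?_, ?_⟩
        · funext i j; simp [hat, h2]
        · funext i j; simp [hat, h3]
        · funext i j; simp [hat, h4]
        · convert hb using 1 <;> funext x <;> simp [hat]
        · right
          have hsum : ∑ q ∈ Finset.range (s.v .D), (if q = t.v .q then s'.arr .pr 0 (t.v .q) + 1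
              else s'.arr .pr 0 q) = ∑ q ∈ Finset.range (s.v .D), s'.arr .pr 0 q + 1 := by
            have hmem : t.v .q ∈ Finset.range (s.v .D) := Finset.mem_range.2 hq
            rw [← Finset.add_sum_erase _ _ hmem, ← Finset.add_sum_erase _ (s'.arr .pr 0) hmem,
              if_pos rfl, Finset.sum_congr rfl fun x hx => if_neg (Finset.ne_of_mem_erase hx)]
            exact Nat.add_right_comm _ _ _
          rw [hsum]
          split_ifs <;> omega)
  rw [hlim] at key
  set s4 := (Cmd.rep .it (Vr.D * (Vr.D + 3)) (.ite (Vr.cur =ₑ 0) takeC (cheapC ;; buyC))).run V Z s3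
    with hs4
  obtain ⟨-, -, -, -, h5, h6⟩ := key
  have hfin : s4.v .cur = 0 ∧ s4.v .nx = s.v .D := by
    rcases h6 with h6 | h6
    · exact h6
    · have h7 : ∑ q ∈ Finset.range (s.v .D), s4.arr .pr 0 q ≤ s.v .D * (s.v .D + 1) := by
        refine (Finset.sum_le_card_nsmul _ _ _ fun q hq => h5.pr_le q (by simpa using hq)).trans ?_
        simp
      have h8 := h5.nx_le
      have h9 : s.v .D * (s.v .D + 3) = s.v .D * (s.v .D + 1) + 2 * s.v .D := by ring
      split_ifs at h6 with hc
      · exact ⟨hc, by omega⟩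
      · omega
  rw [hfin.1, hfin.2] at h5
  exact h5

theorem levelC_run {s : St} (hV : s.v .D + 4 < V) :
    0 < (levelC.run V Z s).v .lev ∧ (levelC.run V Z s).v .lev ≤ s.v .D + 1 ∧
      ∀ q < s.v .D, s.right q → s.arr .pr 0 q ≠ (levelC.run V Z s).v .lev := by
  unfold levelC
  rw [run_seq]
  set s1 := (Cmd.set .lev 0).run V Z s with hs1
  have hlim : (Vr.D + 1 : Ex).eval V s1 = s.v .D + 1 := by
    simp only [eval_add, eval_var, eval_one, hs1, run_set, setv_v, reduceCtorEq, if_false]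
    exact Nat.mod_eq_of_lt (by omega)
  have key := rep_inv (V := V) (Z := Z) (y := .l) (e := Vr.D + 1) (s := s1)
    (p := findC .q .j (.rd1 .S Vr.j &ₑ .rd1 .col Vr.j =ₑ 2 &ₑ .rd1 .pr Vr.j =ₑ Vr.l + 1) ;;
      .ite (Vr.q =ₑ Vr.D) (.lev ≔ Vr.l + 1) .skip)
    (fun m s' => s'.v .D = s.v .D ∧ s'.arr = s.arr ∧
      ((0 < s'.v .lev ∧ s'.v .lev ≤ s.v .D + 1 ∧
        ∀ q < s.v .D, s.right q → s.arr .pr 0 q ≠ s'.v .lev) ∨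
        ∀ l < m, ∃ j < s.v .D, s.arr .pr 0 j = l + 1)) (by simp [hs1]) (by
    rintro m hm s' ⟨h1, h2, h3⟩
    rw [hlim] at hm
    have hmod : (m + 1) % V = m + 1 := Nat.mod_eq_of_lt (by omega)
    have hf := find_run (V := V) (Z := Z) (s := s'.setv .l m) (x := .q) (c := .j)
      (e := .rd1 .S Vr.j &ₑ .rd1 .col Vr.j =ₑ 2 &ₑ .rd1 .pr Vr.j =ₑ Vr.l + 1) (by decide)
      (fun j => s.right j ∧ s.arr .pr 0 j = m + 1) (by
        intro j hj s'' hv ha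
        simp [hv, ha, h2, St.right, St.tst, hmod, and_assoc]) (by decide)
    rw [run_seq]
    set t := (findC .q .j (.rd1 .S Vr.j &ₑ .rd1 .col Vr.j =ₑ 2 &ₑ
      .rd1 .pr Vr.j =ₑ Vr.l + 1)).run V Z (s'.setv .l m) with ht
    have hDt : t.v .D = s.v .D := (run_v (by decide) _).trans (by simp [h1])
    have hlt : t.v .l = m := (run_v (by decide) _).trans (by simp)
    have hlevt : t.v .lev = s'.v .lev := (run_v (by decide) _).trans (by simp)
    have hat : t.arr = s.arr := by
      funext id; rw [← h2]; exact run_arr (by cases id <;> decide) _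
    simp only [setv_v, reduceCtorEq, if_false, h1] at hf
    simp only [run_ite, eval_eq, eval_var, hDt]
    rcases hf with ⟨hq, hno⟩ | ⟨hq, hg⟩
    · rw [if_pos (by simp [hq])]
      refine ⟨by simp [hDt], by simp [hat], .inl ?_⟩
      simp only [run_set, setv_v, if_true, eval_add, eval_var, hlt, eval_one, hmod]
      exact ⟨by omega, by omega, fun q hq hR he => hno q hq ⟨hR, he⟩⟩
    · rw [if_neg (by simp [hq.ne]), run_skip]
      refine ⟨hDt, hat, ?_⟩
      rw [hlevt]
      rcases h3 with h3 | h3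
      · exact .inl h3
      · refine .inr fun l hl => ?_
        rcases Nat.lt_succ_iff_lt_or_eq.1 hl with hl | rfl
        exacts [h3 l hl, ⟨_, hq, hg.2⟩])
  rw [hlim] at key
  rcases key.2.2 with h | h
  · exact h
  · exact (exists_level _ _ h).elim

theorem extractC_run {s : St} (c : ℕ) (hc : c < s.v .D) :
    (extractC.run V Z s).tst .I c ↔
      AucSet (s.v .D) (s.tst .S) (s.arr .pr 0) (s.arr .own 0) (s.v .lev) c := by
  unfold extractC
  rw [run_seq]
  set s1 := (fillC .j .I 1 (.rd1 .S Vr.j &ₑ .rd1 .pr Vr.j <ₑ Vr.lev)).run V Z s with hs1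
  have hD1 : s1.v .D = s.v .D := run_v (by decide) _
  have hl1 : s1.v .lev = s.v .lev := run_v (by decide) _
  have ha1 : ∀ id, id ≠ .I → s1.arr id = s.arr id := by
    intro id h1
    rw [hs1, run_arr (by simp [fillC, Cmd.wa, Cmd.st1, h1])]
  have hf1 : ∀ c < s.v .D, s1.arr .I 0 c ≠ 0 ↔ s.tst .S c ∧ s.arr .pr 0 c < s.v .lev := by
    intro c hc
    rw [hs1, fill_run (fun _ => True) (fun j => if s.arr .S 0 j ≠ 0 ∧
      s.arr .pr 0 j < s.v .lev then 1 else 0) (by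
        intro j hj s' hv ha _
        simp [hv, ha])]
    simp [hc]
  have key := rep_inv (V := V) (Z := Z) (y := .q) (e := Vr.D) (s := s1)
    (p := .ite (.rd1 .pr Vr.q <ₑ Vr.lev &ₑ .rd1 .own Vr.q) (.st1 .I (.rd1 .own Vr.q - 1) 0) .skip)
    (fun m s' => s'.v .D = s.v .D ∧ s'.v .lev = s.v .lev ∧ (∀ id, id ≠ .I → s'.arr id = s.arr id) ∧
      ∀ c < s.v .D, s'.arr .I 0 c ≠ 0 ↔ s.tst .S c ∧ s.arr .pr 0 c < s.v .lev ∧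
        ¬ ∃ q < m, s.arr .pr 0 q < s.v .lev ∧ s.arr .own 0 q = c + 1)
    ⟨hD1, hl1, ha1, by simpa using hf1⟩ (by
    rintro m - s' ⟨h1, h2, h3, h4⟩
    rw [run_ite]
    have e1 : s'.arr .pr = s.arr .pr := h3 _ (by decide)
    have e2 : s'.arr .own = s.arr .own := h3 _ (by decide)
    simp only [eval_and, eval_lt, eval_rd1, eval_var, setv_v, setv_arr, if_true, reduceCtorEq,
      if_false, e1, e2, h2]
    have hiff : ∀ c, (∃ q < m + 1, s.arr .pr 0 q < s.v .lev ∧ s.arr .own 0 q = c + 1) ↔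
        (∃ q < m, s.arr .pr 0 q < s.v .lev ∧ s.arr .own 0 q = c + 1) ∨
        (s.arr .pr 0 m < s.v .lev ∧ s.arr .own 0 m = c + 1) := by
      intro c
      constructor
      · rintro ⟨q, hq, h⟩
        rcases Nat.lt_succ_iff_lt_or_eq.1 hq with hq | rfl
        exacts [.inl ⟨q, hq, h⟩, .inr h]
      · rintro (⟨q, hq, h⟩ | h)
        exacts [⟨q, by omega, h⟩, ⟨m, by omega, h⟩]
    by_cases hg : s.arr .pr 0 m < s.v .lev ∧ s.arr .own 0 m ≠ 0
    · rw [if_pos (by simpa using hg)]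
      refine ⟨by simp [h1], by simp [h2], fun id hid => ?_, fun c hc => ?_⟩
      · funext i j; simp [hid, h3 id hid]
      · simp only [run_st1, seta_arr, eval_sub, eval_rd1, eval_var, setv_v, if_true, setv_arr, e2,
          eval_one, true_and, eval_zero]
        rw [hiff]
        by_cases hcm : c = s.arr .own 0 m - 1
        · rw [if_pos hcm]
          have : s.arr .own 0 m = c + 1 := by omega
          simp [this, hg.1]
        · rw [if_neg hcm, h4 c hc]
          have : s.arr .own 0 m ≠ c + 1 := by omega
          simp [this]
    · rw [if_neg (by simpa using hg)]
      refine ⟨by simp [h1], by simp [h2], fun id hid => by simp [h3 id hid], fun c hc => ?_⟩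
      rw [run_skip, setv_arr, h4 c hc, hiff]
      have : ¬ (s.arr .pr 0 m < s.v .lev ∧ s.arr .own 0 m = c + 1) := fun h => hg ⟨h.1, by omega⟩
      simp [this])
  rw [eval_var, hD1] at key
  exact key.2.2.2 c hc

/-- The result of `cliqueC` is a largest set of vertices in `S` that are pairwise not related
by `Cm`. -/
theorem cliqueC_run {s : St} (hV : s.v .D * (s.v .D + 3) + s.v .D + 4 < V)
    (hsymm : ∀ p q, s.rel .Cm p q → s.rel .Cm q p)
    (hcol : ∀ c < s.v .D, s.tst .S c → s.arr .col 0 c = 1 ∨ s.arr .col 0 c = 2)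
    (hprop : ∀ p < s.v .D, ∀ q < s.v .D, s.tst .S p → s.tst .S q → s.rel .Cm p q →
      s.arr .col 0 p ≠ s.arr .col 0 q) :
    (∀ c < s.v .D, (cliqueC.run V Z s).tst .I c → s.tst .S c) ∧
    (∀ x < s.v .D, ∀ y < s.v .D, (cliqueC.run V Z s).tst .I x → (cliqueC.run V Z s).tst .I y →
      ¬ s.rel .Cm x y) ∧
    ∀ Q : Finset ℕ, (∀ c ∈ Q, c < s.v .D ∧ s.tst .S c) → (∀ x ∈ Q, ∀ y ∈ Q, ¬ s.rel .Cm x y) →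
      Q.card ≤ ((Finset.range (s.v .D)).filter fun c => (cliqueC.run V Z s).tst .I c).card := by
  have h1 := auctionC_run (V := V) (Z := Z) (s := s) hV
  unfold cliqueC
  rw [run_seq, run_seq]
  set s1 := auctionC.run V Z s with hs1
  have hD1 : s1.v .D = s.v .D := run_v (by decide) _
  have hS1 : s1.arr .S = s.arr .S := run_arr (by decide) _
  have hc1 : s1.arr .col = s.arr .col := run_arr (by decide) _
  have h2 := levelC_run (V := V) (Z := Z) (s := s1) (by rw [hD1]; omega)
  set s2 := levelC.run V Z s1 with hs2
  have hD2 : s2.v .D = s.v .D := (run_v (by decide) _).trans hD1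
  have ha2 : s2.arr = s1.arr := by funext id; exact run_arr (by cases id <;> decide) _
  have h3 := extractC_run (V := V) (Z := Z) (s := s2)
  have hS2 : s2.tst .S = s.tst .S := by funext c; simp only [St.tst, ha2, hS1]
  have hR : s1.right = s.right := by funext c; simp only [St.right, St.tst, hS1, hc1]
  rw [hD2, hS2, ha2] at h3
  rw [hD1, hR] at h2
  set s3 := extractC.run V Z s2 with hs3
  have hCLR : ∀ x < s.v .D, ∀ y < s.v .D, s.tst .S x → s.tst .S y → s.rel .Cm x y →
      s.left x ∧ s.right y ∨ s.left y ∧ s.right x := by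
    intro x hx y hy hSx hSy hC
    have hne := hprop x hx y hy hSx hSy hC
    rcases hcol x hx hSx with e1 | e1 <;> rcases hcol y hy hSy with e2 | e2
    · omega
    · exact .inl ⟨⟨hSx, e1⟩, hSy, e2⟩
    · exact .inr ⟨⟨hSy, e2⟩, hSx, e1⟩
    · omega
  refine ⟨fun c hc h => ((h3 c hc).1 h).1, fun x hx y hy hxI hyI => ?_, fun Q hQ hQC => ?_⟩
  · exact h1.indep hCLR hsymm h2.2.1 h2.2.2 hx hy ((h3 x hx).1 hxI) ((h3 y hy).1 hyI)
  · refine h1.card_le (S := s.tst .S) (lev := s2.v .lev) (fun c hc hS => ?_) (fun c hl hr => ?_)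
      (fun c h => h.1) (fun c h => h.1) h2.1 (fun c => ?_) hQ hQC
    · rcases hcol c hc hS with e | e
      exacts [.inl ⟨hS, e⟩, .inr ⟨hS, e⟩]
    · have := hl.2
      have := hr.2
      omega
    · rw [Finset.mem_filter, Finset.mem_range]
      exact and_congr_right fun hc => h3 c hc

/-! ### Edge elimination in a local graph -/

/-- The first `bk` entries of `B` are the vertices of a clique. -/
structure Best (n : ℕ) (Adj : ℕ → ℕ → Prop) (bk : ℕ) (B : ℕ → ℕ) : Prop where
  lt : ∀ x < bk, B x < n
  adj : ∀ x < bk, ∀ y < bk, x ≠ y → Adj (B x) (B y)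

section

variable {n bk : ℕ} {Adj : ℕ → ℕ → Prop} {B : ℕ → ℕ}

theorem Best.zero : Best n Adj 0 B where
  lt x h := absurd h (Nat.not_lt_zero x)
  adj x h := absurd h (Nat.not_lt_zero x)

theorem Best.push (h : Best n Adj bk B) (hA : ∀ u v, Adj u v → Adj v u) {u : ℕ} (hu : u < n)
    (hadj : ∀ x < bk, Adj (B x) u) : Best n Adj (bk + 1) fun x => if x = bk then u else B x where
  lt x hx := by
    split_ifs
    exacts [hu, h.lt x (by omega)]
  adj x hx y hy hxy := by
    split_ifs with h1 h2 h2
    · omega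
    · exact hA _ _ (hadj y (by omega))
    · exact hadj x (by omega)
    · exact h.adj x (by omega) y (by omega) hxy

end

/-- Writes the clique given by `I`, `a` and `b` to `B` if it has more than `bk` vertices. -/
def recordC : Cmd :=
  countC .f .j (.rd1 .I Vr.j) ;;
  .ite (Vr.bk <ₑ Vr.f + 2)
    (.bk ≔ 0 ;;
     .rep .j Vr.D (.ite (.rd1 .I Vr.j) (.st1 .B Vr.bk (.rd1 .X Vr.j) ;; .bk ≔ Vr.bk + 1) .skip) ;;
     .st1 .B Vr.bk (.rd1 .X Vr.a) ;; .bk ≔ Vr.bk + 1 ;;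
     .st1 .B Vr.bk (.rd1 .X Vr.b) ;; .bk ≔ Vr.bk + 1) .skip

variable {V Z : ℕ}

theorem recordC_run {n : ℕ} {Adj : ℕ → ℕ → Prop} {s : St} (hV : s.v .D + 3 < V)
    (hA : ∀ u v, Adj u v → Adj v u) (hX : ∀ i < s.v .D, s.arr .X 0 i < n)
    (hB : Best n Adj (s.v .bk) (s.arr .B 0)) (ha : s.v .a < s.v .D) (hb : s.v .b < s.v .D)
    (hI : ∀ x < s.v .D, ∀ y < s.v .D, s.tst .I x → s.tst .I y → x ≠ y →
      Adj (s.arr .X 0 x) (s.arr .X 0 y))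
    (hIa : ∀ x < s.v .D, s.tst .I x → Adj (s.arr .X 0 x) (s.arr .X 0 (s.v .a)))
    (hIb : ∀ x < s.v .D, s.tst .I x → Adj (s.arr .X 0 x) (s.arr .X 0 (s.v .b)))
    (hab : Adj (s.arr .X 0 (s.v .a)) (s.arr .X 0 (s.v .b))) :
    Best n Adj ((recordC.run V Z s).v .bk) ((recordC.run V Z s).arr .B 0) ∧
    s.v .bk ≤ (recordC.run V Z s).v .bk ∧
    ((Finset.range (s.v .D)).filter fun c => s.tst .I c).card + 2 ≤ (recordC.run V Z s).v .bk := by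
  have h1 := count_run (V := V) (Z := Z) (s := s) (x := .f) (c := .j) (e := .rd1 .I Vr.j) (by decide)
    (fun c => s.tst .I c) (by intro j hj s' hv ha; simp [hv, ha, St.tst]) (by decide) (by omega)
  unfold recordC
  rw [run_seq, run_ite]
  set s1 := (countC .f .j (.rd1 .I Vr.j)).run V Z s with hs1
  have hD1 : s1.v .D = s.v .D := run_v (by decide) _
  have hbk1 : s1.v .bk = s.v .bk := run_v (by decide) _
  have ha1 : s1.v .a = s.v .a := run_v (by decide) _
  have hb1 : s1.v .b = s.v .b := run_v (by decide) _
  have har : s1.arr = s.arr := by funext id; exact run_arr (by cases id <;> decide) _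
  have hle : ((Finset.range (s.v .D)).filter fun c => s.tst .I c).card ≤ s.v .D := by
    simpa using Finset.card_filter_le (Finset.range (s.v .D)) _
  have hmod : (s1.v .f + 2) % V = s1.v .f + 2 := Nat.mod_eq_of_lt (by omega)
  simp only [eval_lt, eval_var, eval_add, eval_two, hmod, hbk1]
  by_cases hlt : s.v .bk < s1.v .f + 2
  · rw [if_pos (by simp [hlt]), run_seq, run_seq]
    set s2 := (Cmd.set .bk 0).run V Z s1 with hs2
    have hD2 : s2.v .D = s.v .D := by simp [hs2, hD1]
    have key := rep_inv (V := V) (Z := Z) (y := .j) (e := Vr.D) (s := s2)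
      (p := .ite (.rd1 .I Vr.j) (.st1 .B Vr.bk (.rd1 .X Vr.j) ;; .bk ≔ Vr.bk + 1) .skip)
      (fun m s' => s'.v .D = s.v .D ∧ s'.v .a = s.v .a ∧ s'.v .b = s.v .b ∧
        s'.arr .I = s.arr .I ∧ s'.arr .X = s.arr .X ∧
        s'.v .bk = ((Finset.range m).filter fun c => s.tst .I c).card ∧
        Best n Adj (s'.v .bk) (s'.arr .B 0) ∧
        ∀ x < s'.v .bk, ∃ i < m, s.tst .I i ∧ s'.arr .B 0 x = s.arr .X 0 i)
      ⟨hD2, by simp [hs2, ha1], by simp [hs2, hb1], by simp [hs2, har], by simp [hs2, har],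
        by simp [hs2], by simp only [hs2, run_set, setv_v, if_true, eval_zero]; exact .zero,
        by simp [hs2]⟩ (by
      rintro m hm s' ⟨h1, h2, h3, h4, h5, h6, h7, h8⟩
      rw [eval_var, hD2] at hm
      have hle : ((Finset.range m).filter fun c => s.tst .I c).card ≤ m := by
        simpa using Finset.card_filter_le (Finset.range m) _
      have hmod : (s'.v .bk + 1) % V = s'.v .bk + 1 := Nat.mod_eq_of_lt (by omega)
      rw [run_ite, Finset.range_add_one, Finset.filter_insert]
      by_cases hg : s.tst .I m
      · rw [if_pos (by simpa [h4, St.tst] using hg), if_pos hg,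
          Finset.card_insert_of_notMem (by simp), ← h6]
        simp only [run_seq, run_st1, run_set, eval_rd1, eval_var, setv_v, setv_arr, seta_v,
          reduceCtorEq, if_false, if_true, eval_add, eval_one, hmod, h5]
        refine ⟨h1, h2, h3, by funext i j; simp [h4], by funext i j; simp [h5], trivial, ?_, ?_⟩
        · convert h7.push hA (hX m hm) (fun x hx => ?_) using 1
          · funext x; simp
          · obtain ⟨i, hi, hIi, hBx⟩ := h8 x hx
            rw [hBx]
            exact hI i (by omega) m hm hIi hg (by omega)
        · intro x hx
          by_cases hxm : x = s'.v .bk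
          · exact ⟨m, by omega, hg, by simp [hxm]⟩
          · obtain ⟨i, hi, hIi, hBx⟩ := h8 x (by omega)
            exact ⟨i, by omega, hIi, by simp [hxm, hBx]⟩
      · rw [if_neg (by simpa [h4, St.tst] using hg), if_neg hg, run_skip]
        refine ⟨by simp [h1], by simp [h2], by simp [h3], h4, h5, by simp [h6], by simpa using h7,
          fun x hx => ?_⟩
        obtain ⟨i, hi, h⟩ := h8 x (by simpa using hx)
        exact ⟨i, by omega, h⟩)
    rw [eval_var, hD2] at key
    set s3 := (Cmd.rep .j Vr.D (.ite (.rd1 .I Vr.j) (.st1 .B Vr.bk (.rd1 .X Vr.j) ;;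
      .bk ≔ Vr.bk + 1) .skip)).run V Z s2 with hs3
    obtain ⟨k1, k2, k3, k4, k5, k6, k7, k8⟩ := key
    have hm1 : (s3.v .bk + 1) % V = s3.v .bk + 1 := Nat.mod_eq_of_lt (by omega)
    have hm2 : (s3.v .bk + 1 + 1) % V = s3.v .bk + 1 + 1 := Nat.mod_eq_of_lt (by omega)
    simp only [run_seq, run_st1, run_set, eval_rd1, eval_var, setv_v, setv_arr, seta_v,
      reduceCtorEq, if_false, if_true, eval_add, eval_one, hm1, hm2, seta_arr, false_and, k2, k3, k5]
    refine ⟨?_, by omega, by omega⟩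
    have b1 := k7.push hA (hX _ ha) (fun x hx => by
      obtain ⟨i, hi, hIi, hBx⟩ := k8 x hx
      rw [hBx]
      exact hIa i hi hIi)
    have b2 := b1.push hA (hX _ hb) (fun x hx => by
      split_ifs with h
      · exact hab
      · obtain ⟨i, hi, hIi, hBx⟩ := k8 x (by omega)
        rw [hBx]
        exact hIb i hi hIi)
    convert b2 using 1
    funext x
    simp
  · rw [if_neg (by simp [hlt]), run_skip, har, hbk1]
    exact ⟨hB, le_rfl, by omega⟩

/-- The common neighborhood of `i` and `j` in the graph `L`. -/
def common (L : ℕ → ℕ → ℕ) (i j c : ℕ) : Prop := L i c ≠ 0 ∧ L j c ≠ 0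

/-- The invariant of the elimination in a local graph with `D` vertices, which are the vertices
`X i` of the graph `Adj`. The remaining edges are given by `L`, the non-edges by `Cm`. If
`memo i j = k + 1`, then the common neighborhood of `i` and `j` in `L` was not co-bipartite at a time
when it had `k` vertices. Every clique that has lost an edge is at most as large as the best clique
that has been found. -/
structure LInv (n : ℕ) (Adj : ℕ → ℕ → Prop) (D : ℕ) (X : ℕ → ℕ) (Cm L memo : ℕ → ℕ → ℕ) (bk : ℕ)
    (B : ℕ → ℕ) : Prop where
  best : Best n Adj bk B
  lt : ∀ i < D, X i < n
  Lsymm : ∀ i < D, ∀ j < D, L i j ≠ 0 → L j i ≠ 0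
  Ladj : ∀ i < D, ∀ j < D, L i j ≠ 0 → Adj (X i) (X j)
  Csymm : ∀ i j, Cm i j ≠ 0 → Cm j i ≠ 0
  Cadj : ∀ i < D, ∀ j < D, Cm i j ≠ 0 ↔ i ≠ j ∧ ¬ Adj (X i) (X j)
  memo : ∀ i < D, ∀ j < D, ∀ k, memo i j = k + 1 → ∃ S' : Finset ℕ, S' ⊆ Finset.range D ∧
    (∀ c < D, common L i j c → c ∈ S') ∧ S'.card = k ∧
    ¬ ∃ f, ProperCol D (· ∈ S') (fun x y => Cm x y ≠ 0) f
  cover : ∀ Q : Finset ℕ, Q ⊆ Finset.range D → (∀ x ∈ Q, ∀ y ∈ Q, x ≠ y → Adj (X x) (X y)) →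
    2 ≤ Q.card → (∀ x ∈ Q, ∀ y ∈ Q, x ≠ y → L x y ≠ 0) ∨ Q.card ≤ bk

/-- The common neighborhood of `i` and `j` in `L` is not co-bipartite. -/
def Stuck (D : ℕ) (Cm L : ℕ → ℕ → ℕ) (i j : ℕ) : Prop :=
  ¬ ∃ f, ProperCol D (common L i j) (fun x y => Cm x y ≠ 0) f

theorem ProperCol.congr {D : ℕ} {S S' : ℕ → Prop} {C : ℕ → ℕ → Prop} {f : ℕ → Bool}
    (h : ∀ c < D, S' c → S c) (hf : ProperCol D S C f) : ProperCol D S' C f :=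
  fun p hp q hq hSp hSq hC => hf p hp q hq (h p hp hSp) (h q hq hSq) hC

section

variable {n D bk : ℕ} {Adj : ℕ → ℕ → Prop} {X B : ℕ → ℕ} {Cm L memo : ℕ → ℕ → ℕ}

theorem LInv.memo_le (h : LInv n Adj D X Cm L memo bk B) {i j : ℕ} (hi : i < D) (hj : j < D) :
    memo i j ≤ D + 1 := by
  rcases hm : memo i j with _ | k
  · omega
  · obtain ⟨S', h1, -, h3, -⟩ := h.memo i hi j hj k hm
    have := Finset.card_le_card h1
    rw [Finset.card_range] at this
    omega

open Classical in
/-- Common neighborhoods only shrink, so a common neighborhood of the recorded size is the recorded one,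
and need not be tested again. -/
theorem LInv.stuck_of_memo (h : LInv n Adj D X Cm L memo bk B) {i j : ℕ} (hi : i < D) (hj : j < D)
    (hm : memo i j = ((Finset.range D).filter (common L i j)).card + 1) : Stuck D Cm L i j := by
  obtain ⟨S', h1, h2, h3, h4⟩ := h.memo i hi j hj _ hm
  have : (Finset.range D).filter (common L i j) = S' := by
    refine Finset.eq_of_subset_of_card_le (fun c hc => ?_) h3.le
    rw [Finset.mem_filter, Finset.mem_range] at hc
    exact h2 c hc.1 hc.2
  rintro ⟨f, hf⟩
  refine h4 ⟨f, hf.congr fun c hc hS => ?_⟩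
  rw [← this, Finset.mem_filter] at hS
  exact hS.2

open Classical in
/-- The number of vertices of the common neighborhood is less than what `memo` records. -/
theorem LInv.card_lt_memo (h : LInv n Adj D X Cm L memo bk B) {i j : ℕ} (hi : i < D) (hj : j < D)
    (hm : memo i j ≠ 0) : ((Finset.range D).filter (common L i j)).card + 1 ≤ memo i j := by
  obtain ⟨k, hk⟩ := Nat.exists_eq_succ_of_ne_zero hm
  obtain ⟨S', h1, h2, h3, h4⟩ := h.memo i hi j hj _ hk
  have : ((Finset.range D).filter (common L i j)).card ≤ S'.card := Finset.card_le_card fun c hc => by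
    rw [Finset.mem_filter, Finset.mem_range] at hc
    exact h2 c hc.1 hc.2
  omega

open Classical in
theorem LInv.stuck (h : LInv n Adj D X Cm L memo bk B) {i j : ℕ} (hst : Stuck D Cm L i j)
    {memo' : ℕ → ℕ → ℕ} (hm : ∀ x y, memo' x y = if x = i ∧ y = j then
      ((Finset.range D).filter (common L i j)).card + 1 else memo x y) :
    LInv n Adj D X Cm L memo' bk B := by
  refine { h with memo := fun x hx y hy k hk => ?_ }
  rw [hm] at hk
  split_ifs at hk with hxy
  · obtain ⟨rfl, rfl⟩ := hxy
    refine ⟨(Finset.range D).filter (common L x y), Finset.filter_subset _ _, fun c hc hS => ?_,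
      by omega, ?_⟩
    · exact Finset.mem_filter.2 ⟨Finset.mem_range.2 hc, hS⟩
    · rintro ⟨f, hf⟩
      refine hst ⟨f, hf.congr fun c hc hS => ?_⟩
      exact Finset.mem_filter.2 ⟨Finset.mem_range.2 hc, hS⟩
  · exact h.memo x hx y hy k hk

/-- The edge `a b` may be removed once a clique has been found that is at least as large as all
cliques that consist of `a`, `b`, and common neighbors of them. -/
theorem LInv.remove (h : LInv n Adj D X Cm L memo bk B) {a b : ℕ} {bk' : ℕ} {B' : ℕ → ℕ}
    (hbest : Best n Adj bk' B') (hle : bk ≤ bk')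
    (hQ : ∀ Q : Finset ℕ, (∀ c ∈ Q, c < D ∧ common L a b c) → (∀ x ∈ Q, ∀ y ∈ Q, Cm x y = 0) →
      Q.card + 2 ≤ bk') {L' : ℕ → ℕ → ℕ}
    (hL' : ∀ x y, L' x y = if x = b ∧ y = a then 0 else if x = a ∧ y = b then 0 else L x y) :
    LInv n Adj D X Cm L' memo bk' B' := by
  have hL : ∀ x y, L' x y ≠ 0 → L x y ≠ 0 := fun x y h1 => by
    rw [hL'] at h1
    split_ifs at h1
    exacts [absurd rfl h1, absurd rfl h1, h1]
  refine { h with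
    best := hbest
    Lsymm := fun i hi j hj hij => ?_
    Ladj := fun i hi j hj hij => h.Ladj i hi j hj (hL i j hij)
    memo := fun i hi j hj k hk => ?_
    cover := fun Q hQD hQA hQ2 => ?_ }
  · have := h.Lsymm i hi j hj (hL i j hij)
    rw [hL'] at hij
    rw [hL', if_neg, if_neg]
    · exact this
    · rintro ⟨rfl, rfl⟩; simp at hij
    · rintro ⟨rfl, rfl⟩; simp at hij
  · obtain ⟨S', h1, h2, h3, h4⟩ := h.memo i hi j hj k hk
    exact ⟨S', h1, fun c hc hS => h2 c hc ⟨hL _ _ hS.1, hL _ _ hS.2⟩, h3, h4⟩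
  · rcases h.cover Q hQD hQA hQ2 with hc | hc
    · by_cases hab : a ∈ Q ∧ b ∈ Q ∧ a ≠ b
      · right
        obtain ⟨haQ, hbQ, hne⟩ := hab
        have h1 := hQ ((Q.erase a).erase b) (fun c hcQ => ?_) (fun x hx y hy => ?_)
        · have hbe : b ∈ Q.erase a := Finset.mem_erase.2 ⟨hne.symm, hbQ⟩
          rw [Finset.card_erase_of_mem hbe, Finset.card_erase_of_mem haQ] at h1
          omega
        · simp only [Finset.mem_erase] at hcQ
          exact ⟨Finset.mem_range.1 (hQD hcQ.2.2), hc a haQ c hcQ.2.2 (Ne.symm hcQ.2.1),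
            hc b hbQ c hcQ.2.2 (Ne.symm hcQ.1)⟩
        · simp only [Finset.mem_erase] at hx hy
          by_contra hC
          have := (h.Cadj x (Finset.mem_range.1 (hQD hx.2.2)) y
            (Finset.mem_range.1 (hQD hy.2.2))).1 hC
          exact this.2 (hQA x hx.2.2 y hy.2.2 this.1)
      · left
        intro x hx y hy hxy
        rw [hL', if_neg, if_neg]
        · exact hc x hx y hy hxy
        · rintro ⟨rfl, rfl⟩; exact hab ⟨hx, hy, hxy⟩
        · rintro ⟨rfl, rfl⟩; exact hab ⟨hy, hx, hxy.symm⟩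
    · exact .inr (hc.trans hle)

end

/-- The number of remaining edges in the first `al` rows. -/
def edgeCount (al D : ℕ) (L : ℕ → ℕ → ℕ) : ℕ :=
  ((Finset.range al ×ˢ Finset.range D).filter fun x => L x.1 x.2 ≠ 0).card

/-- The number of times that `memo i j` can still change. -/
def memoPot (al D : ℕ) (memo : ℕ → ℕ → ℕ) : ℕ :=
  ∑ x ∈ Finset.range al ×ˢ Finset.range D, if memo x.1 x.2 = 0 then D + 1 else memo x.1 x.2 - 1

/-- A bound for the number of steps that are still to be spent on changes of `L` and `memo`. -/
def pot (al D : ℕ) (L memo : ℕ → ℕ → ℕ) : ℕ :=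
  100 * (D + 1) ^ 3 * edgeCount al D L + 100 * (D + 1) ^ 2 * memoPot al D memo

theorem edgeCount_lt {al D a b : ℕ} {L L' : ℕ → ℕ → ℕ} (ha : a < al) (hb : b < D) (hab : L a b ≠ 0)
    (hL' : ∀ x y, L' x y = if x = b ∧ y = a then 0 else if x = a ∧ y = b then 0 else L x y) :
    edgeCount al D L' + 1 ≤ edgeCount al D L := by
  refine Finset.card_lt_card ((Finset.ssubset_iff_of_subset fun x hx => ?_).2 ⟨(a, b), ?_, ?_⟩)
  · rw [Finset.mem_filter] at hx ⊢
    refine ⟨hx.1, fun h0 => hx.2 ?_⟩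
    rw [hL', h0]
    simp
  · simp [ha, hb, hab]
  · rw [Finset.mem_filter, hL']
    simp

theorem memoPot_lt {al D a b m : ℕ} {memo memo' : ℕ → ℕ → ℕ} (ha : a < al) (hb : b < D)
    (hm : ∀ x y, memo' x y = if x = a ∧ y = b then m + 1 else memo x y) (hmD : m ≤ D)
    (hlt : memo a b ≠ 0 → m + 1 < memo a b) :
    memoPot al D memo' + 1 ≤ memoPot al D memo := by
  have hmem : (a, b) ∈ Finset.range al ×ˢ Finset.range D := by simp [ha, hb]
  have e : memo' a b = m + 1 := by rw [hm, if_pos ⟨rfl, rfl⟩]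
  refine Nat.succ_le_of_lt (Finset.sum_lt_sum (fun x hx => ?_) ⟨(a, b), hmem, ?_⟩)
  · by_cases hx : x = (a, b)
    · subst hx
      dsimp only
      rw [e, if_neg (Nat.succ_ne_zero m)]
      split_ifs with h0
      · omega
      · have := hlt h0; omega
    · have e' : memo' x.1 x.2 = memo x.1 x.2 := by
        rw [hm]; exact if_neg fun h => hx (Prod.ext h.1 h.2)
      rw [e']
  · dsimp only
    rw [e, if_neg (Nat.succ_ne_zero m)]
    split_ifs with h0
    · omega
    · have := hlt h0; omega

/-- The common neighborhood of `a` and `b`, and its size. -/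
def commonC : Cmd :=
  fillC .j .S 1 (.rd .L Vr.a Vr.j &ₑ .rd .L Vr.b Vr.j) ;; countC .kk .j (.rd1 .S Vr.j)

/-- Removes the edge `a b`. -/
def removeC : Cmd :=
  cliqueC ;; recordC ;; .st .L Vr.a Vr.b 0 ;; .st .L Vr.b Vr.a 0 ;; .prog ≔ 1

/-- Removes the edge `a b` if its common neighborhood is co-bipartite. -/
def tryC : Cmd :=
  .ite (.rd .L Vr.a Vr.b)
    (commonC ;; .ite (.rd .memo Vr.a Vr.b =ₑ Vr.kk + 1) .skip
      (colorC ;; .ite Vr.ok removeC (.st .memo Vr.a Vr.b (Vr.kk + 1)))) .skip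

variable {V Z : ℕ}

theorem commonC_cost (s : St) : commonC.cost V Z s ≤ 7 * (s.v .D + 1) := by
  refine (Cmd.cost_le (by decide) s).trans ?_
  simp [commonC, fillC, countC, Cmd.bd, Cmd.st1]
  omega

theorem colorC_cost (s : St) : colorC.cost V Z s ≤ 30 * (s.v .D + 1) ^ 2 := by
  refine (Cmd.cost_le (by decide) s).trans ?_
  simp [colorC, pickC, spreadC, verifyC, findC, fillC, Cmd.bd, Cmd.st1]
  nlinarith

theorem removeC_cost (s : St) : removeC.cost V Z s ≤ 60 * (s.v .D + 1) ^ 3 := by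
  refine (Cmd.cost_le (by decide) s).trans ?_
  simp [removeC, cliqueC, auctionC, takeC, cheapC, buyC, levelC, extractC, recordC, findC, fillC,
    countC, Cmd.bd, Cmd.st1]
  have h1 : (s.v .D * (s.v .D + 3)) % V ≤ s.v .D * (s.v .D + 3) := Nat.mod_le _ _
  have h2 : (s.v .D + 1) % V ≤ s.v .D + 1 := Nat.mod_le _ _
  generalize (s.v .D * (s.v .D + 3)) % V = P at *
  generalize (s.v .D + 1) % V = Q at *
  have h3 := Nat.mul_le_mul_right (1 + (1 + (1 + (1 + (1 + s.v .D * 4)) + 5))) h1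
  have h4 := Nat.mul_le_mul_right (1 + (1 + (1 + s.v .D * 3) + 2)) h2
  have h5 := Nat.zero_le (s.v .D ^ 3)
  have h6 := Nat.zero_le (s.v .D ^ 2)
  ring_nf at h3 h4 ⊢
  omega

theorem tryC_run {n : ℕ} {Adj : ℕ → ℕ → Prop} {s : St} (hDn : s.v .D ≤ n) (hV : V = (n + 4) ^ 2)
    (hA : ∀ u v, Adj u v → Adj v u)
    (h : LInv n Adj (s.v .D) (s.arr .X 0) (s.arr .Cm) (s.arr .L) (s.arr .memo) (s.v .bk)
      (s.arr .B 0)) {al : ℕ} (ha : s.v .a < al) (hal : al ≤ s.v .D) (hb : s.v .b < s.v .D) :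
    let s' := tryC.run V Z s
    LInv n Adj (s.v .D) (s.arr .X 0) (s.arr .Cm) (s'.arr .L) (s'.arr .memo) (s'.v .bk)
      (s'.arr .B 0) ∧ s.v .bk ≤ s'.v .bk ∧
    ((s'.v .prog = s.v .prog ∧ s'.arr .L = s.arr .L ∧
        (s.arr .L (s.v .a) (s.v .b) ≠ 0 → Stuck (s.v .D) (s.arr .Cm) (s.arr .L) (s.v .a) (s.v .b))) ∨
      (s'.v .prog = 1 ∧ edgeCount al (s.v .D) (s'.arr .L) + 1 ≤ edgeCount al (s.v .D) (s.arr .L))) ∧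
    tryC.cost V Z s + pot al (s.v .D) (s'.arr .L) (s'.arr .memo) ≤
      pot al (s.v .D) (s.arr .L) (s.arr .memo) + 10 * (s.v .D + 1) := by
  classical
  intro s'
  have haD : s.v .a < s.v .D := by omega
  have hVD : s.v .D * (s.v .D + 3) + s.v .D + 4 < V := by rw [hV]; nlinarith
  by_cases hL : s.arr .L (s.v .a) (s.v .b) = 0
  · have e : s' = s := by
      simp only [s', tryC, run_ite, eval_rd, eval_var, hL, ne_eq, not_true, if_false, run_skip]
    rw [e]
    refine ⟨h, le_rfl, .inl ⟨rfl, rfl, fun h0 => absurd hL h0⟩, ?_⟩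
    simp only [tryC, cost_ite, eval_rd, eval_var, hL, ne_eq, not_true, if_false, cost_skip]
    omega
  have hS1 : ∀ c < s.v .D, (commonC.run V Z s).tst .S c ↔
      common (s.arr .L) (s.v .a) (s.v .b) c := by
    intro c hc
    simp only [commonC, run_seq, St.tst]
    rw [run_arr (by decide), fill_run (fun _ => True) (fun c => if s.arr .L (s.v .a) c ≠ 0 ∧
      s.arr .L (s.v .b) c ≠ 0 then 1 else 0) (by
        intro j hj s' hv ha _
        simp [hv, ha])]
    simp [hc, common]
  have hkk : (commonC.run V Z s).v .kk =
      ((Finset.range (s.v .D)).filter (common (s.arr .L) (s.v .a) (s.v .b))).card := by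
    simp only [commonC, run_seq] at hS1 ⊢
    set t := (fillC .j .S 1 (.rd .L Vr.a Vr.j &ₑ .rd .L Vr.b Vr.j)).run V Z s with ht
    have hDt : t.v .D = s.v .D := run_v (by decide) _
    rw [count_run (by decide) (fun c => t.tst .S c) (by
      intro j hj s' hv ha; simp [hv, ha, St.tst]) (by decide) (by omega), hDt]
    congr 1
    refine Finset.filter_congr fun c hc => ?_
    rw [← hS1 c (Finset.mem_range.1 hc)]
    simp only [St.tst]
    rw [run_arr (c := countC .kk .j (.rd1 .S Vr.j)) (by decide)]
  set s1 := commonC.run V Z s with hs1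
  have hv1 : ∀ x, x ≠ .j → x ≠ .kk → s1.v x = s.v x := fun x hx1 hx2 => run_v (by
    cases x <;> first | decide | contradiction) _
  have ha1 : ∀ id, id ≠ .S → s1.arr id = s.arr id := fun id hid => run_arr (by
    cases id <;> first | decide | contradiction) _
  have hc1 := commonC_cost (V := V) (Z := Z) s
  have hkle : s1.v .kk ≤ s.v .D := by
    rw [hkk]; simpa using Finset.card_filter_le (Finset.range (s.v .D)) _
  have hkmod : (s1.v .kk + 1) % V = s1.v .kk + 1 := Nat.mod_eq_of_lt (by omega)
  by_cases hmemo : s.arr .memo (s.v .a) (s.v .b) = s1.v .kk + 1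
  · have hcond : (.rd .memo Vr.a Vr.b =ₑ Vr.kk + 1 : Ex).eval V s1 ≠ 0 := by
      simp [ha1, hv1, hmemo, hkmod]
    have e : s' = s1 := by
      simp only [s', tryC, run_ite, eval_rd, eval_var, ne_eq, hL, not_false_eq_true, if_true, run_seq]
      rw [← hs1, if_pos hcond, run_skip]
    have hcost : tryC.cost V Z s = 1 + (commonC.cost V Z s + 2) := by
      simp only [tryC, cost_ite, eval_rd, eval_var, ne_eq, hL, not_false_eq_true, if_true, cost_seq]
      rw [← hs1, if_pos hcond, cost_skip]
    rw [e, hcost, ha1 .L (by decide), ha1 .memo (by decide), ha1 .B (by decide),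
      hv1 .bk (by decide) (by decide), hv1 .prog (by decide) (by decide)]
    refine ⟨h, le_rfl, .inl ⟨rfl, rfl, fun _ => h.stuck_of_memo haD hb (by rw [hmemo, hkk])⟩, by omega⟩
  have hcond : ¬ (.rd .memo Vr.a Vr.b =ₑ Vr.kk + 1 : Ex).eval V s1 ≠ 0 := by
    simp [ha1, hv1, hmemo, hkmod]
  have hcol := colorC_run (V := V) (Z := Z) (s := s1) (by
    intro p q; simp only [St.rel]; rw [ha1 .Cm (by decide)]; exact h.Csymm p q)
  set s2 := colorC.run V Z s1 with hs2
  have hv2 : ∀ x, x ∉ commonC.wv ++ colorC.wv → s2.v x = s.v x := fun x hx => by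
    rw [List.mem_append, not_or] at hx
    exact (run_v hx.2 _).trans (run_v hx.1 _)
  have ha2 : ∀ id, id ∉ commonC.wa ++ colorC.wa → s2.arr id = s.arr id := fun id hx => by
    rw [List.mem_append, not_or] at hx
    exact (run_arr hx.2 _).trans (run_arr hx.1 _)
  have hkk2 : s2.v .kk = s1.v .kk := run_v (by decide) _
  have hc2 := colorC_cost (V := V) (Z := Z) s1
  rw [hv1 .D (by decide) (by decide)] at hc2
  have hcost : tryC.cost V Z s = 1 + (commonC.cost V Z s + (1 + (colorC.cost V Z s1 +
      (1 + if s2.v .ok ≠ 0 then removeC.cost V Z s2 else 1)))) := by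
    simp only [tryC, cost_ite, eval_rd, eval_var, ne_eq, hL, not_false_eq_true, if_true, cost_seq]
    rw [← hs1, if_neg hcond, ← hs2]
    rfl
  have hrun : s' = if s2.v .ok ≠ 0 then removeC.run V Z s2 else
      s2.seta .memo (s.v .a) (s.v .b) (s1.v .kk + 1) := by
    simp only [s', tryC, run_ite, eval_rd, eval_var, ne_eq, hL, not_false_eq_true, if_true, run_seq]
    rw [← hs1, if_neg hcond, ← hs2, run_st]
    simp only [eval_var, eval_add, eval_one, hkk2, hkmod, hv2 .a (by decide), hv2 .b (by decide)]
  have hcommon : ∀ c < s.v .D, s2.tst .S c ↔ common (s.arr .L) (s.v .a) (s.v .b) c := by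
    intro c hc
    rw [← hS1 c hc]
    simp only [St.tst]
    rw [run_arr (by decide)]
  have hp0 : 2 ≤ (s.v .D + 1) := by omega
  have hp1 : 2 * (s.v .D + 1) ≤ (s.v .D + 1) ^ 2 := by nlinarith
  have hp2 : 2 * (s.v .D + 1) ^ 2 ≤ (s.v .D + 1) ^ 3 := by
    rw [pow_succ _ 2, mul_comm]; exact Nat.mul_le_mul_left _ hp0
  rcases hcol with ⟨hok, hc12, hprop⟩ | ⟨hok, hno⟩
  · rw [if_pos (by omega)] at hcost hrun
    have hD2 : s2.v .D = s.v .D := hv2 _ (by decide)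
    have hC2 : s2.arr .Cm = s.arr .Cm := ha2 _ (by decide)
    have hclq := cliqueC_run (V := V) (Z := Z) (s := s2) (by rw [hD2]; exact hVD) (by
        intro p q; simp only [St.rel, hC2]; exact h.Csymm p q) (by
        intro c hc hS
        rw [hD2, ← hv1 .D (by decide) (by decide)] at hc
        refine hc12 c hc ?_
        simp only [St.tst] at hS ⊢
        rwa [hs2, run_arr (by decide)] at hS) (by
        intro p hp q hq hSp hSq hC
        rw [hD2, ← hv1 .D (by decide) (by decide)] at hp hq
        refine hprop p hp q hq ?_ ?_ ?_
        · simp only [St.tst] at hSp ⊢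
          rwa [hs2, run_arr (by decide)] at hSp
        · simp only [St.tst] at hSq ⊢
          rwa [hs2, run_arr (by decide)] at hSq
        · simp only [St.rel] at hC ⊢
          rwa [hs2, run_arr (by decide)] at hC)
    set s3 := cliqueC.run V Z s2 with hs3
    have hv3 : ∀ x, x ∉ (commonC.wv ++ colorC.wv) ++ cliqueC.wv → s3.v x = s.v x := fun x hx => by
      rw [List.mem_append, not_or] at hx
      exact (run_v hx.2 _).trans (hv2 _ hx.1)
    have ha3 : ∀ id, id ∉ (commonC.wa ++ colorC.wa) ++ cliqueC.wa → s3.arr id = s.arr id :=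
      fun id hx => by
        rw [List.mem_append, not_or] at hx
        exact (run_arr hx.2 _).trans (ha2 _ hx.1)
    have eD := hv3 .D (by decide)
    have ea := hv3 .a (by decide)
    have eb := hv3 .b (by decide)
    have ebk := hv3 .bk (by decide)
    have eX := ha3 .X (by decide)
    have eB := ha3 .B (by decide)
    have eL := ha3 .L (by decide)
    have em := ha3 .memo (by decide)
    obtain ⟨hI1, hI2, hI3⟩ := hclq
    rw [hD2] at hI1 hI2 hI3
    have hIc : ∀ c < s.v .D, s3.tst .I c → common (s.arr .L) (s.v .a) (s.v .b) c :=
      fun c hc hI => (hcommon c hc).1 (hI1 c hc hI)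
    have hrec := recordC_run (V := V) (Z := Z) (n := n) (Adj := Adj) (s := s3)
      (by rw [eD]; omega) hA (by rw [eD, eX]; exact h.lt) (by rw [ebk, eB]; exact h.best)
      (by rw [ea, eD]; exact haD) (by rw [eb, eD]; exact hb) (by
        rw [eD, eX]
        intro x hx y hy hIx hIy hxy
        have := hI2 x hx y hy hIx hIy
        simp only [St.rel, hC2, h.Cadj x hx y hy] at this
        exact not_not.1 fun hn => this ⟨hxy, hn⟩) (by
        rw [eD, eX, ea]
        intro x hx hIx
        exact hA _ _ (h.Ladj _ haD x hx (hIc x hx hIx).1)) (by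
        rw [eD, eX, eb]
        intro x hx hIx
        exact hA _ _ (h.Ladj _ hb x hx (hIc x hx hIx).2)) (by
        rw [eX, ea, eb]
        exact h.Ladj _ haD _ hb hL)
    rw [eD, ebk] at hrec
    set s4 := recordC.run V Z s3 with hs4
    have e4L : s4.arr .L = s.arr .L := (run_arr (by decide) _).trans eL
    have e4m : s4.arr .memo = s.arr .memo := (run_arr (by decide) _).trans em
    have e4a : s4.v .a = s.v .a := (run_v (by decide) _).trans ea
    have e4b : s4.v .b = s.v .b := (run_v (by decide) _).trans eb
    have hrun' : s' = ((s4.seta .L (s.v .a) (s.v .b) 0).seta .L (s.v .b) (s.v .a) 0).setv .prog 1 := by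
      rw [hrun]
      simp only [removeC, run_seq, ← hs3, ← hs4, run_st, run_set, eval_var, eval_zero, eval_one, e4a,
        e4b, seta_v]
    have hL' : ∀ x y, s'.arr .L x y = if x = s.v .b ∧ y = s.v .a then 0 else
        if x = s.v .a ∧ y = s.v .b then 0 else s.arr .L x y := by
      intro x y; rw [hrun']; simp [e4L]
    have hm' : s'.arr .memo = s.arr .memo := by
      rw [hrun']; funext x y; simp [e4m]
    have hB' : s'.arr .B 0 = s4.arr .B 0 := by
      rw [hrun']; funext x; simp
    have hbk' : s'.v .bk = s4.v .bk := by rw [hrun']; simp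
    have hpr' : s'.v .prog = 1 := by rw [hrun']; simp
    have hcnt := edgeCount_lt ha hb hL hL'
    rw [hm', hB', hbk', hpr']
    refine ⟨h.remove hrec.1 hrec.2.1 (fun Q hQ hQC => ?_) hL', hrec.2.1, .inr ⟨rfl, hcnt⟩, ?_⟩
    · refine le_trans (Nat.add_le_add_right (hI3 Q (fun c hc => ?_) fun x hx y hy => ?_) 2) hrec.2.2
      · exact ⟨(hQ c hc).1, (hcommon c (hQ c hc).1).2 (hQ c hc).2⟩
      · simp only [St.rel, hC2, hQC x hx y hy]; simp
    · have hc3 := removeC_cost (V := V) (Z := Z) s2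
      rw [hD2] at hc3
      rw [hcost]
      simp only [pot]
      have h3 : 100 * (s.v .D + 1) ^ 3 * edgeCount al (s.v .D) (s'.arr .L) + 100 * (s.v .D + 1) ^ 3 ≤
          100 * (s.v .D + 1) ^ 3 * edgeCount al (s.v .D) (s.arr .L) := by
        rw [← Nat.mul_succ]; exact Nat.mul_le_mul_left _ hcnt
      omega
  · rw [if_neg (by omega)] at hcost hrun
    rw [hv1 .D (by decide) (by decide)] at hno
    have hst : Stuck (s.v .D) (s.arr .Cm) (s.arr .L) (s.v .a) (s.v .b) := by
      rintro ⟨f, hf⟩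
      refine hno ⟨f, fun p hp q hq hSp hSq hC => hf p hp q hq ((hS1 p hp).1 hSp) ((hS1 q hq).1 hSq) ?_⟩
      simpa only [St.rel, ha1 .Cm (by decide)] using hC
    have hm : ∀ x y, s'.arr .memo x y = if x = s.v .a ∧ y = s.v .b then
        ((Finset.range (s.v .D)).filter (common (s.arr .L) (s.v .a) (s.v .b))).card + 1
        else s.arr .memo x y := by
      intro x y
      rw [hrun, seta_arr, ha2 .memo (by decide), hkk]
      simp
    have hL' : s'.arr .L = s.arr .L := by
      rw [hrun]; funext i j; simp [ha2 .L (by decide)]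
    have hB' : s'.arr .B = s.arr .B := by
      rw [hrun]; funext i j; simp [ha2 .B (by decide)]
    have hbk' : s'.v .bk = s.v .bk := by rw [hrun]; exact hv2 _ (by decide)
    have hpr' : s'.v .prog = s.v .prog := by rw [hrun]; exact hv2 _ (by decide)
    rw [hL', hB', hbk', hpr']
    refine ⟨h.stuck hst hm, le_rfl, .inl ⟨rfl, rfl, fun _ => hst⟩, ?_⟩
    have := memoPot_lt ha hb hm (by rw [← hkk]; exact hkle) (fun h0 => by
      have h1 := h.card_lt_memo haD hb h0
      rw [← hkk] at h1 ⊢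
      omega)
    rw [hcost]
    simp only [pot]
    have h3 : 100 * (s.v .D + 1) ^ 2 * memoPot al (s.v .D) (s'.arr .memo) + 100 * (s.v .D + 1) ^ 2 ≤
        100 * (s.v .D + 1) ^ 2 * memoPot al (s.v .D) (s.arr .memo) := by
      rw [← Nat.mul_succ]; exact Nat.mul_le_mul_left _ this
    omega

/-- Tries to remove each edge in the first `al` rows once. -/
def roundC : Cmd := .rep .a Vr.al (.rep .b Vr.D tryC)

/-- Removes edges in the first `al` rows as long as that is possible. -/
def elimC : Cmd :=
  .prog ≔ 1 ;; .rep .r (Vr.al * Vr.D) (.ite Vr.prog (.prog ≔ 0 ;; roundC) .skip)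

/-- The state `s` of an elimination that started in state `s₀`. -/
structure Elim (n : ℕ) (Adj : ℕ → ℕ → Prop) (s₀ s : St) : Prop where
  D : s.v .D = s₀.v .D
  al : s.v .al = s₀.v .al
  X : s.arr .X = s₀.arr .X
  Cm : s.arr .Cm = s₀.arr .Cm
  bk : s₀.v .bk ≤ s.v .bk
  inv : LInv n Adj (s₀.v .D) (s₀.arr .X 0) (s₀.arr .Cm) (s.arr .L) (s.arr .memo) (s.v .bk)
    (s.arr .B 0)

/-- The state of a round that started with `c` edges, and in which the pairs in `P` have been tried:
either an edge has been removed, or there are no removable edges in `P`. -/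
def Progress (s₀ : St) (c : ℕ) (P : ℕ → ℕ → Prop) (s : St) : Prop :=
  (s.v .prog = 0 ∧ edgeCount (s₀.v .al) (s₀.v .D) (s.arr .L) ≤ c ∧
    ∀ i j, P i j → s.arr .L i j ≠ 0 → Stuck (s₀.v .D) (s₀.arr .Cm) (s.arr .L) i j) ∨
  (s.v .prog = 1 ∧ edgeCount (s₀.v .al) (s₀.v .D) (s.arr .L) + 1 ≤ c)

theorem Progress.mono {s₀ : St} {c : ℕ} {P P' : ℕ → ℕ → Prop} {s : St} (h : Progress s₀ c P s)
    (hP : ∀ i j, P' i j → P i j) : Progress s₀ c P' s :=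
  h.imp (fun h => ⟨h.1, h.2.1, fun i j hij => h.2.2 i j (hP i j hij)⟩) id

variable {V Z : ℕ}

section

variable {n : ℕ} {Adj : ℕ → ℕ → Prop} {s₀ : St}

theorem Elim.setv {s : St} (h : Elim n Adj s₀ s) {x : Vr} (hD : x ≠ .D) (hal : x ≠ .al)
    (hbk : x ≠ .bk) (a : ℕ) : Elim n Adj s₀ (s.setv x a) where
  D := by simp [hD.symm, h.D]
  al := by simp [hal.symm, h.al]
  X := h.X
  Cm := h.Cm
  bk := by simpa [hbk.symm] using h.bk
  inv := by simpa [hbk.symm] using h.inv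

/-- The potential in state `s`. -/
abbrev St.pot (s₀ s : St) : ℕ := HyperbolicClique.pot (s₀.v .al) (s₀.v .D) (s.arr .L) (s.arr .memo)

/-- Amortized time: a pair costs `O(D)`, apart from changes of `L` and `memo`, which the potential
pays for. -/
theorem Elim.tryC {s : St} (hDn : s₀.v .D ≤ n) (hV : V = (n + 4) ^ 2)
    (hA : ∀ u v, Adj u v → Adj v u) (hal : s₀.v .al ≤ s₀.v .D) (h : Elim n Adj s₀ s) {c : ℕ}
    {P : ℕ → ℕ → Prop} (hp : Progress s₀ c P s) (ha : s.v .a < s₀.v .al) (hb : s.v .b < s₀.v .D) :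
    Elim n Adj s₀ (tryC.run V Z s) ∧
    Progress s₀ c (fun i j => P i j ∨ (i = s.v .a ∧ j = s.v .b)) (tryC.run V Z s) ∧
    tryC.cost V Z s + s₀.pot (tryC.run V Z s) ≤ s₀.pot s + 10 * (s₀.v .D + 1) := by
  have := tryC_run (V := V) (Z := Z) (n := n) (Adj := Adj) (s := s) (by rw [h.D]; exact hDn) hV hA
    (by rw [h.D, h.X, h.Cm]; exact h.inv) (al := s₀.v .al) ha (by rw [h.D]; exact hal)
    (by rw [h.D]; exact hb)
  rw [h.D, h.X, h.Cm] at this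
  obtain ⟨h1, h2, h3, h4⟩ := this
  refine ⟨⟨(run_v (by decide) _).trans h.D, (run_v (by decide) _).trans h.al,
    (run_arr (by decide) _).trans h.X, (run_arr (by decide) _).trans h.Cm, h.bk.trans h2, h1⟩,
    ?_, h4⟩
  rcases h3 with ⟨e1, e2, e3⟩ | ⟨e1, e2⟩
  · rcases hp with ⟨p1, p2, p3⟩ | ⟨p1, p2⟩
    · refine .inl ⟨e1.trans p1, by rwa [e2], ?_⟩
      rw [e2]
      rintro i j (hij | ⟨rfl, rfl⟩)
      exacts [p3 i j hij, e3]
    · exact .inr ⟨e1.trans p1, by rwa [e2]⟩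
  · refine .inr ⟨e1, e2.trans ?_⟩
    rcases hp with ⟨-, p2, -⟩ | ⟨-, p2⟩
    exacts [p2, by omega]

theorem Elim.roundC {s : St} (hDn : s₀.v .D ≤ n) (hV : V = (n + 4) ^ 2)
    (hA : ∀ u v, Adj u v → Adj v u) (hal : s₀.v .al ≤ s₀.v .D) (h : Elim n Adj s₀ s)
    (hp : s.v .prog = 0) :
    Elim n Adj s₀ (roundC.run V Z s) ∧
    Progress s₀ (edgeCount (s₀.v .al) (s₀.v .D) (s.arr .L)) (fun i j => i < s₀.v .al ∧ j < s₀.v .D)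
      (roundC.run V Z s) ∧
    roundC.cost V Z s + s₀.pot (roundC.run V Z s) ≤
      s₀.pot s + (1 + s₀.v .al * (2 + s₀.v .D * (10 * (s₀.v .D + 1) + 1))) := by
  set c := edgeCount (s₀.v .al) (s₀.v .D) (s.arr .L)
  obtain ⟨t, ht, k1, k2, k3⟩ := rep_rule (V := V) (Z := Z) (y := .a) (e := Vr.al) (s := s)
    (p := .rep .b Vr.D HyperbolicClique.tryC)
    (fun m t s' => Elim n Adj s₀ s' ∧ Progress s₀ c (fun i j => i < m ∧ j < s₀.v .D) s' ∧
      t + s₀.pot s' ≤ s₀.pot s + m * (2 + s₀.v .D * (10 * (s₀.v .D + 1) + 1)))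
    ⟨h, .inl ⟨hp, le_rfl, fun i j h => absurd h.1 (Nat.not_lt_zero i)⟩, by omega⟩ (by
    rintro m hm t s' ⟨h1, h2, h3⟩
    rw [eval_var, h.al] at hm
    have hD' : (Ex.var .D).eval V (s'.setv .a m) = s₀.v .D := by simp [h1.D]
    obtain ⟨t', ht', k1, k2, k3, k4⟩ := rep_rule (V := V) (Z := Z) (y := .b) (e := Vr.D)
      (s := s'.setv .a m) (p := HyperbolicClique.tryC)
      (fun l t s'' => Elim n Adj s₀ s'' ∧ s''.v .a = m ∧
        Progress s₀ c (fun i j => (i < m ∧ j < s₀.v .D) ∨ (i = m ∧ j < l)) s'' ∧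
        t + s₀.pot s'' ≤ s₀.pot s' + l * (10 * (s₀.v .D + 1) + 1))
      ⟨h1.setv (by decide) (by decide) (by decide) _, by simp, Progress.mono h2 (by simp), by simp [St.pot]⟩ (by
      rintro l hl t s'' ⟨h1, h2, h3, h4⟩
      rw [hD'] at hl
      obtain ⟨g1, g2, g3⟩ := Elim.tryC (V := V) (Z := Z) hDn hV hA hal
        (h1.setv (x := .b) (by decide) (by decide) (by decide) l) (c := c)
        (P := fun i j => (i < m ∧ j < s₀.v .D) ∨ (i = m ∧ j < l)) h3
        (by simpa [h2] using hm) (by simpa using hl)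
      refine ⟨g1, (run_v (by decide) _).trans (by simp [h2]), g2.mono ?_, ?_⟩
      · rintro i j (h | ⟨rfl, h⟩)
        · exact .inl (.inl h)
        · rcases Nat.lt_succ_iff_lt_or_eq.1 h with h | rfl
          · exact .inl (.inr ⟨rfl, h⟩)
          · exact .inr (by simp [h2])
      · rw [add_mul, one_mul]
        simp only [St.pot, setv_arr] at g3 h4 ⊢
        omega)
    rw [hD'] at k3 k4
    refine ⟨k1, k3.mono ?_, ?_⟩
    · rintro i j ⟨hi, hj⟩
      rcases Nat.lt_succ_iff_lt_or_eq.1 hi with hi | rfl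
      exacts [.inl ⟨hi, hj⟩, .inr ⟨rfl, hj⟩]
    · rw [ht', add_mul, one_mul]
      omega)
  rw [eval_var, h.al] at k2 k3
  refine ⟨k1, k2, ?_⟩
  rw [HyperbolicClique.roundC, ht]
  omega

theorem pot_le {s : St} (h : Elim n Adj s₀ s) (hal : s₀.v .al ≤ s₀.v .D) :
    s₀.pot s ≤ 200 * s₀.v .al * (s₀.v .D + 1) ^ 4 := by
  have h1 : edgeCount (s₀.v .al) (s₀.v .D) (s.arr .L) ≤ s₀.v .al * s₀.v .D :=
    (Finset.card_filter_le _ _).trans (by simp)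
  have h2 : memoPot (s₀.v .al) (s₀.v .D) (s.arr .memo) ≤ s₀.v .al * s₀.v .D * (s₀.v .D + 1) := by
    refine (Finset.sum_le_card_nsmul _ _ (s₀.v .D + 1) fun x hx => ?_).trans (by simp)
    rw [Finset.mem_product, Finset.mem_range, Finset.mem_range] at hx
    have := h.inv.memo_le (hx.1.trans_le hal) hx.2
    split_ifs <;> omega
  have h3 := Nat.mul_le_mul_left (100 * (s₀.v .D + 1) ^ 3) h1
  have h4 := Nat.mul_le_mul_left (100 * (s₀.v .D + 1) ^ 2) h2
  have h5 : s₀.v .al * s₀.v .D ≤ s₀.v .al * (s₀.v .D + 1) := Nat.mul_le_mul_left _ (by omega)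
  have h6 := Nat.mul_le_mul_left ((s₀.v .D + 1) ^ 3) h5
  refine (add_le_add h3 h4).trans ?_
  nlinarith

end

/-- No edge in the first `al` rows can be removed at the end: each round but the last removes an edge, so
that `al * D` rounds suffice. -/
theorem elimC_run {n : ℕ} {Adj : ℕ → ℕ → Prop} {s : St} (hDn : s.v .D ≤ n) (hV : V = (n + 4) ^ 2)
    (hA : ∀ u v, Adj u v → Adj v u) (hal : s.v .al ≤ s.v .D) (hal1 : 1 ≤ s.v .al)
    (h : LInv n Adj (s.v .D) (s.arr .X 0) (s.arr .Cm) (s.arr .L) (s.arr .memo) (s.v .bk)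
      (s.arr .B 0)) :
    Elim n Adj s (elimC.run V Z s) ∧
    (∀ i < s.v .al, ∀ j < s.v .D, (elimC.run V Z s).arr .L i j ≠ 0 →
      Stuck (s.v .D) (s.arr .Cm) ((elimC.run V Z s).arr .L) i j) ∧
    elimC.cost V Z s ≤ 300 * s.v .al * (s.v .D + 1) ^ 4 := by
  have h0 : Elim n Adj s (s.setv .prog 1) :=
    Elim.setv ⟨rfl, rfl, rfl, rfl, le_rfl, h⟩ (by decide) (by decide) (by decide) _
  have hlim : (Vr.al * Vr.D : Ex).eval V (s.setv .prog 1) = s.v .al * s.v .D := by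
    simp only [eval_mul, eval_var, setv_v, reduceCtorEq, if_false]
    exact Nat.mod_eq_of_lt (by rw [hV]; nlinarith)
  set W := 3 + s.v .al * (2 + s.v .D * (10 * (s.v .D + 1) + 1)) + 1 with hW
  obtain ⟨t, ht, k1, k2, k3⟩ := rep_rule (V := V) (Z := Z) (y := .r) (e := Vr.al * Vr.D)
    (s := s.setv .prog 1) (p := .ite Vr.prog (.prog ≔ 0 ;; roundC) .skip)
    (fun m t s' => Elim n Adj s s' ∧
      ((s'.v .prog = 0 ∧ ∀ i < s.v .al, ∀ j < s.v .D, s'.arr .L i j ≠ 0 →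
        Stuck (s.v .D) (s.arr .Cm) (s'.arr .L) i j) ∨
      (s'.v .prog = 1 ∧ edgeCount (s.v .al) (s.v .D) (s'.arr .L) + m ≤ s.v .al * s.v .D)) ∧
      t + s.pot s' ≤ s.pot s + m * W)
    ⟨h0, .inr ⟨by simp, (Finset.card_filter_le _ _).trans (by simp)⟩, by simp [St.pot]⟩ (by
    rintro m hm t s' ⟨h1, h2, h3⟩
    simp only [cost_ite, run_ite, eval_var, setv_v, reduceCtorEq, if_false]
    rw [add_mul, one_mul]
    rcases h2 with ⟨e1, e2⟩ | ⟨e1, e2⟩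
    · rw [if_neg (by simp [e1]), if_neg (by simp [e1])]
      refine ⟨h1.setv (by decide) (by decide) (by decide) _, .inl ⟨by simp [e1], e2⟩, ?_⟩
      rw [cost_skip, run_skip]
      simp only [St.pot, setv_arr] at h3 ⊢
      omega
    · rw [if_pos (by simp [e1]), if_pos (by simp [e1]), run_seq, cost_seq, run_set, cost_set,
        eval_zero]
      obtain ⟨g1, g2, g3⟩ := Elim.roundC (V := V) (Z := Z) hDn hV hA hal
        ((h1.setv (x := .r) (by decide) (by decide) (by decide) m).setv (x := .prog) (by decide)
          (by decide) (by decide) 0) (by simp)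
      refine ⟨g1, ?_, ?_⟩
      · rcases g2 with ⟨p1, p2, p3⟩ | ⟨p1, p2⟩
        · exact .inl ⟨p1, fun i hi j hj => p3 i j ⟨hi, hj⟩⟩
        · refine .inr ⟨p1, ?_⟩
          simp only [setv_arr] at p2
          omega
      · simp only [St.pot, setv_arr] at h3 g3 ⊢
        omega)
  rw [hlim] at k2 k3
  have hrun : elimC.run V Z s = (Cmd.rep .r (Vr.al * Vr.D)
    (.ite Vr.prog (.prog ≔ 0 ;; roundC) .skip)).run V Z (s.setv .prog 1) := rfl
  rw [← hrun] at k1 k2 k3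
  refine ⟨k1, ?_, ?_⟩
  · rcases k2 with ⟨-, k2⟩ | ⟨-, k2⟩
    · exact k2
    · intro i hi j hj hL
      have : (i, j) ∈ (Finset.range (s.v .al) ×ˢ Finset.range (s.v .D)).filter
          fun x => (elimC.run V Z s).arr .L x.1 x.2 ≠ 0 := by
        simp only [Finset.mem_filter, Finset.mem_product, Finset.mem_range]
        exact ⟨⟨hi, hj⟩, hL⟩
      have := Finset.card_pos.2 ⟨_, this⟩
      simp only [edgeCount] at k2
      omega
  · have hc : elimC.cost V Z s = 1 + (1 + t) := by rw [← ht]; rfl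
    have hpot := pot_le (s₀ := s) ⟨rfl, rfl, rfl, rfl, le_rfl, h⟩ hal
    have hWle : W ≤ 4 + s.v .D * (2 + s.v .D * (10 * (s.v .D + 1) + 1)) := by
      rw [hW]
      have := Nat.mul_le_mul_right (2 + s.v .D * (10 * (s.v .D + 1) + 1)) hal
      omega
    have h5 := Nat.mul_le_mul_left (s.v .al * s.v .D) hWle
    have h6 : s.v .D * (4 + s.v .D * (2 + s.v .D * (10 * (s.v .D + 1) + 1))) + 2 ≤
        100 * (s.v .D + 1) ^ 4 := by
      have a1 := Nat.zero_le (s.v .D ^ 4)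
      have a2 := Nat.zero_le (s.v .D ^ 3)
      have a3 := Nat.zero_le (s.v .D ^ 2)
      ring_nf
      omega
    have h7 := Nat.mul_le_mul_left (s.v .al) h6
    rw [hc]
    have h8 : 1 + (1 + t) ≤ 2 * s.v .al + (200 * s.v .al * (s.v .D + 1) ^ 4 + s.v .al * s.v .D *
        (4 + s.v .D * (2 + s.v .D * (10 * (s.v .D + 1) + 1)))) := by omega
    refine h8.trans ?_
    nlinarith

/-! ### The neighborhood of a vertex -/

/-- Every nonempty set of vertices contains a vertex whose neighborhood in that set is
co-bipartite. -/
def VElim (Adj : ℕ → ℕ → Prop) : Prop :=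
  ∀ W : Finset ℕ, W.Nonempty → ∃ v ∈ W, ∃ f : ℕ → Bool, ∀ p ∈ W, ∀ q ∈ W, Adj v p → Adj v q →
    p ≠ q → ¬ Adj p q → f p ≠ f q

/-- Every nonempty subgraph contains an edge whose common neighborhood in that subgraph is
co-bipartite. -/
def EElim (Adj : ℕ → ℕ → Prop) : Prop :=
  ∀ L : ℕ → ℕ → Prop, (∀ u v, L u v → L v u) → (∀ u v, L u v → Adj u v) → (∃ u v, L u v) →
    ∃ u v, L u v ∧ ∃ f : ℕ → Bool, ∀ p q, L u p → L v p → L u q → L v q →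
      p ≠ q → ¬ Adj p q → f p ≠ f q

/-- The matrices of the local graph on the vertices `X 0, …, X (D - 1)`. -/
def initC : Cmd :=
  .rep .p Vr.D (.rep .q Vr.D (.st .memo Vr.p Vr.q 0 ;;
    .tt ≔ .rd .AM (.rd1 .X Vr.p) (.rd1 .X Vr.q) ;; .st .L Vr.p Vr.q Vr.tt ;;
    .st .Cm Vr.p Vr.q ((1 - Vr.tt) &ₑ (1 - (Vr.p =ₑ Vr.q)))))

/-- Searches for the cliques that contain the vertex `X 0`. First only the edges at that vertex are
eliminated; if that fails, all edges are. -/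
def localC : Cmd :=
  initC ;; .al ≔ 1 ;; elimC ;; findC .q .j (.rd .L 0 Vr.j) ;;
  .ite (Vr.q <ₑ Vr.D) (.al ≔ Vr.D ;; elimC) .skip

variable {V Z : ℕ}

theorem initC_cost (s : St) : initC.cost V Z s ≤ 10 * (s.v .D + 1) ^ 2 := by
  refine (Cmd.cost_le (by decide) s).trans ?_
  simp [initC, Cmd.bd]
  nlinarith

theorem initC_run (s : St) (i j : ℕ) :
    (initC.run V Z s).arr .memo i j = (if i < s.v .D ∧ j < s.v .D then 0 else s.arr .memo i j) ∧
    (initC.run V Z s).arr .L i j = (if i < s.v .D ∧ j < s.v .D then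
      s.arr .AM (s.arr .X 0 i) (s.arr .X 0 j) else s.arr .L i j) ∧
    (initC.run V Z s).arr .Cm i j = (if i < s.v .D ∧ j < s.v .D then
      if s.arr .AM (s.arr .X 0 i) (s.arr .X 0 j) = 0 ∧ i ≠ j then 1 else 0 else s.arr .Cm i j) := by
  let Q : (ℕ → ℕ → Prop) → St → Prop := fun P s' => s'.v .D = s.v .D ∧ s'.arr .AM = s.arr .AM ∧
    s'.arr .X = s.arr .X ∧ ∀ i j, (P i j → s'.arr .memo i j = 0 ∧
      s'.arr .L i j = s.arr .AM (s.arr .X 0 i) (s.arr .X 0 j) ∧ s'.arr .Cm i j =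
        if s.arr .AM (s.arr .X 0 i) (s.arr .X 0 j) = 0 ∧ i ≠ j then 1 else 0) ∧
      (¬ P i j → s'.arr .memo i j = s.arr .memo i j ∧ s'.arr .L i j = s.arr .L i j ∧
        s'.arr .Cm i j = s.arr .Cm i j)
  have hcongr : ∀ {P P' : ℕ → ℕ → Prop} {s' : St}, Q P s' → (∀ i j, P i j ↔ P' i j) → Q P' s' := by
    intro P P' s' h hP
    have : P = P' := by funext i j; exact propext (hP i j)
    rwa [← this]
  have key : Q (fun i j => i < s.v .D ∧ j < s.v .D) (initC.run V Z s) := by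
    refine rep_inv (V := V) (Z := Z) (y := .p) (e := Vr.D) (s := s)
      (fun m s' => Q (fun i j => i < m ∧ j < s.v .D) s') ⟨rfl, rfl, rfl, by simp⟩ ?_
    rintro m hm s' h1
    have hD' : (Ex.var .D).eval V (s'.setv .p m) = s.v .D := by simp [h1.1]
    have := rep_inv (V := V) (Z := Z) (y := .q) (e := Vr.D) (s := s'.setv .p m)
      (p := .st .memo Vr.p Vr.q 0 ;;
        .tt ≔ .rd .AM (.rd1 .X Vr.p) (.rd1 .X Vr.q) ;; .st .L Vr.p Vr.q Vr.tt ;;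
        .st .Cm Vr.p Vr.q ((1 - Vr.tt) &ₑ (1 - (Vr.p =ₑ Vr.q))))
      (fun l s' => s'.v .p = m ∧ Q (fun i j => (i < m ∧ j < s.v .D) ∨ (i = m ∧ j < l)) s')
      ⟨by simp, by simp [h1.1], h1.2.1, h1.2.2.1, by simpa using h1.2.2.2⟩ (by
      rintro l hl s'' ⟨h1, h2, h3, h4, h5⟩
      refine ⟨by simp [h1], by simp [h2], ?_, ?_, fun i j => ?_⟩
      · funext i j; simp [h3]
      · funext i j; simp [h4]
      · simp only [run_seq, run_st, run_set, eval_rd, eval_rd1, eval_var, setv_v, setv_arr, seta_v,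
          seta_arr, reduceCtorEq, if_false, if_true, eval_zero, eval_and, eval_sub, eval_one,
          eval_eq, h1, h3, h4, false_and, true_and]
        by_cases hij : i = m ∧ j = l
        · obtain ⟨rfl, rfl⟩ := hij
          refine ⟨fun _ => ⟨by simp, by simp, ?_⟩, fun h => absurd (.inr ⟨rfl, by omega⟩) h⟩
          by_cases e1 : s.arr .AM (s.arr .X 0 i) (s.arr .X 0 j) = 0 <;> by_cases e2 : i = j <;>
            (simp [e1, e2]; try omega)
        · simp only [hij, if_false]
          have : ((i < m ∧ j < s.v .D) ∨ (i = m ∧ j < l + 1)) ↔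
              ((i < m ∧ j < s.v .D) ∨ (i = m ∧ j < l)) := by omega
          rw [this]
          exact h5 i j)
    rw [hD'] at this
    exact hcongr this.2 (by intro i j; omega)
  obtain ⟨-, -, -, h⟩ := key
  obtain ⟨h1, h2⟩ := h i j
  split_ifs with hij hc
  · have := h1 hij; rwa [if_pos hc] at this
  · have := h1 hij; rwa [if_neg hc] at this
  · exact h2 hij

/-- The best clique that has been found is at least as large as every clique that contains the vertex
`X 0`. Under `VElim` the first stage, which takes time `O(D ^ 4)`, removes all edges at `X 0`. -/
theorem localC_run {n : ℕ} {Adj : ℕ → ℕ → Prop} {s : St} (hDn : s.v .D ≤ n) (hD : 0 < s.v .D)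
    (hV : V = (n + 4) ^ 2) (hA : ∀ u v, Adj u v → Adj v u)
    (hX : ∀ i < s.v .D, s.arr .X 0 i < n)
    (hXinj : ∀ i < s.v .D, ∀ j < s.v .D, s.arr .X 0 i = s.arr .X 0 j → i = j)
    (hAM : ∀ u < n, ∀ v < n, s.arr .AM u v ≠ 0 ↔ Adj u v)
    (hCm : ∀ i j, s.arr .Cm i j ≠ 0 → s.arr .Cm j i ≠ 0)
    (hbest : Best n Adj (s.v .bk) (s.arr .B 0)) :
    let s' := localC.run V Z s
    (∀ i j, s'.arr .Cm i j ≠ 0 → s'.arr .Cm j i ≠ 0) ∧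
    Best n Adj (s'.v .bk) (s'.arr .B 0) ∧ s.v .bk ≤ s'.v .bk ∧
    (EElim Adj → ∀ Q : Finset ℕ, Q ⊆ Finset.range (s.v .D) → 0 ∈ Q → 2 ≤ Q.card →
      (∀ x ∈ Q, ∀ y ∈ Q, x ≠ y → Adj (s.arr .X 0 x) (s.arr .X 0 y)) → Q.card ≤ s'.v .bk) ∧
    localC.cost V Z s ≤ 1000 * (s.v .D + 1) ^ 5 ∧
    (VElim Adj → localC.cost V Z s ≤ 1000 * (s.v .D + 1) ^ 4) := by
  intro s'
  have hinit := initC_run (V := V) (Z := Z) s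
  have hic := initC_cost (V := V) (Z := Z) s
  set s1 := initC.run V Z s with hs1
  have hD1 : s1.v .D = s.v .D := run_v (by decide) _
  have hbk1 : s1.v .bk = s.v .bk := run_v (by decide) _
  have hX1 : s1.arr .X = s.arr .X := run_arr (by decide) _
  have hB1 : s1.arr .B = s.arr .B := run_arr (by decide) _
  set s2 := s1.setv .al 1 with hs2
  have hD2 : s2.v .D = s.v .D := by simp [hs2, hD1]
  have hal2 : s2.v .al = 1 := by simp [hs2]
  have hbk2 : s2.v .bk = s.v .bk := by simp [hs2, hbk1]
  have hL : ∀ i < s.v .D, ∀ j < s.v .D, s1.arr .L i j ≠ 0 ↔ Adj (s.arr .X 0 i) (s.arr .X 0 j) := by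
    intro i hi j hj
    rw [(hinit i j).2.1, if_pos ⟨hi, hj⟩]
    exact hAM _ (hX i hi) _ (hX j hj)
  have hCspec : ∀ i < s.v .D, ∀ j < s.v .D, s1.arr .Cm i j ≠ 0 ↔
      i ≠ j ∧ ¬ Adj (s.arr .X 0 i) (s.arr .X 0 j) := by
    intro i hi j hj
    rw [(hinit i j).2.2, if_pos ⟨hi, hj⟩, ← hAM _ (hX i hi) _ (hX j hj)]
    split_ifs with h <;> simp only [ne_eq, not_not] <;> tauto
  have hCsymm : ∀ i j, s1.arr .Cm i j ≠ 0 → s1.arr .Cm j i ≠ 0 := by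
    intro i j h
    by_cases hij : i < s.v .D ∧ j < s.v .D
    · rw [hCspec j hij.2 i hij.1]
      rw [hCspec i hij.1 j hij.2] at h
      exact ⟨h.1.symm, fun h' => h.2 (hA _ _ h')⟩
    · rw [(hinit j i).2.2, if_neg (by tauto)]
      rw [(hinit i j).2.2, if_neg hij] at h
      exact hCm i j h
  have hinv : LInv n Adj (s2.v .D) (s2.arr .X 0) (s2.arr .Cm) (s2.arr .L) (s2.arr .memo) (s2.v .bk)
      (s2.arr .B 0) := by
    rw [hD2, hbk2]
    simp only [hs2, setv_arr, hX1, hB1]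
    exact {
      best := hbest
      lt := hX
      Lsymm := fun i hi j hj h => (hL j hj i hi).2 (hA _ _ ((hL i hi j hj).1 h))
      Ladj := fun i hi j hj h => (hL i hi j hj).1 h
      Csymm := hCsymm
      Cadj := hCspec
      memo := fun i hi j hj k hk => by
        rw [(hinit i j).1, if_pos ⟨hi, hj⟩] at hk
        omega
      cover := fun Q hQD hQ _ => .inl fun x hx y hy hxy =>
        (hL x (Finset.mem_range.1 (hQD hx)) y (Finset.mem_range.1 (hQD hy))).2 (hQ x hx y hy hxy) }
  obtain ⟨g1, g2, g3⟩ := elimC_run (V := V) (Z := Z) (s := s2) (by omega) hV hA (by omega) (by omega)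
    hinv
  rw [hal2] at g2 g3
  rw [hD2] at g2 g3
  set s3 := elimC.run V Z s2 with hs3
  have e3D : s3.v .D = s.v .D := g1.D.trans hD2
  have e3X : s3.arr .X = s.arr .X := g1.X.trans hX1
  have e3C : s3.arr .Cm = s1.arr .Cm := g1.Cm
  have hf := find_run (V := V) (Z := Z) (s := s3) (x := .q) (c := .j) (e := .rd .L 0 Vr.j)
    (by decide) (fun j => s3.arr .L 0 j ≠ 0) (by intro j hj s' hv ha; simp [hv, ha]) (by decide)
  have hfc : (findC .q .j (.rd .L 0 Vr.j)).cost V Z s3 ≤ 3 * (s.v .D + 1) := by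
    refine (Cmd.cost_le (by decide) _).trans ?_
    simp [findC, Cmd.bd, e3D]
    omega
  rw [e3D] at hf
  set s4 := (findC .q .j (.rd .L 0 Vr.j)).run V Z s3 with hs4
  have e4v : ∀ x, x ≠ .q → x ≠ .j → s4.v x = s3.v x := fun x h1 h2 => run_v (by
    simp [findC, Cmd.wv, h1, h2]) _
  have e4a : s4.arr = s3.arr := by funext id; exact run_arr (by cases id <;> decide) _
  have hp0 : (s.v .D + 1) ^ 4 = (s.v .D + 1) ^ 2 * (s.v .D + 1) ^ 2 := by ring
  have hp2 : (s.v .D + 1) ^ 2 ≤ (s.v .D + 1) ^ 4 := Nat.pow_le_pow_right (by omega) (by norm_num)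
  have hp1 : (s.v .D + 1) ≤ (s.v .D + 1) ^ 4 := Nat.le_self_pow (by norm_num) _
  have hp5 : s.v .D * (s.v .D + 1) ^ 4 + (s.v .D + 1) ^ 4 = (s.v .D + 1) ^ 5 := by ring
  have e4D : s4.v .D = s.v .D := (e4v .D (by decide) (by decide)).trans e3D
  have hcost : localC.cost V Z s = initC.cost V Z s + (1 + (elimC.cost V Z s2 +
      ((findC .q .j (.rd .L 0 Vr.j)).cost V Z s3 + (1 + if s4.v .q < s.v .D then
        1 + elimC.cost V Z (s4.setv .al (s.v .D)) else 1)))) := by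
    simp only [localC, cost_seq, cost_set, run_set, eval_one, cost_ite, eval_lt, eval_var, cost_skip]
    rw [← hs1, ← hs2, ← hs3, ← hs4]
    simp only [e4D]
    by_cases hlt : s4.v .q < s.v .D <;> simp only [hlt, if_true, if_false, ne_eq, one_ne_zero,
      not_false_eq_true, not_true]
  have hrun : s' = if s4.v .q < s.v .D then elimC.run V Z (s4.setv .al (s.v .D)) else s4 := by
    simp only [s', localC, run_seq, run_set, eval_one, run_ite, eval_lt, eval_var, run_skip]
    rw [← hs1, ← hs2, ← hs3, ← hs4]
    simp only [e4D]
    by_cases hlt : s4.v .q < s.v .D <;> simp only [hlt, if_true, if_false, ne_eq, one_ne_zero,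
      not_false_eq_true, not_true]
  -- a nonempty row after the first stage contradicts the existence of a good vertex in that row
  have hVE : VElim Adj → ¬ s4.v .q < s.v .D := by
    intro hve hq
    obtain ⟨-, hq'⟩ := hf.resolve_left (by omega)
    obtain ⟨v, hv, f, hvf⟩ := hve (((Finset.range (s.v .D)).filter
      fun j => s3.arr .L 0 j ≠ 0).image (s.arr .X 0)) ⟨_, Finset.mem_image_of_mem _
        (Finset.mem_filter.2 ⟨Finset.mem_range.2 hq, hq'⟩)⟩
    simp only [Finset.mem_image, Finset.mem_filter, Finset.mem_range] at hv hvf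
    obtain ⟨j, ⟨hj, hLj⟩, rfl⟩ := hv
    refine g2 0 (by omega) j hj hLj ⟨fun c => f (s.arr .X 0 c), fun x hx y hy hSx hSy hC => ?_⟩
    have hadj : ∀ c < s.v .D, s3.arr .L j c ≠ 0 → Adj (s.arr .X 0 j) (s.arr .X 0 c) := by
      intro c hc hLc
      have := g1.inv.Ladj j (by omega) c (by omega) hLc
      simpa only [hs2, setv_arr, hX1] using this
    have hC' := (hCspec x hx y hy).1 hC
    exact hvf _ ⟨x, ⟨hx, hSx.1⟩, rfl⟩ _ ⟨y, ⟨hy, hSy.1⟩, rfl⟩ (hadj x hx hSx.2) (hadj y hy hSy.2)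
      (fun e => hC'.1 (hXinj x hx y hy e)) hC'.2
  have e4bk : s4.v .bk = s3.v .bk := e4v .bk (by decide) (by decide)
  have hinv3 := g1.inv
  have hbk3 := g1.bk
  rw [hbk2] at hbk3
  rw [hD2] at hinv3
  simp only [hs2, setv_arr, hX1] at hinv3
  rcases hf with ⟨hq, hempty⟩ | ⟨hq, hne⟩
  · rw [if_neg (by omega)] at hcost hrun
    rw [hrun, e4a, e4bk, e3C]
    refine ⟨hCsymm, hinv3.best, hbk3, fun _ Q hQD hQ0 hQ2 hQA => ?_, by omega, fun _ => by omega⟩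
    refine (hinv3.cover Q hQD hQA hQ2).resolve_left fun hL' => ?_
    obtain ⟨y, hy, hy0⟩ := Finset.exists_mem_ne hQ2 0
    exact hempty y (Finset.mem_range.1 (hQD hy)) (hL' 0 hQ0 y hy hy0.symm)
  · rw [if_pos hq] at hcost hrun
    obtain ⟨k1, k2, k3⟩ := elimC_run (V := V) (Z := Z) (s := s4.setv .al (s.v .D)) (n := n)
      (Adj := Adj) (by simpa [e4D] using hDn) hV hA (by simp [e4D]) (by simp only [setv_v, if_true]; exact hD) (by
        simp only [setv_v, setv_arr, reduceCtorEq, if_false, e4D, e4a, e4bk, e3X, e3C]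
        exact hinv3)
    rw [← hrun] at k1 k2
    have k1i := k1.inv
    have k1b := k1.bk
    have k1C := k1.Cm
    simp only [setv_v, setv_arr, reduceCtorEq, if_false, if_true, e4D, e4a, e4bk, e3X, e3C]
      at k1i k1b k1C k2 k3
    refine ⟨by rw [k1C]; exact hCsymm, k1i.best, hbk3.trans k1b, fun hE Q hQD hQ0 hQ2 hQA => ?_, ?_,
      fun hve => absurd hq (hVE hve)⟩
    · refine (k1i.cover Q hQD hQA hQ2).resolve_left fun hL' => ?_
      obtain ⟨y, hy, hy0⟩ := Finset.exists_mem_ne hQ2 0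
      obtain ⟨u, v, ⟨i, hi, j, hj, hij, rfl, rfl⟩, f, hf⟩ := hE (fun u v => ∃ i < s.v .D, ∃ j < s.v .D,
        s'.arr .L i j ≠ 0 ∧ s.arr .X 0 i = u ∧ s.arr .X 0 j = v)
        (by
          rintro u v ⟨i, hi, j, hj, h1, h2, h3⟩
          exact ⟨j, hj, i, hi, k1i.Lsymm i hi j hj h1, h3, h2⟩)
        (by
          rintro u v ⟨i, hi, j, hj, h1, rfl, rfl⟩
          exact k1i.Ladj i hi j hj h1)
        ⟨_, _, 0, hD, y, Finset.mem_range.1 (hQD hy), hL' 0 hQ0 y hy hy0.symm, rfl, rfl⟩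
      refine k2 i hi j hj hij ⟨fun c => f (s.arr .X 0 c), fun x hx y hy hSx hSy hC => ?_⟩
      have hC' := (hCspec x hx y hy).1 hC
      exact hf _ _ ⟨i, hi, x, hx, hSx.1, rfl, rfl⟩ ⟨j, hj, x, hx, hSx.2, rfl, rfl⟩
        ⟨i, hi, y, hy, hSy.1, rfl, rfl⟩ ⟨j, hj, y, hy, hSy.2, rfl, rfl⟩
        (fun e => hC'.1 (hXinj x hx y hy e)) hC'.2
    · have : 300 * s.v .D * (s.v .D + 1) ^ 4 = 300 * (s.v .D * (s.v .D + 1) ^ 4) := by ring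
      omega

/-! ### Removing the vertices of small degree -/

/-- The adjacency lists `nl` of the graph `Adj` on the numbers below `n`, as they are given by the
contents `inp` of the memory. -/
structure Input (n : ℕ) (Adj : ℕ → ℕ → Prop) (nl : ℕ → List ℕ) (inp : ℕ → ℕ) : Prop where
  zero : inp 0 = n
  len : ∀ u < n, inp (u + 2) = inp (u + 1) + (nl u).length
  get : ∀ u < n, ∀ (t : ℕ) (h : t < (nl u).length), inp (inp (u + 1) + t) = (nl u)[t]
  lt : ∀ i, inp i < (n + 4) ^ 2
  edges : n + 2 < inp (n + 1) ↔ ∃ u < n, nl u ≠ []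
  nodup : ∀ u < n, (nl u).Nodup
  mem : ∀ u < n, ∀ w, w ∈ nl u ↔ Adj u w
  adj_lt : ∀ u w, Adj u w → w < n
  symm : ∀ u w, Adj u w → Adj w u
  irrefl : ∀ u, ¬ Adj u u

/-- Writes the vertex `vv` and the remaining neighbors of `vv` to `X`, and decreases the degrees of
these neighbors. -/
def gatherC : Cmd :=
  .st1 .X 0 Vr.vv ;; .D ≔ 1 ;; .lo ≔ .inp (Vr.vv + 1) ;; .hi ≔ .inp (Vr.vv + 2) ;;
  .rep .u (Vr.hi - Vr.lo) (.nb ≔ .inp (Vr.lo + Vr.u) ;;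
    .ite (.rd1 .alive Vr.nb) (.st1 .X Vr.D Vr.nb ;; .D ≔ Vr.D + 1 ;;
      .st1 .deg Vr.nb (.rd1 .deg Vr.nb - 1)) .skip)

/-- Removes the vertex `vv` after the search for cliques that contain it. -/
def deleteC : Cmd := .st1 .alive Vr.vv 0 ;; gatherC ;; localC

variable {V Z : ℕ} {n : ℕ} {Adj : ℕ → ℕ → Prop} {nl : ℕ → List ℕ}

theorem Input.length_lt {inp : ℕ → ℕ} (h : Input n Adj nl inp) {u : ℕ} (hu : u < n) :
    (nl u).length < n := by
  have h1 : ((nl u).toFinset).card ≤ ((Finset.range n).erase u).card := by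
    refine Finset.card_le_card fun w hw => ?_
    rw [List.mem_toFinset, h.mem u hu] at hw
    rw [Finset.mem_erase, Finset.mem_range]
    exact ⟨fun e => h.irrefl u (e ▸ hw), h.adj_lt u w hw⟩
  rw [List.toFinset_card_of_nodup (h.nodup u hu), Finset.card_erase_of_mem (Finset.mem_range.2 hu),
    Finset.card_range] at h1
  omega

open Classical in
theorem gatherC_run {s : St} (hin : Input n Adj nl s.inp) (hV : V = (n + 4) ^ 2)
    (hv : s.v .vv < n) :
    let s' := gatherC.run V Z s
    let l := (nl (s.v .vv)).filter fun w => s.arr .alive 0 w ≠ 0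
    s'.v .D = l.length + 1 ∧ s'.arr .X 0 0 = s.v .vv ∧
    (∀ (i : ℕ) (h : i < l.length), s'.arr .X 0 (i + 1) = l[i]) ∧
    (∀ w, s'.arr .deg 0 w = if w ∈ l then s.arr .deg 0 w - 1 else s.arr .deg 0 w) ∧
    gatherC.cost V Z s ≤ 6 + 6 * (nl (s.v .vv)).length := by
  intro s' l
  set v := s.v .vv with hvdef
  have hnV : n + 4 < V := by rw [hV]; nlinarith
  have hlt := hin.length_lt hv
  have hm1 : (v + 1) % V = v + 1 := Nat.mod_eq_of_lt (by omega)
  have hm2 : (v + 2) % V = v + 2 := Nat.mod_eq_of_lt (by omega)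
  set s1 := (((s.seta .X 0 0 v).setv .D 1).setv .lo (s.inp (v + 1))).setv .hi (s.inp (v + 2))
    with hs1
  have hlim : (Vr.hi - Vr.lo : Ex).eval V s1 = (nl v).length := by
    simp [hs1, hin.len v hv]
  obtain ⟨t, ht, k1, k2, k3, k4, k5, k6, k7⟩ := rep_rule (V := V) (Z := Z) (y := .u)
    (e := Vr.hi - Vr.lo) (s := s1) (p := .nb ≔ .inp (Vr.lo + Vr.u) ;;
    .ite (.rd1 .alive Vr.nb) (.st1 .X Vr.D Vr.nb ;; .D ≔ Vr.D + 1 ;;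
      .st1 .deg Vr.nb (.rd1 .deg Vr.nb - 1)) .skip)
    (fun m t s' => s'.v .lo = s.inp (v + 1) ∧ s'.inp = s.inp ∧ s'.arr .alive = s.arr .alive ∧
      s'.v .D = (((nl v).take m).filter fun w => s.arr .alive 0 w ≠ 0).length + 1 ∧
      s'.arr .X 0 0 = v ∧
      ((∀ (i : ℕ) (h : i < (((nl v).take m).filter fun w => s.arr .alive 0 w ≠ 0).length),
        s'.arr .X 0 (i + 1) = (((nl v).take m).filter fun w => s.arr .alive 0 w ≠ 0)[i]) ∧
      (∀ w, s'.arr .deg 0 w = if w ∈ ((nl v).take m).filter (fun w => s.arr .alive 0 w ≠ 0)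
        then s.arr .deg 0 w - 1 else s.arr .deg 0 w)) ∧ t ≤ m * 6)
    ⟨by simp [hs1], by simp [hs1], by funext i j; simp [hs1], by simp [hs1], by simp [hs1],
      ⟨by simp, by simp [hs1]⟩, by simp⟩ (by
    rintro m hm t s' ⟨h1, h2, h3, h4, h5, ⟨h6, h7⟩, h8⟩
    rw [hlim] at hm
    have hmod : (s.inp (v + 1) + m) % V = s.inp (v + 1) + m := by
      refine Nat.mod_eq_of_lt ?_
      have := hin.len v hv
      have := hin.lt (v + 2)
      omega
    have hnb := hin.get v hv m hm
    have hle : (((nl v).take m).filter fun w => s.arr .alive 0 w ≠ 0).length ≤ m :=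
      (List.length_filter_le _ _).trans (by simp)
    have hmodD : (s'.v .D + 1) % V = s'.v .D + 1 := Nat.mod_eq_of_lt (by omega)
    have hnot : (nl v)[m] ∉ (nl v).take m := by
      intro hmem
      have hnd := hin.nodup v hv
      rw [List.mem_take_iff_getElem] at hmem
      obtain ⟨i, hi, he⟩ := hmem
      have := hnd.getElem_inj_iff.1 he
      omega
    have htake : (nl v).take (m + 1) = (nl v).take m ++ [(nl v)[m]] := by
      rw [List.take_add_one, List.getElem?_eq_getElem hm]; rfl
    simp only [run_seq, run_set, eval_inp, eval_add, eval_var, setv_v, setv_inp, reduceCtorEq,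
      if_false, if_true, h1, h2, hmod, hnb, run_ite, eval_rd1, setv_arr, h3, cost_seq, cost_set,
      cost_ite]
    by_cases hal : s.arr .alive 0 (nl v)[m] = 0
    · rw [if_neg (by simp [hal]), if_neg (by simp [hal]), htake, List.filter_append]
      simp only [List.filter_cons, hal, ne_eq, not_true, decide_false, List.filter_nil]
      refine ⟨by simp [h1], by simp [h2], by simp [h3], by simpa using h4, by simpa using h5,
        ⟨by simpa using h6, by simpa using h7⟩, ?_⟩
      rw [cost_skip]
      omega
    · rw [if_pos (by simp [hal]), if_pos (by simp [hal]), htake, List.filter_append]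
      simp only [List.filter_cons, hal, ne_eq, not_false_eq_true, decide_true, List.filter_nil,
        if_true]
      refine ⟨by simp [h1], by simp [h2], ?_, ?_, ?_, ⟨?_, ?_⟩, ?_⟩
      · funext i j; simp [h3]
      · simpa [hmodD] using h4
      · simp [h5, h4]
      · intro i hi
        simp only [run_st1, seta_arr, setv_arr, eval_var, setv_v, if_true,
          reduceCtorEq, if_false, false_and, true_and, seta_v]
        rw [List.length_append, List.length_singleton] at hi
        rw [h4]
        by_cases hi' : i < (((nl v).take m).filter fun w => s.arr .alive 0 w ≠ 0).length
        · rw [if_neg (by simp only [ne_eq] at hi' ⊢; omega), h6 i hi']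
          exact (List.getElem_append_left hi').symm
        · have he : i = (((nl v).take m).filter fun w => s.arr .alive 0 w ≠ 0).length := by
            simp only [ne_eq] at hi' ⊢; omega
          subst he
          rw [if_pos rfl]
          simp
      · intro w
        simp only [run_st1, seta_arr, setv_arr, eval_var, setv_v, if_true,
          reduceCtorEq, if_false, false_and, true_and, seta_v, eval_sub, eval_rd1, eval_one]
        by_cases hw : w = (nl v)[m]
        · subst hw
          rw [if_pos rfl, if_pos (by simp), h7, if_neg]
          intro hmem
          exact hnot (List.mem_filter.1 hmem).1
        · rw [if_neg hw, h7]
          simp [hw]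
      · simp only [cost_st1]
        omega)
  rw [hlim, List.take_length] at k4 k6
  rw [hlim] at k7
  have hrun : s' = (Cmd.rep .u (Vr.hi - Vr.lo) (.nb ≔ .inp (Vr.lo + Vr.u) ;;
    .ite (.rd1 .alive Vr.nb) (.st1 .X Vr.D Vr.nb ;; .D ≔ Vr.D + 1 ;;
      .st1 .deg Vr.nb (.rd1 .deg Vr.nb - 1)) .skip)).run V Z s1 := by
    simp only [s', gatherC, run_seq, run_st1, run_set, eval_zero, eval_var, eval_inp, eval_add,
      eval_one, eval_two, seta_v, setv_v, reduceCtorEq, if_false, ← hvdef, hm1, hm2, setv_inp,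
      seta_inp, hs1]
  rw [← hrun] at k4 k5 k6
  refine ⟨k4, k5, k6.1, k6.2, ?_⟩
  have hc : gatherC.cost V Z s = 4 + (1 + t) := by
    rw [← ht]
    simp only [gatherC, cost_seq, run_st1, run_set, eval_zero, eval_var, eval_inp, eval_add,
      eval_one, eval_two, seta_v, setv_v, reduceCtorEq, if_false, ← hvdef, hm1, hm2, setv_inp,
      seta_inp, hs1, cost_set, cost_st1]
    omega
  omega

open Classical in
/-- The invariant of the search in the graph `Adj` on the numbers below `n`. Vertices are removed in
phases, and `κ v` is the number of phases that `v` has survived. Cliques of more than `bk` vertices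
consist of remaining vertices. -/
structure GInv (n : ℕ) (Adj : ℕ → ℕ → Prop) (nl : ℕ → List ℕ) (κ : ℕ → ℕ) (s : St) : Prop where
  input : Input n Adj nl s.inp
  AM : ∀ u < n, ∀ v < n, s.arr .AM u v ≠ 0 ↔ Adj u v
  Csymm : ∀ i j, s.arr .Cm i j ≠ 0 → s.arr .Cm j i ≠ 0
  best : Best n Adj (s.v .bk) (s.arr .B 0)
  pos : 1 ≤ s.v .bk
  deg : ∀ u < n, s.tst .alive u →
    s.arr .deg 0 u = ((Finset.range n).filter fun w => Adj u w ∧ s.tst .alive w).card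
  cover : EElim Adj → ∀ Q : Finset ℕ, Q ⊆ Finset.range n →
    (∀ x ∈ Q, ∀ y ∈ Q, x ≠ y → Adj x y) → Q.card ≤ s.v .bk ∨ ∀ u ∈ Q, s.tst .alive u
  le_deg : ∀ u < n, κ u ≤ (nl u).length
  le_card : ∀ u < n, κ u ≤ ((Finset.range n).filter fun w => Adj u w ∧ κ u ≤ κ w + 1).card

variable {V Z : ℕ} {n : ℕ} {Adj : ℕ → ℕ → Prop} {nl : ℕ → List ℕ}

theorem deleteC_run {κ : ℕ → ℕ} {s : St} (h : GInv n Adj nl κ s) (hV : V = (n + 4) ^ 2)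
    (hv : s.v .vv < n) (hal : s.tst .alive (s.v .vv)) {q : ℕ}
    (hq : q = 5 ∨ q = 4 ∧ VElim Adj) :
    let s' := deleteC.run V Z s
    GInv n Adj nl κ s' ∧
    (∀ w, s'.tst .alive w ↔ w ≠ s.v .vv ∧ s.tst .alive w) ∧
    deleteC.cost V Z s ≤ 7 + 6 * (nl (s.v .vv)).length +
      1000 * (s.arr .deg 0 (s.v .vv) + 2) ^ q := by
  classical
  intro s'
  set v := s.v .vv with hvdef
  set s1 := s.seta .alive 0 v 0 with hs1
  have hal1 : ∀ w, s1.tst .alive w ↔ w ≠ v ∧ s.tst .alive w := by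
    intro w
    simp only [St.tst, hs1, seta_arr]
    by_cases hw : w = v <;> simp [hw]
  have hin1 : Input n Adj nl s1.inp := h.input
  obtain ⟨g1, g2, g3, g4, g5⟩ := gatherC_run (V := V) (Z := Z) (s := s1) hin1 hV (by simpa [hs1])
  have hv1 : s1.v .vv = v := rfl
  rw [hv1] at g1 g2 g3 g4 g5
  set l := (nl v).filter fun w => s1.arr .alive 0 w ≠ 0 with hl
  set s2 := gatherC.run V Z s1 with hs2
  have hlmem : ∀ w, w ∈ l ↔ Adj v w ∧ s.tst .alive w := by
    intro w
    have h1 := hal1 w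
    simp only [St.tst] at h1 ⊢
    rw [hl, List.mem_filter, h.input.mem v hv, decide_eq_true_iff, h1]
    refine and_congr_right fun hvw => and_iff_right ?_
    rintro rfl
    exact h.input.irrefl _ hvw
  have hlnd : l.Nodup := (h.input.nodup v hv).filter _
  have hlen : l.length = s.arr .deg 0 v := by
    rw [h.deg v hv hal, ← List.toFinset_card_of_nodup hlnd]
    congr 1
    ext w
    rw [List.mem_toFinset, hlmem, Finset.mem_filter, Finset.mem_range]
    exact ⟨fun hw => ⟨h.input.adj_lt _ _ hw.1, hw⟩, fun hw => hw.2⟩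
  have hll : l.length < n := (List.length_filter_le _ _).trans_lt (h.input.length_lt hv)
  have ha2 : ∀ id, id ≠ .alive → id ≠ .X → id ≠ .deg → s2.arr id = s.arr id := by
    intro id i1 i2 i3
    refine (run_arr (by simp [gatherC, Cmd.wa, Cmd.st1, i2, i3]) _).trans ?_
    funext i j
    simp [hs1, i1]
  have hbk2 : s2.v .bk = s.v .bk := (run_v (by decide) _).trans rfl
  have hin2 : s2.inp = s.inp := (run_inp (by decide) _).trans rfl
  have halive2 : s2.arr .alive = s1.arr .alive := run_arr (by decide) _
  have hX : ∀ i < s2.v .D, (i = 0 ∧ s2.arr .X 0 i = v) ∨ ∃ hi : i - 1 < l.length, 0 < i ∧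
      s2.arr .X 0 i = l[i - 1] := by
    intro i hi
    rcases i with _ | i
    · exact .inl ⟨rfl, g2⟩
    · exact .inr ⟨by omega, by omega, g3 i (by omega)⟩
  have hXlt : ∀ i < s2.v .D, s2.arr .X 0 i < n := by
    intro i hi
    rcases hX i hi with ⟨-, e⟩ | ⟨hi', -, e⟩ <;> rw [e]
    · exact hv
    · exact h.input.adj_lt v _ ((hlmem _).1 (List.getElem_mem hi')).1
  have hvl : v ∉ l := fun hm => h.input.irrefl v ((hlmem v).1 hm).1
  have hloc := localC_run (V := V) (Z := Z) (n := n) (Adj := Adj) (s := s2) (by omega) (by omega) hV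
    h.input.symm hXlt (by
      intro i hi j hj hij
      rcases hX i hi with ⟨e1, e2⟩ | ⟨e1, e2, e3⟩ <;> rcases hX j hj with ⟨f1, f2⟩ | ⟨f1, f2, f3⟩
      · omega
      · exact (hvl (by rw [← e2, hij, f3]; exact List.getElem_mem _)).elim
      · exact (hvl (by rw [← f2, ← hij, e3]; exact List.getElem_mem _)).elim
      · rw [e3, f3] at hij
        have := hlnd.getElem_inj_iff.1 hij
        omega) (by rw [ha2 .AM (by decide) (by decide) (by decide)]; exact h.AM)
    (by rw [ha2 .Cm (by decide) (by decide) (by decide)]; exact h.Csymm)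
    (by rw [ha2 .B (by decide) (by decide) (by decide), hbk2]; exact h.best)
  obtain ⟨k1, k2, k3, k4, k5, k6⟩ := hloc
  have hs' : s' = localC.run V Z s2 := rfl
  rw [← hs'] at k1 k2 k3 k4
  have halive : ∀ w, s'.tst .alive w ↔ w ≠ v ∧ s.tst .alive w := by
    intro w
    rw [← hal1]
    simp only [St.tst]
    rw [hs', run_arr (by decide), halive2]
  have hc : deleteC.cost V Z s = 1 + (gatherC.cost V Z s1 + localC.cost V Z s2) := rfl
  clear_value s'
  refine ⟨?_, halive, ?_⟩
  · clear_value s2 s1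
    refine ⟨?_, ?_, k1, k2, ?_, ?_, ?_, h.le_deg, h.le_card⟩
    · rw [hs', run_inp (by decide), hin2]; exact h.input
    · rw [hs', run_arr (by decide), ha2 .AM (by decide) (by decide) (by decide)]; exact h.AM
    · rw [hbk2] at k3; exact h.pos.trans k3
    · intro u hu hau
      obtain ⟨huv, hau⟩ := (halive u).1 hau
      rw [hs', run_arr (by decide), g4, ← hs']
      have hd1 : s1.arr .deg 0 u = s.arr .deg 0 u := by simp [hs1]
      rw [hd1]
      have hfil : ((Finset.range n).filter fun w => Adj u w ∧ s'.tst .alive w) =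
          ((Finset.range n).filter fun w => Adj u w ∧ s.tst .alive w).erase v := by
        ext w
        simp only [Finset.mem_filter, Finset.mem_erase, halive w]
        exact ⟨fun ⟨a, b, c, d⟩ => ⟨c, a, b, d⟩, fun ⟨c, a, b, d⟩ => ⟨a, b, c, d⟩⟩
      rw [hfil, h.deg u hu hau]
      by_cases hul : u ∈ l
      · rw [if_pos hul, Finset.card_erase_of_mem]
        simp only [Finset.mem_filter, Finset.mem_range]
        exact ⟨hv, h.input.symm _ _ ((hlmem u).1 hul).1, hal⟩
      · rw [if_neg hul, Finset.erase_eq_of_notMem]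
        simp only [Finset.mem_filter]
        exact fun hm => hul ((hlmem u).2 ⟨h.input.symm _ _ hm.2.1, hau⟩)
    · intro hE Q hQn hQA
      rcases h.cover hE Q hQn hQA with hc | hc
      · left; rw [hbk2] at k3; exact hc.trans k3
      by_cases hvQ : v ∈ Q
      · left
        by_cases hQ2 : 2 ≤ Q.card
        · -- the clique consists of `v` and of remaining neighbors of `v`
          set Q' := (Finset.range (s2.v .D)).filter fun i => s2.arr .X 0 i ∈ Q with hQ'
          have himg : Q ⊆ Q'.image (s2.arr .X 0) := by
            intro w hw
            rw [Finset.mem_image]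
            by_cases hwv : w = v
            · exact ⟨0, Finset.mem_filter.2 ⟨Finset.mem_range.2 (by omega), by rwa [g2]⟩,
                by rw [g2, hwv]⟩
            · have hwl : w ∈ l := (hlmem w).2 ⟨hQA v hvQ w hw (Ne.symm hwv), hc w hw⟩
              obtain ⟨i, hi, rfl⟩ := List.mem_iff_getElem.1 hwl
              exact ⟨i + 1, Finset.mem_filter.2 ⟨Finset.mem_range.2 (by omega),
                by rwa [g3 i hi]⟩, g3 i hi⟩
          have hcard : Q.card ≤ Q'.card := (Finset.card_le_card himg).trans Finset.card_image_le
          have hcl := k4 hE Q' (Finset.filter_subset _ _)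
            (Finset.mem_filter.2 ⟨Finset.mem_range.2 (by omega), by rwa [g2]⟩) (by omega)
            (fun x hx y hy hxy => ?_)
          · omega
          · rw [hQ', Finset.mem_filter, Finset.mem_range] at hx hy
            refine hQA _ hx.2 _ hy.2 fun he => hxy ?_
            rcases hX x hx.1 with ⟨e1, e2⟩ | ⟨e1, e2, e3⟩ <;>
              rcases hX y hy.1 with ⟨f1, f2⟩ | ⟨f1, f2, f3⟩
            · omega
            · exact (hvl (by rw [← e2, he, f3]; exact List.getElem_mem _)).elim
            · exact (hvl (by rw [← f2, ← he, e3]; exact List.getElem_mem _)).elim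
            · rw [e3, f3] at he
              have := hlnd.getElem_inj_iff.1 he
              omega
        · have := h.pos
          omega
      · right
        intro u hu
        exact (halive u).2 ⟨fun e => hvQ (e ▸ hu), hc u hu⟩
  · have hD : s2.v .D + 1 = s.arr .deg 0 v + 2 := by omega
    rw [hD] at k5 k6
    rw [hc]
    rcases hq with rfl | ⟨rfl, hve⟩
    · omega
    · have := k6 hve
      omega

/-- Removes the vertex at position `t` of the list `AL` if its degree is at most `k`, and keeps it in
the list otherwise. -/
def scanC : Cmd :=
  .vv ≔ .rd1 .AL Vr.t ;;
  .ite (.rd1 .deg Vr.vv <ₑ Vr.k + 1) deleteC (.st1 .AL Vr.cnt Vr.vv ;; .cnt ≔ Vr.cnt + 1)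

/-- Phase `k`: goes through the list of the remaining vertices. -/
def phaseC : Cmd := .old ≔ Vr.cnt ;; .cnt ≔ 0 ;; .rep .t Vr.old scanC

/-- A scan of a list of length `old` in phase `k`, after `m` steps: the first `cnt` entries of the
list have been kept, and those from position `m` on are still to be scanned. -/
structure Scan (n : ℕ) (κ : ℕ → ℕ) (k m old : ℕ) (s : St) : Prop where
  cnt_le : s.v .cnt ≤ m
  kept : ∀ i < s.v .cnt, s.arr .AL 0 i < n ∧ s.tst .alive (s.arr .AL 0 i) ∧
    κ (s.arr .AL 0 i) = k + 1
  rest : ∀ i, m ≤ i → i < old → s.arr .AL 0 i < n ∧ s.tst .alive (s.arr .AL 0 i) ∧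
    κ (s.arr .AL 0 i) = k
  kept_inj : ∀ i < s.v .cnt, ∀ j < s.v .cnt, s.arr .AL 0 i = s.arr .AL 0 j → i = j
  rest_inj : ∀ i, m ≤ i → i < old → ∀ j, m ≤ j → j < old → s.arr .AL 0 i = s.arr .AL 0 j → i = j
  all : ∀ u < n, s.tst .alive u → (∃ i < s.v .cnt, s.arr .AL 0 i = u) ∨
    ∃ i, m ≤ i ∧ i < old ∧ s.arr .AL 0 i = u

/-- The first `cnt` entries of `AL` are the remaining vertices, and these are in phase `k`. -/
structure Listed (n : ℕ) (κ : ℕ → ℕ) (k : ℕ) (s : St) : Prop where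
  mem : ∀ i < s.v .cnt, s.arr .AL 0 i < n ∧ s.tst .alive (s.arr .AL 0 i) ∧ κ (s.arr .AL 0 i) = k
  inj : ∀ i < s.v .cnt, ∀ j < s.v .cnt, s.arr .AL 0 i = s.arr .AL 0 j → i = j
  all : ∀ u < n, s.tst .alive u → ∃ i < s.v .cnt, s.arr .AL 0 i = u

/-- A bound on the time that has been spent on each vertex. -/
def spent (n : ℕ) (nl : ℕ → List ℕ) (q : ℕ) (κ : ℕ → ℕ) (s : St) : ℕ :=
  ∑ v ∈ Finset.range n, (10 * κ v +
    if s.tst .alive v then 0 else 20 + 6 * (nl v).length + 1000 * (κ v + 2) ^ q)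

variable {V Z : ℕ} {n : ℕ} {Adj : ℕ → ℕ → Prop} {nl : ℕ → List ℕ} {κ : ℕ → ℕ}

open Classical in
theorem GInv.congr {s s' : St} (h : GInv n Adj nl κ s) (hinp : s'.inp = s.inp)
    (hbk : s'.v .bk = s.v .bk)
    (harr : ∀ id ∈ [Ar.AM, Ar.Cm, Ar.B, Ar.alive, Ar.deg], s'.arr id = s.arr id) :
    GInv n Adj nl κ s' := by
  have e1 := harr .AM (by decide)
  have e2 := harr .Cm (by decide)
  have e3 := harr .B (by decide)
  have e4 := harr .alive (by decide)
  have e5 := harr .deg (by decide)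
  have e4' : s'.tst .alive = s.tst .alive := by funext c; simp only [St.tst, e4]
  refine ⟨hinp ▸ h.input, e1 ▸ h.AM, e2 ▸ h.Csymm, ?_, hbk ▸ h.pos, ?_, ?_, h.le_deg, h.le_card⟩
  · rw [hbk, e3]; exact h.best
  · have hiff : ∀ w, s'.tst .alive w ↔ s.tst .alive w := fun w => by simp only [St.tst, e4]
    intro u hu hau
    rw [e5, h.deg u hu ((hiff u).1 hau)]
    exact congrArg Finset.card (Finset.filter_congr fun w _ => and_congr_right fun _ => (hiff w).symm)
  · rw [hbk, e4']; exact h.cover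

open Classical in
theorem GInv.card_le_length {s : St} (h : GInv n Adj nl κ s) {u : ℕ} (hu : u < n) (P : ℕ → Prop)
    [DecidablePred P] :
    ((Finset.range n).filter fun w => Adj u w ∧ P w).card ≤ (nl u).length := by
  refine (Finset.card_le_card fun w hw => ?_).trans (List.toFinset_card_le (nl u))
  rw [List.mem_toFinset, h.input.mem u hu]
  exact (Finset.mem_filter.1 hw).2.1

open Classical in
/-- A vertex with more than `k` remaining neighbors may enter the next phase. -/
theorem GInv.update {s : St} (h : GInv n Adj nl κ s) {u k : ℕ} (hu : u < n)
    (hal : s.tst .alive u) (hκ : κ u = k) (hdeg : k < s.arr .deg 0 u)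
    (hk : ∀ w < n, s.tst .alive w → k ≤ κ w) :
    GInv n Adj nl (fun w => if w = u then k + 1 else κ w) s := by
  have hle : ∀ w, κ w ≤ (fun w => if w = u then k + 1 else κ w) w := by
    intro w
    dsimp only
    split_ifs with hw
    · subst hw; omega
    · exact le_rfl
  rw [h.deg u hu hal] at hdeg
  refine { h with le_deg := fun w hw => ?_, le_card := fun w hw => ?_ }
  · split_ifs with hwu
    · subst hwu
      exact le_trans hdeg (h.card_le_length hw _)
    · exact h.le_deg w hw
  · by_cases hwu : w = u
    · subst hwu
      rw [if_pos rfl]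
      refine le_trans hdeg (Finset.card_le_card fun x hx => ?_)
      rw [Finset.mem_filter, Finset.mem_range] at hx ⊢
      have h1 := hk x hx.1 hx.2.2
      have h2 := hle x
      dsimp only at h2
      exact ⟨hx.1, hx.2.1, by omega⟩
    · rw [if_neg hwu]
      refine le_trans (h.le_card w hw) (Finset.card_le_card fun x hx => ?_)
      rw [Finset.mem_filter] at hx ⊢
      have h2 := hle x
      dsimp only at h2
      exact ⟨hx.1, hx.2.1, by omega⟩

/-- The time of a step is paid for by the vertex that is removed or that reaches the next level. -/
theorem scanC_run {s : St} {k m old q : ℕ} (h : GInv n Adj nl κ s) (hs : Scan n κ k m old s)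
    (hV : V = (n + 4) ^ 2) (hm : m < old) (ht : s.v .t = m) (hk : s.v .k = k) (hkn : k < n)
    (hold : old ≤ n) (hq : q = 5 ∨ q = 4 ∧ VElim Adj) :
    ∃ κ', GInv n Adj nl κ' (scanC.run V Z s) ∧ Scan n κ' k (m + 1) old (scanC.run V Z s) ∧
      1 + scanC.cost V Z s + spent n nl q κ s ≤ spent n nl q κ' (scanC.run V Z s) := by
  classical
  obtain ⟨hvn, hval, hvκ⟩ := hs.rest m le_rfl hm
  set v := s.arr .AL 0 m with hv
  have hnV : n + 4 < V := by rw [hV]; nlinarith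
  have hmod : (k + 1) % V = k + 1 := Nat.mod_eq_of_lt (by omega)
  set s1 := s.setv .vv v with hs1
  have h1 : GInv n Adj nl κ s1 := h.congr rfl (by simp [hs1]) (fun _ _ => rfl)
  have hrun : scanC.run V Z s = if s.arr .deg 0 v < k + 1 then deleteC.run V Z s1 else
      (s1.seta .AL 0 (s.v .cnt) v).setv .cnt (s.v .cnt + 1) := by
    have hc : (s.v .cnt + 1) % V = s.v .cnt + 1 := Nat.mod_eq_of_lt (by have := hs.cnt_le; omega)
    simp only [scanC, run_seq, run_set, eval_rd1, eval_var, ht, ← hv, ← hs1, run_ite, eval_lt,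
      eval_add, eval_one, run_st1]
    have e1 : s1.v .vv = v := by simp [hs1]
    have e2 : s1.v .k = k := by simp [hs1, hk]
    have e3 : s1.v .cnt = s.v .cnt := by simp [hs1]
    have e4 : s1.arr = s.arr := rfl
    simp only [e1, e2, e3, e4, hmod, hc, seta_v]
    by_cases hlt : s.arr .deg 0 v < k + 1 <;> simp only [hlt, if_true, if_false, ne_eq, one_ne_zero,
      not_false_eq_true, not_true]
  have hcost : scanC.cost V Z s = 2 + if s.arr .deg 0 v < k + 1 then deleteC.cost V Z s1 else 2 := by
    simp only [scanC, cost_seq, cost_set, run_set, eval_rd1, eval_var, ht, ← hv, ← hs1, cost_ite,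
      eval_lt, eval_add, eval_one, cost_st1]
    have e1 : s1.v .vv = v := by simp [hs1]
    have e2 : s1.v .k = k := by simp [hs1, hk]
    have e4 : s1.arr = s.arr := rfl
    simp only [e1, e2, e4, hmod]
    by_cases hlt : s.arr .deg 0 v < k + 1 <;> simp only [hlt, if_true, if_false, ne_eq, one_ne_zero,
      not_false_eq_true, not_true]
    · omega
  by_cases hlt : s.arr .deg 0 v < k + 1
  · rw [if_pos hlt] at hrun hcost
    have e1 : s1.v .vv = v := by simp [hs1]
    obtain ⟨g1, g2, g3⟩ := deleteC_run (V := V) (Z := Z) h1 hV (by rw [e1]; exact hvn)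
      (by rw [e1]; exact hval) hq
    rw [e1] at g2 g3
    rw [hrun, hcost]
    have hcnt : (deleteC.run V Z s1).v .cnt = s.v .cnt := (run_v (by decide) _).trans (by simp [hs1])
    have hAL : (deleteC.run V Z s1).arr .AL = s.arr .AL := run_arr (by decide) _
    generalize deleteC.run V Z s1 = s' at *
    refine ⟨κ, g1, ⟨?_, ?_, ?_, ?_, ?_, ?_⟩, ?_⟩
    · rw [hcnt]; have := hs.cnt_le; omega
    · rw [hcnt, hAL]
      intro i hi
      obtain ⟨a, b, c⟩ := hs.kept i hi
      exact ⟨a, (g2 _).2 ⟨fun e => by rw [e] at c; omega, b⟩, c⟩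
    · rw [hAL]
      intro i hi hi'
      obtain ⟨a, b, c⟩ := hs.rest i (by omega) hi'
      refine ⟨a, (g2 _).2 ⟨fun e => ?_, b⟩, c⟩
      have := hs.rest_inj i (by omega) hi' m le_rfl hm e
      omega
    · rw [hcnt, hAL]; exact hs.kept_inj
    · rw [hAL]
      exact fun i hi hi' j hj hj' => hs.rest_inj i (by omega) hi' j (by omega) hj'
    · rw [hcnt, hAL]
      intro u hu hau
      obtain ⟨huv, hau⟩ := (g2 u).1 hau
      rcases hs.all u hu hau with h | ⟨i, hi, hi', e⟩
      · exact .inl h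
      · refine .inr ⟨i, ?_, hi', e⟩
        have : i ≠ m := by rintro rfl; exact huv e.symm
        omega
    · have hmem := Finset.mem_range.2 hvn
      have hpw : (s.arr .deg 0 v + 2) ^ q ≤ (k + 2) ^ q := Nat.pow_le_pow_left (by omega) q
      have hdeg1 : s1.arr .deg 0 v = s.arr .deg 0 v := rfl
      rw [hdeg1] at g3
      unfold spent
      rw [← Finset.add_sum_erase _ _ hmem, ← Finset.add_sum_erase (Finset.range n)
        (fun v => 10 * κ v + if s'.tst .alive v then 0 else
          20 + 6 * (nl v).length + 1000 * (κ v + 2) ^ q) hmem, if_pos hval,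
        if_neg (fun hn => ((g2 v).1 hn).1 rfl), hvκ]
      have : ∀ x ∈ (Finset.range n).erase v, (10 * κ x + if s'.tst .alive x then 0 else
          20 + 6 * (nl x).length + 1000 * (κ x + 2) ^ q) = (10 * κ x + if s.tst .alive x then 0 else
          20 + 6 * (nl x).length + 1000 * (κ x + 2) ^ q) := by
        intro x hx
        have hiff : s'.tst .alive x ↔ s.tst .alive x :=
          (g2 x).trans (and_iff_right (Finset.ne_of_mem_erase hx))
        simp only [hiff]
      rw [Finset.sum_congr rfl this]
      omega
  · rw [if_neg hlt] at hrun hcost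
    set s' := (s1.seta .AL 0 (s.v .cnt) v).setv .cnt (s.v .cnt + 1) with hs'
    have hcnt : s'.v .cnt = s.v .cnt + 1 := by simp [hs']
    have hAL : ∀ i, s'.arr .AL 0 i = if i = s.v .cnt then v else s.arr .AL 0 i := by
      intro i; simp [hs', hs1]
    have halive : s'.arr .alive = s.arr .alive := by funext i j; simp [hs', hs1]
    have halive' : s'.tst .alive = s.tst .alive := by funext c; simp only [St.tst, halive]
    have hcm := hs.cnt_le
    have hkeep : ∀ i < s.v .cnt, s.arr .AL 0 i ≠ v := by
      intro i hi e
      have := (hs.kept i hi).2.2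
      rw [e] at this
      omega
    rw [hrun, hcost]
    refine ⟨fun w => if w = v then k + 1 else κ w, ?_, ⟨?_, ?_, ?_, ?_, ?_, ?_⟩, ?_⟩
    · refine (h.update hvn hval hvκ (by omega) fun w hw haw => ?_).congr rfl (by simp [hs', hs1])
        (fun id hid => ?_)
      · rcases hs.all w hw haw with ⟨i, hi, rfl⟩ | ⟨i, hi, hi', rfl⟩
        · rw [(hs.kept i hi).2.2]; omega
        · rw [(hs.rest i hi hi').2.2]
      · funext i j
        have : id ≠ .AL := by rintro rfl; simp at hid
        simp [hs', hs1, this]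
    · omega
    · intro i hi
      rw [hAL, halive']
      by_cases h1 : i = s.v .cnt
      · simp only [h1, if_true]
        exact ⟨hvn, hval, trivial⟩
      · simp only [h1, if_false, hkeep i (by omega)]
        exact hs.kept i (by omega)
    · intro i hi hi'
      have hne : i ≠ s.v .cnt := by omega
      rw [hAL, halive', if_neg hne, if_neg]
      · exact hs.rest i (by omega) hi'
      · intro e
        have := hs.rest_inj i (by omega) hi' m le_rfl hm e
        omega
    · intro i hi j hj
      rw [hAL, hAL]
      split_ifs with h1 h2 h2
      · omega
      · exact fun e => absurd e.symm (hkeep j (by omega))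
      · exact fun e => absurd e (hkeep i (by omega))
      · exact hs.kept_inj i (by omega) j (by omega)
    · intro i hi hi' j hj hj'
      rw [hAL, hAL, if_neg (by omega), if_neg (by omega)]
      exact hs.rest_inj i (by omega) hi' j (by omega) hj'
    · intro u hu hau
      rw [halive'] at hau
      rcases hs.all u hu hau with ⟨i, hi, e⟩ | ⟨i, hi, hi', e⟩
      · exact .inl ⟨i, by omega, by rw [hAL, if_neg (by omega), e]⟩
      · by_cases him : i = m
        · exact .inl ⟨s.v .cnt, by omega, by rw [hAL, if_pos rfl, ← e, him]⟩
        · exact .inr ⟨i, by omega, hi', by rw [hAL, if_neg (by omega), e]⟩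
    · have hmem := Finset.mem_range.2 hvn
      have hiff : ∀ w, s'.tst .alive w ↔ s.tst .alive w := fun w => by simp only [St.tst, halive]
      unfold spent
      simp only [hiff]
      rw [← Finset.add_sum_erase _ _ hmem, ← Finset.add_sum_erase (Finset.range n)
        (fun v_1 => 10 * (if v_1 = v then k + 1 else κ v_1) + if s.tst .alive v_1 then 0 else
          20 + 6 * (nl v_1).length + 1000 * ((if v_1 = v then k + 1 else κ v_1) + 2) ^ q) hmem,
        if_pos hval, if_pos hval, hvκ, if_pos rfl]
      have : ∀ x ∈ (Finset.range n).erase v, (10 * (if x = v then k + 1 else κ x) +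
          if s.tst .alive x then 0 else
          20 + 6 * (nl x).length + 1000 * ((if x = v then k + 1 else κ x) + 2) ^ q) =
          (10 * κ x + if s.tst .alive x then 0 else
          20 + 6 * (nl x).length + 1000 * (κ x + 2) ^ q) := by
        intro x hx
        rw [if_neg (Finset.ne_of_mem_erase hx)]
      rw [Finset.sum_congr rfl this]
      omega

theorem phaseC_run {s : St} {k q : ℕ} (h : GInv n Adj nl κ s) (hs : Listed n κ k s)
    (hV : V = (n + 4) ^ 2) (hk : s.v .k = k) (hkn : k < n) (hcnt : s.v .cnt ≤ n)
    (hq : q = 5 ∨ q = 4 ∧ VElim Adj) :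
    ∃ κ', GInv n Adj nl κ' (phaseC.run V Z s) ∧ Listed n κ' (k + 1) (phaseC.run V Z s) ∧
      (phaseC.run V Z s).v .cnt ≤ n ∧
      phaseC.cost V Z s + spent n nl q κ s ≤ spent n nl q κ' (phaseC.run V Z s) + 3 := by
  set s1 := (s.setv .old (s.v .cnt)).setv .cnt 0 with hs1
  have hold : s1.v .old = s.v .cnt := by simp [hs1]
  obtain ⟨t, ht, κ', k1, k2, k3, k4⟩ := rep_rule (V := V) (Z := Z) (y := .t) (e := Vr.old)
    (s := s1) (p := scanC)
    (fun m t s' => ∃ κ', GInv n Adj nl κ' s' ∧ Scan n κ' k m (s.v .cnt) s' ∧ s'.v .k = k ∧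
      t + spent n nl q κ s ≤ spent n nl q κ' s')
    ⟨κ, h.congr rfl (by simp [hs1]) (fun _ _ => rfl), by
      refine ⟨by simp [hs1], by simp [hs1], fun i _ hi => hs.mem i hi, by simp [hs1],
        fun i _ hi j _ hj => hs.inj i hi j hj, fun u hu hau => .inr ?_⟩
      obtain ⟨i, hi, e⟩ := hs.all u hu hau
      exact ⟨i, by omega, hi, e⟩, by simp [hs1, hk], by rw [zero_add]; exact le_rfl⟩ (by
    rintro m hm t s' ⟨κ', h1, h2, h3, h4⟩
    rw [eval_var, hold] at hm
    have e0 : spent n nl q κ' (s'.setv .t m) = spent n nl q κ' s' := rfl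
    obtain ⟨κ'', g1, g2, g3⟩ := scanC_run (V := V) (Z := Z) (s := s'.setv .t m) (m := m) (q := q)
      (h1.congr rfl (by simp) (fun _ _ => rfl))
      ⟨by simpa using h2.cnt_le, by simpa using h2.kept, h2.rest, by simpa using h2.kept_inj,
        h2.rest_inj, by simpa using h2.all⟩
      hV hm (by simp) (by simp [h3]) hkn hcnt hq
    refine ⟨κ'', g1, g2, (run_v (by decide) _).trans (by simp [h3]), ?_⟩
    omega)
  have hrun : phaseC.run V Z s = (Cmd.rep .t Vr.old scanC).run V Z s1 := rfl
  have hc : phaseC.cost V Z s = 1 + (1 + (1 + t)) := by rw [← ht]; rfl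
  rw [← hrun] at k1 k2 k4
  rw [eval_var, hold] at k2
  refine ⟨κ', k1, ⟨k2.kept, k2.kept_inj, fun u hu hau => ?_⟩, k2.cnt_le.trans hcnt, by omega⟩
  rcases k2.all u hu hau with h | ⟨i, hi, hi', -⟩
  exacts [h, by omega]

/-! ### The program -/

/-- Reads the graph. -/
def buildC : Cmd :=
  .rep .u Vr.n (.lo ≔ .inp (Vr.u + 1) ;; .hi ≔ .inp (Vr.u + 2) ;; .st1 .deg Vr.u (Vr.hi - Vr.lo) ;;
    .st1 .AL Vr.u Vr.u ;; .st1 .alive Vr.u 1 ;;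
    .rep .t (Vr.hi - Vr.lo) (.st .AM Vr.u (.inp (Vr.lo + Vr.t)) 1))

/-- The search for a maximum clique in a graph with at least one edge. -/
def searchC : Cmd := buildC ;; .cnt ≔ Vr.n ;; .rep .k Vr.n phaseC

/-- Computes a maximum clique. A graph without edges is recognized from the addresses in the input,
in constant time. -/
def mainC : Cmd :=
  .n ≔ .inp 0 ;; .z ≔ .inp (Vr.n + 1) ;; .bk ≔ (0 <ₑ Vr.n) ;;
  .ite (Vr.n + 2 <ₑ Vr.z) searchC .skip ;; .rep .t Vr.bk (.out Vr.t (.rd1 .B Vr.t))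

variable {V Z : ℕ} {n : ℕ} {Adj : ℕ → ℕ → Prop} {nl : ℕ → List ℕ}

theorem buildC_run {s : St} (hin : Input n Adj nl s.inp) (hV : V = (n + 4) ^ 2) (hn : s.v .n = n)
    (harr : ∀ id i j, s.arr id i j = 0) :
    let s' := buildC.run V Z s
    (∀ u < n, s'.arr .deg 0 u = (nl u).length ∧ s'.arr .AL 0 u = u ∧ s'.tst .alive u) ∧
    (∀ u < n, ∀ v, s'.arr .AM u v ≠ 0 ↔ Adj u v) ∧
    buildC.cost V Z s ≤ 1 + ∑ u ∈ Finset.range n, (7 + 2 * (nl u).length) := by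
  intro s'
  have hnV : n + 4 < V := by rw [hV]; nlinarith
  obtain ⟨t, ht, k1, k2, k3, k4, k5⟩ := rep_rule (V := V) (Z := Z) (y := .u)
    (e := Vr.n) (s := s) (p := .lo ≔ .inp (Vr.u + 1) ;; .hi ≔ .inp (Vr.u + 2) ;;
      .st1 .deg Vr.u (Vr.hi - Vr.lo) ;; .st1 .AL Vr.u Vr.u ;; .st1 .alive Vr.u 1 ;;
      .rep .t (Vr.hi - Vr.lo) (.st .AM Vr.u (.inp (Vr.lo + Vr.t)) 1))
    (fun m t s' => s'.inp = s.inp ∧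
      (∀ u < m, s'.arr .deg 0 u = (nl u).length ∧ s'.arr .AL 0 u = u ∧ s'.tst .alive u) ∧
      (∀ u v, s'.arr .AM u v ≠ 0 ↔ u < m ∧ v ∈ nl u) ∧ s'.v .n = n ∧
      t ≤ ∑ u ∈ Finset.range m, (7 + 2 * (nl u).length))
    ⟨rfl, by simp, by simp [harr], hn, by simp⟩ (by
    rintro m hm t s' ⟨h1, h2, h3, h4, h5⟩
    rw [eval_var, hn] at hm
    have hm1 : (m + 1) % V = m + 1 := Nat.mod_eq_of_lt (by omega)
    have hm2 : (m + 2) % V = m + 2 := Nat.mod_eq_of_lt (by omega)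
    have hlen := hin.len m hm
    have hlenV : s.inp (m + 1) + (nl m).length < V := by rw [← hlen, hV]; exact hin.lt _
    set s1 := ((((((s'.setv .u m).setv .lo (s.inp (m + 1))).setv .hi (s.inp (m + 2))).seta .deg 0 m
      (nl m).length).seta .AL 0 m m).seta .alive 0 m 1) with hs1
    have hlim : (Vr.hi - Vr.lo : Ex).eval V s1 = (nl m).length := by
      simp [hs1, hlen]
    obtain ⟨t', ht', k1, k2, k3, k4, k5, k6, k7⟩ := rep_rule (V := V) (Z := Z) (y := .t)
      (e := Vr.hi - Vr.lo) (s := s1) (p := .st .AM Vr.u (.inp (Vr.lo + Vr.t)) 1)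
      (fun l t s'' => s''.inp = s.inp ∧ s''.v .lo = s.inp (m + 1) ∧ s''.v .u = m ∧ s''.v .n = n ∧
        (∀ id, id ≠ .AM → s''.arr id = s1.arr id) ∧
        (∀ u v, s''.arr .AM u v ≠ 0 ↔ (u < m ∧ v ∈ nl u) ∨ (u = m ∧ v ∈ (nl m).take l)) ∧ t ≤ l * 2)
      ⟨by simp [hs1, h1], by simp [hs1], by simp [hs1], by simp [hs1, h4], by simp, by
        intro u v; simpa [hs1] using h3 u v, by simp⟩ (by
      rintro l hl t s'' ⟨g1, g2, g3, g4, g5, g6, g7⟩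
      rw [hlim] at hl
      have hmod : (s.inp (m + 1) + l) % V = s.inp (m + 1) + l := Nat.mod_eq_of_lt (by omega)
      have hget := hin.get m hm l hl
      have htake : (nl m).take (l + 1) = (nl m).take l ++ [(nl m)[l]] := by
        rw [List.take_add_one, List.getElem?_eq_getElem hl]; rfl
      have hrun : (Cmd.st .AM Vr.u (.inp (Vr.lo + Vr.t)) 1).run V Z (s''.setv .t l) =
          (s''.setv .t l).seta .AM m (nl m)[l] 1 := by
        simp [g1, g2, g3, hmod, hget]
      rw [hrun]
      refine ⟨by simp [g1], by simp [g2], by simp [g3], by simp [g4], fun id hid => ?_,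
        fun u v => ?_, ?_⟩
      · funext i j
        simp [hid, g5 id hid]
      · rw [htake, seta_arr, setv_arr]
        by_cases huv : u = m ∧ v = (nl m)[l]
        · rw [if_pos ⟨rfl, huv⟩]
          exact iff_of_true one_ne_zero (.inr ⟨huv.1, by
            rw [huv.2]; exact List.mem_append_right _ (List.mem_singleton_self _)⟩)
        · rw [if_neg (fun h => huv h.2), g6]
          simp only [List.mem_append, List.mem_singleton]
          tauto
      · rw [cost_st]; omega)
    rw [hlim] at k6 k7
    rw [List.take_length] at k6
    have hrun : (Cmd.set .lo (.inp (Vr.u + 1)) ;; .hi ≔ .inp (Vr.u + 2) ;;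
      .st1 .deg Vr.u (Vr.hi - Vr.lo) ;; .st1 .AL Vr.u Vr.u ;; .st1 .alive Vr.u 1 ;;
      .rep .t (Vr.hi - Vr.lo) (.st .AM Vr.u (.inp (Vr.lo + Vr.t)) 1)).run V Z (s'.setv .u m) =
      (Cmd.rep .t (Vr.hi - Vr.lo) (.st .AM Vr.u (.inp (Vr.lo + Vr.t)) 1)).run V Z s1 := by
      simp only [run_seq, run_set, run_st1, eval_inp, eval_add, eval_var, setv_v, if_true, eval_one,
        eval_two, setv_inp, h1, hm1, hm2, reduceCtorEq, if_false, eval_sub, seta_v, hs1, hlen,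
        Nat.add_sub_cancel_left]
    have hcost : (Cmd.set .lo (.inp (Vr.u + 1)) ;; .hi ≔ .inp (Vr.u + 2) ;;
      .st1 .deg Vr.u (Vr.hi - Vr.lo) ;; .st1 .AL Vr.u Vr.u ;; .st1 .alive Vr.u 1 ;;
      .rep .t (Vr.hi - Vr.lo) (.st .AM Vr.u (.inp (Vr.lo + Vr.t)) 1)).cost V Z (s'.setv .u m) =
      5 + (Cmd.rep .t (Vr.hi - Vr.lo) (.st .AM Vr.u (.inp (Vr.lo + Vr.t)) 1)).cost V Z s1 := by
      simp only [cost_seq, cost_set, cost_st1, run_set, run_st1, eval_inp, eval_add, eval_var, setv_v,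
        if_true, eval_one, eval_two, setv_inp, h1, hm1, hm2, reduceCtorEq, if_false, eval_sub, seta_v,
        hs1, hlen, Nat.add_sub_cancel_left]
      omega
    rw [hrun, hcost, ht']
    refine ⟨k1, fun u hu => ?_, fun u v => ?_, k4, ?_⟩
    · simp only [St.tst]
      rw [k5 _ (by decide), k5 _ (by decide), k5 _ (by decide)]
      by_cases hum : u = m
      · subst hum
        simp [hs1]
      · have := h2 u (by omega)
        simpa [hs1, hum, St.tst] using this
    · rw [k6]
      constructor
      · rintro (⟨a, b⟩ | ⟨rfl, b⟩)
        exacts [⟨by omega, b⟩, ⟨by omega, b⟩]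
      · rintro ⟨a, b⟩
        rcases Nat.lt_succ_iff_lt_or_eq.1 a with a | rfl
        exacts [.inl ⟨a, b⟩, .inr ⟨rfl, b⟩]
    · rw [Finset.sum_range_succ]
      omega)
  rw [eval_var, hn] at k2 k3 k5
  refine ⟨k2, fun u hu v => ?_, ?_⟩
  · rw [← hin.mem u hu]
    exact (k3 u v).trans (and_iff_right hu)
  · rw [buildC, ht]
    omega

theorem Best.le {bk : ℕ} {B : ℕ → ℕ} (h : Best n Adj bk B) (hirr : ∀ u, ¬ Adj u u) : bk ≤ n := by
  have : (Finset.range bk).card ≤ (Finset.range n).card := by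
    refine Finset.card_le_card_of_injOn B (fun x hx => ?_) fun x hx y hy hxy => ?_
    · simpa using h.lt x (by simpa using hx)
    · by_contra hne
      have := h.adj x (by simpa using hx) y (by simpa using hy) hne
      rw [hxy] at this
      exact hirr _ this
  simpa using this

open Classical in
/-- `κ u` is at most the number of neighbors of `u` that are at most one level below `u`, if `κ` gives
the levels of the vertices. -/
structure Levels (n : ℕ) (Adj : ℕ → ℕ → Prop) (κ : ℕ → ℕ) : Prop where
  le_card : ∀ u < n, κ u ≤ ((Finset.range n).filter fun w => Adj u w ∧ κ u ≤ κ w + 1).card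

theorem searchC_run {s : St} (hin : Input n Adj nl s.inp) (hV : V = (n + 4) ^ 2) (hn : s.v .n = n)
    (harr : ∀ id i j, s.arr id i j = 0) (hbk : s.v .bk = 1) (hn0 : 0 < n) {q : ℕ}
    (hq : q = 5 ∨ q = 4 ∧ VElim Adj) :
    Best n Adj ((searchC.run V Z s).v .bk) ((searchC.run V Z s).arr .B 0) ∧
    (EElim Adj → ∀ Q : Finset ℕ, Q ⊆ Finset.range n → (∀ x ∈ Q, ∀ y ∈ Q, x ≠ y → Adj x y) →
      Q.card ≤ (searchC.run V Z s).v .bk) ∧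
    ∃ κ, Levels n Adj κ ∧ searchC.cost V Z s ≤ 3 + ∑ u ∈ Finset.range n,
      (31 + 8 * (nl u).length + 10 * κ u + 1000 * (κ u + 2) ^ q) := by
  classical
  obtain ⟨g1, g2, g3⟩ := buildC_run (V := V) (Z := Z) hin hV hn harr
  set s1 := buildC.run V Z s with hs1
  have hn1 : s1.v .n = n := (run_v (by decide) _).trans hn
  have hbk1 : s1.v .bk = 1 := (run_v (by decide) _).trans hbk
  have hin1 : s1.inp = s.inp := run_inp (by decide) _
  have hCm1 : ∀ i j, s1.arr .Cm i j = 0 := fun i j => by rw [hs1, run_arr (by decide), harr]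
  have hB1 : ∀ i j, s1.arr .B i j = 0 := fun i j => by rw [hs1, run_arr (by decide), harr]
  set s2 := s1.setv .cnt n with hs2
  have hG : GInv n Adj nl (fun _ => 0) s2 := by
    refine ⟨by simp only [hs2, setv_inp, hin1]; exact hin, fun u hu v _ => g2 u hu v,
      fun i j h => absurd (hCm1 i j) h, ?_, by simp [hs2, hbk1], fun u hu _ => ?_,
      fun _ Q hQ _ => .inr fun u hu => ?_, by simp, by simp⟩
    · have e : s2.v .bk = 1 := by simp [hs2, hbk1]
      rw [e]
      refine ⟨fun x _ => ?_, fun x hx y hy hxy => by omega⟩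
      have : s2.arr .B 0 x = 0 := hB1 0 x
      omega
    · rw [show s2.arr .deg 0 u = (nl u).length from (g1 u hu).1,
        ← List.toFinset_card_of_nodup (hin.nodup u hu)]
      congr 1
      ext w
      rw [List.mem_toFinset, hin.mem u hu, Finset.mem_filter, Finset.mem_range]
      exact ⟨fun h => ⟨hin.adj_lt _ _ h, h, (g1 w (hin.adj_lt _ _ h)).2.2⟩, fun h => h.2.1⟩
    · exact (g1 u (Finset.mem_range.1 (hQ hu))).2.2
  have hL : Listed n (fun _ => 0) 0 s2 := by
    have e : s2.v .cnt = n := by simp [hs2]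
    have e' : ∀ u < n, s2.arr .AL 0 u = u := fun u hu => (g1 u hu).2.1
    refine ⟨fun i hi => ?_, fun i hi j hj hij => ?_, fun u hu _ => ⟨u, by omega, e' u hu⟩⟩
    · rw [e] at hi
      rw [e' i hi]
      exact ⟨hi, (g1 i hi).2.2, rfl⟩
    · rw [e] at hi hj
      rwa [e' i hi, e' j hj] at hij
  have hsp : spent n nl q (fun _ => 0) s2 = 0 :=
    Finset.sum_eq_zero fun u hu => by
      have : s2.tst .alive u := (g1 u (Finset.mem_range.1 hu)).2.2
      rw [if_pos this]; rfl
  have hlim : (Ex.var .n).eval V s2 = n := by simp [hs2, hn1]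
  obtain ⟨t, ht, κ, k1, k2, -, k3⟩ := rep_rule (V := V) (Z := Z) (y := .k) (e := Vr.n) (s := s2)
    (p := phaseC) (fun m t s' => ∃ κ, GInv n Adj nl κ s' ∧ Listed n κ m s' ∧ s'.v .cnt ≤ n ∧
      t ≤ spent n nl q κ s' + 4 * m)
    ⟨_, hG, hL, by simp [hs2], by simp⟩ (by
    rintro m hm t s' ⟨κ, h1, h2, h3, h4⟩
    rw [hlim] at hm
    have e0 : spent n nl q κ (s'.setv .k m) = spent n nl q κ s' := rfl
    obtain ⟨κ', f1, f2, f3, f4⟩ := phaseC_run (V := V) (Z := Z) (s := s'.setv .k m) (q := q)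
      (h1.congr rfl (by simp) (fun _ _ => rfl))
      ⟨by simpa using h2.mem, by simpa using h2.inj, by simpa using h2.all⟩ hV (by simp) hm
      (by simpa using h3) hq
    exact ⟨κ', f1, f2, f3, by omega⟩)
  rw [hlim] at k2 k3
  have hrun : searchC.run V Z s = (Cmd.rep .k Vr.n phaseC).run V Z s2 := by
    simp only [searchC, run_seq, run_set, eval_var, ← hs1, hn1, ← hs2]
  have hcost : searchC.cost V Z s = buildC.cost V Z s + (1 + (1 + t)) := by
    rw [← ht]
    simp only [searchC, cost_seq, cost_set, run_set, eval_var, ← hs1, hn1, ← hs2]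
  rw [← hrun] at k1 k2 k3
  generalize searchC.run V Z s = s' at *
  -- a vertex that survives all phases would have too large a degree
  have hdead : ∀ u < n, ¬ s'.tst .alive u := by
    intro u hu hau
    obtain ⟨i, hi, e⟩ := k2.all u hu hau
    have h1 := (k2.mem i hi).2.2
    rw [e] at h1
    have h2 := k1.le_deg u hu
    have h3 := hin.length_lt hu
    omega
  refine ⟨k1.best, fun hE Q hQ hQA => ?_, κ, ⟨k1.le_card⟩, ?_⟩
  · rcases k1.cover hE Q hQ hQA with h | h
    · exact h
    · rcases Q.eq_empty_or_nonempty with rfl | ⟨u, hu⟩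
      · simp
      · exact absurd (h u hu) (hdead u (Finset.mem_range.1 (hQ hu)))
  · have e1 : spent n nl q κ s' = ∑ u ∈ Finset.range n,
        (10 * κ u + (20 + 6 * (nl u).length + 1000 * (κ u + 2) ^ q)) :=
      Finset.sum_congr rfl fun u hu => by rw [if_neg (hdead u (Finset.mem_range.1 hu))]
    rw [e1] at k3
    have e2 : ∑ u ∈ Finset.range n, (31 + 8 * (nl u).length + 10 * κ u + 1000 * (κ u + 2) ^ q) =
        ∑ u ∈ Finset.range n, (7 + 2 * (nl u).length) + (∑ u ∈ Finset.range n,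
        (10 * κ u + (20 + 6 * (nl u).length + 1000 * (κ u + 2) ^ q)) + 4 * n) := by
      rw [show 4 * n = ∑ u ∈ Finset.range n, 4 by simp [mul_comm], ← Finset.sum_add_distrib,
        ← Finset.sum_add_distrib]
      refine Finset.sum_congr rfl fun u _ => by ring
    rw [hcost, e2]
    omega

/-- The output of `mainC` is a maximum clique if every subgraph has an edge with a co-bipartite common
neighborhood. -/
theorem mainC_run {s : St} (hin : Input n Adj nl s.inp) (hV : V = (n + 4) ^ 2)
    (harr : ∀ id i j, s.arr id i j = 0) (hnZ : n ≤ Z) :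
    (EElim Adj → Best n Adj ((mainC.run V Z s).v .bk) (mainC.run V Z s).inp ∧
      ∀ Q : Finset ℕ, Q ⊆ Finset.range n → (∀ x ∈ Q, ∀ y ∈ Q, x ≠ y → Adj x y) →
      Q.card ≤ (mainC.run V Z s).v .bk) ∧
    (¬ n + 2 < s.inp (n + 1) → mainC.cost V Z s ≤ 10) ∧
    ∀ q, (q = 5 ∨ q = 4 ∧ VElim Adj) → ∃ κ, Levels n Adj κ ∧
      mainC.cost V Z s ≤ 10 + ∑ u ∈ Finset.range n,
        (33 + 8 * (nl u).length + 10 * κ u + 1000 * (κ u + 2) ^ q) := by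
  have hnV : n + 4 < V := by rw [hV]; nlinarith
  have hm1 : (n + 1) % V = n + 1 := Nat.mod_eq_of_lt (by omega)
  have hm2 : (n + 2) % V = n + 2 := Nat.mod_eq_of_lt (by omega)
  set s1 := ((s.setv .n n).setv .z (s.inp (n + 1))).setv .bk (if 0 < n then 1 else 0) with hs1
  set s2 := if n + 2 < s.inp (n + 1) then searchC.run V Z s1 else s1 with hs2
  have hrun : mainC.run V Z s = (Cmd.rep .t Vr.bk (.out Vr.t (.rd1 .B Vr.t))).run V Z s2 := by
    simp only [mainC, run_seq, run_set, eval_inp, eval_zero, hin.zero, eval_add, eval_var, setv_v,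
      if_true, eval_one, setv_inp, hm1, eval_lt, reduceCtorEq, if_false, ← hs1, run_ite, eval_two]
    have e1 : s1.v .n = n := by simp [hs1]
    have e2 : s1.v .z = s.inp (n + 1) := by simp [hs1]
    simp only [e1, e2, hm2, run_skip]
    congr 1
    rw [hs2]
    by_cases h : n + 2 < s.inp (n + 1) <;> simp only [h, if_true, if_false, ne_eq, one_ne_zero,
      not_false_eq_true, not_true]
  have hcost : mainC.cost V Z s = 3 + ((1 + if n + 2 < s.inp (n + 1) then searchC.cost V Z s1 else 1) +
      (Cmd.rep .t Vr.bk (.out Vr.t (.rd1 .B Vr.t))).cost V Z s2) := by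
    simp only [mainC, cost_seq, cost_set, run_set, eval_inp, eval_zero, hin.zero, eval_add, eval_var,
      setv_v, if_true, eval_one, setv_inp, hm1, eval_lt, reduceCtorEq, if_false, ← hs1, run_ite,
      eval_two, cost_ite]
    have e1 : s1.v .n = n := by simp [hs1]
    have e2 : s1.v .z = s.inp (n + 1) := by simp [hs1]
    simp only [e1, e2, hm2, run_skip, cost_skip]
    rw [hs2]
    by_cases h : n + 2 < s.inp (n + 1) <;> simp only [h, if_true, if_false, ne_eq, one_ne_zero,
      not_false_eq_true, not_true] <;> omega
  have hout : ∀ B : ℕ → ℕ, s2.arr .B 0 = B → s2.v .bk ≤ n → (mainC.run V Z s).v .bk = s2.v .bk ∧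
      (∀ i < s2.v .bk, (mainC.run V Z s).inp i = B i) ∧
      (Cmd.rep .t Vr.bk (.out Vr.t (.rd1 .B Vr.t))).cost V Z s2 ≤ 1 + s2.v .bk * 2 := by
    intro B hB hbk
    obtain ⟨t, ht, h1, h2, h3, h4⟩ := rep_rule (V := V) (Z := Z) (y := .t) (e := Vr.bk) (s := s2)
      (p := .out Vr.t (.rd1 .B Vr.t)) (fun m t s' => s'.v .bk = s2.v .bk ∧ s'.arr .B 0 = B ∧
        (∀ i < m, s'.inp i = B i) ∧ t ≤ m * 2) ⟨rfl, hB, by simp, by simp⟩ (by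
      rintro m hm t s' ⟨h1, h2, h3, h4⟩
      rw [eval_var] at hm
      have hrun : (Cmd.out Vr.t (.rd1 .B Vr.t)).run V Z (s'.setv .t m) =
          { s'.setv .t m with inp := Function.update s'.inp m (B m) } := by
        simp only [Cmd.run, eval_var, setv_v, if_true, eval_rd1, setv_arr, h2]
        rw [if_pos (by omega)]
        rfl
      rw [hrun]
      refine ⟨by simp [h1], h2, fun i hi => ?_, by rw [cost_out]; omega⟩
      dsimp only
      by_cases him : i = m
      · subst him; simp
      · rw [Function.update_apply, if_neg him]; exact h3 i (by omega))
    rw [← hrun] at h1 h3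
    rw [eval_var] at h3 h4
    exact ⟨h1, h3, by omega⟩
  by_cases hz : n + 2 < s.inp (n + 1)
  · rw [if_pos hz] at hs2 hcost
    have hn0 : 0 < n := by
      obtain ⟨u, hu, -⟩ := hin.edges.1 hz
      omega
    have hbk1 : s1.v .bk = 1 := by simp [hs1, hn0]
    have hsearch := fun q hq => searchC_run (V := V) (Z := Z) (s := s1) hin hV (by simp [hs1]) harr
      hbk1 hn0 (q := q) hq
    rw [← hs2] at hsearch
    obtain ⟨b1, b2, -⟩ := hsearch 5 (.inl rfl)
    have hle := b1.le hin.irrefl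
    obtain ⟨o1, o2, o3⟩ := hout _ rfl hle
    refine ⟨fun hE => ⟨?_, by rw [o1]; exact b2 hE⟩, fun h => absurd hz h, fun q hq => ?_⟩
    · rw [o1]
      exact ⟨fun x hx => by rw [o2 x hx]; exact b1.lt x hx,
        fun x hx y hy hxy => by rw [o2 x hx, o2 y hy]; exact b1.adj x hx y hy hxy⟩
    · obtain ⟨-, -, κ, hκ, hc⟩ := hsearch q hq
      refine ⟨κ, hκ, ?_⟩
      have e2 : ∑ u ∈ Finset.range n, (33 + 8 * (nl u).length + 10 * κ u + 1000 * (κ u + 2) ^ q) =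
          ∑ u ∈ Finset.range n, (31 + 8 * (nl u).length + 10 * κ u + 1000 * (κ u + 2) ^ q) + 2 * n := by
        rw [show 2 * n = ∑ u ∈ Finset.range n, 2 by simp [mul_comm], ← Finset.sum_add_distrib]
        refine Finset.sum_congr rfl fun u _ => by ring
      rw [hcost, e2]
      omega
  · rw [if_neg hz] at hs2 hcost
    have hemp : ∀ u < n, nl u = [] := fun u hu => by
      by_contra hne
      exact hz (hin.edges.2 ⟨u, hu, hne⟩)
    have hno : ∀ u < n, ∀ w, ¬ Adj u w := fun u hu w h => by
      have := (hin.mem u hu w).2 h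
      rw [hemp u hu] at this
      simp at this
    have hbk : s2.v .bk = if 0 < n then 1 else 0 := by simp [hs2, hs1]
    have hB : s2.arr .B 0 = fun _ => 0 := by
      funext i; rw [hs2]; exact harr _ _ _
    have hle : s2.v .bk ≤ n := by rw [hbk]; split_ifs <;> omega
    have hle1 : s2.v .bk ≤ 1 := by rw [hbk]; split_ifs <;> omega
    obtain ⟨o1, o2, o3⟩ := hout _ hB hle
    have hc : mainC.cost V Z s ≤ 10 := by omega
    refine ⟨fun _ => ⟨⟨fun x hx => ?_, fun x hx y hy hxy => ?_⟩, fun Q hQ hQA => ?_⟩, fun _ => hc,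
      fun q _ => ⟨fun _ => 0, ⟨by simp⟩, by omega⟩⟩
    · rw [o1] at hx
      rw [o2 x hx]
      omega
    · rw [o1] at hx hy
      omega
    · rw [o1, hbk]
      rcases Q.eq_empty_or_nonempty with rfl | ⟨u, hu⟩
      · simp
      · have hun := Finset.mem_range.1 (hQ hu)
        rw [if_pos (by omega), Finset.card_le_one]
        intro x hx y hy
        by_contra hxy
        exact hno x (Finset.mem_range.1 (hQ hx)) y (hQA x hx y hy hxy)

/-! ### Correctness and running time of the program -/

section

variable {n : ℕ} (G : SimpleGraph (Fin n)) (adj : Fin n → List (Fin n))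

/-- The adjacency relation of a graph, as a relation on numbers. -/
def natAdj (u v : ℕ) : Prop := ∃ (hu : u < n) (hv : v < n), G.Adj ⟨u, hu⟩ ⟨v, hv⟩

/-- The adjacency lists, as lists of numbers. -/
def natList (u : ℕ) : List ℕ := if h : u < n then (adj ⟨u, h⟩).map Fin.val else []

variable {G adj}

theorem natList_val (v : Fin n) : natList adj v = (adj v).map Fin.val := dif_pos v.2

theorem natAdj_val (u v : Fin n) : natAdj G u v ↔ G.Adj u v :=
  ⟨fun ⟨_, _, h⟩ => h, fun h => ⟨u.2, v.2, h⟩⟩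

theorem input_of_adjLists (hadj : IsAdjLists G adj) :
    Input n (natAdj G) (natList adj) fun i => (encode adj).getD i 0 where
  zero := encode_zero adj
  len u hu := by
    rw [encode_off adj (k := u + 1) (by omega), encode_off adj (k := u) (by omega),
      natList_val ⟨u, hu⟩, List.length_map]
    exact off_succ adj ⟨u, hu⟩
  get u hu t h := by
    have hl := natList_val (adj := adj) ⟨u, hu⟩
    dsimp only at hl
    simp only [hl, List.length_map] at h ⊢
    rw [encode_off adj (k := u) (by omega)]
    exact (encode_list adj ⟨u, hu⟩ h).trans (List.getElem_map _).symm
  lt := encode_lt hadj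
  edges := by
    rw [encode_off adj le_rfl, off_n]
    constructor
    · intro h
      have h0 : 0 < totalDeg adj := by omega
      obtain ⟨v, -, hv⟩ := Finset.sum_pos_iff.1 h0
      refine ⟨v, v.2, fun h => ?_⟩
      rw [natList_val, List.map_eq_nil_iff] at h
      simp [h] at hv
    · rintro ⟨u, hu, h⟩
      have h0 : 0 < totalDeg adj := by
        refine Finset.sum_pos_iff.2 ⟨⟨u, hu⟩, Finset.mem_univ _, List.length_pos_iff.2 fun he => h ?_⟩
        rw [natList_val ⟨u, hu⟩, he, List.map_nil]
      omega
  nodup u hu := by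
    rw [natList_val ⟨u, hu⟩]
    exact (hadj _).1.map Fin.val_injective
  mem u hu w := by
    rw [natList_val ⟨u, hu⟩, List.mem_map]
    constructor
    · rintro ⟨x, hx, rfl⟩
      exact ⟨hu, x.2, ((hadj _).2 x).1 hx⟩
    · rintro ⟨_, hw, h⟩
      exact ⟨⟨w, hw⟩, ((hadj _).2 _).2 h, rfl⟩
  adj_lt _ _ := fun ⟨_, hw, _⟩ => hw
  symm _ _ := fun ⟨hu, hw, h⟩ => ⟨hw, hu, h.symm⟩
  irrefl _ := fun ⟨_, _, h⟩ => G.loopless.irrefl _ h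

/-- The first edge of an elimination ordering that belongs to a subgraph has a co-bipartite common
neighborhood in the subgraph. -/
theorem AdmitsCNEEO.eElim (h : AdmitsCNEEO G) : EElim (natAdj G) := by
  classical
  obtain ⟨L, -, hmem, hL⟩ := h
  intro R hsymm hsub ⟨u₀, v₀, h₀⟩
  have hex : ∃ i : ℕ, ∃ u v : Fin n, R u v ∧ L[i]? = some s(u, v) := by
    obtain ⟨hu, hv, hadj⟩ := hsub _ _ h₀
    obtain ⟨i, hi⟩ := List.mem_iff_getElem?.1 ((hmem s(⟨u₀, hu⟩, ⟨v₀, hv⟩)).2 hadj)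
    exact ⟨i, ⟨u₀, hu⟩, ⟨v₀, hv⟩, h₀, hi⟩
  obtain ⟨u, v, huv, hi⟩ := Nat.find_spec hex
  set i := Nat.find hex
  have hdrop : ∀ x y : Fin n, R x y → (SimpleGraph.fromEdgeSet {e | e ∈ L.drop i}).Adj x y := by
    intro x y hxy
    obtain ⟨_, _, hadj⟩ := hsub _ _ hxy
    obtain ⟨j, hj⟩ := List.mem_iff_getElem?.1 ((hmem s(x, y)).2 hadj)
    have hij : i ≤ j := Nat.find_min' hex ⟨x, y, hxy, hj⟩
    rw [SimpleGraph.fromEdgeSet_adj]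
    refine ⟨List.mem_iff_getElem?.2 ⟨j - i, ?_⟩, hadj.ne⟩
    rw [List.getElem?_drop, ← hj]
    congr 1
    omega
  obtain ⟨c⟩ := hL i u v hi
  set N := (SimpleGraph.fromEdgeSet {e | e ∈ L.drop i}).neighborSet u ∩
    (SimpleGraph.fromEdgeSet {e | e ∈ L.drop i}).neighborSet v
  refine ⟨u, v, huv, fun p => if h : ∃ hp : p < n, (⟨p, hp⟩ : Fin n) ∈ N then
    decide (c ⟨⟨p, h.1⟩, h.2⟩ = 0) else false, fun p q hup hvp huq hvq hpq hnadj => ?_⟩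
  have hpN : ∃ hp : p < n, (⟨p, hp⟩ : Fin n) ∈ N := by
    obtain ⟨_, hp, -⟩ := hsub _ _ hup
    exact ⟨hp, hdrop u ⟨p, hp⟩ hup, hdrop v ⟨p, hp⟩ hvp⟩
  have hqN : ∃ hq : q < n, (⟨q, hq⟩ : Fin n) ∈ N := by
    obtain ⟨_, hq, -⟩ := hsub _ _ huq
    exact ⟨hq, hdrop u ⟨q, hq⟩ huq, hdrop v ⟨q, hq⟩ hvq⟩
  simp only [dif_pos hpN, dif_pos hqN]
  have hc : c ⟨⟨p, hpN.1⟩, hpN.2⟩ ≠ c ⟨⟨q, hqN.1⟩, hqN.2⟩ := by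
    refine c.valid ?_
    rw [SimpleGraph.compl_adj]
    refine ⟨fun he => hpq ?_, fun ha => hnadj ⟨hpN.1, hqN.1, ha⟩⟩
    have := congrArg (fun x => x.1.val) he
    exact this
  intro he
  apply hc
  have : c ⟨⟨p, hpN.1⟩, hpN.2⟩ = 0 ↔ c ⟨⟨q, hqN.1⟩, hqN.2⟩ = 0 := by
    simpa using he
  omega

/-- Every nonempty set of vertices contains a vertex whose neighborhood in that set is
co-bipartite. -/
def VertexElim (G : SimpleGraph (Fin n)) : Prop :=
  ∀ W : Finset (Fin n), W.Nonempty → ∃ v ∈ W, ∃ f : Fin n → Bool, ∀ p ∈ W, ∀ q ∈ W, G.Adj v p →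
    G.Adj v q → p ≠ q → ¬ G.Adj p q → f p ≠ f q

theorem VertexElim.vElim (h : VertexElim G) : VElim (natAdj G) := by
  classical
  intro W hW
  by_cases hWn : ∀ w ∈ W, w < n
  · obtain ⟨w₀, hw₀⟩ := hW
    obtain ⟨v, hv, f, hf⟩ := h (Finset.univ.filter fun v => v.val ∈ W)
      ⟨⟨w₀, hWn _ hw₀⟩, by simpa using hw₀⟩
    simp only [Finset.mem_filter, Finset.mem_univ, true_and] at hv hf
    refine ⟨v, hv, fun p => if h : p < n then f ⟨p, h⟩ else false,
      fun p hp q hq ⟨_, hpn, hvp⟩ ⟨_, hqn, hvq⟩ hpq hnadj => ?_⟩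
    simp only [dif_pos hpn, dif_pos hqn]
    exact hf _ hp _ hq hvp hvq (fun e => hpq (congrArg Fin.val e)) fun ha => hnadj ⟨hpn, hqn, ha⟩
  · push Not at hWn
    obtain ⟨w, hw, hwn⟩ := hWn
    exact ⟨w, hw, fun _ => false, fun p _ q _ ⟨h, _⟩ => absurd h (by omega)⟩

end

/-- The program. -/
def theProg : Prog := mainC.prog

variable {n : ℕ} {G : SimpleGraph (Fin n)} {adj : Fin n → List (Fin n)}

theorem le_off : n ≤ off adj n := by
  rw [off_n]; omega

/-- The word length `40 (⌊log₂ n⌋ + 1)` leaves room for the addresses of all the array entries. -/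
theorem theProg_correct (h : AdmitsCNEEO G) : ComputesMaximumClique theProg 40 G := by
  classical
  intro adj hadj
  obtain ⟨hmain, -⟩ := mainC_run (V := (n + 4) ^ 2) (Z := off adj n) (s := st0 adj)
    (input_of_adjLists hadj) rfl (fun _ _ _ => rfl) le_off
  obtain ⟨hbest, hmax⟩ := hmain h.eElim
  obtain ⟨t, s, hexec, -, h0, h1, h2⟩ := mainC.prog_runs hadj
  refine ⟨t, s, hexec, ?_⟩
  set s' := mainC.run ((n + 4) ^ 2) (off adj n) (st0 adj) with hs'
  have hle := hbest.le (input_of_adjLists hadj).irrefl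
  have hoff := off_n adj
  set l : List (Fin n) := List.ofFn fun i : Fin (s'.v .bk) => (⟨s'.inp i, hbest.lt i i.2⟩ : Fin n)
    with hl
  have hnd : l.Nodup := by
    rw [hl, List.nodup_ofFn]
    intro i j hij
    by_contra hne
    have := hbest.adj i i.2 j j.2 (fun e => hne (Fin.ext e))
    rw [Fin.mk.injEq] at hij
    rw [hij] at this
    exact (input_of_adjLists hadj).irrefl _ this
  have hcard : l.toFinset.card = s'.v .bk := by
    rw [List.toFinset_card_of_nodup hnd, hl, List.length_ofFn]
  refine ⟨l, hnd, ?_, ?_, ?_⟩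
  · rw [State.output, h0, h1, hl]
    refine List.ext_getElem (by simp) fun i hi hi' => ?_
    simp only [List.length_map, List.length_range] at hi
    simp only [zero_add, List.getElem_map, List.getElem_range, List.getElem_ofFn]
    exact h2 i (by omega)
  · intro x hx y hy hxy
    simp only [hl, List.coe_toFinset, Set.mem_ofPred_eq, List.mem_ofFn] at hx hy
    obtain ⟨i, rfl⟩ := hx
    obtain ⟨j, rfl⟩ := hy
    have := hbest.adj i i.2 j j.2 (fun e => hxy (by rw [Fin.ext e]))
    exact (natAdj_val _ _).1 this
  · intro t ht
    rw [hcard]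
    have := hmax (t.map Fin.valEmbedding) (fun x hx => ?_) (fun x hx y hy hxy => ?_)
    · simpa using this
    · obtain ⟨a, -, rfl⟩ := Finset.mem_map.1 hx
      simp
    · obtain ⟨a, ha, rfl⟩ := Finset.mem_map.1 hx
      obtain ⟨b, hb, rfl⟩ := Finset.mem_map.1 hy
      exact (natAdj_val a b).2 (ht ha hb fun e => hxy (by rw [e]))

theorem runTime_le (hadj : IsAdjLists G adj) : runTime theProg 40 adj ≤
    ((mainC.sz * mainC.cost ((n + 4) ^ 2) (off adj n) (st0 adj) + 9 : ℕ) : ℕ∞) := by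
  obtain ⟨t, s, hexec, hle, -⟩ := mainC.prog_runs hadj
  exact (iInf₂_le t ⟨s, hexec⟩).trans (by exact_mod_cast hle)

/-- The time on a graph without edges is bounded. -/
theorem runTime_edgeless (hadj : IsAdjLists G adj) (h : ∀ u v, ¬ G.Adj u v) :
    runTime theProg 40 adj ≤ ((mainC.sz * 10 + 9 : ℕ) : ℕ∞) := by
  have hin := input_of_adjLists hadj
  obtain ⟨-, hmain, -⟩ := mainC_run (V := (n + 4) ^ 2) (Z := off adj n) (s := st0 adj)
    hin rfl (fun _ _ _ => rfl) le_off
  refine (runTime_le hadj).trans ?_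
  have := hmain fun hlt => by
    obtain ⟨u, hu, hne⟩ := hin.edges.1 hlt
    obtain ⟨w, hw⟩ := List.exists_mem_of_ne_nil _ hne
    obtain ⟨_, _, ha⟩ := (hin.mem u hu w).1 hw
    exact h _ _ ha
  have := Nat.mul_le_mul_left mainC.sz this
  exact_mod_cast Nat.add_le_add_right this 9

open Classical in
/-- The number of neighbors of a vertex. -/
noncomputable def dg (G : SimpleGraph (Fin n)) (v : Fin n) : ℕ :=
  (Finset.univ.filter fun w => G.Adj v w).card

open Classical in
/-- `κ` gives levels of the vertices such that the number of neighbors of `v` that are at most one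
level below `v` is at least the level of `v`. -/
def IsLeveling (G : SimpleGraph (Fin n)) (κ : Fin n → ℕ) : Prop :=
  ∀ v, κ v ≤ (Finset.univ.filter fun w => G.Adj v w ∧ κ v ≤ κ w + 1).card

theorem length_eq_dg (hadj : IsAdjLists G adj) (v : Fin n) : (adj v).length = dg G v := by
  classical
  rw [dg, ← List.toFinset_card_of_nodup (hadj v).1]
  congr 1
  ext w
  simp [(hadj v).2 w]

theorem runTime_le_levels (hadj : IsAdjLists G adj) {q : ℕ} (hq : q = 5 ∨ q = 4 ∧ VertexElim G) :
    ∃ κ : Fin n → ℕ, IsLeveling G κ ∧ runTime theProg 40 adj ≤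
      ((mainC.sz * (10 + ∑ v, (33 + 8 * dg G v + 10 * κ v + 1000 * (κ v + 2) ^ q)) + 9 : ℕ) : ℕ∞) := by
  classical
  obtain ⟨-, -, hmain⟩ := mainC_run (V := (n + 4) ^ 2) (Z := off adj n) (s := st0 adj)
    (input_of_adjLists hadj) rfl (fun _ _ _ => rfl) le_off
  obtain ⟨κ, hκ, hcost⟩ := hmain q (hq.imp id fun h => ⟨h.1, h.2.vElim⟩)
  refine ⟨fun v => κ v, fun v => ?_, (runTime_le hadj).trans ?_⟩
  · refine (hκ.le_card v v.2).trans (le_of_eq ?_)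
    rw [← Finset.card_map Fin.valEmbedding]
    congr 1
    ext w
    simp only [Finset.mem_filter, Finset.mem_range, Finset.mem_map, Finset.mem_univ, true_and,
      Fin.valEmbedding_apply]
    constructor
    · rintro ⟨hw, h1, h2⟩
      exact ⟨⟨w, hw⟩, ⟨(natAdj_val v ⟨w, hw⟩).1 h1, h2⟩, rfl⟩
    · rintro ⟨x, ⟨h1, h2⟩, rfl⟩
      exact ⟨x.2, (natAdj_val v x).2 h1, h2⟩
  · have hsum : ∑ u ∈ Finset.range n, (33 + 8 * (natList adj u).length + 10 * κ u +
        1000 * (κ u + 2) ^ q) = ∑ v : Fin n, (33 + 8 * dg G v + 10 * κ v + 1000 * (κ v + 2) ^ q) := by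
      rw [Finset.sum_range]
      refine Finset.sum_congr rfl fun v _ => ?_
      rw [natList_val, List.length_map, length_eq_dg hadj]
    rw [hsum] at hcost
    have := Nat.mul_le_mul_left mainC.sz hcost
    exact_mod_cast Nat.add_le_add_right this 9

/-! ### Bounds for the running time of the program -/

section

variable {n : ℕ} {G : SimpleGraph (Fin n)} {κ : Fin n → ℕ}

theorem sum_dg (G : SimpleGraph (Fin n)) : ∑ v, dg G v = 2 * G.edgeSet.ncard := by
  classical
  rw [← SimpleGraph.coe_edgeFinset, Set.ncard_coe_finset,
    ← SimpleGraph.sum_degrees_eq_twice_card_edges]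
  refine Finset.sum_congr rfl fun v _ => ?_
  rw [dg, ← SimpleGraph.card_neighborFinset_eq_degree, SimpleGraph.neighborFinset_eq_filter]

theorem IsLeveling.le_dg (h : IsLeveling G κ) (v : Fin n) : κ v ≤ dg G v := by
  classical
  refine (h v).trans (Finset.card_le_card fun w hw => ?_)
  rw [Finset.mem_filter] at hw ⊢
  exact ⟨hw.1, hw.2.1⟩

/-- A vertex of level `k` has `k` neighbors of degree at least `k - 1`. -/
theorem IsLeveling.sq_le (h : IsLeveling G κ) (v : Fin n) : κ v ^ 2 ≤ ∑ w, dg G w := by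
  classical
  have hv := h v
  set N := Finset.univ.filter fun w => G.Adj v w ∧ κ v ≤ κ w + 1 with hN
  have hdg : N.card ≤ dg G v := by
    refine Finset.card_le_card fun w hw => ?_
    rw [hN, Finset.mem_filter] at hw
    rw [Finset.mem_filter]
    exact ⟨hw.1, hw.2.1⟩
  have hvN : v ∉ N := by simp [hN]
  calc κ v ^ 2 ≤ N.card * κ v := by rw [sq]; exact Nat.mul_le_mul_right _ hv
    _ ≤ ∑ w ∈ N, (κ w + 1) := by
      rw [← smul_eq_mul]
      refine Finset.card_nsmul_le_sum _ _ _ fun w hw => ?_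
      rw [hN, Finset.mem_filter] at hw
      exact hw.2.2
    _ ≤ ∑ w ∈ N, dg G w + dg G v := by
      rw [Finset.sum_add_distrib, Finset.sum_const, smul_eq_mul, mul_one]
      exact Nat.add_le_add (Finset.sum_le_sum fun w _ => h.le_dg w) hdg
    _ = ∑ w ∈ insert v N, dg G w := by rw [Finset.sum_insert hvN, add_comm]
    _ ≤ ∑ w, dg G w := Finset.sum_le_sum_of_subset (Finset.subset_univ _)

theorem IsLeveling.sum_pow_five_le (h : IsLeveling G κ) : ∑ v, κ v ^ 5 ≤ (∑ v, dg G v) ^ 3 := by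
  calc ∑ v, κ v ^ 5 ≤ ∑ v, (∑ w, dg G w) ^ 2 * dg G v := by
        refine Finset.sum_le_sum fun v _ => ?_
        calc κ v ^ 5 = (κ v ^ 2) ^ 2 * κ v := by ring
          _ ≤ _ := Nat.mul_le_mul (Nat.pow_le_pow_left (h.sq_le v) 2) (h.le_dg v)
    _ = _ := by rw [← Finset.mul_sum]; ring

theorem graphTime_le {P : Prog} {c : ℕ} {b : ℝ≥0∞}
    (h : ∀ adj, IsAdjLists G adj → ∃ t : ℕ, runTime P c adj ≤ (t : ℕ∞) ∧ (t : ℝ≥0∞) ≤ b) :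
    graphTime P c G ≤ b := by
  refine iSup₂_le fun adj hadj => ?_
  obtain ⟨t, h1, h2⟩ := h adj hadj
  refine le_trans ?_ h2
  rw [← ENat.toENNReal_coe]
  exact ENat.toENNReal_le.2 h1

theorem pow_five_le (k : ℕ) : (k + 2) ^ 5 ≤ 243 * (k ^ 5 + 1) := by
  rcases Nat.eq_zero_or_pos k with rfl | h
  · norm_num
  · calc (k + 2) ^ 5 ≤ (3 * k) ^ 5 := Nat.pow_le_pow_left (by omega) 5
      _ = 243 * k ^ 5 := by ring
      _ ≤ _ := by omega

theorem pow_four_le (k : ℕ) : (k + 2) ^ 4 ≤ 81 * (k ^ 4 + 1) := by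
  rcases Nat.eq_zero_or_pos k with rfl | h
  · norm_num
  · calc (k + 2) ^ 4 ≤ (3 * k) ^ 4 := Nat.pow_le_pow_left (by omega) 4
      _ = 81 * k ^ 4 := by ring
      _ ≤ _ := by omega

/-- The bound for the time on an arbitrary graph with at least one edge. -/
theorem runTime_le_worst {adj : Fin n → List (Fin n)} (hadj : IsAdjLists G adj) :
    runTime theProg 40 adj ≤ ((mainC.sz * (10 + 243033 * n + 36 * G.edgeSet.ncard +
      1944000 * G.edgeSet.ncard ^ 3) + 9 : ℕ) : ℕ∞) := by
  obtain ⟨κ, hκ, hle⟩ := runTime_le_levels hadj (Or.inl rfl)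
  refine hle.trans ?_
  norm_cast
  refine Nat.add_le_add_right (Nat.mul_le_mul_left _ ?_) _
  have h1 : ∑ v, (33 + 8 * dg G v + 10 * κ v + 1000 * (κ v + 2) ^ 5) ≤
      ∑ v, (243033 + 18 * dg G v + 243000 * κ v ^ 5) := by
    refine Finset.sum_le_sum fun v _ => ?_
    have := pow_five_le (κ v)
    have := hκ.le_dg v
    omega
  have h2 := hκ.sum_pow_five_le
  simp only [Finset.sum_add_distrib, ← Finset.mul_sum, sum_dg, Finset.sum_const, Finset.card_univ,
    Fintype.card_fin, smul_eq_mul] at h1 h2 ⊢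
  have h3 : (2 * G.edgeSet.ncard) ^ 3 = 8 * G.edgeSet.ncard ^ 3 := by ring
  omega

/-- The time on an arbitrary graph. -/
theorem graphTime_le_worst : ∃ K : ℝ, ∀ (n : ℕ) (G : SimpleGraph (Fin n)),
    graphTime theProg 40 G ≤ ENNReal.ofReal
      (K * (1 + (G.edgeSet.ncard : ℝ) ^ 3 + G.edgeSet.ncard * (n : ℝ) ^ (5 / 2 : ℝ))) := by
  refine ⟨mainC.sz * 1944090 + 9, fun n G => graphTime_le fun adj hadj => ?_⟩
  set m := G.edgeSet.ncard with hm
  have hn0 : (0 : ℝ) ≤ (n : ℝ) ^ (5 / 2 : ℝ) := by positivity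
  rcases Nat.eq_zero_or_pos m with h0 | h0
  · refine ⟨_, runTime_edgeless hadj fun u v huv => ?_, ?_⟩
    · rw [hm, Set.ncard_eq_zero] at h0
      have : s(u, v) ∈ G.edgeSet := huv
      rw [h0] at this
      exact this
    · rw [← ENNReal.ofReal_natCast]
      refine ENNReal.ofReal_le_ofReal ?_
      rw [h0]
      push_cast
      have : (0 : ℝ) ≤ mainC.sz := by positivity
      nlinarith
  · refine ⟨_, runTime_le_worst hadj, ?_⟩
    rw [← ENNReal.ofReal_natCast]
    refine ENNReal.ofReal_le_ofReal ?_
    rw [← hm]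
    have hm1 : (1 : ℝ) ≤ m := by exact_mod_cast h0
    have hsz : (0 : ℝ) ≤ mainC.sz := by positivity
    have hm3 : (m : ℝ) ≤ (m : ℝ) ^ 3 := le_self_pow₀ hm1 (by norm_num)
    have hn1 : (n : ℝ) ≤ (n : ℝ) ^ (5 / 2 : ℝ) := by
      rcases Nat.eq_zero_or_pos n with rfl | hn
      · simp
      · exact Real.self_le_rpow_of_one_le (by exact_mod_cast hn) (by norm_num)
    have hmn : (n : ℝ) ^ (5 / 2 : ℝ) ≤ m * (n : ℝ) ^ (5 / 2 : ℝ) := le_mul_of_one_le_left hn0 hm1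
    push_cast
    have h1 : (10 + 243033 * n + 36 * m + 1944000 * (m : ℝ) ^ 3) ≤
        1944090 * (1 + (m : ℝ) ^ 3 + m * (n : ℝ) ^ (5 / 2 : ℝ)) := by
      linarith [show (0 : ℝ) ≤ n by positivity]
    have := mul_le_mul_of_nonneg_left h1 hsz
    have : (0 : ℝ) ≤ (m : ℝ) ^ 3 := by positivity
    nlinarith

open Classical in
/-- The number of the neighbors of `v` that are not larger than `v`, with respect to `r`. -/
noncomputable def below (G : SimpleGraph (Fin n)) (r : Fin n → ℝ) (v : Fin n) : ℕ :=
  (Finset.univ.filter fun w => G.Adj v w ∧ r w ≤ r v).card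

theorem young (k d : ℕ) : 18 * (d * k ^ 3) ≤ k ^ 4 + 104976 * d ^ 4 := by
  rcases le_total (18 * d) k with h | h
  · calc 18 * (d * k ^ 3) = (18 * d) * k ^ 3 := by ring
      _ ≤ k * k ^ 3 := Nat.mul_le_mul_right _ h
      _ = k ^ 4 := by ring
      _ ≤ _ := Nat.le_add_right _ _
  · calc 18 * (d * k ^ 3) ≤ 18 * (d * (18 * d) ^ 3) :=
          Nat.mul_le_mul_left _ (Nat.mul_le_mul_left _ (Nat.pow_le_pow_left h 3))
      _ = 104976 * d ^ 4 := by ring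
      _ ≤ _ := Nat.le_add_left _ _

/-- Charging every pair of adjacent vertices to the larger one bounds the fourth moment of the
levels by that of the numbers of smaller neighbors. -/
theorem IsLeveling.sum_pow_four_le (h : IsLeveling G κ) (r : Fin n → ℝ) :
    ∑ v, κ v ^ 4 ≤ 104978 * ∑ v, below G r v ^ 4 := by
  classical
  have h1 : ∀ v, κ v ^ 4 ≤ ∑ w, ((if G.Adj v w ∧ r w ≤ r v then κ v ^ 3 else 0) +
      if G.Adj w v ∧ r v ≤ r w then (κ w + 1) ^ 3 else 0) := by
    intro v
    calc κ v ^ 4 = κ v * κ v ^ 3 := by ring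
      _ ≤ _ := Nat.mul_le_mul_right _ (h v)
      _ = ∑ w ∈ Finset.univ.filter (fun w => G.Adj v w ∧ κ v ≤ κ w + 1), κ v ^ 3 := by
        rw [Finset.sum_const, smul_eq_mul]
      _ = ∑ w, if G.Adj v w ∧ κ v ≤ κ w + 1 then κ v ^ 3 else 0 := Finset.sum_filter _ _
      _ ≤ _ := by
        refine Finset.sum_le_sum fun w _ => ?_
        split_ifs with h1 h2 h3 h4 h5 <;> try omega
        · have := Nat.pow_le_pow_left h1.2 3
          omega
        · exact absurd ⟨h1.1.symm, le_of_not_ge fun hh => h2 ⟨h1.1, hh⟩⟩ h4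
  have h2 : ∑ v, κ v ^ 4 ≤ ∑ v, below G r v * (κ v ^ 3 + (κ v + 1) ^ 3) := by
    refine (Finset.sum_le_sum fun v _ => h1 v).trans (le_of_eq ?_)
    simp only [Finset.sum_add_distrib, mul_add]
    congr 1
    · refine Finset.sum_congr rfl fun v _ => ?_
      rw [← Finset.sum_filter, Finset.sum_const, smul_eq_mul, below]
    · rw [Finset.sum_comm]
      refine Finset.sum_congr rfl fun v _ => ?_
      rw [← Finset.sum_filter, Finset.sum_const, smul_eq_mul, below]
  have h3 : ∀ v, 2 * (below G r v * (κ v ^ 3 + (κ v + 1) ^ 3)) ≤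
      κ v ^ 4 + 104978 * below G r v ^ 4 := by
    intro v
    have hy := young (κ v) (below G r v)
    have hp : below G r v ≤ below G r v ^ 4 := Nat.le_self_pow (by norm_num) _
    have hk : κ v ^ 3 + (κ v + 1) ^ 3 ≤ 9 * κ v ^ 3 + 1 := by
      rcases Nat.eq_zero_or_pos (κ v) with h0 | h0
      · rw [h0]; norm_num
      · have := Nat.pow_le_pow_left (show κ v + 1 ≤ 2 * κ v by omega) 3
        rw [mul_pow] at this
        omega
    have := Nat.mul_le_mul_left (below G r v) hk
    rw [mul_add (below G r v) (9 * κ v ^ 3) 1, mul_left_comm] at this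
    omega
  have h4 := Finset.sum_le_sum fun v (_ : v ∈ Finset.univ) => h3 v
  rw [← Finset.mul_sum, Finset.sum_add_distrib, ← Finset.mul_sum] at h4
  omega

/-- The constant factor of the running time. -/
def timeFactor : ℕ := mainC.sz * 8503218000 + 9

theorem timeFactor_mul (x : ℕ) : timeFactor * x = mainC.sz * (8503218000 * x) + 9 * x := by
  have h : timeFactor = mainC.sz * 8503218000 + 9 := rfl
  rw [h, add_mul]
  rw [mul_assoc]

/-- The time on a graph each of whose induced subgraphs has a vertex with co-bipartite neighborhood. -/
theorem graphTime_le_below (hG : VertexElim G) (r : Fin n → ℝ) :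
    graphTime theProg 40 G ≤
      (timeFactor * (1 + n + G.edgeSet.ncard + ∑ v, below G r v ^ 4) : ℕ) := by
  refine graphTime_le fun adj hadj => ?_
  obtain ⟨κ, hκ, hle⟩ := runTime_le_levels hadj (Or.inr ⟨rfl, hG⟩)
  refine ⟨_, hle, ?_⟩
  have h1 : ∑ v, (33 + 8 * dg G v + 10 * κ v + 1000 * (κ v + 2) ^ 4) ≤
      ∑ v, (81033 + 18 * dg G v + 81000 * κ v ^ 4) := by
    refine Finset.sum_le_sum fun v _ => ?_
    have := pow_four_le (κ v)
    have := hκ.le_dg v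
    omega
  have h2 := hκ.sum_pow_four_le r
  simp only [Finset.sum_add_distrib, ← Finset.mul_sum, sum_dg, Finset.sum_const, Finset.card_univ,
    Fintype.card_fin, smul_eq_mul] at h1 h2 ⊢
  have h3 : (10 + (n * 33 + 8 * (2 * G.edgeSet.ncard) + 10 * ∑ v, κ v +
      1000 * ∑ v, (κ v + 2) ^ 4)) ≤ 8503218000 * (1 + n + G.edgeSet.ncard +
      ∑ v, below G r v ^ 4) := by omega
  have h4 := Nat.mul_le_mul_left mainC.sz h3
  refine Nat.cast_le.2 ?_
  rw [timeFactor_mul]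
  omega

end

/-! ### The hyperboloid model -/

/-- The Lorentzian inner product, with signature `(+, -, -)`. -/
def lor (x y : Fin 3 → ℝ) : ℝ := x 0 * y 0 - x 1 * y 1 - x 2 * y 2

/-- The determinant of three vectors. -/
def det₃ (x y z : Fin 3 → ℝ) : ℝ :=
  x 0 * (y 1 * z 2 - y 2 * z 1) - x 1 * (y 0 * z 2 - y 2 * z 0) + x 2 * (y 0 * z 1 - y 1 * z 0)

/-- The upper sheet of the hyperboloid. -/
def OnSheet (x : Fin 3 → ℝ) : Prop := lor x x = 1 ∧ 0 < x 0

theorem lor_comm (x y : Fin 3 → ℝ) : lor x y = lor y x := by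
  unfold lor; ring

theorem OnSheet.one_le {x y : Fin 3 → ℝ} (hx : OnSheet x) (hy : OnSheet y) : 1 ≤ lor x y := by
  obtain ⟨hx, hx0⟩ := hx
  obtain ⟨hy, hy0⟩ := hy
  unfold lor at *
  have h : (1 + x 1 * y 1 + x 2 * y 2) ^ 2 ≤ (x 0 * y 0) ^ 2 := by
    have h1 : (x 0 * y 0) ^ 2 = (1 + x 1 ^ 2 + x 2 ^ 2) * (1 + y 1 ^ 2 + y 2 ^ 2) := by
      rw [mul_pow, show x 0 ^ 2 = 1 + x 1 ^ 2 + x 2 ^ 2 by linarith,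
        show y 0 ^ 2 = 1 + y 1 ^ 2 + y 2 ^ 2 by linarith]
    rw [h1]
    nlinarith [sq_nonneg (x 1 - y 1), sq_nonneg (x 2 - y 2), sq_nonneg (x 1 * y 2 - x 2 * y 1)]
  have := (abs_le.1 (abs_le_of_sq_le_sq h (by positivity))).2
  linarith

theorem OnSheet.eq_of_le_one {x y : Fin 3 → ℝ} (hx : OnSheet x) (hy : OnSheet y)
    (h : lor x y ≤ 1) : x = y := by
  have h1 := le_antisymm h (hx.one_le hy)
  obtain ⟨hx, hx0⟩ := hx
  obtain ⟨hy, hy0⟩ := hy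
  unfold lor at *
  have h2 : (1 + x 1 * y 1 + x 2 * y 2) ^ 2 = (1 + x 1 ^ 2 + x 2 ^ 2) * (1 + y 1 ^ 2 + y 2 ^ 2) := by
    rw [show 1 + x 1 * y 1 + x 2 * y 2 = x 0 * y 0 by linarith, mul_pow,
      show x 0 ^ 2 = 1 + x 1 ^ 2 + x 2 ^ 2 by linarith,
      show y 0 ^ 2 = 1 + y 1 ^ 2 + y 2 ^ 2 by linarith]
  have h3 : (x 1 - y 1) ^ 2 + (x 2 - y 2) ^ 2 + (x 1 * y 2 - x 2 * y 1) ^ 2 = 0 := by linarith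
  have e1 : x 1 = y 1 := by
    nlinarith [sq_nonneg (x 1 - y 1), sq_nonneg (x 2 - y 2), sq_nonneg (x 1 * y 2 - x 2 * y 1)]
  have e2 : x 2 = y 2 := by
    nlinarith [sq_nonneg (x 1 - y 1), sq_nonneg (x 2 - y 2), sq_nonneg (x 1 * y 2 - x 2 * y 1)]
  have e0 : x 0 = y 0 := by
    rw [e1, e2] at hx
    nlinarith
  ext i
  fin_cases i <;> assumption

section

variable {x y z w : Fin 3 → ℝ} {a b p q c : ℝ}

/-- If `z` lies in the triangle with vertices `x`, `y` and `w`, then it is at most as far from `w`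
as the farther one of `x` and `y`. -/
theorem lor_le_of_mem_triangle (hx : OnSheet x) (hy : OnSheet y) (hz : OnSheet z) (hw : OnSheet w)
    (h : ∀ u, a * lor x u + b * lor y u + p * lor w u = q * lor z u) (ha : 0 ≤ a) (hb : 0 ≤ b)
    (hp : 0 ≤ p) (hq : 0 < q) (hxw : lor x w ≤ c) (hyw : lor y w ≤ c) : lor z w ≤ c := by
  have h1 := h w
  have h2 := h z
  rw [hw.1] at h1
  rw [hz.1] at h2
  have := mul_le_mul_of_nonneg_left (hx.one_le hz) ha
  have := mul_le_mul_of_nonneg_left (hy.one_le hz) hb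
  have := mul_le_mul_of_nonneg_left (hw.one_le hz) hp
  have := mul_le_mul_of_nonneg_left hxw ha
  have := mul_le_mul_of_nonneg_left hyw hb
  have hc : 1 ≤ c := (hx.one_le hw).trans hxw
  have := mul_le_mul_of_nonneg_left hc hp
  have hle : q * lor z w ≤ q * c := by nlinarith
  exact le_of_mul_le_mul_left hle hq

/-- If the segments `xw` and `yz` cross and `w` is at most as far from `x` as `y`, then `w` is at most
as far from `z` as `y`: the bisector of `w` and `y` separates the segments otherwise. -/
theorem lor_le_of_crossing (hy : OnSheet y) (hw : OnSheet w)
    (h : ∀ u, a * lor x u + p * lor w u = q * lor z u + b * lor y u) (ha : 0 ≤ a)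
    (hb : 0 < b) (hp : 0 ≤ p) (hq : 0 ≤ q) (hxw : lor x w ≤ lor x y) (hyz : lor y z ≤ c) :
    lor z w ≤ c := by
  have h1 := h w
  have h2 := h y
  rw [hw.1] at h1
  rw [hy.1] at h2
  have hyw := hy.one_le hw
  rw [lor_comm w y] at h2
  have e1 : a * (lor x w - lor x y) + p * (1 - lor y w) =
      q * (lor z w - lor z y) + b * (lor y w - 1) := by linarith
  have e2 : a * (lor x w - lor x y) ≤ 0 := mul_nonpos_of_nonneg_of_nonpos ha (by linarith)
  have e3 : p * (1 - lor y w) ≤ 0 := mul_nonpos_of_nonneg_of_nonpos hp (by linarith)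
  have e4 : 0 ≤ b * (lor y w - 1) := mul_nonneg hb.le (by linarith)
  by_contra! hlt
  rw [lor_comm y z] at hyz
  rcases hq.eq_or_lt with rfl | hq
  · have e5 : b * (lor y w - 1) ≤ 0 := by linarith
    have e6 : lor y w ≤ 1 := by nlinarith
    rw [← hy.eq_of_le_one hw e6] at hlt
    exact absurd hyz (not_le.2 hlt)
  · have : 0 < q * (lor z w - lor z y) := mul_pos hq (by linarith)
    linarith

/-- Cramer's rule. -/
theorem lor_relation (x y z w u : Fin 3 → ℝ) : det₃ y w z * lor x u + -det₃ x w z * lor y u +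
    det₃ x y z * lor w u = det₃ x y w * lor z u := by
  unfold det₃ lor; ring

/-- The coordinates, with respect to `x` and `y`, of the orthogonal projection of `z` to the plane
spanned by `x` and `y`. -/
theorem lor_projection (hx : OnSheet x) (hy : OnSheet y) (z u : Fin 3 → ℝ) :
    (lor x y * lor y z - lor x z) * lor x u + (lor x y * lor x z - lor y z) * lor y u =
      (lor x y ^ 2 - 1) * lor z u + det₃ x y z * det₃ x y u := by
  have h : (lor x y * lor y z - lor y y * lor x z) * lor x u +
      (lor x y * lor x z - lor x x * lor y z) * lor y u =
      (lor x y ^ 2 - lor x x * lor y y) * lor z u + det₃ x y z * det₃ x y u := by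
    unfold det₃ lor; ring
  rwa [hx.1, hy.1, one_mul, one_mul, one_mul] at h

theorem lor_le_of_collinear (hx : OnSheet x) (hy : OnSheet y) (hz : OnSheet z) (hw : OnSheet w)
    (hxz : lor x z ≤ lor x y) (hxw : lor x w ≤ lor x y) (hxy : lor x y ≤ c) (hyz : lor y z ≤ c)
    (hyw : lor y w ≤ c) (h1 : det₃ x y z = 0) (h2 : det₃ x y w = 0) : lor z w ≤ c := by
  have hc : 1 ≤ c := (hx.one_le hy).trans hxy
  rcases (hx.one_le hy).eq_or_lt with h0 | h0
  · rw [← hx.eq_of_le_one hz (hxz.trans h0.ge), ← hx.eq_of_le_one hw (hxw.trans h0.ge), hx.1]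
    exact hc
  have hH : 0 < lor x y ^ 2 - 1 := by nlinarith
  have ez := lor_projection hx hy z
  have ew := lor_projection hx hy w
  simp only [h1, h2, zero_mul, add_zero] at ez ew
  set H := lor x y ^ 2 - 1
  have hAz : 0 ≤ lor x y * lor y z - lor x z := by nlinarith [hy.one_le hz]
  have hAw : 0 ≤ lor x y * lor y w - lor x w := by nlinarith [hy.one_le hw]
  set A := lor x y * lor y z - lor x z
  set A' := lor x y * lor y w - lor x w
  set B := lor x y * lor x z - lor y z
  set B' := lor x y * lor x w - lor y w
  clear_value H A A' B B'
  rcases le_or_gt 0 B with hB | hB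
  · exact lor_le_of_mem_triangle (p := 0) hx hy hz hw (fun u => by rw [zero_mul, add_zero, ez]) hAz hB
      le_rfl hH (hxw.trans hxy) hyw
  rcases le_or_gt 0 B' with hB' | hB'
  · rw [lor_comm]
    exact lor_le_of_mem_triangle (p := 0) hx hy hw hz (fun u => by rw [zero_mul, add_zero, ew]) hAw hB'
      le_rfl hH (hxz.trans hxy) hyz
  -- both points are beyond `x`, and the one that is closer to `x` is between `y` and the other one
  have hA0 : 0 < A := by
    have := ez z
    rw [hz.1] at this
    have := hx.one_le hz
    have := hy.one_le hz
    by_contra! h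
    nlinarith
  have hA0' : 0 < A' := by
    have := ew w
    rw [hw.1] at this
    have := hx.one_le hw
    have := hy.one_le hw
    by_contra! h
    nlinarith
  rcases le_total 0 (A' * B - A * B') with hD | hD
  · refine lor_le_of_mem_triangle (a := 0) (p := A * H) (q := A' * H) hx hy hz hw (fun u => ?_) le_rfl
      hD (by positivity) (by positivity) (hxw.trans hxy) hyw
    linear_combination A' * ez u - A * ew u
  · rw [lor_comm]
    refine lor_le_of_mem_triangle (a := 0) (b := -(A' * B - A * B')) (p := A' * H) (q := A * H) hx hy hw
      hz (fun u => ?_) le_rfl (by linarith) (by positivity) (by positivity) (hxz.trans hxy) hyz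
    linear_combination A * ew u - A' * ez u

theorem lor_le_of_det_nonneg (hx : OnSheet x) (hy : OnSheet y) (hz : OnSheet z) (hw : OnSheet w)
    (hxz : lor x z ≤ lor x y) (hxw : lor x w ≤ lor x y) (hxy : lor x y ≤ c) (hyz : lor y z ≤ c)
    (hyw : lor y w ≤ c) (h : ∀ u, a * lor x u + b * lor y u + p * lor w u = q * lor z u)
    (hp : 0 ≤ p) (hq : 0 ≤ q) (hpq : 0 < p ∨ 0 < q) : lor z w ≤ c := by
  have hz' : ∀ u, -a * lor x u + -b * lor y u + q * lor z u = p * lor w u := fun u => by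
    linarith [h u]
  rcases le_or_gt 0 a with ha | ha
  · rcases le_or_gt 0 b with hb | hb
    · refine lor_le_of_mem_triangle hx hy hz hw h ha hb hp (hq.lt_of_ne' ?_) (hxw.trans hxy) hyw
      rintro rfl
      have := h w
      rw [hw.1] at this
      have := mul_nonneg ha (zero_le_one.trans (hx.one_le hw))
      have := mul_nonneg hb (zero_le_one.trans (hy.one_le hw))
      have := hpq.resolve_right (lt_irrefl _)
      linarith
    · exact lor_le_of_crossing (b := -b) hy hw (fun u => by linarith [h u]) ha (by linarith) hp hq
        hxw hyz
  · rw [lor_comm]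
    rcases lt_or_ge 0 b with hb | hb
    · exact lor_le_of_crossing (a := -a) (b := b) (p := q) (q := p) hy hz
        (fun u => by linarith [h u]) (by linarith) hb hq hp hxz hyw
    · refine lor_le_of_mem_triangle hx hy hw hz hz' (by linarith) (by linarith) hq
        (hp.lt_of_ne' ?_) (hxz.trans hxy) hyz
      rintro rfl
      have := hz' z
      rw [hz.1] at this
      have := mul_nonneg (show 0 ≤ -a by linarith) (zero_le_one.trans (hx.one_le hz))
      have := mul_nonneg (show 0 ≤ -b by linarith) (zero_le_one.trans (hy.one_le hz))
      have := hpq.resolve_left (lt_irrefl _)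
      linarith

/-- Two points on the same side of the line through `x` and `y` are at most as far from each other as
allowed by `c`, if this holds for their distances to `y` and the distance of `x` and `y`, and none of
them is farther from `x` than `y`. -/
theorem lor_le_of_same_side (hx : OnSheet x) (hy : OnSheet y) (hz : OnSheet z) (hw : OnSheet w)
    (hxz : lor x z ≤ lor x y) (hxw : lor x w ≤ lor x y) (hxy : lor x y ≤ c) (hyz : lor y z ≤ c)
    (hyw : lor y w ≤ c) (hside : 0 < det₃ x y z ↔ 0 < det₃ x y w) : lor z w ≤ c := by
  by_cases h0 : det₃ x y z = 0 ∧ det₃ x y w = 0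
  · exact lor_le_of_collinear hx hy hz hw hxz hxw hxy hyz hyw h0.1 h0.2
  rcases lt_or_ge 0 (det₃ x y z) with h | h
  · exact lor_le_of_det_nonneg hx hy hz hw hxz hxw hxy hyz hyw (lor_relation x y z w) h.le
      (hside.1 h).le (Or.inl h)
  · have h' : det₃ x y w ≤ 0 := not_lt.1 fun h' => absurd (hside.2 h') (not_lt.2 h)
    refine lor_le_of_det_nonneg (a := -det₃ y w z) (b := det₃ x w z) (p := -det₃ x y z)
      (q := -det₃ x y w) hx hy hz hw hxz hxw hxy hyz hyw (fun u => ?_) (by linarith) (by linarith) ?_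
    · linarith [lor_relation x y z w u]
    · by_contra! hh
      exact h0 ⟨le_antisymm h (by linarith), le_antisymm h' (by linarith)⟩

end

/-! ### Elimination orderings of hyperbolic unit disk graphs -/

/-- The point of the hyperboloid with polar coordinates `p`. -/
noncomputable def polar (p : ℝ × ℝ) : Fin 3 → ℝ :=
  ![Real.cosh p.1, Real.sinh p.1 * Real.cos p.2, Real.sinh p.1 * Real.sin p.2]

theorem lor_polar (p q : ℝ × ℝ) : lor (polar p) (polar q) =
    Real.cosh p.1 * Real.cosh q.1 - Real.sinh p.1 * Real.sinh q.1 * Real.cos (p.2 - q.2) := by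
  simp only [lor, polar, Matrix.cons_val_zero, Matrix.cons_val_one, Matrix.cons_val,
    Real.cos_sub]
  ring

theorem onSheet_polar (p : ℝ × ℝ) : OnSheet (polar p) := by
  refine ⟨?_, Real.cosh_pos _⟩
  rw [lor_polar, sub_self, Real.cos_zero, mul_one, ← sq, ← sq, Real.cosh_sq_sub_sinh_sq]

theorem hypDist_le_iff {p q : ℝ × ℝ} {t : ℝ} (ht : 0 ≤ t) :
    hypDist p q ≤ t ↔ lor (polar p) (polar q) ≤ Real.cosh t := by
  have h := (onSheet_polar p).one_le (onSheet_polar q)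
  rw [hypDist, ← lor_polar]
  nth_rw 1 [← Real.arcosh_cosh ht]
  exact Real.arcosh_le_arcosh (by linarith) (Real.cosh_pos _)

theorem hypDist_nonneg (p q : ℝ × ℝ) : 0 ≤ hypDist p q := by
  rw [hypDist, ← lor_polar]
  exact Real.arcosh_nonneg ((onSheet_polar p).one_le (onSheet_polar q))

theorem diskGraph_adj {V : Type*} {t : ℝ} (ht : 0 ≤ t) {p : V → ℝ × ℝ} {u v : V} :
    (diskGraph t p).Adj u v ↔ u ≠ v ∧ lor (polar (p u)) (polar (p v)) ≤ Real.cosh t := by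
  rw [diskGraph, SimpleGraph.fromRel_adj, hypDist_le_iff ht, hypDist_le_iff ht,
    lor_comm (polar (p v)), or_self]

theorem vertexElim_diskGraph {n : ℕ} {R : ℝ} {p : Fin n → ℝ × ℝ}
    (hp : ∀ v, (p v).1 ∈ Set.Icc 0 R) : VertexElim (diskGraph R p) := by
  intro W hW
  obtain ⟨v, hv, hmax⟩ := W.exists_max_image (fun v => (p v).1) hW
  have hR : 0 ≤ R := (hp v).1.trans (hp v).2
  have h0 : ∀ u, lor (polar (0, 0)) (polar (p u)) = Real.cosh (p u).1 := fun u => by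
    rw [lor_polar]; simp
  have hcosh : ∀ u ∈ W, lor (polar (0, 0)) (polar (p u)) ≤ lor (polar (0, 0)) (polar (p v)) := by
    intro u hu
    rw [h0, h0, Real.cosh_le_cosh, abs_of_nonneg (hp u).1, abs_of_nonneg (hp v).1]
    exact hmax u hu
  classical
  refine ⟨v, hv, fun u => decide (0 < det₃ (polar (0, 0)) (polar (p v)) (polar (p u))),
    fun a ha b hb hva hvb hab hn hf => hn ?_⟩
  rw [diskGraph_adj hR] at hva hvb ⊢
  refine ⟨hab, lor_le_of_same_side (onSheet_polar (0, 0)) (onSheet_polar (p v)) (onSheet_polar _)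
    (onSheet_polar _) (hcosh a ha) (hcosh b hb) ?_ hva.2 hvb.2 (decide_eq_decide.1 hf)⟩
  rw [h0, Real.cosh_le_cosh, abs_of_nonneg (hp v).1, abs_of_nonneg hR]
  exact (hp v).2

/-- The edges, in the order of decreasing length, form an elimination ordering. -/
theorem IsHyperbolicUnitDiskGraph.admitsCNEEO {n : ℕ} {G : SimpleGraph (Fin n)}
    (h : IsHyperbolicUnitDiskGraph G) : AdmitsCNEEO G := by
  classical
  obtain ⟨t, p, -, rfl⟩ := h
  rcases lt_or_ge t 0 with ht | ht
  · have h0 : ∀ u v, ¬ (diskGraph t p).Adj u v := fun u v h => by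
      rw [diskGraph, SimpleGraph.fromRel_adj] at h
      rcases h.2 with h | h <;> linarith [hypDist_nonneg (p u) (p v), hypDist_nonneg (p v) (p u)]
    refine ⟨[], List.nodup_nil, fun e => ?_, fun i u v h => by simp at h⟩
    induction e with
    | h u v => simpa using h0 u v
  set G := diskGraph t p with hG
  let len : Sym2 (Fin n) → ℝ := Sym2.lift ⟨fun u v => lor (polar (p u)) (polar (p v)),
    fun u v => lor_comm _ _⟩
  let r : Sym2 (Fin n) → Sym2 (Fin n) → Prop := fun e e' => len e' ≤ len e
  have : Std.Total r := ⟨fun e e' => le_total _ _⟩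
  have : IsTrans _ r := ⟨fun e e' e'' h h' => le_trans h' h⟩
  set L := List.insertionSort r G.edgeFinset.toList with hL
  have hperm : L.Perm G.edgeFinset.toList := List.perm_insertionSort r _
  have hmem : ∀ e, e ∈ L ↔ e ∈ G.edgeSet := fun e => by
    rw [hperm.mem_iff, Finset.mem_toList, SimpleGraph.mem_edgeFinset]
  refine ⟨L, hperm.nodup_iff.2 (Finset.nodup_toList _), hmem, fun i u v hi => ?_⟩
  have hlen : ∀ x y, (SimpleGraph.fromEdgeSet {e | e ∈ L.drop i}).Adj x y →
      lor (polar (p x)) (polar (p y)) ≤ lor (polar (p u)) (polar (p v)) := by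
    intro x y hxy
    rw [SimpleGraph.fromEdgeSet_adj] at hxy
    have h1 : s(x, y) ∈ L.drop i := hxy.1
    obtain ⟨hi', hiv⟩ := List.getElem?_eq_some_iff.1 hi
    rw [List.drop_eq_getElem_cons hi', hiv, List.mem_cons] at h1
    rcases h1 with h1 | h1
    · exact le_of_eq (congrArg len h1)
    · have hsort : L.Pairwise r := List.pairwise_insertionSort r _
      have hd : (L.drop i).Pairwise r := hsort.sublist (List.drop_sublist i L)
      rw [List.drop_eq_getElem_cons hi', hiv, List.pairwise_cons] at hd
      exact hd.1 _ h1
  have huv : lor (polar (p u)) (polar (p v)) ≤ Real.cosh t :=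
    ((diskGraph_adj ht).1 ((hmem s(u, v)).1 (List.mem_of_getElem? hi))).2
  refine SimpleGraph.Coloring.colorable (α := Bool) ⟨fun x =>
    decide (0 < det₃ (polar (p u)) (polar (p v)) (polar (p x))), fun {x y} hxy hf => ?_⟩
  rw [SimpleGraph.compl_adj] at hxy
  have hux := hlen _ _ x.2.1
  have hvx := hlen _ _ x.2.2
  have huy := hlen _ _ y.2.1
  have hvy := hlen _ _ y.2.2
  refine hxy.2 ((diskGraph_adj ht).2 ⟨fun e => hxy.1 (Subtype.ext e), ?_⟩)
  exact lor_le_of_same_side (onSheet_polar _) (onSheet_polar _) (onSheet_polar _) (onSheet_polar _) hux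
    huy huv (hvx.trans huv) (hvy.trans huv) (decide_eq_decide.1 hf)

/-! ### The law of a random point -/

section

variable {α R : ℝ}

theorem cosh_sub_one_pos (hα : 0 < α) (hR : 0 < R) : 0 < Real.cosh (α * R) - 1 :=
  sub_pos.2 (Real.one_lt_cosh.2 (mul_pos hα hR).ne')

instance : IsProbabilityMeasure angularLaw := by
  refine ⟨?_⟩
  rw [angularLaw, Measure.smul_apply, Measure.restrict_apply_univ, Real.volume_Ico, sub_zero,
    smul_eq_mul, ENNReal.inv_mul_cancel]
  · simpa using Real.pi_pos
  · exact ENNReal.ofReal_ne_top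

theorem measurable_radialDensity (α R : ℝ) : Measurable fun r =>
    ENNReal.ofReal (α * Real.sinh (α * r) / (Real.cosh (α * R) - 1)) := by
  fun_prop

theorem isProbabilityMeasure_radialLaw (hα : 0 < α) (hR : 0 < R) :
    IsProbabilityMeasure (radialLaw α R) := by
  refine ⟨?_⟩
  have hc := cosh_sub_one_pos hα hR
  have hint : ∫ r in (0 : ℝ)..R, α * Real.sinh (α * r) / (Real.cosh (α * R) - 1) = 1 := by
    rw [intervalIntegral.integral_eq_sub_of_hasDerivAt
      (f := fun r => Real.cosh (α * r) / (Real.cosh (α * R) - 1)) (fun r _ => by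
        have := (((hasDerivAt_id r).const_mul α).cosh).div_const (Real.cosh (α * R) - 1)
        simpa [mul_comm] using this) (Continuous.intervalIntegrable (by fun_prop) _ _)]
    rw [mul_zero, Real.cosh_zero, ← sub_div, div_self hc.ne']
  rw [radialLaw, withDensity_apply _ MeasurableSet.univ, Measure.restrict_univ,
    ← ofReal_integral_eq_lintegral_ofReal]
  · rw [integral_Icc_eq_integral_Ioc, ← intervalIntegral.integral_of_le hR.le, hint,
      ENNReal.ofReal_one]
  · exact (Continuous.continuousOn (by fun_prop)).integrableOn_Icc
  · refine (ae_restrict_iff' measurableSet_Icc).2 (Filter.Eventually.of_forall fun r hr => ?_)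
    exact div_nonneg (mul_nonneg hα.le (Real.sinh_nonneg_iff.2 (mul_nonneg hα.le hr.1))) hc.le

theorem ae_radialLaw (α R : ℝ) : ∀ᵐ r ∂radialLaw α R, r ∈ Set.Icc 0 R :=
  (withDensity_absolutelyContinuous _ _).ae_le (ae_restrict_mem measurableSet_Icc)

theorem ae_angularLaw : ∀ᵐ φ ∂angularLaw, φ ∈ Set.Ico 0 (2 * Real.pi) :=
  Measure.ae_smul_measure (ae_restrict_mem measurableSet_Ico) _

theorem four_le_exp (hα : 1 / 2 < α) (hR : 4 ≤ R) : 4 ≤ Real.exp (α * R) := by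
  have h1 : (2 : ℝ) ≤ Real.exp 1 := by linarith [Real.add_one_le_exp (1 : ℝ)]
  have h2 : Real.exp (1 + 1) ≤ Real.exp (α * R) := Real.exp_le_exp.2 (by nlinarith)
  rw [Real.exp_add] at h2
  nlinarith

theorem radialDensity_le (hα : 1 / 2 < α) (hα1 : α < 1) (hR : 4 ≤ R) (r : ℝ) :
    α * Real.sinh (α * r) / (Real.cosh (α * R) - 1) ≤ 2 * Real.exp (α * (r - R)) := by
  have h4 := four_le_exp hα hR
  have hc := cosh_sub_one_pos (α := α) (R := R) (by linarith) (by linarith)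
  rw [div_le_iff₀ hc, mul_sub α, Real.exp_sub]
  have hcosh : Real.exp (α * R) / 4 ≤ Real.cosh (α * R) - 1 := by
    rw [Real.cosh_eq]
    linarith [Real.exp_pos (-(α * R))]
  calc α * Real.sinh (α * r) ≤ α * (Real.exp (α * r) / 2) := by
        refine mul_le_mul_of_nonneg_left ?_ (by linarith)
        rw [Real.sinh_eq]
        linarith [Real.exp_pos (-(α * r))]
    _ ≤ Real.exp (α * r) / 2 := mul_le_of_le_one_left (by positivity) hα1.le
    _ = 2 * (Real.exp (α * r) / Real.exp (α * R)) * (Real.exp (α * R) / 4) := by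
      field_simp
      norm_num
    _ ≤ _ := mul_le_mul_of_nonneg_left hcosh (by positivity)

theorem lintegral_radialLaw_le (hα : 1 / 2 < α) (hα1 : α < 1) (hR : 4 ≤ R) (f : ℝ → ℝ≥0∞) :
    ∫⁻ r, f r ∂radialLaw α R ≤
      ∫⁻ r in Set.Icc 0 R, ENNReal.ofReal (2 * Real.exp (α * (r - R))) * f r := by
  refine (lintegral_withDensity_le_lintegral_mul _ (measurable_radialDensity α R) f).trans ?_
  exact lintegral_mono fun r =>
    mul_le_mul_left (ENNReal.ofReal_le_ofReal (radialDensity_le hα hα1 hR r)) (f r)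

theorem lintegral_exp_le {β r : ℝ} (hβ : 0 < β) (hr : 0 ≤ r) :
    ∫⁻ s in Set.Icc 0 r, ENNReal.ofReal (Real.exp (β * s)) ≤
      ENNReal.ofReal (Real.exp (β * r) / β) := by
  have hint : ∫ s in (0 : ℝ)..r, Real.exp (β * s) = Real.exp (β * r) / β - 1 / β := by
    rw [intervalIntegral.integral_eq_sub_of_hasDerivAt (f := fun s => Real.exp (β * s) / β)
      (fun s _ => by
        have := (((hasDerivAt_id s).const_mul β).exp).div_const β
        simpa [hβ.ne'] using this) (Continuous.intervalIntegrable (by fun_prop) _ _)]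
    simp
  rw [← ofReal_integral_eq_lintegral_ofReal]
  · rw [integral_Icc_eq_integral_Ioc, ← intervalIntegral.integral_of_le hr, hint]
    refine ENNReal.ofReal_le_ofReal ?_
    have : 0 ≤ 1 / β := by positivity
    linarith
  · exact (Continuous.continuousOn (by fun_prop)).integrableOn_Icc
  · exact Filter.Eventually.of_forall fun s => (Real.exp_pos _).le

/-! ### The angle between adjacent points -/

theorem lor_polar_eq (p q : ℝ × ℝ) : lor (polar p) (polar q) =
    Real.cosh (p.1 + q.1) * Real.sin ((p.2 - q.2) / 2) ^ 2 +
      Real.cosh (p.1 - q.1) * Real.cos ((p.2 - q.2) / 2) ^ 2 := by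
  have h1 : Real.cos (p.2 - q.2) = 2 * Real.cos ((p.2 - q.2) / 2) ^ 2 - 1 := by
    rw [← Real.cos_two_mul]; ring_nf
  rw [lor_polar, h1, Real.sin_sq, Real.cosh_add, Real.cosh_sub]
  ring

theorem abs_sin_le_of_lor_le {p q : ℝ × ℝ} (h : lor (polar p) (polar q) ≤ Real.cosh R) (hR : 0 ≤ R) :
    |Real.sin ((p.2 - q.2) / 2)| ≤ 3 / 2 * Real.exp ((R - p.1 - q.1) / 2) := by
  rw [lor_polar_eq] at h
  have h1 : 0 ≤ Real.cosh (p.1 - q.1) * Real.cos ((p.2 - q.2) / 2) ^ 2 :=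
    mul_nonneg (Real.cosh_pos _).le (sq_nonneg _)
  have h2 : Real.exp (p.1 + q.1) / 2 ≤ Real.cosh (p.1 + q.1) := by
    rw [Real.cosh_eq]
    linarith [Real.exp_pos (-(p.1 + q.1))]
  have h3 : Real.cosh R ≤ Real.exp R := by
    rw [Real.cosh_eq]
    linarith [Real.exp_le_exp.2 (show -R ≤ R by linarith)]
  have h4 : Real.exp (p.1 + q.1) / 2 * Real.sin ((p.2 - q.2) / 2) ^ 2 ≤ Real.exp R := by
    have := mul_le_mul_of_nonneg_right h2 (sq_nonneg (Real.sin ((p.2 - q.2) / 2)))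
    linarith
  refine abs_le_of_sq_le_sq ?_ (by positivity)
  rw [mul_pow, ← Real.exp_nat_mul]
  have h5 : Real.exp R = Real.exp (p.1 + q.1) * Real.exp (R - p.1 - q.1) := by
    rw [← Real.exp_add]; ring_nf
  rw [h5, div_mul_eq_mul_div, mul_div_assoc] at h4
  have h6 := le_of_mul_le_mul_left h4 (Real.exp_pos _)
  have h7 : ((2 : ℕ) : ℝ) * ((R - p.1 - q.1) / 2) = R - p.1 - q.1 := by push_cast; ring
  rw [h7]
  linarith [Real.exp_pos (R - p.1 - q.1)]

/-- A point of the circle is close to `φ` if its angle is close to `φ` modulo `2 π`. -/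
theorem angularLaw_le {φ η : ℝ} (hφ : φ ∈ Set.Ico 0 (2 * Real.pi)) (hη : 0 ≤ η) :
    angularLaw {ψ | |Real.sin ((φ - ψ) / 2)| ≤ η} ≤ ENNReal.ofReal (3 * η) := by
  have hpi := Real.pi_pos
  have hsub : {ψ | |Real.sin ((φ - ψ) / 2)| ≤ η} ∩ Set.Ico 0 (2 * Real.pi) ⊆
      (Metric.closedBall φ (Real.pi * η) ∪ Metric.closedBall (φ - 2 * Real.pi) (Real.pi * η)) ∪
        Metric.closedBall (φ + 2 * Real.pi) (Real.pi * η) := by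
    rintro ψ ⟨hψ, hψ0, hψ1⟩
    obtain ⟨hφ0, hφ1⟩ := hφ
    have hψ : |Real.sin ((φ - ψ) / 2)| ≤ η := hψ
    have key : ∀ x : ℝ, |x| ≤ Real.pi / 2 → |Real.sin x| ≤ η → |2 * x| ≤ Real.pi * η := by
      intro x hx h
      have := Real.mul_abs_le_abs_sin hx
      rw [abs_mul, abs_two]
      have h1 : 2 / Real.pi * |x| ≤ η := this.trans h
      rw [div_mul_eq_mul_div, div_le_iff₀ hpi] at h1
      linarith
    simp only [Set.mem_union, Metric.mem_closedBall, Real.dist_eq]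
    rcases le_total |(φ - ψ) / 2| (Real.pi / 2) with h | h
    · left; left
      have := key _ h hψ
      rwa [mul_div_cancel₀ _ two_ne_zero, abs_sub_comm] at this
    · rcases le_abs.1 h with h | h
      · left; right
        have := key (Real.pi - (φ - ψ) / 2) (abs_le.2 ⟨by linarith, by linarith⟩)
          (by rwa [Real.sin_pi_sub])
        rw [show ψ - (φ - 2 * Real.pi) = 2 * (Real.pi - (φ - ψ) / 2) by ring]
        exact this
      · right
        have := key ((φ - ψ) / 2 + Real.pi) (abs_le.2 ⟨by linarith, by linarith⟩)
          (by rwa [Real.sin_add_pi, abs_neg])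
        rw [show ψ - (φ + 2 * Real.pi) = -(2 * ((φ - ψ) / 2 + Real.pi)) by ring, abs_neg]
        exact this
  have hvol : volume ({ψ | |Real.sin ((φ - ψ) / 2)| ≤ η} ∩ Set.Ico 0 (2 * Real.pi)) ≤
      ENNReal.ofReal (6 * (Real.pi * η)) := by
    refine (measure_mono hsub).trans ((measure_union_le _ _).trans
      ((add_le_add_left (measure_union_le _ _) _).trans ?_))
    rw [Real.volume_closedBall, Real.volume_closedBall, Real.volume_closedBall,
      ← ENNReal.ofReal_add (by positivity) (by positivity),
      ← ENNReal.ofReal_add (by positivity) (by positivity)]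
    exact ENNReal.ofReal_le_ofReal (by linarith)
  rw [angularLaw, Measure.smul_apply, Measure.restrict_apply' measurableSet_Ico, smul_eq_mul]
  refine (mul_le_mul_right hvol _).trans ?_
  rw [← ENNReal.ofReal_inv_of_pos (by positivity), ← ENNReal.ofReal_mul (by positivity)]
  refine ENNReal.ofReal_le_ofReal (le_of_eq ?_)
  field_simp
  ring

/-- The bound for the angle, interpolated with the trivial bound for probabilities. -/
theorem angularLaw_adj_le {τ : ℝ} (h0 : 0 ≤ τ) (h1 : τ ≤ 1) (hR : 0 ≤ R) (r s : ℝ) {φ : ℝ}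
    (hφ : φ ∈ Set.Ico 0 (2 * Real.pi)) :
    angularLaw {ψ | lor (polar (r, φ)) (polar (s, ψ)) ≤ Real.cosh R} ≤
      ENNReal.ofReal (5 * Real.exp (τ * (R - r - s) / 2)) := by
  rcases le_total 0 (R - r - s) with h | h
  · refine prob_le_one.trans ?_
    rw [ENNReal.one_le_ofReal]
    have : 1 ≤ Real.exp (τ * (R - r - s) / 2) := Real.one_le_exp (by positivity)
    linarith
  · have hle : Real.exp ((R - r - s) / 2) ≤ Real.exp (τ * (R - r - s) / 2) :=
      Real.exp_le_exp.2 (by nlinarith)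
    have hsub : {ψ | lor (polar (r, φ)) (polar (s, ψ)) ≤ Real.cosh R} ⊆
        {ψ | |Real.sin ((φ - ψ) / 2)| ≤ 3 / 2 * Real.exp ((R - r - s) / 2)} := fun ψ hψ =>
      abs_sin_le_of_lor_le (p := (r, φ)) (q := (s, ψ)) hψ hR
    refine (measure_mono hsub).trans ((angularLaw_le hφ (by positivity)).trans (ENNReal.ofReal_le_ofReal ?_))
    linarith [Real.exp_pos ((R - r - s) / 2)]

end

/-! ### Moments of numbers of neighbors -/

/-- Conditionally on one of the points, the others are independent. -/
theorem pi_forall_mem {X : Type*} [MeasurableSpace X] (μ : Measure X) [IsProbabilityMeasure μ] {k : ℕ}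
    (v : Fin (k + 1)) {E : Set (X × X)} (hE : MeasurableSet E) (S : Finset (Fin k)) :
    (Measure.pi fun _ : Fin (k + 1) => μ) {p | ∀ w ∈ S, (p v, p (v.succAbove w)) ∈ E} =
      ∫⁻ x, μ {y | (x, y) ∈ E} ^ S.card ∂μ := by
  classical
  have hA : MeasurableSet {z : X × (Fin k → X) | ∀ w ∈ S, (z.1, z.2 w) ∈ E} := by
    have : {z : X × (Fin k → X) | ∀ w ∈ S, (z.1, z.2 w) ∈ E} =
        ⋂ w ∈ S, (fun z : X × (Fin k → X) => (z.1, z.2 w)) ⁻¹' E := by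
      ext z; simp
    rw [this]
    exact Finset.measurableSet_biInter S fun w _ =>
      (measurable_fst.prodMk ((measurable_pi_apply w).comp measurable_snd)) hE
  have h := (measurePreserving_piFinSuccAbove (fun _ : Fin (k + 1) => μ) v).measure_preimage
    hA.nullMeasurableSet
  have hset : (MeasurableEquiv.piFinSuccAbove (fun _ : Fin (k + 1) => X) v) ⁻¹'
      {z : X × (Fin k → X) | ∀ w ∈ S, (z.1, z.2 w) ∈ E} =
      {p | ∀ w ∈ S, (p v, p (v.succAbove w)) ∈ E} := rfl
  rw [hset] at h
  rw [h, Measure.prod_apply hA]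
  refine lintegral_congr fun x => ?_
  have hpi : Prod.mk x ⁻¹' {z : X × (Fin k → X) | ∀ w ∈ S, (z.1, z.2 w) ∈ E} =
      Set.univ.pi fun w => if w ∈ S then {y | (x, y) ∈ E} else Set.univ := by
    ext q
    simp only [Set.mem_preimage, Set.mem_ofPred_eq, Set.mem_univ_pi]
    refine forall_congr' fun w => ?_
    split_ifs with hw <;> simp [hw]
  rw [hpi, Measure.pi_pi]
  simp only [apply_ite μ, measure_univ]
  rw [Finset.prod_ite, Finset.prod_const, Finset.prod_const_one, mul_one, Finset.filter_mem_eq_inter,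
    Finset.univ_inter]

theorem measurableSet_forall_mem {X : Type*} [MeasurableSpace X] {k : ℕ} (v : Fin (k + 1))
    {E : Set (X × X)} (hE : MeasurableSet E) (S : Finset (Fin k)) :
    MeasurableSet {p : Fin (k + 1) → X | ∀ w ∈ S, (p v, p (v.succAbove w)) ∈ E} := by
  have : {p : Fin (k + 1) → X | ∀ w ∈ S, (p v, p (v.succAbove w)) ∈ E} =
      ⋂ w ∈ S, (fun p : Fin (k + 1) → X => (p v, p (v.succAbove w))) ⁻¹' E := by
    ext z; simp
  rw [this]
  exact Finset.measurableSet_biInter S fun w _ =>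
    ((measurable_pi_apply _).prodMk (measurable_pi_apply _)) hE

section

variable {X : Type*} {k : ℕ}

open Classical in
/-- The number of the points that are in the relation `E` to the point `p v`. -/
noncomputable def count (E : Set (X × X)) (v : Fin (k + 1)) (p : Fin (k + 1) → X) : ℕ :=
  (Finset.univ.filter fun w : Fin k => (p v, p (v.succAbove w)) ∈ E).card

theorem choose_count (E : Set (X × X)) (v : Fin (k + 1)) (j : ℕ) (p : Fin (k + 1) → X) :
    ((count E v p).choose j : ℝ≥0∞) = ∑ S ∈ Finset.powersetCard j (Finset.univ : Finset (Fin k)),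
      {p : Fin (k + 1) → X | ∀ w ∈ S, (p v, p (v.succAbove w)) ∈ E}.indicator 1 p := by
  classical
  rw [count, ← Finset.card_powersetCard, Finset.card_eq_sum_ones, Nat.cast_sum]
  have : Finset.powersetCard j (Finset.univ.filter fun w : Fin k => (p v, p (v.succAbove w)) ∈ E) =
      (Finset.powersetCard j (Finset.univ : Finset (Fin k))).filter
        fun S => ∀ w ∈ S, (p v, p (v.succAbove w)) ∈ E := by
    ext S
    simp only [Finset.mem_powersetCard, Finset.mem_filter, Finset.subset_iff, Finset.mem_univ, true_and,
      implies_true, and_comm]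
  rw [this, Finset.sum_filter]
  refine Finset.sum_congr rfl fun S _ => ?_
  simp [Set.indicator_apply]

theorem measurable_choose_count [MeasurableSpace X] {E : Set (X × X)} (hE : MeasurableSet E)
    (v : Fin (k + 1)) (j : ℕ) :
    Measurable fun p => ((count E v p).choose j : ℝ≥0∞) := by
  simp only [choose_count]
  exact Finset.measurable_sum _ fun S _ =>
    measurable_one.indicator (measurableSet_forall_mem v hE S)

/-- The factorial moments of a number of neighbors. -/
theorem lintegral_choose_count [MeasurableSpace X] (μ : Measure X) [IsProbabilityMeasure μ]
    {E : Set (X × X)} (hE : MeasurableSet E) (v : Fin (k + 1)) (j : ℕ) :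
    ∫⁻ p, ((count E v p).choose j : ℝ≥0∞) ∂(Measure.pi fun _ : Fin (k + 1) => μ) =
      k.choose j * ∫⁻ x, μ {y | (x, y) ∈ E} ^ j ∂μ := by
  simp only [choose_count]
  rw [lintegral_finsetSum _ fun S _ =>
    measurable_one.indicator (measurableSet_forall_mem v hE S)]
  have : ∀ S ∈ Finset.powersetCard j (Finset.univ : Finset (Fin k)),
      ∫⁻ p, {p : Fin (k + 1) → X | ∀ w ∈ S, (p v, p (v.succAbove w)) ∈ E}.indicator 1 p
        ∂(Measure.pi fun _ : Fin (k + 1) => μ) = ∫⁻ x, μ {y | (x, y) ∈ E} ^ j ∂μ := by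
    intro S hS
    rw [lintegral_indicator_one (measurableSet_forall_mem v hE S), pi_forall_mem μ v hE,
      (Finset.mem_powersetCard.1 hS).2]
  rw [Finset.sum_congr rfl this, Finset.sum_const, Finset.card_powersetCard, Finset.card_univ,
    Fintype.card_fin, nsmul_eq_mul]

end

theorem continuous_polar : Continuous polar := by
  refine continuous_pi fun i => ?_
  fin_cases i <;> simp only [polar] <;> dsimp <;> fun_prop

theorem continuous_lor_polar :
    Continuous fun z : (ℝ × ℝ) × (ℝ × ℝ) => lor (polar z.1) (polar z.2) := by
  have h1 : ∀ i, Continuous fun z : (ℝ × ℝ) × (ℝ × ℝ) => polar z.1 i := fun i =>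
    (continuous_apply i).comp (continuous_polar.comp continuous_fst)
  have h2 : ∀ i, Continuous fun z : (ℝ × ℝ) × (ℝ × ℝ) => polar z.2 i := fun i =>
    (continuous_apply i).comp (continuous_polar.comp continuous_snd)
  unfold lor
  exact (((h1 0).mul (h2 0)).sub ((h1 1).mul (h2 1))).sub ((h1 2).mul (h2 2))

/-- The pairs of points at distance at most `R`. -/
def close (R : ℝ) : Set ((ℝ × ℝ) × (ℝ × ℝ)) := {z | lor (polar z.1) (polar z.2) ≤ Real.cosh R}

/-- The pairs of points at distance at most `R` such that the second point is not farther from the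
origin than the first one. -/
def closeBelow (R : ℝ) : Set ((ℝ × ℝ) × (ℝ × ℝ)) := close R ∩ {z | z.2.1 ≤ z.1.1}

theorem measurableSet_close (R : ℝ) : MeasurableSet (close R) :=
  (isClosed_le continuous_lor_polar continuous_const).measurableSet

theorem measurableSet_closeBelow (R : ℝ) : MeasurableSet (closeBelow R) :=
  (measurableSet_close R).inter
    (isClosed_le (by fun_prop) (by fun_prop)).measurableSet

section

variable {α R : ℝ}

/-- The law of a random point. -/
noncomputable def pointLaw (α R : ℝ) : Measure (ℝ × ℝ) := (radialLaw α R).prod angularLaw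

theorem isProbabilityMeasure_pointLaw (hα : 0 < α) (hR : 0 < R) :
    IsProbabilityMeasure (pointLaw α R) := by
  have := isProbabilityMeasure_radialLaw hα hR
  unfold pointLaw
  infer_instance

theorem ae_pointLaw (hα : 0 < α) (hR : 0 < R) :
    ∀ᵐ x ∂pointLaw α R, x.1 ∈ Set.Icc 0 R ∧ x.2 ∈ Set.Ico 0 (2 * Real.pi) := by
  have := isProbabilityMeasure_radialLaw hα hR
  exact (Measure.quasiMeasurePreserving_fst.ae (ae_radialLaw α R)).and
    (Measure.quasiMeasurePreserving_snd.ae ae_angularLaw)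

theorem pointLaw_closeBelow_le {τ : ℝ} (hα : 1 / 2 < α) (hα1 : α < 1) (hR : 4 ≤ R) (h0 : 0 ≤ τ)
    (h1 : τ ≤ 1) {x : ℝ × ℝ} (hx : x.1 ∈ Set.Icc 0 R) (hx' : x.2 ∈ Set.Ico 0 (2 * Real.pi)) :
    pointLaw α R {y | (x, y) ∈ closeBelow R} ≤
      ENNReal.ofReal (10 / (α - τ / 2) * Real.exp ((τ / 2 - α) * R + (α - τ) * x.1)) := by
  obtain ⟨r, φ⟩ := x
  dsimp only at hx hx' ⊢
  have hβ : 0 < α - τ / 2 := by linarith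
  have hm : MeasurableSet {y | ((r, φ), y) ∈ closeBelow R} :=
    measurable_prodMk_left (measurableSet_closeBelow R)
  rw [pointLaw, Measure.prod_apply hm]
  have hsec : ∀ s, angularLaw (Prod.mk s ⁻¹' {y | ((r, φ), y) ∈ closeBelow R}) ≤
      (Set.Iic r).indicator (fun s => ENNReal.ofReal (5 * Real.exp (τ * (R - r - s) / 2))) s := by
    intro s
    by_cases hs : s ∈ Set.Iic r
    · rw [Set.indicator_of_mem hs]
      exact (measure_mono fun ψ hψ => hψ.1).trans
        (angularLaw_adj_le h0 h1 (by linarith) r s hx')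
    · rw [Set.indicator_of_notMem hs, nonpos_iff_eq_zero, ← measure_empty (μ := angularLaw)]
      congr 1
      ext ψ
      exact ⟨fun h => hs h.2, fun h => h.elim⟩
  refine (lintegral_mono hsec).trans ((lintegral_radialLaw_le hα hα1 hR _).trans ?_)
  have hstep : ∀ s, ENNReal.ofReal (2 * Real.exp (α * (s - R))) *
      (Set.Iic r).indicator (fun s => ENNReal.ofReal (5 * Real.exp (τ * (R - r - s) / 2))) s =
      (Set.Iic r).indicator (fun s => ENNReal.ofReal (10 * Real.exp ((τ / 2 - α) * R - τ / 2 * r)) *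
        ENNReal.ofReal (Real.exp ((α - τ / 2) * s))) s := by
    intro s
    by_cases hs : s ∈ Set.Iic r
    · rw [Set.indicator_of_mem hs, Set.indicator_of_mem hs, ← ENNReal.ofReal_mul (by positivity),
        ← ENNReal.ofReal_mul (by positivity), mul_mul_mul_comm, mul_assoc 10, ← Real.exp_add,
        ← Real.exp_add]
      ring_nf
    · rw [Set.indicator_of_notMem hs, Set.indicator_of_notMem hs, mul_zero]
  simp only [hstep]
  rw [lintegral_indicator measurableSet_Iic, Measure.restrict_restrict measurableSet_Iic]
  have hset : Set.Iic r ∩ Set.Icc 0 R = Set.Icc 0 r := by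
    ext s
    simp only [Set.mem_inter_iff, Set.mem_Iic, Set.mem_Icc]
    constructor
    · rintro ⟨h, h', -⟩; exact ⟨h', h⟩
    · rintro ⟨h, h'⟩; exact ⟨h', h, h'.trans hx.2⟩
  rw [hset, lintegral_const_mul _ (by fun_prop)]
  refine (mul_le_mul_right (lintegral_exp_le hβ hx.1) _).trans ?_
  rw [← ENNReal.ofReal_mul (by positivity)]
  refine ENNReal.ofReal_le_ofReal (le_of_eq ?_)
  rw [show (τ / 2 - α) * R + (α - τ) * r = (τ / 2 - α) * R - τ / 2 * r + (α - τ / 2) * r by ring,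
    Real.exp_add]
  ring

theorem lintegral_closeBelow_le {τ : ℝ} (hα : 1 / 2 < α) (hα1 : α < 1) (hR : 4 ≤ R) (h0 : 0 ≤ τ)
    (h1 : τ ≤ 1) (hτ : 0 < 5 * α - 4 * τ) :
    ∫⁻ x, pointLaw α R {y | (x, y) ∈ closeBelow R} ^ 4 ∂pointLaw α R ≤
      ENNReal.ofReal (2 * (10 / (α - τ / 2)) ^ 4 / (5 * α - 4 * τ) * Real.exp (-2 * τ * R)) := by
  have := isProbabilityMeasure_radialLaw (α := α) (R := R) (by linarith) (by linarith)
  have hβ : 0 < α - τ / 2 := by linarith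
  set D := 10 / (α - τ / 2) with hD
  have hD0 : 0 < D := by positivity
  have hle : ∀ᵐ x ∂pointLaw α R, pointLaw α R {y | (x, y) ∈ closeBelow R} ^ 4 ≤
      ENNReal.ofReal (D * Real.exp ((τ / 2 - α) * R + (α - τ) * x.1)) ^ 4 := by
    filter_upwards [ae_pointLaw (α := α) (R := R) (by linarith) (by linarith)] with x hx
    exact pow_le_pow_left' (pointLaw_closeBelow_le hα hα1 hR h0 h1 hx.1 hx.2) 4
  refine (lintegral_mono_ae hle).trans ?_
  have hfst : ∫⁻ x, ENNReal.ofReal (D * Real.exp ((τ / 2 - α) * R + (α - τ) * x.1)) ^ 4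
      ∂pointLaw α R = ∫⁻ r, ENNReal.ofReal (D * Real.exp ((τ / 2 - α) * R + (α - τ) * r)) ^ 4
      ∂radialLaw α R := by
    rw [pointLaw, lintegral_prod _ (by fun_prop)]
    simp
  rw [hfst]
  refine (lintegral_radialLaw_le hα hα1 hR _).trans ?_
  have hstep : ∀ r, ENNReal.ofReal (2 * Real.exp (α * (r - R))) *
      ENNReal.ofReal (D * Real.exp ((τ / 2 - α) * R + (α - τ) * r)) ^ 4 =
      ENNReal.ofReal (2 * D ^ 4 * Real.exp ((2 * τ - 5 * α) * R)) *
        ENNReal.ofReal (Real.exp ((5 * α - 4 * τ) * r)) := by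
    intro r
    rw [← ENNReal.ofReal_pow (by positivity), ← ENNReal.ofReal_mul (by positivity),
      ← ENNReal.ofReal_mul (by positivity), mul_pow, ← Real.exp_nat_mul, mul_mul_mul_comm,
      mul_assoc (2 * D ^ 4), ← Real.exp_add, ← Real.exp_add]
    push_cast
    ring_nf
  simp only [hstep]
  rw [lintegral_const_mul _ (by fun_prop)]
  refine (mul_le_mul_right (lintegral_exp_le hτ (by linarith)) _).trans ?_
  rw [← ENNReal.ofReal_mul (by positivity)]
  refine ENNReal.ofReal_le_ofReal (le_of_eq ?_)
  rw [show -2 * τ * R = (2 * τ - 5 * α) * R + (5 * α - 4 * τ) * R by ring, Real.exp_add]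
  ring

end

/-! ### The expected number of edges -/

section

variable {α R : ℝ}

theorem radialDensity_ge (hα : 1 / 2 < α) (hα1 : α < 1) (hR : 4 ≤ R) {r : ℝ} (hr : R - 1 ≤ r) :
    1 / 12 ≤ α * Real.sinh (α * r) / (Real.cosh (α * R) - 1) := by
  have hc := cosh_sub_one_pos (α := α) (R := R) (by linarith) (by linarith)
  rw [le_div_iff₀ hc]
  have h1 : Real.cosh (α * R) - 1 ≤ Real.exp (α * R) / 2 := by
    rw [Real.cosh_eq]
    have : Real.exp (-(α * R)) ≤ 1 := Real.exp_le_one_iff.2 (by nlinarith)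
    linarith
  have h2 : Real.exp (α * r) / 4 ≤ Real.sinh (α * r) := by
    have h3 : 2 * (α * r) + 1 ≤ Real.exp (2 * (α * r)) := Real.add_one_le_exp _
    have h4 : 3 ≤ 2 * (α * r) := by nlinarith
    have h5 : Real.exp (2 * (α * r)) = Real.exp (α * r) * Real.exp (α * r) := by
      rw [← Real.exp_add]; ring_nf
    have h6 : Real.exp (α * r) * Real.exp (-(α * r)) = 1 := by
      rw [← Real.exp_add, add_neg_cancel, Real.exp_zero]
    have h7 : 2 * Real.exp (-(α * r)) ≤ Real.exp (α * r) := by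
      nlinarith [Real.exp_pos (-(α * r)), Real.exp_pos (α * r)]
    rw [Real.sinh_eq]
    linarith
  have h3 : Real.exp (α * R) ≤ 3 * Real.exp (α * r) := by
    calc Real.exp (α * R) ≤ Real.exp (1 + α * r) := Real.exp_le_exp.2 (by nlinarith)
      _ = Real.exp 1 * Real.exp (α * r) := Real.exp_add _ _
      _ ≤ _ := mul_le_mul_of_nonneg_right (by linarith [Real.exp_one_lt_d9]) (Real.exp_pos _).le
  nlinarith [Real.exp_pos (α * r)]

/-- The points in an annulus of width `1` at the boundary have a positive fraction of the mass. -/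
theorem radialLaw_ge (hα : 1 / 2 < α) (hα1 : α < 1) (hR : 4 ≤ R) :
    ENNReal.ofReal (1 / 12) ≤ radialLaw α R (Set.Icc (R - 1) R) := by
  rw [radialLaw, withDensity_apply _ measurableSet_Icc, Measure.restrict_restrict measurableSet_Icc,
    Set.inter_eq_left.2 (Set.Icc_subset_Icc_left (by linarith))]
  calc ENNReal.ofReal (1 / 12) = ∫⁻ _ in Set.Icc (R - 1) R, ENNReal.ofReal (1 / 12) := by
        rw [setLIntegral_const, Real.volume_Icc, sub_sub_cancel, ENNReal.ofReal_one, mul_one]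
    _ ≤ _ := setLIntegral_mono (measurable_radialDensity α R) fun r hr =>
        ENNReal.ofReal_le_ofReal (radialDensity_ge hα hα1 hR hr.1)

theorem angularLaw_ge {φ t : ℝ} (hφ : φ ∈ Set.Ico 0 (2 * Real.pi)) (h1 : t ≤ 1) :
    ENNReal.ofReal (t / (2 * Real.pi)) ≤ angularLaw {ψ | |φ - ψ| ≤ t} := by
  have hpi := Real.pi_gt_three
  have h : ENNReal.ofReal t ≤ volume ({ψ | |φ - ψ| ≤ t} ∩ Set.Ico 0 (2 * Real.pi)) := by
    rcases le_total φ Real.pi with h | h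
    · have : Set.Ico φ (φ + t) ⊆ {ψ | |φ - ψ| ≤ t} ∩ Set.Ico 0 (2 * Real.pi) := by
        rintro ψ ⟨h3, h4⟩
        refine ⟨show |φ - ψ| ≤ t from abs_le.2 ⟨by linarith, by linarith⟩, hφ.1.trans h3, ?_⟩
        linarith
      refine le_trans (le_of_eq ?_) (measure_mono this)
      rw [Real.volume_Ico, add_sub_cancel_left]
    · have : Set.Ioc (φ - t) φ ⊆ {ψ | |φ - ψ| ≤ t} ∩ Set.Ico 0 (2 * Real.pi) := by
        rintro ψ ⟨h3, h4⟩
        refine ⟨show |φ - ψ| ≤ t from abs_le.2 ⟨by linarith, by linarith⟩, ?_, h4.trans_lt hφ.2⟩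
        linarith
      refine le_trans (le_of_eq ?_) (measure_mono this)
      rw [Real.volume_Ioc, sub_sub_cancel]
  rw [angularLaw, Measure.smul_apply, Measure.restrict_apply' measurableSet_Ico, smul_eq_mul]
  refine le_trans (le_of_eq ?_) (mul_le_mul_right h _)
  rw [← ENNReal.ofReal_inv_of_pos (by positivity), ← ENNReal.ofReal_mul (by positivity),
    div_eq_inv_mul]

theorem lor_le_of_angle_le (hR : 4 ≤ R) {x y : ℝ × ℝ} (hx : x.1 ∈ Set.Icc (R - 1) R)
    (hy : y.1 ∈ Set.Icc (R - 1) R) (h : |x.2 - y.2| ≤ Real.exp (-R / 2)) :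
    lor (polar x) (polar y) ≤ Real.cosh R := by
  rw [lor_polar_eq]
  have h1 : Real.cosh (x.1 + y.1) ≤ Real.exp (2 * R) := by
    rw [Real.cosh_eq]
    have h1 : Real.exp (x.1 + y.1) ≤ Real.exp (2 * R) :=
      Real.exp_le_exp.2 (by linarith [hx.2, hy.2])
    have h2 : Real.exp (-(x.1 + y.1)) ≤ Real.exp (2 * R) :=
      Real.exp_le_exp.2 (by linarith [hx.1, hy.1])
    linarith
  have h2 : Real.sin ((x.2 - y.2) / 2) ^ 2 ≤ Real.exp (-R) / 4 := by
    refine Real.sin_sq_le_sq.trans ?_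
    have h3 := pow_le_pow_left₀ (abs_nonneg _) h 2
    rw [sq_abs, ← Real.exp_nat_mul] at h3
    have h4 : ((2 : ℕ) : ℝ) * (-R / 2) = -R := by push_cast; ring
    rw [h4] at h3
    nlinarith
  have h3 : Real.cosh (x.1 - y.1) ≤ Real.exp 1 := by
    refine (Real.cosh_le_cosh.2 (show |x.1 - y.1| ≤ |1| from ?_)).trans ?_
    · rw [abs_one]
      exact abs_le.2 ⟨by linarith [hx.1, hy.2], by linarith [hy.1, hx.2]⟩
    · rw [Real.cosh_eq]
      linarith [Real.exp_le_exp.2 (show (-1 : ℝ) ≤ 1 by norm_num)]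
  have h4 : Real.exp 1 ≤ Real.exp R / 4 := by
    have : Real.exp (3 + 1) ≤ Real.exp R := Real.exp_le_exp.2 (by linarith)
    rw [Real.exp_add] at this
    have := Real.add_one_le_exp (3 : ℝ)
    nlinarith [Real.exp_pos 1]
  have h5 : Real.exp R / 2 ≤ Real.cosh R := by
    rw [Real.cosh_eq]
    linarith [Real.exp_pos (-R)]
  have h6 : Real.cosh (x.1 + y.1) * Real.sin ((x.2 - y.2) / 2) ^ 2 ≤ Real.exp R / 4 := by
    refine (mul_le_mul h1 h2 (sq_nonneg _) (Real.exp_pos _).le).trans (le_of_eq ?_)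
    rw [mul_div_assoc', ← Real.exp_add]
    ring_nf
  have h7 : Real.cosh (x.1 - y.1) * Real.cos ((x.2 - y.2) / 2) ^ 2 ≤ Real.exp 1 :=
    (mul_le_of_le_one_right (Real.cosh_pos _).le (Real.cos_sq_le_one _)).trans h3
  linarith

theorem lintegral_close_ge (hα : 1 / 2 < α) (hα1 : α < 1) (hR : 4 ≤ R) :
    ENNReal.ofReal (Real.exp (-R / 2) / 1000) ≤
      ∫⁻ x, pointLaw α R {y | (x, y) ∈ close R} ∂pointLaw α R := by
  have := isProbabilityMeasure_radialLaw (α := α) (R := R) (by linarith) (by linarith)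
  set I := Set.Icc (R - 1) R with hI
  set t := Real.exp (-R / 2) with ht
  have ht0 : 0 < t := Real.exp_pos _
  have ht1 : t ≤ 1 := Real.exp_le_one_iff.2 (by linarith)
  have hpi := Real.pi_pos
  have hpi4 : Real.pi < 3.15 := Real.pi_lt_d2
  have hle : ∀ᵐ x ∂pointLaw α R, (I ×ˢ Set.univ).indicator
      (fun _ => ENNReal.ofReal (1 / 12 * (t / (2 * Real.pi)))) x ≤
      pointLaw α R {y | (x, y) ∈ close R} := by
    filter_upwards [ae_pointLaw (α := α) (R := R) (by linarith) (by linarith)] with x hx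
    by_cases hxI : x ∈ I ×ˢ (Set.univ : Set ℝ)
    · rw [Set.indicator_of_mem hxI, ENNReal.ofReal_mul (by positivity)]
      refine (mul_le_mul' (radialLaw_ge hα hα1 hR) (angularLaw_ge hx.2 ht1)).trans ?_
      rw [← Measure.prod_prod, ← pointLaw]
      exact measure_mono fun y hy => lor_le_of_angle_le hR hxI.1 hy.1 hy.2
    · rw [Set.indicator_of_notMem hxI]
      exact zero_le
  refine le_trans ?_ (lintegral_mono_ae hle)
  rw [lintegral_indicator (measurableSet_Icc.prod MeasurableSet.univ), setLIntegral_const, pointLaw,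
    Measure.prod_prod, measure_univ, mul_one]
  refine le_trans ?_ (mul_le_mul_right (radialLaw_ge hα hα1 hR) _)
  rw [← ENNReal.ofReal_mul (by positivity)]
  refine ENNReal.ofReal_le_ofReal ?_
  rw [show 1 / 12 * (t / (2 * Real.pi)) * (1 / 12) = t / (288 * Real.pi) by field_simp; norm_num]
  exact div_le_div_of_nonneg_left ht0.le (by positivity) (by linarith)

end

section

variable {k : ℕ} {R : ℝ}

theorem card_filter_succAbove (v : Fin (k + 1)) (P : Fin (k + 1) → Prop) [DecidablePred P]
    (hv : ¬ P v) : (Finset.univ.filter P).card =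
      (Finset.univ.filter fun w : Fin k => P (v.succAbove w)).card := by
  classical
  rw [← Finset.card_map (v.succAboveEmb)]
  congr 1
  ext w
  simp only [Finset.mem_filter, Finset.mem_univ, true_and, Finset.mem_map, Fin.succAboveEmb_apply]
  constructor
  · intro h
    obtain ⟨u, rfl⟩ := Fin.exists_succAbove_eq (show w ≠ v from fun e => hv (e ▸ h))
    exact ⟨u, h, rfl⟩
  · rintro ⟨u, h, rfl⟩
    exact h

theorem dg_diskGraph (hR : 0 ≤ R) (p : Fin (k + 1) → ℝ × ℝ) (v : Fin (k + 1)) :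
    dg (diskGraph R p) v = count (close R) v p := by
  classical
  rw [dg, count, card_filter_succAbove v _ ((diskGraph R p).loopless.irrefl v)]
  congr 1
  refine Finset.filter_congr fun w _ => ?_
  rw [diskGraph_adj hR]
  exact and_iff_right (Fin.succAbove_ne v w).symm

theorem below_diskGraph (hR : 0 ≤ R) (p : Fin (k + 1) → ℝ × ℝ) (v : Fin (k + 1)) :
    below (diskGraph R p) (fun v => (p v).1) v = count (closeBelow R) v p := by
  classical
  rw [below, count, card_filter_succAbove v _ fun h => (diskGraph R p).loopless.irrefl v h.1]
  congr 1
  refine Finset.filter_congr fun w _ => ?_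
  rw [diskGraph_adj hR]
  exact and_congr_left' (and_iff_right (Fin.succAbove_ne v w).symm)

theorem two_mul_ncard_diskGraph (hR : 0 ≤ R) (p : Fin (k + 1) → ℝ × ℝ) :
    2 * ((diskGraph R p).edgeSet.ncard : ℝ≥0∞) = ∑ v, ((count (close R) v p).choose 1 : ℝ≥0∞) := by
  simp only [Nat.choose_one_right, ← dg_diskGraph hR]
  rw [← Nat.cast_sum, sum_dg]
  push_cast
  rfl

theorem measurable_ncard_diskGraph (hR : 0 ≤ R) :
    Measurable fun p : Fin (k + 1) → ℝ × ℝ => ((diskGraph R p).edgeSet.ncard : ℝ≥0∞) := by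
  have h : (fun p : Fin (k + 1) → ℝ × ℝ => ((diskGraph R p).edgeSet.ncard : ℝ≥0∞)) =
      fun p => 2⁻¹ * ∑ v, ((count (close R) v p).choose 1 : ℝ≥0∞) := by
    funext p
    rw [← two_mul_ncard_diskGraph hR, ← mul_assoc, ENNReal.inv_mul_cancel two_ne_zero
      ENNReal.ofNat_ne_top, one_mul]
  rw [h]
  exact (Finset.measurable_sum _ fun v _ =>
    measurable_choose_count (measurableSet_close R) v 1).const_mul _

end

/-- The expected number of edges is at least linear. -/
theorem le_lintegral_ncard {k : ℕ} {α C : ℝ} (hα : 1 / 2 < α) (hα1 : α < 1)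
    (hR : 4 ≤ diskRadius (k + 1) C) : (k : ℝ≥0∞) * ENNReal.ofReal (Real.exp (-C / 2) / 1000) ≤
      2 * ∫⁻ p, ((diskGraph (diskRadius (k + 1) C) p).edgeSet.ncard : ℝ≥0∞)
        ∂pointsLaw (k + 1) α C := by
  set R := diskRadius (k + 1) C with hRdef
  have := isProbabilityMeasure_pointLaw (α := α) (R := R) (by linarith) (by linarith)
  rw [← lintegral_const_mul' _ _ ENNReal.ofNat_ne_top]
  simp only [two_mul_ncard_diskGraph (show 0 ≤ R by linarith)]
  rw [lintegral_finsetSum _ fun v _ => measurable_choose_count (measurableSet_close R) v 1]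
  have h1 : ∀ v : Fin (k + 1), ∫⁻ p, ((count (close R) v p).choose 1 : ℝ≥0∞)
      ∂pointsLaw (k + 1) α C = k * ∫⁻ x, pointLaw α R {y | (x, y) ∈ close R} ∂pointLaw α R := by
    intro v
    refine (lintegral_choose_count (pointLaw α R) (measurableSet_close R) v 1).trans ?_
    simp
  simp only [h1, Finset.sum_const, Finset.card_univ, Fintype.card_fin, nsmul_eq_mul]
  rw [mul_left_comm]
  refine mul_le_mul_right ?_ _
  refine le_trans (le_of_eq ?_) (mul_le_mul_right (lintegral_close_ge hα hα1 hR) _)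
  rw [← ENNReal.ofReal_natCast, ← ENNReal.ofReal_mul (by positivity)]
  congr 1
  have hk : (0 : ℝ) < ((k + 1 : ℕ) : ℝ) := by positivity
  rw [hRdef, diskRadius, show -(2 * Real.log ((k + 1 : ℕ) : ℝ) + C) / 2 =
    -C / 2 - Real.log ((k + 1 : ℕ) : ℝ) by ring, Real.exp_sub, Real.exp_log hk]
  field_simp

/-! ### The expected running time -/

theorem pow_four_le_choose (d : ℕ) : d ^ 4 ≤ 6144 * (d + d.choose 4) := by
  rcases lt_or_ge d 4 with h | h
  · have h3 : d ^ 3 ≤ 27 := (Nat.pow_le_pow_left (by omega : d ≤ 3) 3).trans (by norm_num)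
    calc d ^ 4 = d ^ 3 * d := by ring
      _ ≤ 27 * d := Nat.mul_le_mul_right _ h3
      _ ≤ _ := by omega
  · have h1 := Nat.pow_sub_le_descFactorial d 4
    have h2 := Nat.descFactorial_eq_factorial_mul_choose d 4
    calc d ^ 4 ≤ (4 * (d + 1 - 4)) ^ 4 := Nat.pow_le_pow_left (by omega) 4
      _ = 256 * (d + 1 - 4) ^ 4 := by ring
      _ ≤ 256 * (24 * d.choose 4) := by
        refine Nat.mul_le_mul_left _ (h1.trans (le_of_eq ?_))
        rw [h2]; rfl
      _ ≤ _ := by omega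

theorem ae_pointsLaw {n : ℕ} {α C : ℝ} (hα : 0 < α) (hR : 0 < diskRadius n C) :
    ∀ᵐ p ∂pointsLaw n α C, ∀ v, (p v).1 ∈ Set.Icc 0 (diskRadius n C) := by
  have := isProbabilityMeasure_pointLaw hα hR
  refine ae_all_iff.2 fun v => ?_
  have h := (measurePreserving_eval (fun _ : Fin n => pointLaw α (diskRadius n C)) v)
  exact (h.quasiMeasurePreserving.ae (ae_pointLaw hα hR)).mono fun p hp => hp.1

theorem below_le_dg {n : ℕ} (G : SimpleGraph (Fin n)) (r : Fin n → ℝ) (v : Fin n) :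
    below G r v ≤ dg G v := by
  classical
  refine Finset.card_le_card fun w hw => ?_
  rw [Finset.mem_filter] at hw ⊢
  exact ⟨hw.1, hw.2.1⟩

theorem dg_le {n : ℕ} (G : SimpleGraph (Fin n)) (v : Fin n) : dg G v ≤ n := by
  classical
  exact (Finset.card_le_univ _).trans_eq (Fintype.card_fin n)

theorem lintegral_graphTime_le {k : ℕ} {α C : ℝ} (hα : 0 < α) (hR : 0 < diskRadius (k + 1) C) :
    ∫⁻ p, graphTime theProg 40 (diskGraph (diskRadius (k + 1) C) p) ∂pointsLaw (k + 1) α C ≤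
      timeFactor * (1 + (k + 1 : ℕ) + 12289 * ∫⁻ p,
        ((diskGraph (diskRadius (k + 1) C) p).edgeSet.ncard : ℝ≥0∞) ∂pointsLaw (k + 1) α C +
        6144 * (((k + 1 : ℕ) : ℝ≥0∞) ^ 5 * ∫⁻ x, pointLaw α (diskRadius (k + 1) C)
          {y | (x, y) ∈ closeBelow (diskRadius (k + 1) C)} ^ 4
          ∂pointLaw α (diskRadius (k + 1) C))) := by
  set R := diskRadius (k + 1) C with hRdef
  have := isProbabilityMeasure_pointLaw hα hR
  have hprob : IsProbabilityMeasure (pointsLaw (k + 1) α C) :=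
    inferInstanceAs (IsProbabilityMeasure (Measure.pi fun _ => pointLaw α R))
  have hle : ∀ᵐ p ∂pointsLaw (k + 1) α C, graphTime theProg 40 (diskGraph R p) ≤
      timeFactor * (1 + (k + 1 : ℕ) + 12289 * ((diskGraph R p).edgeSet.ncard : ℝ≥0∞) +
        6144 * ∑ v, ((count (closeBelow R) v p).choose 4 : ℝ≥0∞)) := by
    filter_upwards [ae_pointsLaw hα hR] with p hp
    refine (graphTime_le_below (vertexElim_diskGraph hp) fun v => (p v).1).trans ?_
    have h1 : ∑ v, below (diskGraph R p) (fun v => (p v).1) v ^ 4 ≤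
        6144 * (2 * (diskGraph R p).edgeSet.ncard) +
          6144 * ∑ v, (count (closeBelow R) v p).choose 4 := by
      rw [← sum_dg, ← mul_add, ← Finset.sum_add_distrib, Finset.mul_sum]
      refine Finset.sum_le_sum fun v _ => (pow_four_le_choose _).trans ?_
      rw [below_diskGraph hR.le]
      have := below_le_dg (diskGraph R p) (fun v => (p v).1) v
      rw [below_diskGraph hR.le] at this
      omega
    have h2 := Nat.mul_le_mul_left timeFactor (show 1 + (k + 1) + (diskGraph R p).edgeSet.ncard +
      ∑ v, below (diskGraph R p) (fun v => (p v).1) v ^ 4 ≤ 1 + (k + 1) +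
        12289 * (diskGraph R p).edgeSet.ncard +
          6144 * ∑ v, (count (closeBelow R) v p).choose 4 by omega)
    exact_mod_cast h2
  refine (lintegral_mono_ae hle).trans ?_
  rw [lintegral_const_mul' _ _ (ENNReal.natCast_ne_top _)]
  refine mul_le_mul_right ?_ _
  have hm := measurable_ncard_diskGraph (k := k) hR.le
  rw [lintegral_add_left (f := fun p => 1 + ((k + 1 : ℕ) : ℝ≥0∞) +
      12289 * ((diskGraph R p).edgeSet.ncard : ℝ≥0∞)) (measurable_const.add (hm.const_mul _)),
    lintegral_add_left measurable_const,
    lintegral_const, measure_univ, mul_one, lintegral_const_mul' _ _ ENNReal.ofNat_ne_top,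
    lintegral_const_mul' _ _ ENNReal.ofNat_ne_top,
    lintegral_finsetSum _ fun v _ => measurable_choose_count (measurableSet_closeBelow R) v 4]
  refine add_le_add_right (mul_le_mul_right ?_ _) _
  have h1 : ∀ v : Fin (k + 1), ∫⁻ p, ((count (closeBelow R) v p).choose 4 : ℝ≥0∞)
      ∂pointsLaw (k + 1) α C ≤ ((k + 1 : ℕ) : ℝ≥0∞) ^ 4 *
        ∫⁻ x, pointLaw α R {y | (x, y) ∈ closeBelow R} ^ 4 ∂pointLaw α R := by
    intro v
    refine (lintegral_choose_count (pointLaw α R) (measurableSet_closeBelow R) v 4).trans_le ?_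
    refine mul_le_mul_left ?_ _
    exact_mod_cast (Nat.choose_le_pow k 4).trans (Nat.pow_le_pow_left (Nat.le_succ k) 4)
  refine (Finset.sum_le_sum fun v _ => h1 v).trans (le_of_eq ?_)
  rw [Finset.sum_const, Finset.card_univ, Fintype.card_fin, nsmul_eq_mul, ← mul_assoc]
  congr 1
  ring

/-- Graphs of bounded size. -/
theorem lintegral_graphTime_le_of_small {n N : ℕ} {α C : ℝ} (hα : 0 < α) (hR : 0 < diskRadius n C)
    (hn : n ≤ N) : ∫⁻ p, graphTime theProg 40 (diskGraph (diskRadius n C) p) ∂pointsLaw n α C ≤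
      (timeFactor * (1 + N + N ^ 2 + N ^ 5) : ℕ) := by
  have := isProbabilityMeasure_pointLaw hα hR
  have hprob : IsProbabilityMeasure (pointsLaw n α C) :=
    inferInstanceAs (IsProbabilityMeasure (Measure.pi fun _ => pointLaw α (diskRadius n C)))
  have hle : ∀ᵐ p ∂pointsLaw n α C, graphTime theProg 40 (diskGraph (diskRadius n C) p) ≤
      (timeFactor * (1 + N + N ^ 2 + N ^ 5) : ℕ) := by
    filter_upwards [ae_pointsLaw hα hR] with p hp
    refine (graphTime_le_below (vertexElim_diskGraph hp) fun v => (p v).1).trans (Nat.cast_le.2 ?_)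
    refine Nat.mul_le_mul_left _ ?_
    have h1 : 2 * (diskGraph (diskRadius n C) p).edgeSet.ncard ≤ N ^ 2 := by
      rw [← sum_dg]
      refine (Finset.sum_le_card_nsmul _ _ _ fun v _ => (dg_le _ v).trans hn).trans ?_
      rw [Finset.card_univ, Fintype.card_fin, smul_eq_mul, sq]
      exact Nat.mul_le_mul_right _ hn
    have h2 : ∑ v, below (diskGraph (diskRadius n C) p) (fun v => (p v).1) v ^ 4 ≤ N ^ 5 := by
      refine (Finset.sum_le_card_nsmul _ _ (N ^ 4) fun v _ => Nat.pow_le_pow_left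
        ((below_le_dg _ _ v).trans ((dg_le _ v).trans hn)) 4).trans ?_
      rw [Finset.card_univ, Fintype.card_fin, smul_eq_mul, pow_succ' N 4]
      exact Nat.mul_le_mul_right _ hn
    omega
  refine (lintegral_mono_ae hle).trans ?_
  rw [lintegral_const, measure_univ, mul_one]

/-- The exponent `τ` with which the bounds for the probability that two points are adjacent are
interpolated balances the vertices close to the origin and those close to the boundary. -/
theorem pow_five_mul_lintegral_le {α : ℝ} (C : ℝ) (hα : 1 / 2 < α) (hα1 : α < 1) : ∃ K : ℝ≥0∞,
    K ≠ ⊤ ∧ ∀ k : ℕ, 4 ≤ diskRadius (k + 1) C →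
      ((k + 1 : ℕ) : ℝ≥0∞) ^ 5 * ∫⁻ x, pointLaw α (diskRadius (k + 1) C)
          {y | (x, y) ∈ closeBelow (diskRadius (k + 1) C)} ^ 4 ∂pointLaw α (diskRadius (k + 1) C) ≤
        K * ((k + 1 : ℕ) + ENNReal.ofReal (((k + 1 : ℕ) : ℝ) ^ (6 * (1 - α)))) := by
  set τ := min 1 ((6 * α - 1) / 4) with hτdef
  have h0 : 0 ≤ τ := le_min zero_le_one (by linarith)
  have h1 : τ ≤ 1 := min_le_left _ _
  have h2 : τ ≤ (6 * α - 1) / 4 := min_le_right _ _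
  have hγ : 0 < 5 * α - 4 * τ := by linarith
  set D := 2 * (10 / (α - τ / 2)) ^ 4 / (5 * α - 4 * τ) with hD
  have hD0 : 0 ≤ D := by positivity
  refine ⟨ENNReal.ofReal (D * Real.exp (-2 * τ * C)), ENNReal.ofReal_ne_top, fun k hR => ?_⟩
  refine (mul_le_mul_right (lintegral_closeBelow_le hα hα1 hR h0 h1 hγ) _).trans ?_
  have hn : (1 : ℝ) ≤ ((k + 1 : ℕ) : ℝ) := by exact_mod_cast Nat.succ_le_succ (Nat.zero_le k)
  rw [← ENNReal.ofReal_natCast (k + 1)]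
  set x : ℝ := ((k + 1 : ℕ) : ℝ) with hx
  have hx0 : 0 < x := by linarith
  rw [← ENNReal.ofReal_pow hx0.le, ← ENNReal.ofReal_mul (by positivity),
    ← ENNReal.ofReal_add hx0.le (by positivity), ← ENNReal.ofReal_mul (by positivity)]
  refine ENNReal.ofReal_le_ofReal ?_
  have hexp : Real.exp (-2 * τ * diskRadius (k + 1) C) = Real.exp (-2 * τ * C) * x ^ (-4 * τ) := by
    rw [diskRadius, Real.rpow_def_of_pos hx0, ← Real.exp_add]
    congr 1
    ring
  have hpow : x ^ 5 * x ^ (-4 * τ) = x ^ (5 - 4 * τ) := by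
    rw [← Real.rpow_natCast, ← Real.rpow_add hx0]
    congr 1
    push_cast
    ring
  have hle : x ^ (5 - 4 * τ) ≤ x + x ^ (6 * (1 - α)) := by
    rcases min_choice 1 ((6 * α - 1) / 4) with h | h
    · rw [hτdef, h, show (5 : ℝ) - 4 * 1 = 1 by norm_num, Real.rpow_one]
      linarith [Real.rpow_nonneg hx0.le (6 * (1 - α))]
    · rw [hτdef, h, show (5 : ℝ) - 4 * ((6 * α - 1) / 4) = 6 * (1 - α) by ring]
      linarith
  calc x ^ 5 * (D * Real.exp (-2 * τ * diskRadius (k + 1) C))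
      = D * Real.exp (-2 * τ * C) * (x ^ 5 * x ^ (-4 * τ)) := by rw [hexp]; ring
    _ ≤ _ := by
      rw [hpow]
      exact mul_le_mul_of_nonneg_left hle (by positivity)

theorem expectedTime_le {α : ℝ} (C : ℝ) (hα : 1 / 2 < α) (hα1 : α < 1) : ∃ K : ℝ, ∀ n : ℕ, 1 ≤ n →
    0 < diskRadius n C →
      ∫⁻ p, graphTime theProg 40 (diskGraph (diskRadius n C) p) ∂pointsLaw n α C ≤
        ENNReal.ofReal K *
          (∫⁻ p, ((diskGraph (diskRadius n C) p).edgeSet.ncard : ℝ≥0∞) ∂pointsLaw n α C +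
            ENNReal.ofReal ((n : ℝ) ^ (6 * (1 - α)))) := by
  obtain ⟨a, ha, hJ⟩ := pow_five_mul_lintegral_le C hα hα1
  set N := ⌈Real.exp ((4 - C) / 2)⌉₊ with hN
  set b : ℝ≥0∞ := ENNReal.ofReal (4000 * Real.exp (C / 2)) with hb
  set K₁ : ℝ≥0∞ := timeFactor * (1 + (1 + 6144 * a) * (b + 1) + 12289 + 6144 * a) with hK₁
  set K₀ : ℝ≥0∞ := ((timeFactor * (1 + N + N ^ 2 + N ^ 5) : ℕ) : ℝ≥0∞) with hK₀
  have hb' : b ≠ ⊤ := ENNReal.ofReal_ne_top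
  have hK₁' : K₁ ≠ ⊤ := by finiteness
  have hK₀' : K₀ ≠ ⊤ := ENNReal.natCast_ne_top _
  refine ⟨(K₁ + K₀).toReal, fun n hn hR => ?_⟩
  rw [ENNReal.ofReal_toReal (ENNReal.add_ne_top.2 ⟨hK₁', hK₀'⟩)]
  have hY : 1 ≤ ENNReal.ofReal ((n : ℝ) ^ (6 * (1 - α))) :=
    ENNReal.one_le_ofReal.2 (Real.one_le_rpow (by exact_mod_cast hn) (by linarith))
  rcases lt_or_ge (diskRadius n C) 4 with h4 | h4
  · have hnN : n ≤ N := by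
      have h1 : Real.log n < (4 - C) / 2 := by rw [diskRadius] at h4; linarith
      rw [Real.log_lt_iff_lt_exp (by exact_mod_cast hn)] at h1
      exact_mod_cast h1.le.trans (Nat.le_ceil _)
    refine (lintegral_graphTime_le_of_small (by linarith) hR hnN).trans ?_
    rw [← hK₀]
    calc K₀ ≤ (K₁ + K₀) * 1 := by rw [mul_one]; exact le_add_self
      _ ≤ _ := mul_le_mul_right (hY.trans le_add_self) _
  obtain ⟨k, rfl⟩ : ∃ k, n = k + 1 := ⟨n - 1, by omega⟩
  refine (lintegral_graphTime_le (by linarith) hR).trans ?_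
  have hJk := hJ k h4
  have hm := le_lintegral_ncard hα hα1 h4
  set X := ∫⁻ p, ((diskGraph (diskRadius (k + 1) C) p).edgeSet.ncard : ℝ≥0∞)
    ∂pointsLaw (k + 1) α C
  set Y := ENNReal.ofReal (((k + 1 : ℕ) : ℝ) ^ (6 * (1 - α)))
  have hnX : ((k + 1 : ℕ) : ℝ≥0∞) ≤ b * X + Y := by
    rcases Nat.eq_zero_or_pos k with rfl | hk
    · simpa using hY.trans le_add_self
    · refine le_trans ?_ le_self_add
      have h1 : ((k + 1 : ℕ) : ℝ≥0∞) ≤ 2 * k := by exact_mod_cast (by omega : k + 1 ≤ 2 * k)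
      have h2 : ENNReal.ofReal (2000 * Real.exp (C / 2)) *
          ENNReal.ofReal (Real.exp (-C / 2) / 1000) = 2 := by
        rw [← ENNReal.ofReal_mul (by positivity), show 2000 * Real.exp (C / 2) *
          (Real.exp (-C / 2) / 1000) = 2 * (Real.exp (C / 2) * Real.exp (-C / 2)) by ring,
          ← Real.exp_add, show C / 2 + -C / 2 = 0 by ring, Real.exp_zero, mul_one]
        simp
      calc ((k + 1 : ℕ) : ℝ≥0∞) ≤ 2 * k := h1
        _ = ENNReal.ofReal (2000 * Real.exp (C / 2)) *
            (k * ENNReal.ofReal (Real.exp (-C / 2) / 1000)) := by rw [← h2]; ring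
        _ ≤ ENNReal.ofReal (2000 * Real.exp (C / 2)) * (2 * X) := mul_le_mul_right hm _
        _ = b * X := by
          rw [hb, show (4000 : ℝ) * Real.exp (C / 2) = 2000 * Real.exp (C / 2) * 2 by ring,
            ENNReal.ofReal_mul (p := 2000 * Real.exp (C / 2)) (by positivity), ENNReal.ofReal_ofNat]
          ring
  refine le_trans ?_ (mul_le_mul_left (le_self_add : K₁ ≤ K₁ + K₀) _)
  calc _ ≤ timeFactor * (Y + (b * X + Y) + 12289 * X + 6144 * (a * ((b * X + Y) + Y))) := by
        have hJ' := hJk.trans (mul_le_mul_right (add_le_add_left hnX Y) a)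
        exact mul_le_mul_right (add_le_add (add_le_add_left (add_le_add hY hnX) _)
          (mul_le_mul_right hJ' _)) _
    _ ≤ timeFactor * (Y + (b * X + Y) + 12289 * X + 6144 * (a * ((b * X + Y) + Y))) +
        timeFactor * (X + (1 + 6144 * a) * (X + b * Y) + 12289 * Y + 6144 * a * X) := le_self_add
    _ = K₁ * (X + Y) := by rw [hK₁]; ring

end HyperbolicClique

theorem mainTheorem2 :
    -- every hyperbolic unit disk graph admits a CNEEO
    (∀ (n : ℕ) (G : SimpleGraph (Fin n)), IsHyperbolicUnitDiskGraph G → AdmitsCNEEO G) ∧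
    ∃ (P : Prog) (c : ℕ),
      -- correctness and worst-case running time on all graphs that admit a CNEEO
      (∃ K : ℝ, ∀ (n : ℕ) (G : SimpleGraph (Fin n)), AdmitsCNEEO G →
        ComputesMaximumClique P c G ∧
        graphTime P c G ≤ ENNReal.ofReal
          (K * (1 + (G.edgeSet.ncard : ℝ) ^ 3 + G.edgeSet.ncard * (n : ℝ) ^ (5 / 2 : ℝ)))) ∧
      -- expected running time on hyperbolic random graphs
      (∀ α C : ℝ, 1 / 2 < α → α < 1 → ∃ K : ℝ, ∀ n : ℕ, 1 ≤ n → 0 < diskRadius n C →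
        ∫⁻ p, graphTime P c (diskGraph (diskRadius n C) p) ∂pointsLaw n α C ≤
          ENNReal.ofReal K *
            (∫⁻ p, ((diskGraph (diskRadius n C) p).edgeSet.ncard : ℝ≥0∞) ∂pointsLaw n α C +
              ENNReal.ofReal ((n : ℝ) ^ (6 * (1 - α))))) := by
  obtain ⟨K, hK⟩ := graphTime_le_worst
  exact ⟨fun _ _ h => h.admitsCNEEO, theProg, 40,
    ⟨K, fun n G h => ⟨theProg_correct h, hK n G⟩⟩,
    fun _ C hα hα1 => expectedTime_le C hα hα1⟩
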